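/- **Theorem.** Let $0<\lambda\le 1$. Let $\Omega_0=(0,1)\times(0,1)$ and let $\Omega_1,\Omega_2,\Omega_3$ be the open triangles with vertices $A,B,C$; $A,A_0,D$; $B,B_0,E$ respectively, where $A=(0,0)$, $B=(1,0)$, $A_0=(0,1)$, $B_0=(1,1)$, $C=(\tfrac12,-\tfrac12)$, $D=(-\tfrac12,\tfrac12)$, $E=(\tfrac32,\tfrac12)$. With $AB$, $AA_0$, $BB_0$ denoting open segments, put $\Omega=\Omega_0\cup\Omega_1\cup\Omega_2\cup\Omega_3\cup AB\cup AA_0\cup BB_0$. For a function $g$ let $${}_CD_{0y}^{\lambda}g(y)=\begin{cases} g'(y), & \lambda=1,\\[2pt] \dfrac{1}{\Gamma(1-\lambda)}\displaystyle\int_0^y (y-t)^{-\lambda}g'(t)\,dt, & 0<\lambda<1,\end{cases}$$ be the Caputo derivative, and let $$W=C(\overline\Omega)\cap C^1(\Omega\setminus AB)\cap C^{2,\lambda}_{x,y}(\Omega_0)\cap C^2(\Omega_1\cup\Omega_2\cup\Omega_3),$$ where $u\in C^{2,\lambda}_{x,y}(\Omega_0)$ means that $u$, $u_x$, $u_{xx}$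 and ${}_CD^\lambda_{0y}u$ exist (the last one, for $\lambda<1$, with an absolutely convergent integral) and are continuous in $\Omega_0$. Let $a_1,a_2,a_3,\varphi_2\in C^1[0,\tfrac12]\cap C^2(0,\tfrac12)$ and $\varphi_1\in C^1[\tfrac12,1]\cap C^2(\tfrac12,1)$ be real-valued functions with $\varphi_1(1)=\varphi_2(0)$, $a_1(t)\ne0$ for all $t\in[0,\tfrac12]$, and $a_1(0)+a_2(0)\neq 0$. Then there is one and only one function $u\in W$ (as a function on $\overline\Omega$) such that $$u_{xx}-{}_CD^{\lambda}_{0y}u=0\ \text{ in }\Omega_0,\qquad u_{xx}-u_{yy}=0\ \text{ in }\Omega_1\cup\Omega_2\cup\Omega_3,$$ $$a_1(t)\,u(-t,t)+a_2(t)\,u(t,-t)=a_3(t),\qquad 0\le t\le \tfrac12,$$ $$u(x,x-1)=\varphi_1(x),\quad \tfrac12\le x\le1,\qquad\qquad u(1+y,y)=\varphi_2(y),\quad 0\le y\le\tfrac12,$$ and, for every $x\in(0,1)$, the limits $\lim_{y\to+0}{}_CD^{\lambda}_{0y}u(x,y)$ and $u_y(x,-0)=\lim_{y\to-0}u_y(x,y)$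 exist, are finite, and are equal. -/

import Mathlib

namespace MixedProblem

open Set Filter Topology MeasureTheory

noncomputable section

/-- The open unit square. -/
def Ω₀ : Set (ℝ × ℝ) := {p | 0 < p.1 ∧ p.1 < 1 ∧ 0 < p.2 ∧ p.2 < 1}

/-- The open characteristic triangle with vertices `A(0,0)`, `B(1,0)`, `C(1/2,-1/2)`. -/
def Ω₁ : Set (ℝ × ℝ) := {p | p.2 < 0 ∧ 0 < p.1 + p.2 ∧ p.1 - p.2 < 1}

/-- The open characteristic triangle with vertices `A(0,0)`, `A₀(0,1)`, `D(-1/2,1/2)`. -/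
def Ω₂ : Set (ℝ × ℝ) := {p | p.1 < 0 ∧ 0 < p.1 + p.2 ∧ p.2 - p.1 < 1}

/-- The open characteristic triangle with vertices `B(1,0)`, `B₀(1,1)`, `E(3/2,1/2)`. -/
def Ω₃ : Set (ℝ × ℝ) := {p | 1 < p.1 ∧ p.1 - p.2 < 1 ∧ p.1 + p.2 < 2}

/-- The open segment from `A(0,0)` to `B(1,0)`. -/
def AB : Set (ℝ × ℝ) := {p | 0 < p.1 ∧ p.1 < 1 ∧ p.2 = 0}

/-- The open segment from `A(0,0)` to `A₀(0,1)`. -/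
def AA₀ : Set (ℝ × ℝ) := {p | p.1 = 0 ∧ 0 < p.2 ∧ p.2 < 1}

/-- The open segment from `B(1,0)` to `B₀(1,1)`. -/
def BB₀ : Set (ℝ × ℝ) := {p | p.1 = 1 ∧ 0 < p.2 ∧ p.2 < 1}

/-- The mixed domain. -/
def Ω : Set (ℝ × ℝ) := Ω₀ ∪ Ω₁ ∪ Ω₂ ∪ Ω₃ ∪ AB ∪ AA₀ ∪ BB₀

/-- The partial derivative in the first variable. -/
def dx (u : ℝ × ℝ → ℝ) (p : ℝ × ℝ) : ℝ := deriv (fun s => u (s, p.2)) p.1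

/-- The partial derivative in the second variable. -/
def dy (u : ℝ × ℝ → ℝ) (p : ℝ × ℝ) : ℝ := deriv (fun t => u (p.1, t)) p.2

/-- The Caputo derivative of order `lam` with base point `0`, at `y`. -/
def caputo (lam : ℝ) (g : ℝ → ℝ) (y : ℝ) : ℝ :=
  if lam = 1 then deriv g y
  else 1 / Real.Gamma (1 - lam) * ∫ t in (0 : ℝ)..y, (y - t) ^ (-lam) * deriv g t

/-- The Caputo derivative of order `lam` of `g` at `y` makes sense: the derivative of `g` in its
definition exists, and the integral in it converges. -/
def CaputoExists (lam : ℝ) (g : ℝ → ℝ) (y : ℝ) : Prop :=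
  if lam = 1 then DifferentiableAt ℝ g y
  else (∀ t ∈ Ioo 0 y, DifferentiableAt ℝ g t) ∧
    IntervalIntegrable (fun t => (y - t) ^ (-lam) * deriv g t) volume 0 y

/-- The Caputo derivative in the second variable. -/
def caputoY (lam : ℝ) (u : ℝ × ℝ → ℝ) (p : ℝ × ℝ) : ℝ := caputo lam (fun t => u (p.1, t)) p.2

/-- `u ∈ C^{2,lam}_{x,y}(Ω₀)`: the derivatives `u_x`, `u_xx` and the Caputo derivative of order
`lam` in `y` exist in `Ω₀`, and they are continuous there. -/
structure IsC2Caputo (lam : ℝ) (u : ℝ × ℝ → ℝ) : Prop where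
  diff_x : ∀ p ∈ Ω₀, DifferentiableAt ℝ (fun s => u (s, p.2)) p.1
  diff_xx : ∀ p ∈ Ω₀, DifferentiableAt ℝ (fun s => dx u (s, p.2)) p.1
  caputo_exists : ∀ p ∈ Ω₀, CaputoExists lam (fun t => u (p.1, t)) p.2
  cont : ContinuousOn u Ω₀
  cont_x : ContinuousOn (dx u) Ω₀
  cont_xx : ContinuousOn (dx (dx u)) Ω₀
  cont_caputo : ContinuousOn (caputoY lam u) Ω₀

/-- The class `W = C(closure Ω) ∩ C¹(Ω \ AB) ∩ C^{2,lam}_{x,y}(Ω₀) ∩ C²(Ω₁ ∪ Ω₂ ∪ Ω₃)`. -/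
structure MemW (lam : ℝ) (u : ℝ × ℝ → ℝ) : Prop where
  cont : ContinuousOn u (closure Ω)
  c1 : ContDiffOn ℝ 1 u (Ω \ AB)
  c2Caputo : IsC2Caputo lam u
  c2_Ω₁ : ContDiffOn ℝ 2 u Ω₁
  c2_Ω₂ : ContDiffOn ℝ 2 u Ω₂
  c2_Ω₃ : ContDiffOn ℝ 2 u Ω₃

/-- `u` is a solution, in the class `W`, of the non-local problem with data
`a₁, a₂, a₃, φ₁, φ₂`. -/
structure IsSolution (lam : ℝ) (a₁ a₂ a₃ φ₁ φ₂ : ℝ → ℝ) (u : ℝ × ℝ → ℝ) : Prop where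
  memW : MemW lam u
  /-- The fractional diffusion equation in the square. -/
  eq_parabolic : ∀ p ∈ Ω₀, dx (dx u) p - caputoY lam u p = 0
  /-- The wave equation in the three triangles. -/
  eq_hyperbolic : ∀ p ∈ Ω₁ ∪ Ω₂ ∪ Ω₃, dx (dx u) p - dy (dy u) p = 0
  /-- The non-local condition linking the characteristics `AD` and `AC`. -/
  nonlocal : ∀ t ∈ Icc (0 : ℝ) (1 / 2), a₁ t * u (-t, t) + a₂ t * u (t, -t) = a₃ t
  /-- The condition on the characteristic `CB`. -/
  on_CB : ∀ x ∈ Icc (1 / 2 : ℝ) 1, u (x, x - 1) = φ₁ x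
  /-- The condition on the characteristic `BE`. -/
  on_BE : ∀ y ∈ Icc (0 : ℝ) (1 / 2), u (1 + y, y) = φ₂ y
  /-- The gluing condition on `AB`: both one-sided limits exist, and they agree. -/
  gluing : ∀ x ∈ Ioo (0 : ℝ) 1, ∃ ν : ℝ,
    Tendsto (fun y => caputoY lam u (x, y)) (𝓝[>] 0) (𝓝 ν) ∧
    Tendsto (fun y => dy u (x, y)) (𝓝[<] 0) (𝓝 ν)

end

end MixedProblem

/-! The unknown trace on `AB` decouples from everything else. Let `τ` be this trace and `Φ` the
datum on `CB`. D'Alembert's formula in the lower triangle gives u_y(x,-0) = Φ'((x+1)/2) - τ'(x). In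
the square the Caputo derivative equals u_xx, whose limit at y = 0 is τ''. The gluing condition is
therefore the ordinary differential equation τ'' + τ' = Φ'((x+1)/2). The non-local condition at t =
0 gives τ(0), because a₁(0) + a₂(0) ≠ 0, and the datum on `CB` gives τ(1); this two-point problem
has exactly one solution. Now u is known on `AC`, and since a₁ has no zero the non-local condition
yields the values ψ on `AD`. With χ the datum on `BE`, d'Alembert's formula in the side triangles
and C¹ matching across the vertical sides become u_y - u_x = ψ'(y/2) on x = 0 and u_y + u_x =
χ'(y/2) on x = 1. What remains is the diffusion equation in the square with initial value τ and
these two side conditions (`exists_squareSolution`).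

The square problem is solved by potentials. The kernels F_a = `fker l a` have Laplace transform
s^(-a) exp(-x s^(l/2)), so ∂ₓF_a = -F_{a-l/2}, ∂ₜF_a = F_{a-1}, and fractional integration of order
c maps F_a to F_{a+c}. Hence F_1 solves the equation: its Caputo derivative, the integral of order
1-l of F_0, is F_{1-l} = ∂ₓ²F_1. The solution is an initial-value potential plus one F_1-layer on
each vertical side. The side conditions form a Volterra system with a kernel t^(-l/2) plus a smooth
part, solvable by contraction in a weighted norm (`exists_volterra_solution`). As l/2 ≤ 1/2,
substituting the equation into itself shows that the densities are C¹ (`contDiffOn_of_volterra`);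
this is what C² regularity in the side triangles requires. All facts on F_a come from contour
integrals for the Wright function: the parabola Re √s = 1 gives smoothness and decay, and vertical
lines give the convolution rule (`integral_rpow_mul_fker`).

For uniqueness let w be the difference of two solutions. By the parallelogram law (`parallelogram`)
w is constant along one family of characteristics in the lower triangle, so the gluing condition
says that w_xx(x,y) tends to -τ'(x) for each x. Convergence is only pointwise; a Baire category
argument (`second_deriv_trace_eq`) still identifies the limit with τ''. Hence τ'' = -τ' with zero
end values, so τ = 0, and then w = 0 on `AD`. In the left and right triangles w is now constant on
the lines x + y = const and x - y = const. Suppose w is positive somewhere in the square and look at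
a maximum of w - εy. Inside, the Caputo derivative is positive there (`caputo_pos`) while w_xx ≤ 0.
On the side x = 0 the characteristics give w_x = w_y ≥ ε, against w_x ≤ 0; the side x = 1 is
symmetric. So w ≤ 0, and exchanging the two solutions gives w = 0. -/

open Set Filter Topology MeasureTheory

noncomputable section

namespace MixedProblem

/-! ### The Wright function -/

/-- The vertical line `Re s = 1`. -/
def vline (w : ℝ) : ℂ := 1 + w * Complex.I

lemma vline_re (w : ℝ) : (vline w).re = 1 := by simp [vline]

lemma vline_im (w : ℝ) : (vline w).im = w := by simp [vline]

lemma vline_ne_zero (w : ℝ) : vline w ≠ 0 := by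
  intro h
  have := congrArg Complex.re h
  simp [vline_re] at this

lemma vline_mem_slitPlane (w : ℝ) : vline w ∈ Complex.slitPlane := by
  left
  simp [vline_re]

lemma continuous_vline : Continuous vline := by
  unfold vline
  fun_prop

lemma hasDerivAt_vline (w : ℝ) : HasDerivAt vline Complex.I w := by
  have h : HasDerivAt (fun w : ℝ => (1 : ℂ) + w * Complex.I) (1 * Complex.I) w :=
    ((Complex.ofRealCLM.hasDerivAt (x := w)).mul_const Complex.I).const_add 1
  rw [one_mul] at h
  exact h

lemma norm_vline_sq (w : ℝ) : ‖vline w‖ ^ 2 = 1 + w ^ 2 := by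
  rw [← Complex.normSq_eq_norm_sq, Complex.normSq_apply, vline_re, vline_im]
  ring

lemma one_le_norm_vline (w : ℝ) : 1 ≤ ‖vline w‖ := by
  have := norm_vline_sq w
  nlinarith [norm_nonneg (vline w), sq_nonneg w]

lemma norm_vline_le (w : ℝ) : ‖vline w‖ ≤ 1 + |w| := by
  have := norm_vline_sq w
  have h2 := sq_abs w
  nlinarith [norm_nonneg (vline w), abs_nonneg w]

lemma continuous_vline_cpow (b : ℂ) : Continuous fun w => vline w ^ b :=
  continuous_vline.cpow continuous_const vline_mem_slitPlane

lemma norm_vline_cpow (w b : ℝ) : ‖vline w ^ (b : ℂ)‖ = ‖vline w‖ ^ b := by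
  rw [Complex.norm_cpow_of_ne_zero (vline_ne_zero w)]
  simp

lemma norm_vline_cpow_le (w b : ℝ) : ‖vline w ^ (b : ℂ)‖ ≤ Real.exp (|b| * |w|) := by
  rw [norm_vline_cpow]
  calc ‖vline w‖ ^ b ≤ ‖vline w‖ ^ |b| :=
        Real.rpow_le_rpow_of_exponent_le (one_le_norm_vline w) (le_abs_self b)
    _ ≤ (Real.exp |w|) ^ |b| := by
        refine Real.rpow_le_rpow (norm_nonneg _) ((norm_vline_le w).trans ?_) (abs_nonneg b)
        linarith [Real.add_one_le_exp |w|]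
    _ = Real.exp (|b| * |w|) := by rw [← Real.exp_mul, mul_comm]

/-- Weighted AM-GM gives cos^l t ≤ l cos t + (1 - l), and concavity of the cosine on [-π/2, π/2],
applied between t and 0, bounds the right-hand side by cos(l t). -/
lemma cos_rpow_le_cos_mul {l t : ℝ} (hl₀ : 0 ≤ l) (hl₁ : l ≤ 1) (ht : |t| ≤ Real.pi / 2) :
    Real.cos t ^ l ≤ Real.cos (l * t) := by
  have ht' := abs_le.1 ht
  have hc : 0 ≤ Real.cos t := Real.cos_nonneg_of_mem_Icc ⟨by linarith, by linarith⟩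
  have h1 := Real.geom_mean_le_arith_mean2_weighted hl₀ (sub_nonneg.2 hl₁) hc zero_le_one
    (by ring)
  rw [Real.one_rpow, mul_one, mul_one] at h1
  have h2 := strictConcaveOn_cos_Icc.concaveOn.2 (x := t) ⟨by linarith, by linarith⟩
    (y := 0) ⟨by linarith [Real.pi_pos], by linarith [Real.pi_pos]⟩ hl₀ (sub_nonneg.2 hl₁) (by ring)
  simp only [smul_eq_mul, Real.cos_zero, mul_one, mul_zero, add_zero] at h2
  linarith

lemma abs_arg_vline_lt (w : ℝ) : |(vline w).arg| < Real.pi / 2 := by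
  rw [Complex.abs_arg_lt_pi_div_two_iff]
  left
  simp [vline_re]

lemma norm_vline_mul_cos_arg (w : ℝ) : ‖vline w‖ * Real.cos (vline w).arg = 1 := by
  rw [Complex.norm_mul_cos_arg, vline_re]

/-- On the line |σ| cos(arg σ) = 1, hence 1 = |σ|^l cos^l(arg σ) ≤ |σ|^l cos(l arg σ). This is what
turns the factor exp(-z σ^l) into the decay exp(-z) of the Wright function. -/
lemma one_le_re_vline_cpow {l : ℝ} (hl₀ : 0 ≤ l) (hl₁ : l ≤ 1) (w : ℝ) :
    1 ≤ (vline w ^ (l : ℂ)).re := by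
  rw [Complex.cpow_ofReal_re]
  have h1 := cos_rpow_le_cos_mul hl₀ hl₁ (abs_arg_vline_lt w).le
  have hc : 0 ≤ Real.cos (vline w).arg := by
    have := abs_lt.1 (abs_arg_vline_lt w)
    exact Real.cos_nonneg_of_mem_Icc ⟨by linarith, by linarith⟩
  calc (1 : ℝ) = (‖vline w‖ * Real.cos (vline w).arg) ^ l := by
        rw [norm_vline_mul_cos_arg, Real.one_rpow]
    _ = ‖vline w‖ ^ l * Real.cos (vline w).arg ^ l := Real.mul_rpow (norm_nonneg _) hc
    _ ≤ _ := by
        rw [mul_comm (vline w).arg l]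
        gcongr

/-- The integrand of the Wright function `wright`. -/
def wrightInt (l a z w : ℝ) : ℂ :=
  Complex.exp (vline w ^ 2) * vline w ^ ((1 - 2 * a : ℝ) : ℂ) *
    Complex.exp (-(z * vline w ^ (l : ℂ)))

/-- The Wright function `∑ (-z)ⁿ / (n! Γ(a - l n / 2))`, as an integral over the parabola
`s = σ²`, `Re σ = 1`. -/
def wright (l a z : ℝ) : ℝ := Real.pi⁻¹ * (∫ w, wrightInt l a z w).re

lemma continuous_wrightInt (l a z : ℝ) : Continuous (wrightInt l a z) := by
  unfold wrightInt
  have h1 := continuous_vline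
  have h2 := continuous_vline_cpow ((1 - 2 * a : ℝ) : ℂ)
  have h3 := continuous_vline_cpow (l : ℂ)
  fun_prop

lemma norm_exp_vline_sq (w : ℝ) : ‖Complex.exp (vline w ^ 2)‖ = Real.exp (1 - w ^ 2) := by
  rw [Complex.norm_exp, pow_two, Complex.mul_re, vline_re, vline_im]
  ring_nf

lemma exp_gauss_le (A : ℝ) (w : ℝ) :
    Real.exp (1 - w ^ 2) * Real.exp (A * |w|) ≤
      Real.exp (1 + A ^ 2 / 2) * Real.exp (-(1 / 2) * w ^ 2) := by
  rw [← Real.exp_add, ← Real.exp_add, Real.exp_le_exp]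
  nlinarith [sq_nonneg (|w| - A), sq_abs w]

lemma integrable_exp_gauss (A : ℝ) :
    Integrable fun w : ℝ => Real.exp (1 - w ^ 2) * Real.exp (A * |w|) := by
  refine ((integrable_exp_neg_mul_sq (b := 1 / 2) (by norm_num)).const_mul
    (Real.exp (1 + A ^ 2 / 2))).mono' (by fun_prop) (ae_of_all _ fun w => ?_)
  rw [Real.norm_of_nonneg (by positivity)]
  exact exp_gauss_le A w

lemma norm_wrightInt_le_of_nonneg {l : ℝ} (hl₀ : 0 ≤ l) (hl₁ : l ≤ 1) (a : ℝ) {z : ℝ} (hz : 0 ≤ z)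
    (w : ℝ) : ‖wrightInt l a z w‖ ≤
      Real.exp (-z) * (Real.exp (1 - w ^ 2) * Real.exp (|1 - 2 * a| * |w|)) := by
  unfold wrightInt
  rw [norm_mul, norm_mul, norm_exp_vline_sq, Complex.norm_exp]
  have h1 := norm_vline_cpow_le w (1 - 2 * a)
  have h2 := one_le_re_vline_cpow hl₀ hl₁ w
  have h3 : Real.exp ((-((z : ℂ) * vline w ^ (l : ℂ))).re) ≤ Real.exp (-z) := by
    rw [Real.exp_le_exp, Complex.neg_re, Complex.re_ofReal_mul]
    nlinarith
  rw [mul_comm (Real.exp (-z))]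
  gcongr

/-- Here z may have either sign: |σ^l| ≤ |σ| ≤ 1 + |w|, and the Gaussian factor absorbs the
resulting exponential. The bound is uniform for |z| ≤ Z, so it dominates when differentiating in z.
-/
lemma norm_wrightInt_le {l : ℝ} (hl₁ : l ≤ 1) (a : ℝ) {z Z : ℝ} (hz : |z| ≤ Z)
    (w : ℝ) : ‖wrightInt l a z w‖ ≤
      Real.exp Z * (Real.exp (1 - w ^ 2) * Real.exp ((|1 - 2 * a| + Z) * |w|)) := by
  unfold wrightInt
  rw [norm_mul, norm_mul, norm_exp_vline_sq, Complex.norm_exp]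
  have h1 := norm_vline_cpow_le w (1 - 2 * a)
  have h3 : Real.exp ((-((z : ℂ) * vline w ^ (l : ℂ))).re) ≤ Real.exp (Z * (1 + |w|)) := by
    rw [Real.exp_le_exp]
    refine (Complex.re_le_norm _).trans ?_
    rw [norm_neg, norm_mul, Complex.norm_real, norm_vline_cpow, Real.norm_eq_abs]
    have : ‖vline w‖ ^ l ≤ 1 + |w| := by
      refine le_trans ?_ (norm_vline_le w)
      calc ‖vline w‖ ^ l ≤ ‖vline w‖ ^ (1 : ℝ) :=
            Real.rpow_le_rpow_of_exponent_le (one_le_norm_vline w) hl₁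
        _ = _ := Real.rpow_one _
    have h0 : 0 ≤ Z := (abs_nonneg z).trans hz
    gcongr
  calc _ ≤ Real.exp (1 - w ^ 2) * Real.exp (|1 - 2 * a| * |w|) * Real.exp (Z * (1 + |w|)) := by
        gcongr
    _ = _ := by
        rw [← Real.exp_add, ← Real.exp_add, ← Real.exp_add, ← Real.exp_add]
        ring_nf

lemma integrable_wrightInt {l : ℝ} (hl₁ : l ≤ 1) (a z : ℝ) :
    Integrable (wrightInt l a z) :=
  ((integrable_exp_gauss _).const_mul _).mono' (continuous_wrightInt l a z).aestronglyMeasurable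
    (ae_of_all _ fun w => norm_wrightInt_le hl₁ a le_rfl w)

/-- The exponent 1 - 2a comes from s^(-a) ds with s = σ², ds = 2σ dσ. Lowering a by l/2 therefore
multiplies by σ^l, which is also the effect of -d/dz on exp(-z σ^l). -/
lemma wrightInt_mul_cpow (l a z w : ℝ) :
    wrightInt l (a - l / 2) z w = wrightInt l a z w * vline w ^ (l : ℂ) := by
  unfold wrightInt
  have : ((1 - 2 * (a - l / 2) : ℝ) : ℂ) = ((1 - 2 * a : ℝ) : ℂ) + (l : ℂ) := by
    push_cast; ring
  rw [this, Complex.cpow_add _ _ (vline_ne_zero w)]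
  ring

lemma hasDerivAt_wright {l : ℝ} (hl₁ : l ≤ 1) (a z : ℝ) :
    HasDerivAt (wright l a) (-wright l (a - l / 2) z) z := by
  have key := hasDerivAt_integral_of_dominated_loc_of_deriv_le (μ := volume) (𝕜 := ℝ)
    (F := fun z w => wrightInt l a z w) (F' := fun z w => -wrightInt l (a - l / 2) z w)
    (x₀ := z) (s := Metric.ball z 1) (Metric.ball_mem_nhds z one_pos)
    (Eventually.of_forall fun x => (continuous_wrightInt l a x).aestronglyMeasurable)
    (integrable_wrightInt hl₁ a z)
    (continuous_wrightInt l (a - l / 2) z).neg.aestronglyMeasurable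
    (bound := fun w => Real.exp (|z| + 1) * (Real.exp (1 - w ^ 2) *
      Real.exp ((|1 - 2 * (a - l / 2)| + (|z| + 1)) * |w|)))
    (ae_of_all _ fun w x hx => by
      rw [norm_neg]
      refine norm_wrightInt_le hl₁ _ ?_ w
      rw [Metric.mem_ball, Real.dist_eq] at hx
      have := abs_sub_abs_le_abs_sub x z
      linarith)
    ((integrable_exp_gauss _).const_mul _)
    (ae_of_all _ fun w x _ => by
      rw [wrightInt_mul_cpow]
      unfold wrightInt
      have h1 : HasDerivAt (fun x : ℝ => -((x : ℂ) * vline w ^ (l : ℂ)))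
          (-(1 * vline w ^ (l : ℂ))) x :=
        ((Complex.ofRealCLM.hasDerivAt (x := x)).mul_const _).neg
      have h2 := (h1.cexp).const_mul
        (Complex.exp (vline w ^ 2) * vline w ^ ((1 - 2 * a : ℝ) : ℂ))
      exact h2.congr_deriv (by ring))
  have h2 := (Complex.reCLM.hasFDerivAt.comp_hasDerivAt z key.2).const_mul Real.pi⁻¹
  refine h2.congr_deriv ?_
  rw [integral_neg]
  simp [wright]

lemma continuous_wright {l : ℝ} (hl₁ : l ≤ 1) (a : ℝ) : Continuous (wright l a) :=
  continuous_iff_continuousAt.2 fun z => (hasDerivAt_wright hl₁ a z).continuousAt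

lemma exists_abs_wright_le {l : ℝ} (hl₀ : 0 ≤ l) (hl₁ : l ≤ 1) (a : ℝ) :
    ∃ C, 0 < C ∧ ∀ z, 0 ≤ z → |wright l a z| ≤ C * Real.exp (-z) := by
  set I := ∫ w : ℝ, Real.exp (1 - w ^ 2) * Real.exp (|1 - 2 * a| * |w|)
  have hI : 0 ≤ I := integral_nonneg fun w => by positivity
  have hpi := Real.pi_pos
  refine ⟨Real.pi⁻¹ * I + 1, by positivity, fun z hz => ?_⟩
  have h1 : ‖∫ w, wrightInt l a z w‖ ≤ Real.exp (-z) * I := by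
    rw [← integral_const_mul]
    exact norm_integral_le_of_norm_le ((integrable_exp_gauss _).const_mul _)
      (ae_of_all _ fun w => norm_wrightInt_le_of_nonneg hl₀ hl₁ a hz w)
  unfold wright
  rw [abs_mul, abs_of_pos (inv_pos.2 hpi)]
  have h2 := (Complex.abs_re_le_norm (∫ w, wrightInt l a z w)).trans h1
  calc _ ≤ Real.pi⁻¹ * (Real.exp (-z) * I) := by gcongr
    _ ≤ _ := by nlinarith [Real.exp_pos (-z)]

lemma hasDerivAt_vline_cpow (w b : ℝ) :
    HasDerivAt (fun w => vline w ^ (b : ℂ))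
      (b * vline w ^ ((b - 1 : ℝ) : ℂ) * Complex.I) w := by
  have h := ((hasDerivAt_id (vline w)).cpow_const (c := (b : ℂ)) (vline_mem_slitPlane w)).comp w
    (hasDerivAt_vline w)
  refine h.congr_deriv ?_
  push_cast
  simp

/-- The derivative in w of the integrand with parameter a - 1/2 has zero integral and is a
combination of the integrands with parameters a - 1, a and a - l/2. The recurrence yields both the
time derivative of the kernel and the factor x contained in `fker l 0`. -/
lemma wright_sub_one {l : ℝ} (hl₁ : l ≤ 1) (a z : ℝ) :
    wright l (a - 1) z = (a - 1) * wright l a z + l / 2 * z * wright l (a - l / 2) z := by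
  have hI := fun a => integrable_wrightInt hl₁ a z
  have hF : ∀ w, wrightInt l (a - 1 / 2) z w = Complex.exp (vline w ^ 2) *
      vline w ^ ((2 - 2 * a : ℝ) : ℂ) * Complex.exp (-(z * vline w ^ (l : ℂ))) := by
    intro w
    unfold wrightInt
    congr 3
    push_cast
    ring
  have hd : ∀ w, HasDerivAt (wrightInt l (a - 1 / 2) z)
      (Complex.I * (2 * wrightInt l (a - 1) z w + (2 - 2 * a) * wrightInt l a z w
        - z * l * wrightInt l (a - l / 2) z w)) w := by
    intro w
    rw [show wrightInt l (a - 1 / 2) z = _ from funext hF]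
    have h1 := ((hasDerivAt_vline w).pow 2).cexp
    have h2 := hasDerivAt_vline_cpow w (2 - 2 * a)
    have h3 := (((hasDerivAt_vline_cpow w l).const_mul (z : ℂ)).neg).cexp
    refine ((h1.mul h2).mul h3).congr_deriv ?_
    unfold wrightInt
    have e0 : vline w ^ ((2 - 2 * a : ℝ) : ℂ) = vline w ^ ((1 - 2 * a : ℝ) : ℂ) * vline w := by
      rw [show ((2 - 2 * a : ℝ) : ℂ) = ((1 - 2 * a : ℝ) : ℂ) + 1 by push_cast; ring,
        Complex.cpow_add _ _ (vline_ne_zero w), Complex.cpow_one]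
    have e1 : vline w ^ ((1 - 2 * (a - 1) : ℝ) : ℂ) =
        vline w ^ ((1 - 2 * a : ℝ) : ℂ) * vline w * vline w := by
      rw [show ((1 - 2 * (a - 1) : ℝ) : ℂ) = ((1 - 2 * a : ℝ) : ℂ) + 1 + 1 by push_cast; ring,
        Complex.cpow_add _ _ (vline_ne_zero w), Complex.cpow_add _ _ (vline_ne_zero w),
        Complex.cpow_one]
    have e2 : vline w ^ ((2 - 2 * a - 1 : ℝ) : ℂ) = vline w ^ ((1 - 2 * a : ℝ) : ℂ) := by
      congr 2; ring
    have e3 : vline w ^ ((1 - 2 * (a - l / 2) : ℝ) : ℂ) =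
        vline w ^ ((1 - 2 * a : ℝ) : ℂ) * (vline w ^ ((l - 1 : ℝ) : ℂ) * vline w) := by
      rw [show ((1 - 2 * (a - l / 2) : ℝ) : ℂ) =
          ((1 - 2 * a : ℝ) : ℂ) + (((l - 1 : ℝ) : ℂ) + 1) by push_cast; ring,
        Complex.cpow_add _ _ (vline_ne_zero w), Complex.cpow_add _ _ (vline_ne_zero w),
        Complex.cpow_one]
    simp only [Pi.mul_apply, Pi.pow_apply, Pi.neg_apply]
    rw [e0, e1, e2, e3]
    push_cast
    ring
  have hadd : Integrable fun w => 2 * wrightInt l (a - 1) z w + (2 - 2 * a) * wrightInt l a z w :=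
    ((hI (a - 1)).const_mul 2).add ((hI a).const_mul (2 - 2 * a))
  have h0 := integral_eq_zero_of_hasDerivAt_of_integrable hd
    ((hadd.sub ((hI (a - l / 2)).const_mul (z * l))).const_mul Complex.I) (hI _)
  rw [integral_const_mul, integral_sub hadd
    ((hI (a - l / 2)).const_mul _), integral_add ((hI (a - 1)).const_mul 2) ((hI a).const_mul _),
    integral_const_mul, integral_const_mul, integral_const_mul] at h0
  have h1 := (mul_eq_zero.1 h0).resolve_left Complex.I_ne_zero
  have h2 := congrArg Complex.re h1
  have e4 : (2 - 2 * a : ℂ) = ((2 - 2 * a : ℝ) : ℂ) := by push_cast; ring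
  have e5 : (z * l : ℂ) = ((z * l : ℝ) : ℂ) := by push_cast; ring
  rw [e4, e5, Complex.sub_re, Complex.add_re, Complex.re_ofReal_mul, Complex.re_ofReal_mul,
    show (2 : ℂ) = ((2 : ℝ) : ℂ) by norm_num, Complex.re_ofReal_mul, Complex.zero_re] at h2
  unfold wright
  linear_combination (Real.pi⁻¹ / 2) * h2

/-! ### Deformation of contours and the value of the Wright function at zero -/

/-- Invariance of a line integral under a deformation: if `∂f/∂κ = ∂g/∂w`, then `∫ f(κ, w) dw`
does not depend on `κ`. -/
lemma integral_eq_of_deformation {a b : ℝ} (hab : a ≤ b) {f h g : ℝ → ℝ → ℂ} {bd : ℝ → ℝ}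
    (hbd : Integrable bd)
    (hf : ∀ κ ∈ Icc a b, ∀ w, HasDerivAt (fun κ => f κ w) (h κ w) κ)
    (hh : ContinuousOn (Function.uncurry h) (Icc a b ×ˢ univ))
    (hb : ∀ κ ∈ Icc a b, ∀ w, ‖h κ w‖ ≤ bd w)
    (hg : ∀ κ ∈ Icc a b, ∀ w, HasDerivAt (g κ) (h κ w) w)
    (hgi : ∀ κ ∈ Icc a b, Integrable (g κ))
    (hfa : Integrable (f a)) (hfb : Integrable (f b)) : ∫ w, f a w = ∫ w, f b w := by
  have hcont : ∀ κ ∈ Icc a b, Continuous (h κ) := fun κ hκ => by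
    have : ContinuousOn (fun w : ℝ => Function.uncurry h (κ, w)) univ :=
      hh.comp (by fun_prop) (fun w _ => ⟨hκ, mem_univ _⟩)
    exact continuousOn_univ.1 this
  have hcont' : ∀ w, ContinuousOn (fun κ => h κ w) (Icc a b) := fun w =>
    hh.comp (f := fun κ : ℝ => (κ, w)) (by fun_prop) (fun κ hκ => ⟨hκ, mem_univ _⟩)
  have hprod : Integrable (Function.uncurry fun w κ => h κ w)
      (volume.prod (volume.restrict (Ioc a b))) := by
    refine Integrable.mono' (hbd.comp_fst (volume.restrict (Ioc a b))) ?_ ?_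
    · have h1 : (volume.prod (volume.restrict (Ioc a b)) : Measure (ℝ × ℝ)) =
          (volume.prod volume).restrict (univ ×ˢ Ioc a b) := by
        rw [← Measure.prod_restrict, Measure.restrict_univ]
      rw [h1]
      refine ContinuousOn.aestronglyMeasurable ?_ (MeasurableSet.univ.prod measurableSet_Ioc)
      exact hh.comp (f := fun p : ℝ × ℝ => (p.2, p.1)) (by fun_prop)
        (fun p hp => ⟨Ioc_subset_Icc_self hp.2, mem_univ _⟩)
    · have h1 : ∀ᵐ p : ℝ × ℝ ∂(volume.prod (volume.restrict (Ioc a b))), p.2 ∈ Ioc a b := by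
        have := Measure.quasiMeasurePreserving_snd (μ := (volume : Measure ℝ))
          (ν := volume.restrict (Ioc a b))
        exact this.ae (ae_restrict_mem measurableSet_Ioc)
      filter_upwards [h1] with p hp
      exact hb p.2 (Ioc_subset_Icc_self hp) p.1
  have h1 : ∀ w, f b w - f a w = ∫ κ in Ioc a b, h κ w := by
    intro w
    rw [← intervalIntegral.integral_of_le hab]
    refine (intervalIntegral.integral_eq_sub_of_hasDerivAt (fun κ hκ => hf κ ?_ w) ?_).symm
    · rwa [uIcc_of_le hab] at hκ
    · exact ((hcont' w).mono (by rw [uIcc_of_le hab])).intervalIntegrable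
  -- After exchanging the integrals, the inner one is that of the w-derivative of the integrable
  -- function `g κ`, so it vanishes.
  have h2 : ∫ w, (f b w - f a w) = 0 := by
    simp_rw [h1]
    rw [integral_integral_swap hprod]
    refine setIntegral_eq_zero_of_forall_eq_zero fun κ hκ => ?_
    have hκ' := Ioc_subset_Icc_self hκ
    exact integral_eq_zero_of_hasDerivAt_of_integrable (hg κ hκ')
      (hbd.mono' (hcont κ hκ').aestronglyMeasurable (ae_of_all _ (hb κ hκ'))) (hgi κ hκ')
  rw [integral_sub hfb hfa, sub_eq_zero] at h2
  exact h2.symm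

lemma norm_exp_mul_vline_sq (d w : ℝ) :
    ‖Complex.exp (d * vline w ^ 2)‖ = Real.exp (d * (1 - w ^ 2)) := by
  rw [Complex.norm_exp, Complex.re_ofReal_mul, pow_two, Complex.mul_re, vline_re, vline_im]
  ring_nf

lemma integrable_exp_mul_one_sub_sq {d : ℝ} (hd : 0 < d) :
    Integrable fun w : ℝ => Real.exp (d * (1 - w ^ 2)) := by
  have h := (integrable_exp_neg_mul_sq hd).const_mul (Real.exp d)
  refine h.congr (ae_of_all _ fun w => ?_)
  simp only
  rw [← Real.exp_add]
  ring_nf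

lemma norm_vline_mul_exp_le {d κ w : ℝ} (hd : 0 < d) (hκ : κ ∈ Icc d 1) :
    ‖vline w * Complex.exp (κ * vline w ^ 2)‖ ≤
      Real.exp 1 * (1 + 2 / d) * Real.exp (-(d / 2) * w ^ 2) := by
  rw [norm_mul, norm_exp_mul_vline_sq]
  have h1 := norm_vline_le w
  have h2 : 1 + |w| ≤ (1 + 2 / d) * Real.exp (d / 2 * w ^ 2) := by
    have h3 := Real.add_one_le_exp (d / 2 * w ^ 2)
    have h4 : (1 + 2 / d) * (d / 2 * w ^ 2 + 1) = d / 2 * w ^ 2 + 1 + (w ^ 2 + 2 / d) := by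
      field_simp
    have hd1 : d ≤ 1 := hκ.1.trans hκ.2
    have h5 : 2 ≤ 2 / d := by rw [le_div_iff₀ hd]; linarith
    have h6 : (1 + 2 / d) * (d / 2 * w ^ 2 + 1) ≤ (1 + 2 / d) * Real.exp (d / 2 * w ^ 2) := by
      gcongr
    have h7 : 0 ≤ d / 2 * w ^ 2 := by positivity
    nlinarith [sq_nonneg (|w| - 1), sq_abs w]
  have h3 : Real.exp (κ * (1 - w ^ 2)) ≤ Real.exp 1 * Real.exp (-d * w ^ 2) := by
    rw [← Real.exp_add, Real.exp_le_exp]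
    nlinarith [hκ.1, hκ.2, sq_nonneg w]
  calc ‖vline w‖ * Real.exp (κ * (1 - w ^ 2))
      ≤ ((1 + 2 / d) * Real.exp (d / 2 * w ^ 2)) * (Real.exp 1 * Real.exp (-d * w ^ 2)) := by
        gcongr
        exact h1.trans h2
    _ = Real.exp 1 * (1 + 2 / d) * (Real.exp (d / 2 * w ^ 2) * Real.exp (-d * w ^ 2)) := by ring
    _ = _ := by
        rw [← Real.exp_add]
        ring_nf

lemma integrable_exp_mul_vline_inv {d : ℝ} (hd : 0 < d) :
    Integrable fun w => Complex.exp (d * vline w ^ 2) * (vline w)⁻¹ := by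
  refine (integrable_exp_mul_one_sub_sq hd).mono' ?_ (ae_of_all _ fun w => ?_)
  · have := continuous_vline
    exact (Continuous.mul (by fun_prop) (this.inv₀ vline_ne_zero)).aestronglyMeasurable
  · rw [norm_mul, norm_exp_mul_vline_sq, norm_inv]
    exact mul_le_of_le_one_right (Real.exp_pos _).le (inv_le_one_of_one_le₀ (one_le_norm_vline w))

/-- Differentiating in the scale κ produces σ² σ⁻¹ = σ, and σ exp(κσ²) is a total derivative along
the line. -/
lemma integral_exp_mul_vline_inv_eq {d : ℝ} (hd : 0 < d) (hd1 : d ≤ 1) :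
    ∫ w, Complex.exp (d * vline w ^ 2) * (vline w)⁻¹ =
      ∫ w, Complex.exp ((1 : ℝ) * vline w ^ 2) * (vline w)⁻¹ := by
  have hc := continuous_vline
  refine integral_eq_of_deformation hd1
    (f := fun κ w => Complex.exp (κ * vline w ^ 2) * (vline w)⁻¹)
    (h := fun κ w => vline w * Complex.exp (κ * vline w ^ 2))
    (g := fun κ w => (2 * κ * Complex.I)⁻¹ * Complex.exp (κ * vline w ^ 2))
    (bd := fun w => Real.exp 1 * (1 + 2 / d) * Real.exp (-(d / 2) * w ^ 2))
    ((integrable_exp_neg_mul_sq (by positivity)).const_mul _) ?_ ?_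
    (fun κ hκ w => norm_vline_mul_exp_le hd hκ) ?_ ?_
    (integrable_exp_mul_vline_inv hd) (integrable_exp_mul_vline_inv one_pos)
  · intro κ _ w
    have h1 : HasDerivAt (fun κ : ℝ => (κ : ℂ) * vline w ^ 2) (1 * vline w ^ 2) κ :=
      (Complex.ofRealCLM.hasDerivAt (x := κ)).mul_const _
    refine (h1.cexp.mul_const (vline w)⁻¹).congr_deriv ?_
    field_simp [vline_ne_zero w]
  · apply Continuous.continuousOn
    simp only [Function.uncurry_def]
    fun_prop
  · intro κ hκ w
    have hκ0 : (κ : ℂ) ≠ 0 := by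
      have := hd.trans_le hκ.1
      exact_mod_cast this.ne'
    have h1 := (((hasDerivAt_vline w).pow 2).const_mul (κ : ℂ)).cexp.const_mul
      ((2 * (κ : ℂ) * Complex.I)⁻¹)
    refine h1.congr_deriv ?_
    simp only [Pi.pow_apply]
    field_simp [Complex.I_ne_zero]
    push_cast
    ring
  · intro κ hκ
    refine Integrable.const_mul ?_ _
    refine (integrable_exp_mul_one_sub_sq (hd.trans_le hκ.1)).mono' ?_ (ae_of_all _ fun w => ?_)
    · exact Continuous.aestronglyMeasurable (by fun_prop)
    · rw [norm_exp_mul_vline_sq]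

/-- Only the real part is followed because the limit d → 0 of the integrand is 1/σ, which is not
absolutely integrable, whereas its real part 1/(1 + w²) is. -/
lemma re_exp_mul_vline_inv (d w : ℝ) :
    (Complex.exp (d * vline w ^ 2) * (vline w)⁻¹).re =
      Real.exp (d * (1 - w ^ 2)) * (Real.cos (2 * d * w) + w * Real.sin (2 * d * w)) *
        (1 + w ^ 2)⁻¹ := by
  have h1 : (vline w)⁻¹ = (((1 + w ^ 2)⁻¹ : ℝ) : ℂ) * (1 - w * Complex.I) := by
    have : ((1 + w ^ 2 : ℝ) : ℂ) = vline w * (1 - w * Complex.I) := by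
      unfold vline
      push_cast
      linear_combination ((w : ℂ) ^ 2) * Complex.I_sq
    have h0 : ((1 + w ^ 2 : ℝ) : ℂ) ≠ 0 := by
      have : (1 + w ^ 2 : ℝ) ≠ 0 := by positivity
      exact_mod_cast this
    rw [Complex.ofReal_inv, inv_eq_iff_eq_inv, mul_inv, inv_inv, this]
    have h2 : (1 - (w : ℂ) * Complex.I) ≠ 0 := by
      intro h
      rw [this, h, mul_zero] at h0
      exact h0 rfl
    field_simp
  have h2 : (d * vline w ^ 2 : ℂ) = ((d * (1 - w ^ 2) : ℝ) : ℂ) +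
      ((2 * d * w : ℝ) : ℂ) * Complex.I := by
    unfold vline
    push_cast
    linear_combination (d * (w : ℂ) ^ 2) * Complex.I_sq
  rw [h1, h2, Complex.exp_add, Complex.exp_mul_I, ← Complex.ofReal_exp, ← Complex.ofReal_cos,
    ← Complex.ofReal_sin]
  simp only [Complex.mul_re, Complex.mul_im, Complex.add_re, Complex.add_im, Complex.ofReal_re,
    Complex.ofReal_im, Complex.I_re, Complex.I_im, Complex.sub_re, Complex.sub_im, Complex.one_re,
    Complex.one_im]
  ring

/-- The value is 1/Γ(1). Replacing exp(σ²) by exp(dσ²) does not change the integral, and as d → 0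
its real part tends to ∫ dw/(1 + w²) = π. -/
lemma wright_one_zero (l : ℝ) : wright l 1 0 = 1 := by
  have h0 : ∀ w, wrightInt l 1 0 w = Complex.exp ((1 : ℝ) * vline w ^ 2) * (vline w)⁻¹ := by
    intro w
    unfold wrightInt
    rw [show ((1 - 2 * 1 : ℝ) : ℂ) = -1 by norm_num, Complex.cpow_neg_one]
    simp
  have h1 : ∀ d : ℝ, 0 < d → d ≤ 1 → (∫ w, wrightInt l 1 0 w).re =
      ∫ w : ℝ, Real.exp (d * (1 - w ^ 2)) * (Real.cos (2 * d * w) + w * Real.sin (2 * d * w)) *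
        (1 + w ^ 2)⁻¹ := by
    intro d hd hd1
    simp_rw [h0]
    rw [← integral_exp_mul_vline_inv_eq hd hd1, ← Complex.reCLM_apply,
      ← ContinuousLinearMap.integral_comp_comm _ (integrable_exp_mul_vline_inv hd)]
    simp only [Complex.reCLM_apply, re_exp_mul_vline_inv]
  have h2 : Tendsto (fun d : ℝ => ∫ w : ℝ, Real.exp (d * (1 - w ^ 2)) *
      (Real.cos (2 * d * w) + w * Real.sin (2 * d * w)) * (1 + w ^ 2)⁻¹) (𝓝[>] 0)
      (𝓝 (∫ w : ℝ, (1 + w ^ 2)⁻¹)) := by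
    refine tendsto_integral_filter_of_dominated_convergence
      (fun w => Real.exp 1 * 3 * (1 + w ^ 2)⁻¹) ?_ ?_ (integrable_inv_one_add_sq.const_mul _) ?_
    · refine Eventually.of_forall fun d => Continuous.aestronglyMeasurable ?_
      have : Continuous fun w : ℝ => (1 + w ^ 2)⁻¹ :=
        Continuous.inv₀ (by fun_prop) fun w => by positivity
      fun_prop
    · filter_upwards [Ioc_mem_nhdsGT one_pos] with d hd
      refine ae_of_all _ fun w => ?_
      have hw : 0 ≤ (1 + w ^ 2)⁻¹ := by positivity
      rw [norm_mul, Real.norm_of_nonneg hw]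
      refine mul_le_mul_of_nonneg_right ?_ hw
      rw [norm_mul, Real.norm_of_nonneg (Real.exp_pos _).le]
      have e1 : Real.exp (d * (1 - w ^ 2)) ≤ Real.exp 1 * Real.exp (-(d * w ^ 2)) := by
        rw [← Real.exp_add, Real.exp_le_exp]
        nlinarith [hd.2]
      -- The factor w in front of the sine would spoil domination; |sin(2dw)| ≤ 2d|w| makes it a
      -- multiple of dw², which exp(-dw²) absorbs uniformly in d.
      have e2 : ‖Real.cos (2 * d * w) + w * Real.sin (2 * d * w)‖ ≤ 1 + 2 * (d * w ^ 2) := by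
        refine (norm_add_le _ _).trans (add_le_add (Real.abs_cos_le_one _) ?_)
        rw [norm_mul, Real.norm_eq_abs, Real.norm_eq_abs]
        have h3 : |Real.sin (2 * d * w)| ≤ |2 * d * w| := Real.abs_sin_le_abs
        rw [abs_mul, abs_of_pos (show 0 < 2 * d by linarith [hd.1])] at h3
        calc |w| * |Real.sin (2 * d * w)| ≤ |w| * (2 * d * |w|) := by gcongr
          _ = 2 * (d * w ^ 2) := by rw [← sq_abs w]; ring
      have e3 : Real.exp (-(d * w ^ 2)) * (1 + 2 * (d * w ^ 2)) ≤ 3 := by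
        have h0 : 0 ≤ d * w ^ 2 := mul_nonneg hd.1.le (sq_nonneg w)
        have h4 := Real.add_one_le_exp (d * w ^ 2)
        have h5 : Real.exp (-(d * w ^ 2)) * Real.exp (d * w ^ 2) = 1 := by
          rw [← Real.exp_add]; simp
        nlinarith [Real.exp_pos (-(d * w ^ 2))]
      calc _ ≤ Real.exp 1 * Real.exp (-(d * w ^ 2)) * (1 + 2 * (d * w ^ 2)) := by gcongr
        _ = Real.exp 1 * (Real.exp (-(d * w ^ 2)) * (1 + 2 * (d * w ^ 2))) := by ring
        _ ≤ _ := by gcongr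
    · refine ae_of_all _ fun w => ?_
      have : Continuous fun d : ℝ => Real.exp (d * (1 - w ^ 2)) *
          (Real.cos (2 * d * w) + w * Real.sin (2 * d * w)) * (1 + w ^ 2)⁻¹ := by fun_prop
      have h := (this.tendsto 0).mono_left (nhdsWithin_le_nhds (s := Ioi (0 : ℝ)))
      simpa using h
  have h3 : Tendsto (fun d : ℝ => ∫ w : ℝ, Real.exp (d * (1 - w ^ 2)) *
      (Real.cos (2 * d * w) + w * Real.sin (2 * d * w)) * (1 + w ^ 2)⁻¹) (𝓝[>] 0)
      (𝓝 (∫ w, wrightInt l 1 0 w).re) := by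
    refine tendsto_const_nhds.congr' ?_
    filter_upwards [Ioc_mem_nhdsGT one_pos] with d hd using h1 d hd.1 hd.2
  unfold wright
  rw [tendsto_nhds_unique h3 h2, integral_univ_inv_one_add_sq, inv_mul_cancel₀ Real.pi_ne_zero]

/-! ### Moments of the Wright function -/

lemma integrableOn_mul_wright {l : ℝ} (hl₀ : 0 ≤ l) (hl₁ : l ≤ 1) (a : ℝ) (n : ℕ) :
    IntegrableOn (fun z => z ^ n * wright l a z) (Ioi 0) := by
  obtain ⟨C, hC, h⟩ := exists_abs_wright_le hl₀ hl₁ a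
  have h0 : IntegrableOn (fun z : ℝ => z ^ (n : ℝ) * Real.exp (-1 * z ^ (1 : ℝ))) (Ioi 0) :=
    integrableOn_rpow_mul_exp_neg_mul_rpow (by linarith [n.cast_nonneg (α := ℝ)]) one_pos one_pos
  have hc := continuous_wright hl₁ a
  refine (h0.const_mul C).mono' (Continuous.aestronglyMeasurable (by fun_prop)) ?_
  filter_upwards [ae_restrict_mem measurableSet_Ioi] with z hz
  have hz' : (0 : ℝ) < z := hz
  rw [norm_mul, Real.norm_of_nonneg (by positivity), Real.rpow_natCast, Real.rpow_one]
  have := h z hz'.le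
  calc z ^ n * ‖wright l a z‖ ≤ z ^ n * (C * Real.exp (-z)) := by gcongr; exact this
    _ = _ := by ring_nf

lemma integrableOn_wright {l : ℝ} (hl₀ : 0 ≤ l) (hl₁ : l ≤ 1) (a : ℝ) :
    IntegrableOn (wright l a) (Ioi 0) := by
  simpa using integrableOn_mul_wright hl₀ hl₁ a 0

lemma tendsto_mul_wright_atTop {l : ℝ} (hl₀ : 0 ≤ l) (hl₁ : l ≤ 1) (a : ℝ) (n : ℕ) :
    Tendsto (fun z => z ^ n * wright l a z) atTop (𝓝 0) := by
  obtain ⟨C, hC, h⟩ := exists_abs_wright_le hl₀ hl₁ a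
  have h1 := (Real.tendsto_pow_mul_exp_neg_atTop_nhds_zero n).const_mul C
  rw [mul_zero] at h1
  refine squeeze_zero_norm' ?_ h1
  filter_upwards [eventually_gt_atTop 0] with z hz
  rw [norm_mul, Real.norm_of_nonneg (by positivity)]
  calc z ^ n * ‖wright l a z‖ ≤ z ^ n * (C * Real.exp (-z)) := by gcongr; exact h z hz.le
    _ = _ := by ring

lemma integral_Ioi_wright {l : ℝ} (hl₀ : 0 ≤ l) (hl₁ : l ≤ 1) (a : ℝ) {x : ℝ} (hx : 0 ≤ x) :
    ∫ z in Ioi x, wright l (a - l / 2) z = wright l a x := by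
  have h0 := tendsto_mul_wright_atTop hl₀ hl₁ a 0
  simp only [pow_zero, one_mul] at h0
  have h := integral_Ioi_of_hasDerivAt_of_tendsto (a := x)
    (continuous_wright hl₁ a).continuousWithinAt
    (fun z _ => hasDerivAt_wright hl₁ a z)
    ((integrableOn_wright hl₀ hl₁ (a - l / 2)).mono_set (Ioi_subset_Ioi hx)).neg h0
  rw [integral_neg, zero_sub] at h
  exact neg_injective h

lemma integral_wright_density {l : ℝ} (hl₀ : 0 ≤ l) (hl₁ : l ≤ 1) :
    ∫ z in Ioi 0, wright l (1 - l / 2) z = 1 := by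
  rw [integral_Ioi_wright hl₀ hl₁ 1 le_rfl, wright_one_zero]

/-- Integrate d/dz (z W_{1-l/2}) = W_{1-l/2} - z W_{1-l}, where the first term has mass one. This
first moment normalises the limit of u_xx at the initial line in `tendsto_initPot_deriv_deriv`. -/
lemma integral_mul_wright_one_sub {l : ℝ} (hl₀ : 0 ≤ l) (hl₁ : l ≤ 1) :
    ∫ z in Ioi 0, z * wright l (1 - l) z = 1 := by
  have h0 := tendsto_mul_wright_atTop hl₀ hl₁ (1 - l / 2) 1
  have hi := (integrableOn_mul_wright hl₀ hl₁ (1 - l) 1)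
  have hi0 := integrableOn_wright hl₀ hl₁ (1 - l / 2)
  simp only [pow_one] at h0 hi
  have h := integral_Ioi_of_hasDerivAt_of_tendsto (a := 0)
    (f := fun z => z * wright l (1 - l / 2) z)
    (f' := fun z => wright l (1 - l / 2) z - z * wright l (1 - l) z)
    (Continuous.continuousWithinAt (continuous_id.mul (continuous_wright hl₁ _)))
    (fun z _ => by
      refine ((hasDerivAt_id z).mul (hasDerivAt_wright hl₁ (1 - l / 2) z)).congr_deriv ?_
      rw [show 1 - l / 2 - l / 2 = 1 - l by ring]
      simp only [id]
      ring)
    (hi0.sub hi) h0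
  rw [integral_sub hi0 hi, integral_wright_density hl₀ hl₁] at h
  linarith

/-! ### The Wright function as an integral over a vertical line -/

lemma exists_rpow_mul_exp_neg_le {A b : ℝ} (hA : 0 < A) (hb : 0 < b) (M : ℝ) :
    ∃ C, 0 < C ∧ ∀ A', A ≤ A' → ∀ r : ℝ, 1 ≤ r → r ^ M * Real.exp (-(A' * r ^ b)) ≤ C := by
  -- With n ≥ M/b one has r^M ≤ (r^b)^n, and a single term of the exponential series bounds (A
  -- r^b)^n by n! exp(A r^b).
  obtain ⟨n, hn⟩ := exists_nat_ge (M / b)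
  refine ⟨n.factorial / A ^ n, by positivity, fun A' hA' r hr => ?_⟩
  have hr0 : 0 < r := by linarith
  have h1 : r ^ M ≤ (r ^ b) ^ n := by
    rw [← Real.rpow_natCast, ← Real.rpow_mul hr0.le]
    refine Real.rpow_le_rpow_of_exponent_le hr ?_
    rw [div_le_iff₀ hb] at hn
    linarith
  have hu : 0 < r ^ b := by positivity
  have h2 := Real.pow_div_factorial_le_exp (A * r ^ b) (by positivity) n
  rw [mul_pow, div_le_iff₀ (by positivity)] at h2
  have h3 : Real.exp (-(A' * r ^ b)) ≤ Real.exp (-(A * r ^ b)) := by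
    rw [Real.exp_le_exp]
    nlinarith
  rw [le_div_iff₀ (by positivity)]
  calc r ^ M * Real.exp (-(A' * r ^ b)) * A ^ n
      ≤ (r ^ b) ^ n * Real.exp (-(A * r ^ b)) * A ^ n := by gcongr
    _ = A ^ n * (r ^ b) ^ n * Real.exp (-(A * r ^ b)) := by ring
    _ ≤ Real.exp (A * r ^ b) * n.factorial * Real.exp (-(A * r ^ b)) := by gcongr
    _ = n.factorial := by
        rw [mul_right_comm, ← Real.exp_add]
        simp

lemma exists_norm_vline_rpow_mul_exp_le {A b : ℝ} (hA : 0 < A) (hb : 0 < b) (M : ℝ) :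
    ∃ C, 0 < C ∧ ∀ w, ‖vline w‖ ^ M * Real.exp (-(A * ‖vline w‖ ^ b)) ≤ C * (1 + w ^ 2)⁻¹ := by
  obtain ⟨C, hC, h⟩ := exists_rpow_mul_exp_neg_le hA hb (M + 2)
  refine ⟨C, hC, fun w => ?_⟩
  have h1 := h A le_rfl _ (one_le_norm_vline w)
  have h0 : 0 < ‖vline w‖ := norm_pos_iff.2 (vline_ne_zero w)
  rw [← norm_vline_sq, ← div_eq_mul_inv, le_div_iff₀ (by positivity)]
  calc _ = ‖vline w‖ ^ (M + 2) * Real.exp (-(A * ‖vline w‖ ^ b)) := by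
        rw [Real.rpow_add h0, show (2 : ℝ) = ((2 : ℕ) : ℝ) by norm_num, Real.rpow_natCast]
        ring
    _ ≤ C := h1

lemma cos_mul_pi_div_two_pos {l : ℝ} (hl₀ : 0 < l) (hl₁ : l < 1) :
    0 < Real.cos (l * (Real.pi / 2)) := by
  have := Real.pi_pos
  apply Real.cos_pos_of_mem_Ioo
  constructor <;> nlinarith

/-- Since |arg σ| < π/2 and p ≤ l < 1, the argument of σ^p stays below lπ/2 < π/2: in such a sector
the real part controls the modulus. The case l = 1 is excluded because the constant would be zero.
-/
lemma cos_mul_norm_le_re_vline_cpow {l p : ℝ} (hp₀ : 0 ≤ p) (hpl : p ≤ l) (hl₁ : l < 1)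
    (w : ℝ) : Real.cos (l * (Real.pi / 2)) * ‖vline w‖ ^ p ≤ (vline w ^ (p : ℂ)).re := by
  rw [Complex.cpow_ofReal_re, mul_comm]
  refine mul_le_mul_of_nonneg_left ?_ (Real.rpow_nonneg (norm_nonneg _) _)
  rw [← Real.cos_abs ((vline w).arg * p), abs_mul, abs_of_nonneg hp₀]
  have h1 := (abs_arg_vline_lt w).le
  have hpi := Real.pi_pos
  have hl₀ := hp₀.trans hpl
  refine Real.cos_le_cos_of_nonneg_of_le_pi (by positivity) (by nlinarith) ?_
  rw [mul_comm]
  gcongr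

/-- The curves s = σ^κ bend to the left of Re s = 1. If κ|arg σ| ≤ π/2, `cos_rpow_le_cos_mul` with
exponent 1/κ gives cos(κ arg σ) ≤ cos^κ(arg σ); otherwise the angle lies between π/2 and π and the
real part is nonpositive. So |exp s| ≤ e throughout the deformation. -/
lemma re_vline_cpow_le_one {κ : ℝ} (hκ : κ ∈ Icc (1 : ℝ) 2) (w : ℝ) :
    (vline w ^ (κ : ℂ)).re ≤ 1 := by
  have hκ0 : 0 < κ := by linarith [hκ.1]
  rw [Complex.cpow_ofReal_re]
  have hpi := Real.pi_pos
  have ha := abs_arg_vline_lt w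
  rw [← Real.cos_abs ((vline w).arg * κ), abs_mul, abs_of_pos hκ0]
  by_cases h : |(vline w).arg| * κ ≤ Real.pi / 2
  · have h1 := cos_rpow_le_cos_mul (l := κ⁻¹) (t := |(vline w).arg| * κ) (by positivity)
      (inv_le_one_of_one_le₀ hκ.1) (by rwa [abs_of_nonneg (by positivity)])
    rw [show κ⁻¹ * (|(vline w).arg| * κ) = |(vline w).arg| by field_simp, Real.cos_abs] at h1
    have hc : 0 ≤ Real.cos (|(vline w).arg| * κ) :=
      Real.cos_nonneg_of_mem_Icc ⟨by nlinarith [abs_nonneg (vline w).arg], h⟩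
    have h2 := norm_vline_mul_cos_arg w
    have h3 : Real.cos (|(vline w).arg| * κ) ≤ Real.cos (vline w).arg ^ κ := by
      have := Real.rpow_le_rpow (by positivity) h1 hκ0.le
      rwa [← Real.rpow_mul hc, inv_mul_cancel₀ hκ0.ne', Real.rpow_one] at this
    have hc' : 0 ≤ Real.cos (vline w).arg := le_trans (by positivity) h1
    calc _ ≤ ‖vline w‖ ^ κ * Real.cos (vline w).arg ^ κ := by gcongr
      _ = 1 := by rw [← Real.mul_rpow (norm_nonneg _) hc', h2, Real.one_rpow]
  · have : Real.cos (|(vline w).arg| * κ) ≤ 0 :=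
      Real.cos_nonpos_of_pi_div_two_le_of_le (not_le.1 h).le (by nlinarith [hκ.2])
    exact (mul_nonpos_of_nonneg_of_nonpos (by positivity) this).trans zero_le_one

lemma norm_log_vline_le (w : ℝ) : ‖Complex.log (vline w)‖ ≤ 3 * ‖vline w‖ := by
  have h1 := one_le_norm_vline w
  have h2 : ‖Complex.log (vline w)‖ ≤ |(Complex.log (vline w)).re| + |(Complex.log (vline w)).im| :=
    Complex.norm_le_abs_re_add_abs_im _
  rw [Complex.log_re, Complex.log_im, abs_of_nonneg (Real.log_nonneg h1)] at h2
  have h3 := Real.log_le_sub_one_of_pos (by linarith : 0 < ‖vline w‖)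
  have h4 := abs_arg_vline_lt w
  have h5 := Real.pi_lt_d2
  linarith

lemma vline_cpow_mul_self (w b : ℝ) :
    vline w ^ ((b - 1 : ℝ) : ℂ) * vline w = vline w ^ (b : ℂ) := by
  rw [show (b : ℂ) = ((b - 1 : ℝ) : ℂ) + 1 by push_cast; ring,
    Complex.cpow_add _ _ (vline_ne_zero w), Complex.cpow_one]

/-- The integrand of the Wright function over the contour `s = σ ^ κ`, `Re σ = 1`, up to the
factor `κ`. -/
def contourInt (l a z κ w : ℝ) : ℂ :=
  Complex.exp (vline w ^ (κ : ℂ)) * vline w ^ ((κ * (1 - a) - 1 : ℝ) : ℂ) *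
    Complex.exp (-(z * vline w ^ ((κ * (l / 2) : ℝ) : ℂ)))

/-- The derivative of `κ * contourInt l a z κ w` in `κ`. -/
def contourIntDeriv (l a z κ w : ℝ) : ℂ :=
  contourInt l a z κ w * (1 + κ * (Complex.log (vline w) * vline w ^ (κ : ℂ) +
      (1 - a) * Complex.log (vline w) -
      z * (l / 2) * Complex.log (vline w) * vline w ^ ((κ * (l / 2) : ℝ) : ℂ)))

lemma hasDerivAt_vline_cpow_exponent (w q q' κ : ℝ) :
    HasDerivAt (fun κ : ℝ => vline w ^ ((κ * q + q' : ℝ) : ℂ))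
      (q * Complex.log (vline w) * vline w ^ ((κ * q + q' : ℝ) : ℂ)) κ := by
  have h1 : HasDerivAt (fun κ : ℝ => ((κ * q + q' : ℝ) : ℂ)) (q : ℂ) κ := by
    have := (((hasDerivAt_id κ).mul_const q).add_const q').ofReal_comp
    simpa using this
  refine (((hasDerivAt_id ((κ * q + q' : ℝ) : ℂ)).const_cpow (c := vline w)
    (Or.inl (vline_ne_zero w))).comp κ h1).congr_deriv ?_
  simp only [id]
  ring

lemma hasDerivAt_mul_contourInt (l a z κ w : ℝ) :
    HasDerivAt (fun κ : ℝ => (κ : ℂ) * contourInt l a z κ w) (contourIntDeriv l a z κ w) κ := by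
  have h1 := hasDerivAt_vline_cpow_exponent w 1 0 κ
  have h2 := hasDerivAt_vline_cpow_exponent w (1 - a) (-1) κ
  have h3 := hasDerivAt_vline_cpow_exponent w (l / 2) 0 κ
  simp only [mul_one, add_zero, ← sub_eq_add_neg] at h1 h2 h3
  have h4 : HasDerivAt (fun κ : ℝ => (κ : ℂ)) 1 κ := Complex.ofRealCLM.hasDerivAt
  refine (h4.mul (((h1.cexp).mul h2).mul ((h3.const_mul (z : ℂ)).neg.cexp))).congr_deriv ?_
  simp only [contourIntDeriv, contourInt, Pi.mul_apply, Pi.neg_apply]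
  generalize Complex.exp (-((z : ℂ) * vline w ^ ((κ * (l / 2) : ℝ) : ℂ))) = e₁
  generalize Complex.exp (vline w ^ (κ : ℂ)) = e₂
  generalize vline w ^ ((κ * (1 - a) - 1 : ℝ) : ℂ) = e₃
  generalize vline w ^ ((κ * (l / 2) : ℝ) : ℂ) = e₄
  push_cast
  ring

/-- For an integrand F(s) ds pulled back along s = σ^κ, both ∂_κ(F(s) ∂_w s) and ∂_w(F(s) ∂_κ s) are
the same expression. Here ∂_κ s = σ^κ log σ, which explains the logarithm in the primitive. -/
lemma hasDerivAt_contourInt_mul_log (l a z κ w : ℝ) :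
    HasDerivAt (fun w => -Complex.I * (contourInt l a z κ w * vline w * Complex.log (vline w)))
      (contourIntDeriv l a z κ w) w := by
  have hE' : (fun w => -Complex.I * (contourInt l a z κ w * vline w * Complex.log (vline w))) =
      fun w => -Complex.I * (Complex.exp (vline w ^ (κ : ℂ)) *
        vline w ^ ((κ * (1 - a) : ℝ) : ℂ) *
        Complex.exp (-(z * vline w ^ ((κ * (l / 2) : ℝ) : ℂ))) * Complex.log (vline w)) := by
    funext w
    simp only [contourInt]
    rw [← vline_cpow_mul_self w (κ * (1 - a))]
    ring
  rw [hE']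
  have h1 := (hasDerivAt_vline_cpow w κ).cexp
  have h2 := hasDerivAt_vline_cpow w (κ * (1 - a))
  have h3 := (((hasDerivAt_vline_cpow w (κ * (l / 2))).const_mul (z : ℂ)).neg).cexp
  have h4 : HasDerivAt (fun w => Complex.log (vline w)) ((vline w)⁻¹ * Complex.I) w :=
    (Complex.hasDerivAt_log (vline_mem_slitPlane w)).comp w (hasDerivAt_vline w)
  refine ((((h1.mul h2).mul h3).mul h4).const_mul (-Complex.I)).congr_deriv ?_
  simp only [contourIntDeriv, contourInt, Pi.mul_apply, Pi.neg_apply]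
  generalize Complex.exp (-((z : ℂ) * vline w ^ ((κ * (l / 2) : ℝ) : ℂ))) = e₁
  generalize Complex.exp (vline w ^ (κ : ℂ)) = e₂
  rw [← vline_cpow_mul_self w (κ * (1 - a)), ← vline_cpow_mul_self w κ,
    ← vline_cpow_mul_self w (κ * (l / 2))]
  have h0 := mul_inv_cancel₀ (vline_ne_zero w)
  generalize vline w ^ ((κ * (1 - a) - 1 : ℝ) : ℂ) = e₃
  generalize vline w ^ ((κ * (l / 2) - 1 : ℝ) : ℂ) = e₄
  generalize vline w ^ ((κ - 1 : ℝ) : ℂ) = e₅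
  generalize Complex.log (vline w) = L
  generalize vline w = s at h0 ⊢
  push_cast
  linear_combination (-e₂ * e₃ * e₁ * (s * s⁻¹) - e₁ * e₂ * e₃ * s * L * (κ * e₅
    - z * κ * (l / 2) * e₄) - e₁ * e₂ * e₃ * L * κ * (1 - a)) * Complex.I_sq + (e₁ * e₂ * e₃) * h0

lemma continuous_vline_cpow_comp {q : ℝ × ℝ → ℝ} (hq : Continuous q) :
    Continuous fun p : ℝ × ℝ => vline p.2 ^ ((q p : ℝ) : ℂ) :=
  (continuous_vline.comp continuous_snd).cpow (by fun_prop) fun p => vline_mem_slitPlane _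

lemma continuous_contourInt (l a z : ℝ) :
    Continuous fun p : ℝ × ℝ => contourInt l a z p.1 p.2 := by
  have h2 := continuous_vline_cpow_comp (q := fun p => p.1) (by fun_prop)
  have h3 := continuous_vline_cpow_comp (q := fun p => p.1 * (1 - a) - 1) (by fun_prop)
  have h4 := continuous_vline_cpow_comp (q := fun p => p.1 * (l / 2)) (by fun_prop)
  exact (h2.cexp.mul h3).mul (continuous_const.mul h4).neg.cexp

lemma continuous_contourIntDeriv (l a z : ℝ) :
    Continuous fun p : ℝ × ℝ => contourIntDeriv l a z p.1 p.2 := by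
  have h2 := continuous_vline_cpow_comp (q := fun p => p.1) (by fun_prop)
  have h4 := continuous_vline_cpow_comp (q := fun p => p.1 * (l / 2)) (by fun_prop)
  have h5 : Continuous fun p : ℝ × ℝ => Complex.log (vline p.2) :=
    (continuous_vline.comp continuous_snd).clog fun p => vline_mem_slitPlane _
  have h6 : Continuous fun p : ℝ × ℝ => (p.1 : ℂ) := by fun_prop
  exact (continuous_contourInt l a z).mul (continuous_const.add (h6.mul (((h5.mul h2).add
    (continuous_const.mul h5)).sub ((continuous_const.mul h5).mul h4))))

lemma norm_vline_cpow_le_rpow {p N : ℝ} (h : p ≤ N) (w : ℝ) :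
    ‖vline w ^ (p : ℂ)‖ ≤ ‖vline w‖ ^ N := by
  rw [norm_vline_cpow]
  exact Real.rpow_le_rpow_of_exponent_le (one_le_norm_vline w) h

/-- No Gaussian decay is available at κ = 1, so integrability rests on exp(-z σ^(κl/2)); this is why
z > 0 and l < 1 are needed. The powers are estimated by exponents independent of κ. -/
lemma norm_contourInt_le {l : ℝ} (hl₀ : 0 < l) (hl₁ : l < 1) (a : ℝ) {z : ℝ} (hz : 0 < z)
    {κ : ℝ} (hκ : κ ∈ Icc (1 : ℝ) 2) (w : ℝ) :
    ‖contourInt l a z κ w‖ ≤ Real.exp 1 * (‖vline w‖ ^ (2 * |1 - a|) *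
      Real.exp (-(z * Real.cos (l * (Real.pi / 2)) * ‖vline w‖ ^ (l / 2)))) := by
  have hc := cos_mul_pi_div_two_pos hl₀ hl₁
  have hκa : κ * (1 - a) ≤ 2 * |1 - a| := by
    have := le_abs_self (1 - a)
    have := abs_nonneg (1 - a)
    nlinarith [hκ.1, hκ.2]
  have h1 : ‖Complex.exp (vline w ^ (κ : ℂ))‖ ≤ Real.exp 1 := by
    rw [Complex.norm_exp, Real.exp_le_exp]
    exact re_vline_cpow_le_one hκ w
  have h2 : ‖Complex.exp (-(z * vline w ^ ((κ * (l / 2) : ℝ) : ℂ)))‖ ≤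
      Real.exp (-(z * Real.cos (l * (Real.pi / 2)) * ‖vline w‖ ^ (l / 2))) := by
    rw [Complex.norm_exp, Real.exp_le_exp, Complex.neg_re, Complex.re_ofReal_mul, neg_le_neg_iff]
    have h1 := cos_mul_norm_le_re_vline_cpow (l := l) (p := κ * (l / 2))
      (by nlinarith [hκ.1]) (by nlinarith [hκ.2]) hl₁ w
    have h2 : ‖vline w‖ ^ (l / 2) ≤ ‖vline w‖ ^ (κ * (l / 2)) :=
      Real.rpow_le_rpow_of_exponent_le (one_le_norm_vline w) (by nlinarith [hκ.1])
    rw [mul_assoc]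
    refine mul_le_mul_of_nonneg_left (le_trans ?_ h1) hz.le
    gcongr
  have h3 := norm_vline_cpow_le_rpow (p := κ * (1 - a) - 1) (N := 2 * |1 - a|)
    (by linarith) w
  simp only [contourInt, norm_mul]
  rw [← mul_assoc]
  gcongr

lemma norm_vline_rpow_add (w M : ℝ) (n : ℕ) :
    ‖vline w‖ ^ (M + n) = ‖vline w‖ ^ M * ‖vline w‖ ^ n := by
  rw [Real.rpow_add (by linarith [one_le_norm_vline w]), Real.rpow_natCast]

lemma norm_contourIntDeriv_le {l : ℝ} (hl₀ : 0 < l) (hl₁ : l < 1) (a : ℝ) {z : ℝ} (hz : 0 < z)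
    {κ : ℝ} (hκ : κ ∈ Icc (1 : ℝ) 2) (w : ℝ) :
    ‖contourIntDeriv l a z κ w‖ ≤ Real.exp 1 * (7 + 6 * |1 - a| + 6 * (z * (l / 2))) *
      (‖vline w‖ ^ (2 * |1 - a| + (3 : ℕ)) *
      Real.exp (-(z * Real.cos (l * (Real.pi / 2)) * ‖vline w‖ ^ (l / 2)))) := by
  have hr := one_le_norm_vline w
  have hr0 : 0 ≤ ‖vline w‖ := norm_nonneg _
  have hlog := norm_log_vline_le w
  have hp1 := norm_vline_cpow_le_rpow hκ.2 w
  have hp2 := norm_vline_cpow_le_rpow (p := κ * (l / 2)) (N := 2) (by nlinarith [hκ.2]) w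
  have hpow : ‖vline w‖ ^ (2 : ℝ) = ‖vline w‖ ^ 2 := by
    rw [show (2 : ℝ) = ((2 : ℕ) : ℝ) by norm_num, Real.rpow_natCast]
  rw [hpow] at hp1 hp2
  have hr2 : ‖vline w‖ ≤ ‖vline w‖ ^ 3 := by nlinarith [mul_nonneg hr0 hr0]
  have hr3 : 1 ≤ ‖vline w‖ ^ 3 := by linarith
  have n1 : ‖Complex.log (vline w) * vline w ^ (κ : ℂ)‖ ≤ 3 * ‖vline w‖ ^ 3 := by
    rw [norm_mul]
    calc _ ≤ 3 * ‖vline w‖ * ‖vline w‖ ^ 2 := by gcongr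
      _ = _ := by ring
  have n2 : ‖((1 : ℂ) - a) * Complex.log (vline w)‖ ≤ 3 * |1 - a| * ‖vline w‖ ^ 3 := by
    rw [norm_mul, show (1 - a : ℂ) = ((1 - a : ℝ) : ℂ) by push_cast; ring, Complex.norm_real,
      Real.norm_eq_abs]
    calc _ ≤ |1 - a| * (3 * ‖vline w‖ ^ 3) := by gcongr; linarith
      _ = _ := by ring
  have n3 : ‖(z : ℂ) * (l / 2) * Complex.log (vline w) *
      vline w ^ ((κ * (l / 2) : ℝ) : ℂ)‖ ≤ 3 * (z * (l / 2)) * ‖vline w‖ ^ 3 := by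
    rw [norm_mul, norm_mul, show (z * (l / 2) : ℂ) = ((z * (l / 2) : ℝ) : ℂ) by push_cast; ring,
      Complex.norm_real, Real.norm_of_nonneg (by positivity)]
    calc _ ≤ z * (l / 2) * (3 * ‖vline w‖) * ‖vline w‖ ^ 2 := by gcongr
      _ = _ := by ring
  have hbr : ‖(1 + κ * (Complex.log (vline w) * vline w ^ (κ : ℂ) +
      (1 - a) * Complex.log (vline w) -
      z * (l / 2) * Complex.log (vline w) * vline w ^ ((κ * (l / 2) : ℝ) : ℂ)) : ℂ)‖ ≤
      (7 + 6 * |1 - a| + 6 * (z * (l / 2))) * ‖vline w‖ ^ 3 := by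
    refine (norm_add_le _ _).trans ?_
    rw [norm_one, norm_mul, Complex.norm_real, Real.norm_of_nonneg (by linarith [hκ.1])]
    have n4 := (norm_sub_le (Complex.log (vline w) * vline w ^ (κ : ℂ) +
      (1 - a) * Complex.log (vline w)) (z * (l / 2) * Complex.log (vline w) *
        vline w ^ ((κ * (l / 2) : ℝ) : ℂ))).trans
      (add_le_add (norm_add_le _ _) le_rfl)
    have n5 : κ * ‖Complex.log (vline w) * vline w ^ (κ : ℂ) +
      (1 - a) * Complex.log (vline w) - z * (l / 2) * Complex.log (vline w) *
        vline w ^ ((κ * (l / 2) : ℝ) : ℂ)‖ ≤ 2 * (3 * ‖vline w‖ ^ 3 +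
        3 * |1 - a| * ‖vline w‖ ^ 3 + 3 * (z * (l / 2)) * ‖vline w‖ ^ 3) :=
      mul_le_mul hκ.2 (by linarith) (norm_nonneg _) zero_le_two
    linarith
  have h0 : 0 ≤ 7 + 6 * |1 - a| + 6 * (z * (l / 2)) := by positivity
  rw [contourIntDeriv, norm_mul, norm_vline_rpow_add]
  refine (mul_le_mul (norm_contourInt_le hl₀ hl₁ a hz hκ w) hbr (norm_nonneg _)
    (by positivity)).trans (le_of_eq ?_)
  ring

lemma continuous_contourInt_line (l a z κ : ℝ) : Continuous (contourInt l a z κ) :=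
  ((continuous_vline_cpow _).cexp.mul (continuous_vline_cpow _)).mul
    (continuous_const.mul (continuous_vline_cpow _)).neg.cexp

/-- The Wright function as an integral over a vertical line. -/
lemma wright_eq_vertical {l : ℝ} (hl₀ : 0 < l) (hl₁ : l < 1) (a : ℝ) {z : ℝ} (hz : 0 < z) :
    wright l a z = (2 * Real.pi)⁻¹ * (∫ w, Complex.exp (vline w) * vline w ^ ((-a : ℝ) : ℂ) *
      Complex.exp (-(z * vline w ^ ((l / 2 : ℝ) : ℂ)))).re := by
  have hc := cos_mul_pi_div_two_pos hl₀ hl₁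
  have hint := integrable_inv_one_add_sq
  have hbd : ∀ M : ℝ, ∃ C, 0 < C ∧ ∀ w, ‖vline w‖ ^ M *
      Real.exp (-(z * Real.cos (l * (Real.pi / 2)) * ‖vline w‖ ^ (l / 2))) ≤
        C * (1 + w ^ 2)⁻¹ := fun M =>
    exists_norm_vline_rpow_mul_exp_le (mul_pos hz hc) (half_pos hl₀) M
  have hcont := continuous_contourInt_line l a z
  have hfi : ∀ κ ∈ Icc (1 : ℝ) 2, Integrable fun w => (κ : ℂ) * contourInt l a z κ w := by
    intro κ hκ
    obtain ⟨C, hC, h⟩ := hbd (2 * |1 - a|)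
    refine Integrable.const_mul ?_ _
    refine (hint.const_mul (Real.exp 1 * C)).mono' (hcont κ).aestronglyMeasurable
      (ae_of_all _ fun w => (norm_contourInt_le hl₀ hl₁ a hz hκ w).trans ?_)
    rw [mul_assoc (Real.exp 1)]
    exact mul_le_mul_of_nonneg_left (h w) (Real.exp_pos 1).le
  obtain ⟨C, hC, h3⟩ := hbd (2 * |1 - a| + (3 : ℕ))
  have hgi : ∀ κ ∈ Icc (1 : ℝ) 2, Integrable fun w =>
      -Complex.I * (contourInt l a z κ w * vline w * Complex.log (vline w)) := by
    intro κ hκ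
    obtain ⟨C, hC, h⟩ := hbd (2 * |1 - a| + (2 : ℕ))
    refine ((hint.const_mul C).const_mul (Real.exp 1 * 3)).mono' ?_ (ae_of_all _ fun w => ?_)
    · have h5 : Continuous fun w => Complex.log (vline w) :=
        continuous_vline.clog vline_mem_slitPlane
      exact (continuous_const.mul (((hcont κ).mul continuous_vline).mul h5)).aestronglyMeasurable
    · rw [norm_mul, norm_neg, Complex.norm_I, one_mul, norm_mul, norm_mul]
      refine le_trans ?_ (mul_le_mul_of_nonneg_left (h w) (by positivity))
      rw [norm_vline_rpow_add]
      refine (mul_le_mul (mul_le_mul_of_nonneg_right (norm_contourInt_le hl₀ hl₁ a hz hκ w)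
        (norm_nonneg _)) (norm_log_vline_le w) (norm_nonneg _) (by positivity)).trans
        (le_of_eq ?_)
      ring
  -- κ = 1 is the vertical line and κ = 2 the parabola defining `wright`.
  have key := integral_eq_of_deformation one_le_two
    (f := fun κ w => (κ : ℂ) * contourInt l a z κ w)
    (h := contourIntDeriv l a z)
    (g := fun κ w => -Complex.I * (contourInt l a z κ w * vline w * Complex.log (vline w)))
    (bd := fun w => Real.exp 1 * (7 + 6 * |1 - a| + 6 * (z * (l / 2))) * (C * (1 + w ^ 2)⁻¹))
    ((hint.const_mul _).const_mul _) (fun κ _ w => hasDerivAt_mul_contourInt l a z κ w)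
    (continuous_contourIntDeriv l a z).continuousOn
    (fun κ hκ w => (norm_contourIntDeriv_le hl₀ hl₁ a hz hκ w).trans
      (mul_le_mul_of_nonneg_left (h3 w) (by positivity)))
    (fun κ _ w => hasDerivAt_contourInt_mul_log l a z κ w)
    hgi (hfi 1 (by simp)) (hfi 2 (by simp))
  · have e1 : ∀ w, ((1 : ℝ) : ℂ) * contourInt l a z 1 w = Complex.exp (vline w) *
        vline w ^ ((-a : ℝ) : ℂ) * Complex.exp (-(z * vline w ^ ((l / 2 : ℝ) : ℂ))) := by
      intro w
      simp only [contourInt, Complex.ofReal_one, one_mul, Complex.cpow_one]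
      congr 4
      ring_nf
    have e2 : ∀ w, ((2 : ℝ) : ℂ) * contourInt l a z 2 w = 2 * wrightInt l a z w := by
      intro w
      simp only [contourInt, wrightInt]
      rw [show ((2 : ℝ) : ℂ) = ((2 : ℕ) : ℂ) by norm_num, Complex.cpow_natCast,
        show (2 * (1 - a) - 1 : ℝ) = 1 - 2 * a by ring, show 2 * (l / 2) = l by ring]
      norm_num
    simp only [e1, e2] at key
    rw [key, integral_const_mul, wright]
    rw [show (2 : ℂ) = ((2 : ℝ) : ℂ) by norm_num, Complex.re_ofReal_mul]
    field_simp

/-! ### The kernel as an inverse Laplace transform and its fractional integrals -/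

/-- The kernel with Laplace transform `s ^ (-a) * exp (-x * s ^ (l / 2))` in the variable `t`. -/
def fker (l a x t : ℝ) : ℝ :=
  if 0 < t then t ^ (a - 1) * wright l a (x * t ^ (-(l / 2))) else 0

lemma fker_of_pos {l a x t : ℝ} (ht : 0 < t) :
    fker l a x t = t ^ (a - 1) * wright l a (x * t ^ (-(l / 2))) := if_pos ht

lemma fker_of_nonpos {l a x t : ℝ} (ht : t ≤ 0) : fker l a x t = 0 := if_neg ht.not_gt

/-- The integrand of the kernel `fker` over the line `Re s = μ`. -/
def vertInt (l a x t μ w : ℝ) : ℂ :=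
  Complex.exp (((t * μ : ℝ) : ℂ) * vline w) * ((μ ^ (1 - a) : ℝ) : ℂ) *
    vline w ^ ((-a : ℝ) : ℂ) *
    Complex.exp (-(((x * μ ^ (l / 2) : ℝ) : ℂ) * vline w ^ ((l / 2 : ℝ) : ℂ)))

/-- The derivative of `vertInt` in `μ`. -/
def vertIntDeriv (l a x t μ w : ℝ) : ℂ :=
  vertInt l a x t μ w * (t * vline w + (((1 - a) * μ⁻¹ : ℝ) : ℂ) -
    ((x * (l / 2) * μ ^ (l / 2 - 1) : ℝ) : ℂ) * vline w ^ ((l / 2 : ℝ) : ℂ))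

lemma continuous_vertInt_line (l a x t μ : ℝ) : Continuous (vertInt l a x t μ) :=
  (((continuous_const.mul continuous_vline).cexp.mul continuous_const).mul
    (continuous_vline_cpow _)).mul (continuous_const.mul (continuous_vline_cpow _)).neg.cexp

lemma norm_vertInt_le {l : ℝ} (hl₀ : 0 < l) (hl₁ : l < 1) (a : ℝ) {x : ℝ} (hx : 0 < x) (t : ℝ)
    {m μ : ℝ} (hm : 0 < m) (hμ : m ≤ μ) (w : ℝ) :
    ‖vertInt l a x t μ w‖ ≤ Real.exp (t * μ) * μ ^ (1 - a) * (‖vline w‖ ^ (-a) *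
      Real.exp (-(x * m ^ (l / 2) * Real.cos (l * (Real.pi / 2)) * ‖vline w‖ ^ (l / 2)))) := by
  have hμ0 := hm.trans_le hμ
  have hc := cos_mul_pi_div_two_pos hl₀ hl₁
  have h1 : ‖Complex.exp (((t * μ : ℝ) : ℂ) * vline w)‖ = Real.exp (t * μ) := by
    rw [Complex.norm_exp, Complex.re_ofReal_mul, vline_re, mul_one]
  have h2 : ‖Complex.exp (-(((x * μ ^ (l / 2) : ℝ) : ℂ) * vline w ^ ((l / 2 : ℝ) : ℂ)))‖ ≤
      Real.exp (-(x * m ^ (l / 2) * Real.cos (l * (Real.pi / 2)) * ‖vline w‖ ^ (l / 2))) := by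
    rw [Complex.norm_exp, Real.exp_le_exp, Complex.neg_re, Complex.re_ofReal_mul, neg_le_neg_iff]
    have h1 := cos_mul_norm_le_re_vline_cpow (l := l) (p := l / 2)
      (by positivity) (by linarith) hl₁ w
    rw [mul_assoc (x * m ^ (l / 2))]
    refine mul_le_mul ?_ h1 (by positivity) (by positivity)
    gcongr
  rw [vertInt, norm_mul, norm_mul, norm_mul, h1, Complex.norm_real, norm_vline_cpow,
    Real.norm_of_nonneg (by positivity), mul_assoc (Real.exp (t * μ) * μ ^ (1 - a))]
  gcongr

lemma hasDerivAt_vertInt (l a x t w : ℝ) {μ : ℝ} (hμ : 0 < μ) :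
    HasDerivAt (fun μ => vertInt l a x t μ w) (vertIntDeriv l a x t μ w) μ := by
  have h1 : HasDerivAt (fun μ : ℝ => ((t * μ : ℝ) : ℂ)) (t : ℂ) μ := by
    have := ((hasDerivAt_id μ).const_mul t).ofReal_comp
    simpa using this
  have h2 : HasDerivAt (fun μ : ℝ => ((μ ^ (1 - a) : ℝ) : ℂ))
      (((μ ^ (1 - a) * ((1 - a) * μ⁻¹) : ℝ)) : ℂ) μ := by
    refine ((Real.hasDerivAt_rpow_const (p := 1 - a) (Or.inl hμ.ne')).ofReal_comp).congr_deriv ?_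
    rw [Real.rpow_sub_one hμ.ne']
    push_cast
    ring
  have h3 : HasDerivAt (fun μ : ℝ => ((x * μ ^ (l / 2) : ℝ) : ℂ))
      ((x * (l / 2) * μ ^ (l / 2 - 1) : ℝ) : ℂ) μ := by
    refine (((Real.hasDerivAt_rpow_const (p := l / 2)
      (Or.inl hμ.ne')).const_mul x).ofReal_comp).congr_deriv ?_
    push_cast
    ring
  refine ((((h1.mul_const (vline w)).cexp.mul h2).mul_const
    (vline w ^ ((-a : ℝ) : ℂ))).mul
    ((h3.mul_const (vline w ^ ((l / 2 : ℝ) : ℂ))).neg.cexp)).congr_deriv ?_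
  simp only [vertIntDeriv, vertInt, Pi.mul_apply, Pi.neg_apply]
  push_cast
  ring

/-- The same exchange of derivatives as for the curves σ^κ, now with s = μσ: ∂_μ s = σ and ∂_w s =
iμ, so the primitive in w is the integrand times σ/(iμ). -/
lemma hasDerivAt_vertInt_mul (l a x t w : ℝ) {μ : ℝ} (hμ : 0 < μ) :
    HasDerivAt (fun w => -Complex.I * (vertInt l a x t μ w * ((μ⁻¹ : ℝ) : ℂ) * vline w))
      (vertIntDeriv l a x t μ w) w := by
  have h1 := ((hasDerivAt_vline w).const_mul ((t * μ : ℝ) : ℂ)).cexp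
  have h2 := hasDerivAt_vline_cpow w (1 - a)
  have h3 := (((hasDerivAt_vline_cpow w (l / 2)).const_mul
    ((x * μ ^ (l / 2) : ℝ) : ℂ)).neg).cexp
  have hE : (fun w => -Complex.I * (vertInt l a x t μ w * ((μ⁻¹ : ℝ) : ℂ) * vline w)) =
      fun w => (-Complex.I * ((μ ^ (1 - a) : ℝ) : ℂ) * ((μ⁻¹ : ℝ) : ℂ)) *
        (Complex.exp (((t * μ : ℝ) : ℂ) * vline w) * vline w ^ ((1 - a : ℝ) : ℂ) *
        Complex.exp (-(((x * μ ^ (l / 2) : ℝ) : ℂ) * vline w ^ ((l / 2 : ℝ) : ℂ)))) := by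
    funext w
    rw [← vline_cpow_mul_self w (1 - a), vertInt, show 1 - a - 1 = -a by ring]
    ring
  rw [hE]
  refine (((h1.mul h2).mul h3).const_mul _).congr_deriv ?_
  simp only [vertIntDeriv, vertInt, Pi.mul_apply, Pi.neg_apply]
  rw [← vline_cpow_mul_self w (1 - a), ← vline_cpow_mul_self w (l / 2),
    show 1 - a - 1 = -a by ring, Real.rpow_sub_one hμ.ne' (l / 2)]
  have h0 : ((μ : ℝ) : ℂ) * ((μ⁻¹ : ℝ) : ℂ) = 1 := by
    rw [← Complex.ofReal_mul, mul_inv_cancel₀ hμ.ne', Complex.ofReal_one]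
  rw [div_eq_mul_inv (μ ^ (l / 2))]
  push_cast at h0 ⊢
  generalize Complex.exp ((t : ℂ) * μ * vline w) = e₁
  generalize ((μ ^ (1 - a) : ℝ) : ℂ) = e₂
  generalize vline w ^ (-(a : ℂ)) = e₃
  generalize vline w ^ ((l : ℂ) / 2 - 1) = e₄
  generalize ((μ ^ (l / 2) : ℝ) : ℂ) = e₅
  generalize Complex.exp (-((x : ℂ) * e₅ * (e₄ * vline w))) = e₆
  generalize ((μ : ℂ))⁻¹ = m' at h0 ⊢
  linear_combination (-(e₁ * e₂ * e₃ * e₆) * (m' * (t * μ * vline w + (1 - a)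
    - x * e₅ * (l / 2) * e₄ * vline w))) * Complex.I_sq + e₁ * e₂ * e₃ * e₆ * t * vline w * h0

lemma integrable_vertInt {l : ℝ} (hl₀ : 0 < l) (hl₁ : l < 1) (a : ℝ) {x : ℝ} (hx : 0 < x) (t : ℝ)
    {μ : ℝ} (hμ : 0 < μ) : Integrable (vertInt l a x t μ) := by
  have hc := cos_mul_pi_div_two_pos hl₀ hl₁
  obtain ⟨C, hC, h⟩ := exists_norm_vline_rpow_mul_exp_le
    (A := x * μ ^ (l / 2) * Real.cos (l * (Real.pi / 2))) (b := l / 2) (by positivity)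
    (by positivity) (-a)
  refine ((integrable_inv_one_add_sq.const_mul C).const_mul
    (Real.exp (t * μ) * μ ^ (1 - a))).mono' (continuous_vertInt_line l a x t μ).aestronglyMeasurable
    (ae_of_all _ fun w => (norm_vertInt_le hl₀ hl₁ a hx t hμ le_rfl w).trans ?_)
  exact mul_le_mul_of_nonneg_left (h w) (by positivity)

lemma integral_vertInt_eq_of_le {l : ℝ} (hl₀ : 0 < l) (hl₁ : l < 1) (a : ℝ) {x : ℝ} (hx : 0 < x)
    (t : ℝ) {m M : ℝ} (hm : 0 < m) (hmM : m ≤ M) :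
    ∫ w, vertInt l a x t m w = ∫ w, vertInt l a x t M w := by
  have hc := cos_mul_pi_div_two_pos hl₀ hl₁
  obtain ⟨C, hC, h⟩ := exists_norm_vline_rpow_mul_exp_le
    (A := x * m ^ (l / 2) * Real.cos (l * (Real.pi / 2))) (b := l / 2) (by positivity)
    (by positivity) (-a + (1 : ℕ))
  have hpos : ∀ μ ∈ Icc m M, 0 < μ := fun μ hμ => hm.trans_le hμ.1
  have hrp : ∀ q : ℝ, ContinuousOn (fun μ : ℝ => μ ^ q) (Icc m M) := fun q μ hμ =>
    (Real.continuousAt_rpow_const μ q (Or.inl (hpos μ hμ).ne')).continuousWithinAt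
  obtain ⟨K₁, hK₁⟩ := isCompact_Icc.exists_bound_of_continuousOn
    (f := fun μ : ℝ => Real.exp (t * μ) * μ ^ (1 - a)) (s := Icc m M)
    ((by fun_prop : Continuous fun μ : ℝ => Real.exp (t * μ)).continuousOn.mul (hrp _))
  obtain ⟨K₂, hK₂⟩ := isCompact_Icc.exists_bound_of_continuousOn
    (f := fun μ : ℝ => |t| + |(1 - a) * μ⁻¹| + |x * (l / 2) * μ ^ (l / 2 - 1)|) (s := Icc m M) (by
      have h1 := hrp (-1)
      have h2 := hrp (l / 2 - 1)
      simp only [Real.rpow_neg_one] at h1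
      fun_prop)
  refine integral_eq_of_deformation hmM (f := vertInt l a x t) (h := vertIntDeriv l a x t)
    (g := fun μ w => -Complex.I * (vertInt l a x t μ w * ((μ⁻¹ : ℝ) : ℂ) * vline w))
    (bd := fun w => K₁ * K₂ * (C * (1 + w ^ 2)⁻¹))
    ((integrable_inv_one_add_sq.const_mul _).const_mul _)
    (fun μ hμ w => hasDerivAt_vertInt l a x t w (hpos μ hμ)) ?_ ?_
    (fun μ hμ w => hasDerivAt_vertInt_mul l a x t w (hpos μ hμ)) ?_
    (integrable_vertInt hl₀ hl₁ a hx t hm) (integrable_vertInt hl₀ hl₁ a hx t (hm.trans_le hmM))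
  · have hrp' : ∀ q : ℝ, ContinuousOn (fun p : ℝ × ℝ => ((p.1 ^ q : ℝ) : ℂ))
        (Icc m M ×ˢ univ) := fun q =>
      Complex.continuous_ofReal.comp_continuousOn
        ((hrp q).comp continuous_fst.continuousOn fun p hp => hp.1)
    have h1 := hrp' (1 - a)
    have h2 := hrp' (l / 2)
    have h3 := hrp' (l / 2 - 1)
    have h4 := hrp' (-1)
    simp only [Real.rpow_neg_one] at h4
    have h5 : Continuous fun p : ℝ × ℝ => vline p.2 := continuous_vline.comp continuous_snd
    have h6 := fun q : ℝ => continuous_vline_cpow_comp (q := fun _ => q) continuous_const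
    have h7 := (h6 (-a)).continuousOn (s := Icc m M ×ˢ univ)
    have h8 := (h6 (l / 2)).continuousOn (s := Icc m M ×ˢ univ)
    have h9 := h5.continuousOn (s := Icc m M ×ˢ univ)
    have h10 : ContinuousOn (fun p : ℝ × ℝ => Complex.exp (((t * p.1 : ℝ) : ℂ) * vline p.2))
        (Icc m M ×ˢ univ) := by
      refine ContinuousOn.cexp (ContinuousOn.mul (Continuous.continuousOn (by fun_prop)) h9)
    have e1 : ContinuousOn (fun p : ℝ × ℝ => vertInt l a x t p.1 p.2) (Icc m M ×ˢ univ) := by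
      simp only [vertInt, Complex.ofReal_mul x]
      exact ((h10.mul h1).mul h7).mul (((continuousOn_const.mul h2).mul h8).neg.cexp)
    have e2 : ContinuousOn (fun p : ℝ × ℝ => vertIntDeriv l a x t p.1 p.2) (Icc m M ×ˢ univ) := by
      simp only [vertIntDeriv, Complex.ofReal_mul]
      refine e1.mul (((continuousOn_const.mul h9).add (continuousOn_const.mul h4)).sub
        ((continuousOn_const.mul h3).mul h8))
    exact e2
  · intro μ hμ w
    have hμ0 := hpos μ hμ
    have hr := one_le_norm_vline w
    have hbr : ‖(t * vline w + (((1 - a) * μ⁻¹ : ℝ) : ℂ) -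
        ((x * (l / 2) * μ ^ (l / 2 - 1) : ℝ) : ℂ) * vline w ^ ((l / 2 : ℝ) : ℂ) : ℂ)‖ ≤
        K₂ * ‖vline w‖ := by
      have h2 := norm_vline_cpow_le_rpow (p := l / 2) (N := 1) (by linarith) w
      rw [Real.rpow_one] at h2
      have h3 := (le_abs_self _).trans (hK₂ μ hμ)
      refine (norm_sub_le _ _).trans ((add_le_add (norm_add_le _ _) le_rfl).trans ?_)
      rw [norm_mul, norm_mul, Complex.norm_real, Complex.norm_real, Complex.norm_real,
        Real.norm_eq_abs, Real.norm_eq_abs, Real.norm_eq_abs]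
      calc _ ≤ |t| * ‖vline w‖ + |(1 - a) * μ⁻¹| * ‖vline w‖ +
            |x * (l / 2) * μ ^ (l / 2 - 1)| * ‖vline w‖ := by
            gcongr
            exact le_mul_of_one_le_right (abs_nonneg _) hr
        _ = (|t| + |(1 - a) * μ⁻¹| + |x * (l / 2) * μ ^ (l / 2 - 1)|) * ‖vline w‖ := by ring
        _ ≤ _ := by gcongr
    have hK := (le_abs_self _).trans (hK₁ μ hμ)
    have h1 := (norm_vertInt_le hl₀ hl₁ a hx t hm hμ.1 w).trans
      (mul_le_mul_of_nonneg_right hK (by positivity))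
    have hK1 : 0 ≤ K₁ := le_trans (by positivity) hK
    have hK2 : 0 ≤ K₂ := le_trans (abs_nonneg _) (hK₂ μ hμ)
    rw [vertIntDeriv, norm_mul]
    refine (mul_le_mul h1 hbr (norm_nonneg _) (by positivity)).trans ?_
    refine le_trans (le_of_eq ?_) (mul_le_mul_of_nonneg_left (h w) (by positivity))
    rw [norm_vline_rpow_add]
    ring
  · intro μ hμ
    have hμ0 := hpos μ hμ
    refine ((integrable_inv_one_add_sq.const_mul C).const_mul
      (Real.exp (t * μ) * μ ^ (1 - a) * μ⁻¹)).mono' ?_ (ae_of_all _ fun w => ?_)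
    · exact (continuous_const.mul (((continuous_vertInt_line l a x t μ).mul
        continuous_const).mul continuous_vline)).aestronglyMeasurable
    · rw [norm_mul, norm_neg, Complex.norm_I, one_mul, norm_mul, norm_mul, Complex.norm_real,
        Real.norm_of_nonneg (by positivity)]
      refine (mul_le_mul_of_nonneg_right (mul_le_mul_of_nonneg_right
        (norm_vertInt_le hl₀ hl₁ a hx t hm hμ.1 w) (by positivity)) (norm_nonneg _)).trans ?_
      refine le_trans (le_of_eq ?_) (mul_le_mul_of_nonneg_left (h w) (by positivity))
      rw [norm_vline_rpow_add]
      ring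

lemma integral_vertInt_eq {l : ℝ} (hl₀ : 0 < l) (hl₁ : l < 1) (a : ℝ) {x : ℝ} (hx : 0 < x)
    (t : ℝ) {m M : ℝ} (hm : 0 < m) (hM : 0 < M) :
    ∫ w, vertInt l a x t m w = ∫ w, vertInt l a x t M w := by
  rcases le_total m M with h | h
  · exact integral_vertInt_eq_of_le hl₀ hl₁ a hx t hm h
  · exact (integral_vertInt_eq_of_le hl₀ hl₁ a hx t hM h).symm

/-- Causality: the line can be pushed to Re s = μ → ∞, where exp(tμ) with t < 0 beats the power of
μ. -/
lemma integral_vertInt_eq_zero {l : ℝ} (hl₀ : 0 < l) (hl₁ : l < 1) (a : ℝ) {x : ℝ} (hx : 0 < x)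
    {t : ℝ} (ht : t < 0) : ∫ w, vertInt l a x t 1 w = 0 := by
  have hc := cos_mul_pi_div_two_pos hl₀ hl₁
  set J := ∫ w, ‖vline w‖ ^ (-a) *
      Real.exp (-(x * 1 ^ (l / 2) * Real.cos (l * (Real.pi / 2)) * ‖vline w‖ ^ (l / 2)))
  have hJi : Integrable fun w => ‖vline w‖ ^ (-a) *
      Real.exp (-(x * 1 ^ (l / 2) * Real.cos (l * (Real.pi / 2)) * ‖vline w‖ ^ (l / 2))) := by
    obtain ⟨C, hC, h⟩ := exists_norm_vline_rpow_mul_exp_le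
      (A := x * 1 ^ (l / 2) * Real.cos (l * (Real.pi / 2))) (b := l / 2) (by positivity)
      (by positivity) (-a)
    refine (integrable_inv_one_add_sq.const_mul C).mono' ?_ (ae_of_all _ fun w => ?_)
    · have hn : Continuous fun w => ‖vline w‖ := continuous_vline.norm
      have h0 : ∀ w, ‖vline w‖ ≠ 0 := fun w => norm_ne_zero_iff.2 (vline_ne_zero w)
      have h1 := fun q : ℝ => hn.rpow_const (p := q) fun w => Or.inl (h0 w)
      exact ((h1 _).mul (continuous_const.mul (h1 _)).neg.rexp).aestronglyMeasurable
    · rw [Real.norm_of_nonneg (by positivity)]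
      exact h w
  have h1 : Tendsto (fun μ : ℝ => Real.exp (t * μ) * μ ^ (1 - a) * J) atTop (𝓝 0) := by
    have h := (tendsto_rpow_mul_exp_neg_mul_atTop_nhds_zero (1 - a) (-t) (by linarith)).mul_const J
    rw [zero_mul] at h
    refine h.congr fun μ => ?_
    rw [neg_neg, mul_comm (μ ^ (1 - a))]
  have h2 : ∀ᶠ μ : ℝ in atTop, ‖∫ w, vertInt l a x t 1 w‖ ≤ Real.exp (t * μ) * μ ^ (1 - a) * J := by
    filter_upwards [eventually_ge_atTop 1] with μ hμ
    rw [integral_vertInt_eq hl₀ hl₁ a hx t one_pos (one_pos.trans_le hμ), ← integral_const_mul]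
    exact norm_integral_le_of_norm_le (hJi.const_mul _)
      (ae_of_all _ fun w => norm_vertInt_le hl₀ hl₁ a hx t one_pos hμ w)
  exact norm_le_zero_iff.1 (ge_of_tendsto h1 h2)

/-- For t > 0 the line is moved to Re s = 1/t, where the scaling recovers `wright_eq_vertical`; for
t < 0 both sides vanish. On the fixed line Re s = 1 time enters only through exp(tσ), so
convolutions in time become products. -/
lemma fker_eq_vertical {l : ℝ} (hl₀ : 0 < l) (hl₁ : l < 1) (a : ℝ) {x : ℝ} (hx : 0 < x)
    {t : ℝ} (ht : t ≠ 0) :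
    fker l a x t = (2 * Real.pi)⁻¹ * (∫ w, vertInt l a x t 1 w).re := by
  rcases lt_or_gt_of_ne ht with h | h
  · rw [fker_of_nonpos h.le, integral_vertInt_eq_zero hl₀ hl₁ a hx h]
    simp
  · have hz : 0 < x * t ^ (-(l / 2)) := by positivity
    rw [fker_of_pos h, wright_eq_vertical hl₀ hl₁ a hz,
      integral_vertInt_eq hl₀ hl₁ a hx t one_pos (inv_pos.2 h)]
    have e : ∀ w, vertInt l a x t t⁻¹ w = ((t ^ (a - 1) : ℝ) : ℂ) *
        (Complex.exp (vline w) * vline w ^ ((-a : ℝ) : ℂ) *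
        Complex.exp (-(((x * t ^ (-(l / 2)) : ℝ) : ℂ) * vline w ^ ((l / 2 : ℝ) : ℂ)))) := by
      intro w
      rw [vertInt, mul_inv_cancel₀ ht, Real.inv_rpow h.le, Real.inv_rpow h.le,
        ← Real.rpow_neg h.le, ← Real.rpow_neg h.le, neg_sub, Complex.ofReal_one, one_mul]
      ring
    simp_rw [e]
    rw [integral_const_mul, Complex.re_ofReal_mul]
    ring

lemma norm_exp_neg_mul_vline (t w : ℝ) : ‖Complex.exp (-(t * vline w))‖ = Real.exp (-t) := by
  rw [Complex.norm_exp, Complex.neg_re, Complex.re_ofReal_mul, vline_re, mul_one]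

lemma integrableOn_rpow_mul_exp_vline {c : ℝ} (hc : 0 < c) (w : ℝ) :
    IntegrableOn (fun t : ℝ => ((t ^ (c - 1) : ℝ) : ℂ) * Complex.exp (-(t * vline w)))
      (Ioi 0) := by
  refine (Real.GammaIntegral_convergent hc).mono' ?_ ?_
  · refine ContinuousOn.aestronglyMeasurable ?_ measurableSet_Ioi
    refine ContinuousOn.mul ?_ (Continuous.continuousOn (by fun_prop))
    exact Complex.continuous_ofReal.comp_continuousOn fun t ht =>
      (Real.continuousAt_rpow_const t _ (Or.inl (ne_of_gt ht))).continuousWithinAt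
  · filter_upwards [ae_restrict_mem measurableSet_Ioi] with t ht
    have ht' : (0 : ℝ) < t := ht
    rw [norm_mul, norm_exp_neg_mul_vline, Complex.norm_real, Real.norm_of_nonneg (by positivity),
      mul_comm]

lemma vline_mul_integral_rpow_mul_exp {c : ℝ} (hc : 0 < c) (w : ℝ) :
    vline w * ∫ t in Ioi (0 : ℝ), ((t ^ c : ℝ) : ℂ) * Complex.exp (-(t * vline w)) =
      c * ∫ t in Ioi (0 : ℝ), ((t ^ (c - 1) : ℝ) : ℂ) * Complex.exp (-(t * vline w)) := by
  have hi1 := integrableOn_rpow_mul_exp_vline hc w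
  have hi2 := integrableOn_rpow_mul_exp_vline (c := c + 1) (by linarith) w
  rw [add_sub_cancel_right] at hi2
  have h := integral_Ioi_of_hasDerivAt_of_tendsto (a := 0) (m := (0 : ℂ))
    (f := fun t : ℝ => ((t ^ c : ℝ) : ℂ) * Complex.exp (-(t * vline w)))
    (f' := fun t : ℝ => c * (((t ^ (c - 1) : ℝ) : ℂ) * Complex.exp (-(t * vline w))) -
      vline w * (((t ^ c : ℝ) : ℂ) * Complex.exp (-(t * vline w)))) ?_ ?_
    ((hi1.const_mul _).sub (hi2.const_mul _)) ?_
  · rw [integral_sub (hi1.const_mul _) (hi2.const_mul _), integral_const_mul, integral_const_mul,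
      Real.zero_rpow hc.ne', Complex.ofReal_zero, zero_mul, sub_zero, sub_eq_zero] at h
    exact h.symm
  · refine Continuous.continuousWithinAt ?_
    have : Continuous fun t : ℝ => t ^ c := Real.continuous_rpow_const hc.le
    fun_prop
  · intro t ht
    have ht' : (0 : ℝ) < t := ht
    have h1 := (Real.hasDerivAt_rpow_const (p := c) (Or.inl ht'.ne')).ofReal_comp
    have h2 : HasDerivAt (fun t : ℝ => -((t : ℂ) * vline w)) (-(1 * vline w)) t :=
      ((Complex.ofRealCLM.hasDerivAt (x := t)).mul_const _).neg
    refine (h1.mul h2.cexp).congr_deriv ?_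
    push_cast
    ring
  · rw [tendsto_zero_iff_norm_tendsto_zero]
    have h1 := tendsto_rpow_mul_exp_neg_mul_atTop_nhds_zero c 1 one_pos
    refine h1.congr' ?_
    filter_upwards [eventually_gt_atTop 0] with t ht
    rw [norm_mul, norm_exp_neg_mul_vline, Complex.norm_real, Real.norm_of_nonneg (by positivity)]
    ring_nf

lemma hasDerivAt_integral_rpow_mul_exp_vline {c : ℝ} (hc : 0 < c) (w : ℝ) :
    HasDerivAt (fun w : ℝ => ∫ t in Ioi (0 : ℝ),
        ((t ^ (c - 1) : ℝ) : ℂ) * Complex.exp (-(t * vline w)))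
      (-Complex.I * ∫ t in Ioi (0 : ℝ), ((t ^ c : ℝ) : ℂ) * Complex.exp (-(t * vline w))) w := by
  have hi2 := fun w => integrableOn_rpow_mul_exp_vline (c := c + 1) (by linarith) w
  rw [add_sub_cancel_right] at hi2
  have key := hasDerivAt_integral_of_dominated_loc_of_deriv_le (μ := volume.restrict (Ioi 0))
    (𝕜 := ℝ) (F := fun w t => ((t ^ (c - 1) : ℝ) : ℂ) * Complex.exp (-(t * vline w)))
    (F' := fun w t => -Complex.I * (((t ^ c : ℝ) : ℂ) * Complex.exp (-(t * vline w))))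
    (x₀ := w) (s := univ) univ_mem
    (Eventually.of_forall fun w => (integrableOn_rpow_mul_exp_vline hc w).aestronglyMeasurable)
    (integrableOn_rpow_mul_exp_vline hc w) ((hi2 w).const_mul _).aestronglyMeasurable
    (bound := fun t => Real.exp (-t) * t ^ c) ?_ ?_ ?_
  · refine key.2.congr_deriv ?_
    rw [integral_const_mul]
  · filter_upwards [ae_restrict_mem measurableSet_Ioi] with t ht w _
    have ht' : (0 : ℝ) < t := ht
    rw [norm_mul, norm_neg, Complex.norm_I, one_mul, norm_mul, norm_exp_neg_mul_vline,
      Complex.norm_real, Real.norm_of_nonneg (by positivity), mul_comm]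
  · have := Real.GammaIntegral_convergent (s := c + 1) (by linarith)
    rwa [add_sub_cancel_right] at this
  · filter_upwards [ae_restrict_mem measurableSet_Ioi] with t ht w _
    have ht' : (0 : ℝ) < t := ht
    have h2 := (((hasDerivAt_vline w).const_mul (t : ℂ)).neg).cexp.const_mul
      ((t ^ (c - 1) : ℝ) : ℂ)
    refine h2.congr_deriv ?_
    simp only [Pi.neg_apply]
    rw [show t ^ c = t ^ (c - 1) * t by rw [Real.rpow_sub_one ht'.ne']; field_simp]
    push_cast
    ring

/-- If I denotes the integral, integration by parts expresses σ times its w-derivative through I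
itself, and σ^c I turns out to be constant along the line. At σ = 1 it equals Γ(c). -/
lemma integral_rpow_mul_exp_neg_mul_vline {c : ℝ} (hc : 0 < c) (w : ℝ) :
    ∫ t in Ioi (0 : ℝ), ((t ^ (c - 1) : ℝ) : ℂ) * Complex.exp (-(t * vline w)) =
      Real.Gamma c * vline w ^ ((-c : ℝ) : ℂ) := by
  set I : ℝ → ℂ := fun w => ∫ t in Ioi (0 : ℝ),
    ((t ^ (c - 1) : ℝ) : ℂ) * Complex.exp (-(t * vline w)) with hI
  have hd : ∀ w, HasDerivAt (fun w => vline w ^ (c : ℂ) * I w) 0 w := by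
    intro w
    have h := (hasDerivAt_vline_cpow w c).mul (hasDerivAt_integral_rpow_mul_exp_vline hc w)
    refine h.congr_deriv ?_
    have h1 := vline_mul_integral_rpow_mul_exp hc w
    rw [← vline_cpow_mul_self w c]
    linear_combination (-vline w ^ ((c - 1 : ℝ) : ℂ) * Complex.I) * h1
  have hconst := is_const_of_deriv_eq_zero (fun w => (hd w).differentiableAt)
    (fun w => (hd w).deriv) w 0
  have h0 : vline 0 = 1 := by simp [vline]
  have h1 : I 0 = Real.Gamma c := by
    rw [Real.Gamma_eq_integral hc, hI, ← integral_complex_ofReal]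
    refine setIntegral_congr_fun measurableSet_Ioi fun t _ => ?_
    simp only [h0]
    push_cast
    rw [mul_one, mul_comm]
  simp only [h0, Complex.one_cpow, one_mul, h1] at hconst
  have hne : vline w ^ (c : ℂ) ≠ 0 := by
    rw [Complex.cpow_ne_zero_iff]
    exact Or.inl (vline_ne_zero w)
  rw [Complex.ofReal_neg, Complex.cpow_neg, ← hconst]
  field_simp
  simp [hI]

/-- The fractional integral of order `c` of the kernel `fker l a` is `fker l (a + c)`. -/
lemma integral_rpow_mul_fker {l : ℝ} (hl₀ : 0 < l) (hl₁ : l < 1) (a : ℝ) {c : ℝ} (hc : 0 < c)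
    {x : ℝ} (hx : 0 < x) {y : ℝ} (hy : 0 < y) :
    ∫ t in (0 : ℝ)..y, (y - t) ^ (c - 1) * fker l a x t = Real.Gamma c * fker l (a + c) x y := by
  -- The kernel vanishes for negative times, so after reflection the upper limit may be taken
  -- infinite.
  have h1 : ∫ t in (0 : ℝ)..y, (y - t) ^ (c - 1) * fker l a x t =
      ∫ t in Ioi (0 : ℝ), t ^ (c - 1) * fker l a x (y - t) := by
    have := intervalIntegral.integral_comp_sub_left (a := 0) (b := y)
      (fun t => t ^ (c - 1) * fker l a x (y - t)) y
    simp only [sub_sub_cancel, sub_self, sub_zero] at this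
    rw [this, intervalIntegral.integral_of_le hy.le]
    refine (setIntegral_eq_of_subset_of_forall_sdiff_eq_zero measurableSet_Ioi
      Ioc_subset_Ioi_self fun t ht => ?_).symm
    have ht' : ¬ (t ≤ y) := fun h => ht.2 ⟨ht.1, h⟩
    rw [fker_of_nonpos (by linarith), mul_zero]
  -- A time shift is multiplication by exp(-tσ); integrating it against t^(c-1) then produces Γ(c)
  -- σ^(-c), which raises the parameter a by c.
  have hshift : ∀ t w, vertInt l a x (y - t) 1 w =
      Complex.exp (-(t * vline w)) * vertInt l a x y 1 w := by
    intro t w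
    simp only [vertInt]
    rw [show (((y - t) * 1 : ℝ) : ℂ) * vline w = -(t * vline w) + ((y * 1 : ℝ) : ℂ) * vline w by
      push_cast; ring, Complex.exp_add]
    ring
  set G : ℝ → ℝ → ℂ := fun t w => (((t ^ (c - 1) : ℝ) : ℂ) * Complex.exp (-(t * vline w))) *
    vertInt l a x y 1 w with hG
  have hVi := integrable_vertInt hl₀ hl₁ a hx y one_pos
  have hprod : Integrable (Function.uncurry G) ((volume.restrict (Ioi 0)).prod volume) := by
    have hb := (Real.GammaIntegral_convergent hc).mul_prod hVi.norm
    refine hb.mono' ?_ ?_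
    · have hm : (volume.restrict (Ioi (0 : ℝ))).prod (volume : Measure ℝ) =
          (volume.prod volume).restrict (Ioi 0 ×ˢ univ) := by
        rw [← Measure.prod_restrict, Measure.restrict_univ]
      rw [hm]
      refine ContinuousOn.aestronglyMeasurable ?_ (measurableSet_Ioi.prod MeasurableSet.univ)
      have e1 : ContinuousOn (fun p : ℝ × ℝ => ((p.1 ^ (c - 1) : ℝ) : ℂ)) (Ioi 0 ×ˢ univ) :=
        Complex.continuous_ofReal.comp_continuousOn fun p hp =>
          ((Real.continuousAt_rpow_const p.1 _ (Or.inl (ne_of_gt hp.1))).comp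
            continuous_fst.continuousAt).continuousWithinAt
      have e2 : Continuous fun p : ℝ × ℝ => Complex.exp (-(p.1 * vline p.2)) := by
        have := continuous_vline
        fun_prop
      exact (e1.mul e2.continuousOn).mul
        ((continuous_vertInt_line l a x y 1).comp continuous_snd).continuousOn
    · have h1 : ∀ᵐ p : ℝ × ℝ ∂((volume.restrict (Ioi 0)).prod volume), p.1 ∈ Ioi (0 : ℝ) :=
        (Measure.quasiMeasurePreserving_fst (μ := volume.restrict (Ioi (0 : ℝ)))
          (ν := (volume : Measure ℝ))).ae (ae_restrict_mem measurableSet_Ioi)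
      filter_upwards [h1] with p hp
      have hp' : (0 : ℝ) < p.1 := hp
      simp only [Function.uncurry_def, hG]
      rw [norm_mul, norm_mul, norm_exp_neg_mul_vline, Complex.norm_real,
        Real.norm_of_nonneg (by positivity), mul_comm (p.1 ^ (c - 1))]
  have h2 : ∫ t in Ioi (0 : ℝ), t ^ (c - 1) * fker l a x (y - t) =
      ∫ t in Ioi (0 : ℝ), (2 * Real.pi)⁻¹ * (∫ w, G t w).re := by
    refine integral_congr_ae ?_
    have hne : ∀ᵐ t ∂(volume.restrict (Ioi (0 : ℝ))), t ≠ y :=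
      ae_restrict_of_ae (Measure.ae_ne volume y)
    filter_upwards [hne] with t ht
    rw [fker_eq_vertical hl₀ hl₁ a hx (sub_ne_zero.2 ht.symm)]
    have : ∀ w, G t w = ((t ^ (c - 1) : ℝ) : ℂ) * vertInt l a x (y - t) 1 w := by
      intro w
      rw [hshift, hG]
      ring
    simp_rw [this]
    rw [integral_const_mul, Complex.re_ofReal_mul]
    ring
  have hGi : Integrable (fun t => ∫ w, G t w) (volume.restrict (Ioi 0)) := hprod.integral_prod_left
  have h3 : ∀ w, ∫ t in Ioi (0 : ℝ), G t w = Real.Gamma c * vertInt l (a + c) x y 1 w := by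
    intro w
    simp only [hG]
    rw [integral_mul_const, integral_rpow_mul_exp_neg_mul_vline hc, vertInt, vertInt,
      show ((-(a + c) : ℝ) : ℂ) = ((-a : ℝ) : ℂ) + ((-c : ℝ) : ℂ) by push_cast; ring,
      Complex.cpow_add _ _ (vline_ne_zero w), Real.one_rpow, Real.one_rpow, Real.one_rpow]
    ring
  rw [h1, h2, integral_const_mul, fker_eq_vertical hl₀ hl₁ (a + c) hx hy.ne']
  have h4 : ∫ t in Ioi (0 : ℝ), (∫ w, G t w).re = (∫ t in Ioi (0 : ℝ), ∫ w, G t w).re := by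
    have := ContinuousLinearMap.integral_comp_comm Complex.reCLM hGi
    simpa using this
  rw [h4, integral_integral_swap hprod]
  simp_rw [h3]
  rw [integral_const_mul, Complex.re_ofReal_mul]
  ring

/-! ### Derivatives and bounds of the kernel -/

lemma hasDerivAt_fker_left {l : ℝ} (hl₁ : l ≤ 1) (a x t : ℝ) :
    HasDerivAt (fun x => fker l a x t) (-fker l (a - l / 2) x t) x := by
  by_cases ht : 0 < t
  · simp only [fker_of_pos ht]
    have h1 := ((hasDerivAt_wright hl₁ a (x * t ^ (-(l / 2)))).comp x
      ((hasDerivAt_id x).mul_const (t ^ (-(l / 2))))).const_mul (t ^ (a - 1))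
    refine h1.congr_deriv ?_
    rw [show a - l / 2 - 1 = (a - 1) + (-(l / 2)) by ring, Real.rpow_add ht]
    ring
  · simp only [fker_of_nonpos (not_lt.1 ht), neg_zero]
    exact hasDerivAt_const x 0

/-- The product rule leaves (a - 1) W_a + (l/2) z W_{a-l/2} at z = x t^(-l/2), and `wright_sub_one`
recombines this into W_{a-1}. -/
lemma hasDerivAt_fker_right_of_pos {l : ℝ} (hl₁ : l ≤ 1) (a x : ℝ) {t : ℝ} (ht : 0 < t) :
    HasDerivAt (fun t => fker l a x t) (fker l (a - 1) x t) t := by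
  have h1 := (Real.hasDerivAt_rpow_const (p := a - 1) (Or.inl ht.ne')).mul
    ((hasDerivAt_wright hl₁ a (x * t ^ (-(l / 2)))).comp t
      ((Real.hasDerivAt_rpow_const (p := -(l / 2)) (Or.inl ht.ne')).const_mul x))
  have h2 : (fun t => fker l a x t) =ᶠ[𝓝 t]
      fun t => t ^ (a - 1) * wright l a (x * t ^ (-(l / 2))) := by
    filter_upwards [lt_mem_nhds ht] with s hs using fker_of_pos hs
  refine (h1.congr_of_eventuallyEq h2).congr_deriv ?_
  rw [fker_of_pos ht, wright_sub_one hl₁, Real.rpow_sub_one ht.ne' (a - 1),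
    Real.rpow_sub_one ht.ne' (-(l / 2))]
  simp only [Function.comp]
  field_simp

lemma exists_abs_fker_le {l : ℝ} (hl₀ : 0 ≤ l) (hl₁ : l ≤ 1) (a : ℝ) :
    ∃ C, 0 < C ∧ ∀ x t, 0 ≤ x → 0 < t →
      |fker l a x t| ≤ C * (t ^ (a - 1) * Real.exp (-(x * t ^ (-(l / 2))))) := by
  obtain ⟨C, hC, h⟩ := exists_abs_wright_le hl₀ hl₁ a
  refine ⟨C, hC, fun x t hx ht => ?_⟩
  rw [fker_of_pos ht, abs_mul, abs_of_pos (by positivity)]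
  have := h (x * t ^ (-(l / 2))) (by positivity)
  calc _ ≤ t ^ (a - 1) * (C * Real.exp (-(x * t ^ (-(l / 2))))) := by gcongr
    _ = _ := by ring

/-- Away from `x = 0`, the kernel is flat at `t = 0`. -/
lemma exists_abs_fker_le_mul {l : ℝ} (hl₀ : 0 < l) (hl₁ : l ≤ 1) (a : ℝ) {x₀ : ℝ} (hx₀ : 0 < x₀)
    (T : ℝ) : ∃ C, 0 < C ∧ ∀ x t, x₀ ≤ x → t ≤ T → |fker l a x t| ≤ C * |t| := by
  obtain ⟨C, hC, h⟩ := exists_abs_fker_le hl₀.le hl₁ a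
  set R := max T 1 with hR
  have hR1 : 1 ≤ R := le_max_right _ _
  have hR0 : 0 < R := by linarith
  -- To be used with r = R/t ≥ 1: then A r^(l/2) = x₀ t^(-l/2), and the exponent 2 - a is chosen so
  -- that t^(a-1) is bounded with one power of t to spare.
  obtain ⟨D, hD, h'⟩ := exists_rpow_mul_exp_neg_le (A := x₀ * R ^ (-(l / 2))) (b := l / 2)
    (by positivity) (by positivity) (2 - a)
  refine ⟨C * (D * R ^ (a - 2)), by positivity, fun x t hx ht => ?_⟩
  by_cases ht0 : 0 < t
  · refine (h x t (hx₀.le.trans hx) ht0).trans ?_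
    have htR : t ≤ R := ht.trans (le_max_left _ _)
    have hr : 1 ≤ R / t := by rwa [le_div_iff₀ ht0, one_mul]
    have h1 := h' (x₀ * R ^ (-(l / 2))) le_rfl (R / t) hr
    have e1 : x₀ * R ^ (-(l / 2)) * (R / t) ^ (l / 2) = x₀ * t ^ (-(l / 2)) := by
      rw [Real.div_rpow hR0.le ht0.le, Real.rpow_neg hR0.le, Real.rpow_neg ht0.le]
      have : R ^ (l / 2) ≠ 0 := by positivity
      field_simp
    have e2 : (R / t) ^ (2 - a) = R ^ (2 - a) * (t ^ (a - 1) * t⁻¹) := by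
      rw [Real.div_rpow hR0.le ht0.le, div_eq_mul_inv, ← Real.rpow_neg ht0.le,
        ← div_eq_mul_inv (t ^ (a - 1)), ← Real.rpow_sub_one ht0.ne']
      ring_nf
    rw [e1, e2] at h1
    have h2 : Real.exp (-(x * t ^ (-(l / 2)))) ≤ Real.exp (-(x₀ * t ^ (-(l / 2)))) := by
      rw [Real.exp_le_exp, neg_le_neg_iff]
      gcongr
    have e3 : R ^ (a - 2) * R ^ (2 - a) = 1 := by
      rw [← Real.rpow_add hR0]
      simp
    rw [abs_of_pos ht0, mul_assoc C]
    refine mul_le_mul_of_nonneg_left ?_ hC.le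
    calc t ^ (a - 1) * Real.exp (-(x * t ^ (-(l / 2))))
        ≤ t ^ (a - 1) * Real.exp (-(x₀ * t ^ (-(l / 2)))) := by gcongr
      _ = R ^ (a - 2) * (R ^ (2 - a) * (t ^ (a - 1) * t⁻¹) *
          Real.exp (-(x₀ * t ^ (-(l / 2))))) * t := by
          have : t⁻¹ * t = 1 := inv_mul_cancel₀ ht0.ne'
          linear_combination (-t ^ (a - 1) * Real.exp (-(x₀ * t ^ (-(l / 2))))) * e3 -
            (R ^ (a - 2) * R ^ (2 - a) * t ^ (a - 1) * Real.exp (-(x₀ * t ^ (-(l / 2))))) * this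
      _ ≤ R ^ (a - 2) * D * t := by gcongr
      _ = _ := by ring
  · rw [fker_of_nonpos (not_lt.1 ht0), abs_zero]
    positivity

lemma continuousAt_fker_right_zero {l : ℝ} (hl₀ : 0 < l) (hl₁ : l ≤ 1) (a : ℝ) {x : ℝ}
    (hx : 0 < x) : ContinuousAt (fun t => fker l a x t) 0 := by
  obtain ⟨C, hC, h⟩ := exists_abs_fker_le_mul hl₀ hl₁ a hx 1
  have h0 : fker l a x 0 = 0 := fker_of_nonpos le_rfl
  unfold ContinuousAt
  simp only [h0]
  refine squeeze_zero_norm' (a := fun t => C * |t|) ?_ ?_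
  · filter_upwards [gt_mem_nhds (one_pos : (0 : ℝ) < 1)] with t ht using h x t le_rfl ht.le
  · have : Continuous fun t : ℝ => C * |t| := by fun_prop
    simpa using this.tendsto 0

/-- For x > 0 every kernel of the family, whatever its parameter, is continuous at t = 0 with value
0, so the derivative formula extends through the junction with the zero branch. -/
lemma hasDerivAt_fker_right {l : ℝ} (hl₀ : 0 < l) (hl₁ : l ≤ 1) (a : ℝ) {x : ℝ} (hx : 0 < x)
    (t : ℝ) : HasDerivAt (fun t => fker l a x t) (fker l (a - 1) x t) t := by
  have hne : ∀ s ≠ (0 : ℝ), HasDerivAt (fun t => fker l a x t) (fker l (a - 1) x s) s := by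
    intro s hs
    rcases lt_or_gt_of_ne hs with h | h
    · rw [fker_of_nonpos h.le]
      refine (hasDerivAt_const s (0 : ℝ)).congr_of_eventuallyEq ?_
      filter_upwards [gt_mem_nhds h] with r hr using fker_of_nonpos hr.le
    · exact hasDerivAt_fker_right_of_pos hl₁ a x h
  by_cases ht : t = 0
  · subst ht
    exact hasDerivAt_of_hasDerivAt_of_ne hne (continuousAt_fker_right_zero hl₀ hl₁ a hx)
      (continuousAt_fker_right_zero hl₀ hl₁ (a - 1) hx)
  · exact hne t ht

lemma continuous_fker_right {l : ℝ} (hl₀ : 0 < l) (hl₁ : l ≤ 1) (a : ℝ) {x : ℝ} (hx : 0 < x) :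
    Continuous fun t => fker l a x t :=
  continuous_iff_continuousAt.2 fun t => (hasDerivAt_fker_right hl₀ hl₁ a hx t).continuousAt

lemma continuousOn_fker {l : ℝ} (hl₁ : l ≤ 1) (a : ℝ) :
    ContinuousOn (fun p : ℝ × ℝ => fker l a p.1 p.2) {p | 0 < p.2} := by
  have h : ContinuousOn (fun p : ℝ × ℝ => p.2 ^ (a - 1) *
      wright l a (p.1 * p.2 ^ (-(l / 2)))) {p | 0 < p.2} := by
    have h1 : ∀ q : ℝ, ContinuousOn (fun p : ℝ × ℝ => p.2 ^ q) {p | 0 < p.2} := fun q p hp =>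
      (continuous_snd.continuousAt.rpow_const (Or.inl (ne_of_gt hp))).continuousWithinAt
    exact (h1 _).mul ((continuous_wright hl₁ a).comp_continuousOn
      (continuous_fst.continuousOn.mul (h1 _)))
  exact h.congr fun p hp => fker_of_pos hp

lemma continuous_fker_left {l : ℝ} (hl₁ : l ≤ 1) (a t : ℝ) : Continuous fun x => fker l a x t :=
  continuous_iff_continuousAt.2 fun x => (hasDerivAt_fker_left hl₁ a x t).continuousAt

lemma measurable_fker {l : ℝ} (hl₁ : l ≤ 1) (a : ℝ) :
    Measurable fun p : ℝ × ℝ => fker l a p.1 p.2 := by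
  unfold fker
  refine Measurable.ite (measurableSet_lt measurable_const measurable_snd) ?_ measurable_const
  exact (measurable_snd.pow_const _).mul ((continuous_wright hl₁ a).measurable.comp
    (measurable_fst.mul (measurable_snd.pow_const _)))

/-! ### Layer potentials -/

/-- The convolution in `y` of the kernel `fker l a x` with the density `ρ`. -/
def layer (l a : ℝ) (ρ : ℝ → ℝ) (x y : ℝ) : ℝ := ∫ t in (0 : ℝ)..y, fker l a x t * ρ (y - t)

lemma layer_of_nonpos (l a : ℝ) (ρ : ℝ → ℝ) (x : ℝ) {y : ℝ} (hy : y ≤ 0) :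
    layer l a ρ x y = 0 := by
  unfold layer
  rw [intervalIntegral.integral_symm, neg_eq_zero]
  refine intervalIntegral.integral_zero_ae (ae_of_all _ fun t ht => ?_)
  rw [uIoc_of_le hy] at ht
  rw [fker_of_nonpos ht.2, zero_mul]

/-- The domain of integration is made independent of y, as dominated convergence requires. -/
lemma layer_eq_setIntegral (l a : ℝ) (ρ : ℝ → ℝ) (x : ℝ) {y Y : ℝ} (hy : y ≤ Y) :
    layer l a ρ x y = ∫ t in Ioo 0 Y, (Ioo 0 y).indicator (fun t => fker l a x t * ρ (y - t)) t := by
  by_cases h0 : 0 < y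
  · rw [setIntegral_indicator measurableSet_Ioo, inter_eq_self_of_subset_right
      (Ioo_subset_Ioo_right hy), layer, intervalIntegral.integral_of_le h0.le,
      integral_Ioc_eq_integral_Ioo]
  · rw [layer_of_nonpos l a ρ x (not_lt.1 h0), Ioo_eq_empty h0]
    simp

/-- Joint continuity of a layer potential, given a dominating function for its kernel. -/
lemma continuousWithinAt_layer {l : ℝ} (hl₁ : l ≤ 1) {a : ℝ} {ρ : ℝ → ℝ}
    (hρ : Continuous ρ) {R : ℝ} (hR : ∀ t, |ρ t| ≤ R) {D : Set ℝ} {g : ℝ → ℝ} {x₀ y₀ : ℝ}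
    (hg : IntegrableOn g (Ioo 0 (y₀ + 1)))
    (hb : ∀ x ∈ D, ∀ t ∈ Ioo 0 (y₀ + 1), |fker l a x t| ≤ g t) :
    ContinuousWithinAt (fun p : ℝ × ℝ => layer l a ρ p.1 p.2) (D ×ˢ univ) (x₀, y₀) := by
  have hR0 : 0 ≤ R := (abs_nonneg _).trans (hR 0)
  have hnear : ∀ᶠ p : ℝ × ℝ in 𝓝[D ×ˢ univ] (x₀, y₀), p.1 ∈ D ∧ p.2 < y₀ + 1 := by
    have h1 : ∀ᶠ p : ℝ × ℝ in 𝓝 (x₀, y₀), p.2 < y₀ + 1 :=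
      continuous_snd.continuousAt.eventually_lt continuousAt_const (by simp)
    filter_upwards [self_mem_nhdsWithin, nhdsWithin_le_nhds h1] with p hp hp'
    exact ⟨hp.1, hp'⟩
  have key : Tendsto (fun p : ℝ × ℝ => ∫ t in Ioo 0 (y₀ + 1),
      (Ioo 0 p.2).indicator (fun t => fker l a p.1 t * ρ (p.2 - t)) t) (𝓝[D ×ˢ univ] (x₀, y₀))
      (𝓝 (∫ t in Ioo 0 (y₀ + 1),
        (Ioo 0 y₀).indicator (fun t => fker l a x₀ t * ρ (y₀ - t)) t)) := by
    refine tendsto_integral_filter_of_dominated_convergence (fun t => g t * R) ?_ ?_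
      (hg.mul_const R) ?_
    · refine Eventually.of_forall fun p => ?_
      refine AEStronglyMeasurable.indicator ?_ measurableSet_Ioo
      refine Measurable.aestronglyMeasurable ?_
      refine ((measurable_fker hl₁ a).comp (measurable_const.prodMk measurable_id)).mul ?_
      exact (hρ.comp (continuous_const.sub continuous_id)).measurable
    · filter_upwards [hnear] with p hp
      filter_upwards [ae_restrict_mem measurableSet_Ioo] with t ht
      have h1 := hb p.1 hp.1 t ht
      refine (norm_indicator_le_norm_self _ _).trans ?_
      rw [norm_mul]
      exact mul_le_mul h1 (hR _) (norm_nonneg _) ((abs_nonneg _).trans h1)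
    · have hne : ∀ᵐ t ∂(volume.restrict (Ioo (0 : ℝ) (y₀ + 1))), t ≠ y₀ :=
        ae_restrict_of_ae (Measure.ae_ne volume y₀)
      filter_upwards [hne, ae_restrict_mem measurableSet_Ioo] with t hty ht
      refine Tendsto.mono_left ?_ nhdsWithin_le_nhds
      rcases lt_or_gt_of_ne hty with h | h
      · have h1 : ∀ᶠ p : ℝ × ℝ in 𝓝 (x₀, y₀), t ∈ Ioo 0 p.2 := by
          filter_upwards [continuousAt_const.eventually_lt (f := fun _ => t)
            continuous_snd.continuousAt (by simpa using h : t < (x₀, y₀).2)] with p hp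
          exact ⟨ht.1, hp⟩
        rw [indicator_of_mem (show t ∈ Ioo 0 y₀ from ⟨ht.1, h⟩)]
        have h2 : Continuous fun p : ℝ × ℝ => fker l a p.1 t * ρ (p.2 - t) :=
          ((continuous_fker_left hl₁ a t).comp continuous_fst).mul
            (hρ.comp (continuous_snd.sub continuous_const))
        refine (h2.tendsto (x₀, y₀)).congr' ?_
        filter_upwards [h1] with p hp
        rw [indicator_of_mem hp]
      · have h1 : ∀ᶠ p : ℝ × ℝ in 𝓝 (x₀, y₀), t ∉ Ioo 0 p.2 := by
          filter_upwards [continuous_snd.continuousAt.eventually_lt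
            (continuousAt_const (y := t)) (by simpa using h : (x₀, y₀).2 < t)] with p hp hmem
          exact absurd hmem.2 (not_lt.2 (le_of_lt hp))
        rw [indicator_of_notMem (show t ∉ Ioo 0 y₀ from fun hm => absurd hm.2 (not_lt.2 h.le))]
        refine tendsto_const_nhds.congr' ?_
        filter_upwards [h1] with p hp
        rw [indicator_of_notMem hp]
  unfold ContinuousWithinAt
  simp only
  rw [layer_eq_setIntegral l a ρ x₀ (show y₀ ≤ y₀ + 1 by linarith)]
  refine key.congr' ?_
  filter_upwards [hnear] with p hp
  rw [layer_eq_setIntegral l a ρ p.1 hp.2.le]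

/-- For `a > 0` the layer potentials are continuous up to `x = 0`. -/
lemma continuousOn_layer_of_pos {l : ℝ} (hl₀ : 0 < l) (hl₁ : l ≤ 1) {a : ℝ} (ha : 0 < a)
    {ρ : ℝ → ℝ} (hρ : Continuous ρ) {R : ℝ} (hR : ∀ t, |ρ t| ≤ R) :
    ContinuousOn (fun p : ℝ × ℝ => layer l a ρ p.1 p.2) (Ici 0 ×ˢ univ) := by
  rintro ⟨x₀, y₀⟩ _
  obtain ⟨C, hC, h⟩ := exists_abs_fker_le hl₀.le hl₁ a
  refine continuousWithinAt_layer hl₁ hρ hR (g := fun t => C * t ^ (a - 1)) ?_ ?_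
  · refine Integrable.const_mul ?_ C
    by_cases hy : 0 ≤ y₀ + 1
    · have := (intervalIntegral.intervalIntegrable_rpow' (a := 0) (b := y₀ + 1) (r := a - 1)
        (by linarith)).1
      exact this.mono_set Ioo_subset_Ioc_self
    · rw [Ioo_eq_empty (by linarith)]
      simp
  · intro x hx t ht
    refine (h x t hx ht.1).trans ?_
    have ht0 := ht.1
    have : Real.exp (-(x * t ^ (-(l / 2)))) ≤ 1 := by
      rw [Real.exp_le_one_iff, neg_nonpos]
      exact mul_nonneg hx (by positivity)
    have h2 : t ^ (a - 1) * Real.exp (-(x * t ^ (-(l / 2)))) ≤ t ^ (a - 1) * 1 := by gcongr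
    rw [mul_one] at h2
    gcongr

/-- Inside the domain all the layer potentials are continuous. -/
lemma continuousOn_layer {l : ℝ} (hl₀ : 0 < l) (hl₁ : l ≤ 1) (a : ℝ)
    {ρ : ℝ → ℝ} (hρ : Continuous ρ) {R : ℝ} (hR : ∀ t, |ρ t| ≤ R) :
    ContinuousOn (fun p : ℝ × ℝ => layer l a ρ p.1 p.2) (Ioi 0 ×ˢ univ) := by
  rintro ⟨x₀, y₀⟩ ⟨hx, _⟩
  have hx' : 0 < x₀ := hx
  obtain ⟨C, hC, h⟩ := exists_abs_fker_le_mul hl₀ hl₁ a (half_pos hx') (y₀ + 1)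
  have h1 : ContinuousWithinAt (fun p : ℝ × ℝ => layer l a ρ p.1 p.2)
      (Ici (x₀ / 2) ×ˢ univ) (x₀, y₀) := by
    refine continuousWithinAt_layer hl₁ hρ hR (g := fun t => C * |t|) ?_ ?_
    · exact ((by fun_prop : Continuous fun t : ℝ => C * |t|).integrableOn_Icc).mono_set
        Ioo_subset_Icc_self
    · exact fun x hx t ht => h x t hx ht.2.le
  refine (h1.continuousAt ?_).continuousWithinAt
  exact prod_mem_nhds (Ici_mem_nhds (by linarith)) univ_mem

lemma hasDerivAt_layer_left {l : ℝ} (hl₀ : 0 < l) (hl₁ : l ≤ 1) (a : ℝ)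
    {ρ : ℝ → ℝ} (hρ : Continuous ρ) {R : ℝ} (hR : ∀ t, |ρ t| ≤ R) {x : ℝ} (hx : 0 < x) (y : ℝ) :
    HasDerivAt (fun x => layer l a ρ x y) (-layer l (a - l / 2) ρ x y) x := by
  by_cases hy : 0 < y
  swap
  · simp only [layer_of_nonpos _ _ _ _ (not_lt.1 hy), neg_zero]
    exact hasDerivAt_const x 0
  obtain ⟨C, hC, h⟩ := exists_abs_fker_le_mul hl₀ hl₁ (a - l / 2) (half_pos hx) y
  have hR0 : 0 ≤ R := (abs_nonneg _).trans (hR 0)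
  have hcont : ∀ a x, 0 < x → Continuous fun t => fker l a x t * ρ (y - t) := fun a x hx =>
    (continuous_fker_right hl₀ hl₁ a hx).mul (hρ.comp (continuous_const.sub continuous_id))
  have key := intervalIntegral.hasDerivAt_integral_of_dominated_loc_of_deriv_le
    (μ := volume) (a := 0) (b := y) (𝕜 := ℝ) (F := fun x t => fker l a x t * ρ (y - t))
    (F' := fun x t => -fker l (a - l / 2) x t * ρ (y - t)) (x₀ := x) (s := Ioi (x / 2))
    (bound := fun t => C * |t| * R) (Ioi_mem_nhds (by linarith))
    (by
      filter_upwards [lt_mem_nhds hx] with x hx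
      exact (hcont a x hx).aestronglyMeasurable)
    ((hcont a x hx).intervalIntegrable _ _)
    (by
      simp only [neg_mul]
      exact (hcont (a - l / 2) x hx).neg.aestronglyMeasurable)
    (ae_of_all _ fun t ht x hx => by
      rw [uIoc_of_le hy.le] at ht
      have h1 := h x t (le_of_lt hx) ht.2
      rw [norm_mul, norm_neg]
      exact mul_le_mul h1 (hR _) (norm_nonneg _) (by positivity))
    ((by fun_prop : Continuous fun t : ℝ => C * |t| * R).intervalIntegrable _ _)
    (ae_of_all _ fun t _ x _ => (hasDerivAt_fker_left hl₁ a x t).mul_const _)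
  refine key.2.congr_deriv ?_
  simp only [neg_mul, layer]
  rw [intervalIntegral.integral_neg]

/-- Putting the shift on the kernel, which vanishes at nonpositive times, removes y from both the
limits and the density. Differentiation in y then needs no regularity of `ρ` and gives no boundary
term. -/
lemma layer_eq_integral_fixed (l a : ℝ) (ρ : ℝ → ℝ) {x y Y : ℝ} (hl₀ : 0 < l) (hl₁ : l ≤ 1)
    (hx : 0 < x) (hρ : Continuous ρ) (hY : y ≤ Y) :
    layer l a ρ x y = ∫ t in (0 : ℝ)..Y, fker l a x (y - t) * ρ t := by
  have hc : Continuous fun t => fker l a x (y - t) * ρ t :=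
    ((continuous_fker_right hl₀ hl₁ a hx).comp (continuous_const.sub continuous_id)).mul hρ
  have h1 : layer l a ρ x y = ∫ t in (0 : ℝ)..y, fker l a x (y - t) * ρ t := by
    have := intervalIntegral.integral_comp_sub_left (a := 0) (b := y)
      (fun t => fker l a x t * ρ (y - t)) y
    simp only [sub_sub_cancel, sub_self, sub_zero] at this
    rw [layer, ← this]
  have h2 : ∫ t in y..Y, fker l a x (y - t) * ρ t = 0 := by
    refine intervalIntegral.integral_zero_ae (ae_of_all _ fun t ht => ?_)
    rw [uIoc_of_le hY] at ht
    rw [fker_of_nonpos (by linarith [ht.1]), zero_mul]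
  rw [h1, ← intervalIntegral.integral_add_adjacent_intervals (hc.intervalIntegrable 0 y)
    (hc.intervalIntegrable y Y), h2, add_zero]

lemma hasDerivAt_layer_right {l : ℝ} (hl₀ : 0 < l) (hl₁ : l ≤ 1) (a : ℝ)
    {ρ : ℝ → ℝ} (hρ : Continuous ρ) {R : ℝ} (hR : ∀ t, |ρ t| ≤ R) {x : ℝ} (hx : 0 < x) {y : ℝ}
    (hy : 0 < y) : HasDerivAt (fun y => layer l a ρ x y) (layer l (a - 1) ρ x y) y := by
  obtain ⟨C, hC, h⟩ := exists_abs_fker_le_mul hl₀ hl₁ (a - 1) hx (y + 1)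
  have hR0 : 0 ≤ R := (abs_nonneg _).trans (hR 0)
  have hcont : ∀ a y, Continuous fun t => fker l a x (y - t) * ρ t := fun a y =>
    ((continuous_fker_right hl₀ hl₁ a hx).comp (continuous_const.sub continuous_id)).mul hρ
  have key := intervalIntegral.hasDerivAt_integral_of_dominated_loc_of_deriv_le
    (μ := volume) (a := 0) (b := y + 1) (𝕜 := ℝ) (F := fun y t => fker l a x (y - t) * ρ t)
    (F' := fun y t => fker l (a - 1) x (y - t) * ρ t) (x₀ := y) (s := Ioo 0 (y + 1))
    (bound := fun t => C * (y + 1) * R) (Ioo_mem_nhds hy (by linarith))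
    (Eventually.of_forall fun y => (hcont a y).aestronglyMeasurable)
    ((hcont a y).intervalIntegrable _ _) (hcont (a - 1) y).aestronglyMeasurable
    (ae_of_all _ fun t ht y' hy' => by
      rw [uIoc_of_le (by linarith)] at ht
      have h1 := h x (y' - t) le_rfl (by linarith [hy'.2, ht.1])
      have h2 : |y' - t| ≤ y + 1 := by
        rw [abs_le]
        constructor <;> linarith [hy'.1, hy'.2, ht.1, ht.2]
      rw [norm_mul]
      refine mul_le_mul (h1.trans ?_) (hR _) (norm_nonneg _) (by positivity)
      gcongr)
    (intervalIntegrable_const)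
    (ae_of_all _ fun t _ y' _ => by
      have := (hasDerivAt_fker_right hl₀ hl₁ a hx (y' - t)).comp_sub_const y' t
      exact this.mul_const _)
  rw [layer_eq_integral_fixed l (a - 1) ρ hl₀ hl₁ hx hρ (by linarith : y ≤ y + 1)]
  refine key.2.congr_of_eventuallyEq ?_
  filter_upwards [Ioo_mem_nhds hy (by linarith : y < y + 1)] with y' hy'
  exact layer_eq_integral_fixed l a ρ hl₀ hl₁ hx hρ hy'.2.le

/-- The fractional integral of order `1 - l` of `layer l 0 ρ x`. -/
lemma integral_rpow_mul_layer {l : ℝ} (hl₀ : 0 < l) (hl₁ : l < 1) {ρ : ℝ → ℝ} (hρ : Continuous ρ)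
    {R : ℝ} (hR : ∀ t, |ρ t| ≤ R) {x : ℝ} (hx : 0 < x) {y : ℝ} (hy : 0 < y) :
    ∫ t in (0 : ℝ)..y, (y - t) ^ (-l) * layer l 0 ρ x t =
      Real.Gamma (1 - l) * layer l (1 - l) ρ x y := by
  have hfc := continuous_fker_right hl₀ hl₁.le 0 hx
  obtain ⟨C, hC, h⟩ := exists_abs_fker_le_mul hl₀ hl₁.le 0 hx y
  have hrp : IntegrableOn (fun t : ℝ => (y - t) ^ (-l)) (Ioc 0 y) := by
    have h1 := (intervalIntegral.intervalIntegrable_rpow' (a := 0) (b := y) (r := -l)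
      (by linarith)).comp_sub_left y
    simp only [sub_zero, sub_self] at h1
    exact h1.symm.1
  have hprod : Integrable (Function.uncurry fun t s => (y - t) ^ (-l) * (fker l 0 x (t - s) * ρ s))
      ((volume.restrict (Ioc 0 y)).prod (volume.restrict (Ioc 0 y))) := by
    have hb : Integrable (fun p : ℝ × ℝ => (y - p.1) ^ (-l) * (C * y * R))
        ((volume.restrict (Ioc 0 y)).prod (volume.restrict (Ioc 0 y))) :=
      Integrable.mul_prod hrp (integrable_const (C * y * R))
    refine hb.mono' ?_ ?_
    · refine Measurable.aestronglyMeasurable ?_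
      have e1 : Measurable fun p : ℝ × ℝ => (y - p.1) ^ (-l) :=
        (measurable_const.sub measurable_fst).pow_const _
      have e2 : Continuous fun p : ℝ × ℝ => fker l 0 x (p.1 - p.2) * ρ p.2 :=
        (hfc.comp (continuous_fst.sub continuous_snd)).mul (hρ.comp continuous_snd)
      exact e1.mul e2.measurable
    · rw [Measure.prod_restrict]
      filter_upwards [ae_restrict_mem (measurableSet_Ioc.prod measurableSet_Ioc)] with p hp
      simp only [Function.uncurry_def]
      have h0 : 0 ≤ y - p.1 := by linarith [hp.1.2]
      rw [norm_mul, norm_mul, Real.norm_of_nonneg (Real.rpow_nonneg h0 _)]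
      have h1 := h x (p.1 - p.2) le_rfl (by linarith [hp.1.2, hp.2.1])
      have h2 : |p.1 - p.2| ≤ y := by
        rw [abs_le]
        constructor <;> linarith [hp.1.1, hp.1.2, hp.2.1, hp.2.2]
      refine mul_le_mul_of_nonneg_left ?_ (Real.rpow_nonneg h0 _)
      refine mul_le_mul (h1.trans ?_) (hR _) (norm_nonneg _) (by positivity)
      gcongr
  calc ∫ t in (0 : ℝ)..y, (y - t) ^ (-l) * layer l 0 ρ x t
      = ∫ t in Ioc 0 y, ∫ s in Ioc 0 y, (y - t) ^ (-l) * (fker l 0 x (t - s) * ρ s) := by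
        rw [intervalIntegral.integral_of_le hy.le]
        refine setIntegral_congr_fun measurableSet_Ioc fun t ht => ?_
        rw [layer_eq_integral_fixed l 0 ρ hl₀ hl₁.le hx hρ ht.2,
          intervalIntegral.integral_of_le hy.le, integral_const_mul]
    _ = ∫ s in Ioc 0 y, ∫ t in Ioc 0 y, (y - t) ^ (-l) * (fker l 0 x (t - s) * ρ s) :=
        integral_integral_swap hprod
    _ = ∫ s in Ioc 0 y, Real.Gamma (1 - l) * (fker l (1 - l) x (y - s) * ρ s) := by
        have hne : ∀ᵐ s ∂(volume.restrict (Ioc 0 y)), s ≠ y :=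
          ae_restrict_of_ae (Measure.ae_ne volume y)
        refine integral_congr_ae ?_
        filter_upwards [hne, ae_restrict_mem measurableSet_Ioc] with s hsy hs
        have hsy' : 0 < y - s := by
          have := lt_of_le_of_ne hs.2 hsy
          linarith
        have e1 := integral_rpow_mul_fker hl₀ hl₁ 0 (c := 1 - l) (by linarith) hx hsy'
        rw [show (1 - l - 1 : ℝ) = -l by ring, zero_add] at e1
        have e2 : ∫ t in Ioc 0 y, (y - t) ^ (-l) * (fker l 0 x (t - s) * ρ s) =
            (∫ t in Ioc 0 y, (y - t) ^ (-l) * fker l 0 x (t - s)) * ρ s := by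
          rw [← integral_mul_const]
          simp only [mul_assoc]
        have e3 : ∫ t in Ioc 0 y, (y - t) ^ (-l) * fker l 0 x (t - s) =
            ∫ t in Ioc s y, (y - t) ^ (-l) * fker l 0 x (t - s) := by
          refine setIntegral_eq_of_subset_of_forall_sdiff_eq_zero measurableSet_Ioc
            (Ioc_subset_Ioc_left hs.1.le) fun t ht => ?_
          have : t ≤ s := by
            by_contra hcon
            exact ht.2 ⟨not_le.1 hcon, ht.1.2⟩
          rw [fker_of_nonpos (by linarith), mul_zero]
        have e4 : ∫ t in Ioc s y, (y - t) ^ (-l) * fker l 0 x (t - s) =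
            ∫ t in (0 : ℝ)..(y - s), (y - s - t) ^ (-l) * fker l 0 x t := by
          rw [← intervalIntegral.integral_of_le hs.2]
          have := intervalIntegral.integral_comp_sub_right (a := s) (b := y)
            (fun t => (y - s - t) ^ (-l) * fker l 0 x t) s
          rw [sub_self] at this
          rw [← this]
          refine intervalIntegral.integral_congr fun t _ => ?_
          ring_nf
        rw [e2, e3, e4, e1]
        ring
    _ = _ := by
        rw [integral_const_mul, ← intervalIntegral.integral_of_le hy.le,
          layer_eq_integral_fixed l (1 - l) ρ hl₀ hl₁.le hx hρ le_rfl]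

lemma layer_one_zero (l : ℝ) (ρ : ℝ → ℝ) {y : ℝ} (hy : 0 ≤ y) :
    layer l 1 ρ 0 y = ∫ t in (0 : ℝ)..y, ρ t := by
  have h1 : layer l 1 ρ 0 y = ∫ t in (0 : ℝ)..y, ρ (y - t) := by
    unfold layer
    rw [intervalIntegral.integral_of_le hy, intervalIntegral.integral_of_le hy]
    refine setIntegral_congr_fun measurableSet_Ioc fun t ht => ?_
    rw [fker_of_pos ht.1, zero_mul, wright_one_zero, sub_self, Real.rpow_zero, one_mul, one_mul]
  rw [h1, intervalIntegral.integral_comp_sub_left (fun t => ρ t) y]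
  simp

/-- At a = 1 the recurrence `wright_sub_one` reads W_0(z) = (l/2) z W_{1-l/2}(z), which brings out
the factor x. The right-hand side is C times the t-derivative of exp(-x t^(-l/2)). -/
lemma exists_abs_fker_zero_le {l : ℝ} (hl₀ : 0 < l) (hl₁ : l ≤ 1) :
    ∃ C, 0 < C ∧ ∀ x t, 0 < x → 0 < t → |fker l 0 x t| ≤
      C * (x * (l / 2) * t ^ (-(l / 2) - 1) * Real.exp (-(x * t ^ (-(l / 2))))) := by
  obtain ⟨C, hC, h⟩ := exists_abs_wright_le hl₀.le hl₁ (1 - l / 2)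
  refine ⟨C, hC, fun x t hx ht => ?_⟩
  have hz : 0 < x * t ^ (-(l / 2)) := by positivity
  have h1 := wright_sub_one hl₁ 1 (x * t ^ (-(l / 2)))
  rw [sub_self, zero_mul, zero_add] at h1
  rw [fker_of_pos ht, h1, zero_sub, Real.rpow_neg_one, abs_mul, abs_mul, abs_of_pos (inv_pos.2 ht),
    abs_of_pos (by positivity : 0 < l / 2 * (x * t ^ (-(l / 2))))]
  rw [Real.rpow_sub_one ht.ne']
  calc _ ≤ t⁻¹ * (l / 2 * (x * t ^ (-(l / 2))) * (C * Real.exp (-(x * t ^ (-(l / 2)))))) := by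
        have := h _ hz.le
        gcongr
    _ = _ := by
        field_simp

/-- The majorant of `exists_abs_fker_zero_le` is an exact derivative of a function with values in
[0, 1], so its mass is at most one for every x: this is the uniform bound an approximate identity
needs. -/
lemma integral_abs_fker_zero_le {l : ℝ} (hl₀ : 0 < l) (hl₁ : l ≤ 1) :
    ∃ C, 0 < C ∧ ∀ x δ, 0 < x → 0 < δ → ∫ t in (0 : ℝ)..δ, |fker l 0 x t| ≤ C := by
  obtain ⟨C, hC, h⟩ := exists_abs_fker_zero_le hl₀ hl₁
  refine ⟨C, hC, fun x δ hx hδ => ?_⟩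
  -- The case distinction matters at t = 0: there the convention `0 ^ (-(l / 2)) = 0` would give
  -- exp(0) = 1 instead of the limit 0.
  set g : ℝ → ℝ := fun t => if 0 < t then Real.exp (-(x * t ^ (-(l / 2)))) else 0 with hg
  set g' : ℝ → ℝ := fun t => x * (l / 2) * t ^ (-(l / 2) - 1) * Real.exp (-(x * t ^ (-(l / 2))))
    with hg'
  have hd : ∀ t ∈ Ioo 0 δ, HasDerivAt g (g' t) t := by
    intro t ht
    have h1 := (((Real.hasDerivAt_rpow_const (p := -(l / 2))
      (Or.inl ht.1.ne')).const_mul x).neg).exp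
    have h2 : g =ᶠ[𝓝 t] fun t => Real.exp (-(x * t ^ (-(l / 2)))) := by
      filter_upwards [lt_mem_nhds ht.1] with s hs using if_pos hs
    refine (HasDerivAt.congr_of_eventuallyEq h1 h2).congr_deriv ?_
    simp only [hg', Pi.neg_apply]
    ring
  have hpos : ∀ t ∈ Ioo 0 δ, 0 ≤ g' t := by
    intro t ht
    have := ht.1
    simp only [hg']
    positivity
  have hc : ContinuousOn g (Icc 0 δ) := by
    intro t ht
    rcases eq_or_lt_of_le ht.1 with rfl | ht0
    · have h0 : g 0 = 0 := by simp [hg]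
      unfold ContinuousWithinAt
      rw [h0]
      obtain ⟨D, hD, h'⟩ := exists_rpow_mul_exp_neg_le (A := x) (b := l / 2) hx (by positivity) 1
      refine squeeze_zero_norm' (a := fun t => D * t) ?_ ?_
      · have : ∀ᶠ t : ℝ in 𝓝[Icc 0 δ] 0, t < 1 := nhdsWithin_le_nhds (gt_mem_nhds one_pos)
        filter_upwards [this, self_mem_nhdsWithin] with t ht1 ht2
        by_cases h0 : 0 < t
        · simp only [hg, if_pos h0]
          rw [Real.norm_of_nonneg (Real.exp_pos _).le]
          have h1 := h' x le_rfl t⁻¹ (one_le_inv_iff₀.2 ⟨h0, ht1.le⟩)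
          rw [Real.rpow_one, Real.inv_rpow h0.le, ← Real.rpow_neg h0.le, inv_mul_le_iff₀ h0] at h1
          linarith
        · simp only [hg, if_neg h0, norm_zero]
          have := ht2.1
          positivity
      · have : Continuous fun t : ℝ => D * t := by fun_prop
        simpa using (this.tendsto 0).mono_left nhdsWithin_le_nhds
    · have h1 : ContinuousAt (fun t : ℝ => Real.exp (-(x * t ^ (-(l / 2))))) t :=
        ((continuousAt_const.mul (Real.continuousAt_rpow_const t _ (Or.inl ht0.ne'))).neg).rexp
      refine (h1.congr ?_).continuousWithinAt
      filter_upwards [lt_mem_nhds ht0] with s hs using (if_pos hs).symm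
  have hi := intervalIntegral.integrableOn_deriv_of_nonneg hc hd hpos
  have hii : IntervalIntegrable g' volume 0 δ := (intervalIntegrable_iff_integrableOn_Ioc_of_le
    hδ.le).2 hi
  have hint : ∫ t in (0 : ℝ)..δ, g' t = g δ - g 0 :=
    intervalIntegral.integral_eq_sub_of_hasDerivAt_of_le hδ.le hc hd hii
  calc ∫ t in (0 : ℝ)..δ, |fker l 0 x t| ≤ ∫ t in (0 : ℝ)..δ, C * g' t := by
        refine intervalIntegral.integral_mono_on_of_le_Ioo hδ.le
          ((continuous_fker_right hl₀ hl₁ 0 hx).abs.intervalIntegrable _ _) (hii.const_mul C) ?_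
        exact fun t ht => h x t hx ht.1
    _ = C * (g δ - g 0) := by rw [intervalIntegral.integral_const_mul, hint]
    _ ≤ C * 1 := by
        have h1 : g δ ≤ 1 := by
          simp only [hg, if_pos hδ]
          rw [Real.exp_le_one_iff, neg_nonpos]
          positivity
        have h0 : g 0 = 0 := by simp [hg]
        rw [h0, sub_zero]
        gcongr
    _ = C := mul_one C

/-- The layer potentials `layer l 0 ρ` have the trace `ρ` on `x = 0`. -/
lemma tendsto_layer_zero {l : ℝ} (hl₀ : 0 < l) (hl₁ : l ≤ 1) {ρ : ℝ → ℝ}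
    (hρ : Continuous ρ) {R : ℝ} (hR : ∀ t, |ρ t| ≤ R) {y₀ : ℝ} (hy₀ : 0 < y₀) :
    Tendsto (fun p : ℝ × ℝ => layer l 0 ρ p.1 p.2) (𝓝[Ioi 0 ×ˢ univ] (0, y₀)) (𝓝 (ρ y₀)) := by
  obtain ⟨C₁, hC₁, h₁⟩ := exists_abs_fker_zero_le hl₀ hl₁
  obtain ⟨C₂, hC₂, h₂⟩ := integral_abs_fker_zero_le hl₀ hl₁
  have hR0 : 0 ≤ R := (abs_nonneg _).trans (hR 0)
  -- F_1(x, y) is the mass of F_0(x, ·) on (0, y), and it tends to F_1(0, y₀) = 1. The rest is the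
  -- usual argument for an approximate identity.
  have hmain : Tendsto (fun p : ℝ × ℝ => ρ y₀ * fker l 1 p.1 p.2) (𝓝[Ioi 0 ×ˢ univ] (0, y₀))
      (𝓝 (ρ y₀ * 1)) := by
    refine Tendsto.const_mul _ ?_
    have h1 : ContinuousAt (fun p : ℝ × ℝ => fker l 1 p.1 p.2) (0, y₀) :=
      (continuousOn_fker hl₁ 1).continuousAt
        ((isOpen_lt continuous_const continuous_snd).mem_nhds hy₀)
    have h2 : fker l 1 0 y₀ = 1 := by
      rw [fker_of_pos hy₀, zero_mul, wright_one_zero, sub_self, Real.rpow_zero, one_mul]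
    have h3 := h1.tendsto
    simp only [h2] at h3
    exact h3.mono_left nhdsWithin_le_nhds
  have hrest : Tendsto (fun p : ℝ × ℝ => layer l 0 ρ p.1 p.2 - ρ y₀ * fker l 1 p.1 p.2)
      (𝓝[Ioi 0 ×ˢ univ] (0, y₀)) (𝓝 0) := by
    rw [Metric.tendsto_nhds]
    intro ε hε
    obtain ⟨η, hη, hηρ⟩ := Metric.continuousAt_iff.1 (hρ.continuousAt (x := y₀))
      (ε / (2 * C₂)) (by positivity)
    set δ := min (η / 2) (y₀ / 2) with hδdef
    have hδ : 0 < δ := by positivity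
    have hδη : δ ≤ η / 2 := min_le_left _ _
    have hδy : δ ≤ y₀ / 2 := min_le_right _ _
    -- K - 1 is the coefficient of x in the estimate on (δ, y), where the kernel is O(x); the added
    -- one keeps K positive when R = 0.
    set K := C₁ * ((l / 2) * δ ^ (-(l / 2) - 1)) * (2 * R) * (2 * y₀) + 1 with hK
    have hK0 : 0 < K := by positivity
    have e1 : ∀ᶠ p : ℝ × ℝ in 𝓝[Ioi 0 ×ˢ univ] (0, y₀), p.1 < ε / (2 * K) :=
      nhdsWithin_le_nhds (continuous_fst.continuousAt.eventually_lt continuousAt_const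
        (show (0 : ℝ) < ε / (2 * K) by positivity))
    have e2 : ∀ᶠ p : ℝ × ℝ in 𝓝[Ioi 0 ×ˢ univ] (0, y₀), p.2 ∈ Ioo (y₀ - δ) (y₀ + δ) :=
      nhdsWithin_le_nhds (continuous_snd.continuousAt.preimage_mem_nhds
        (Ioo_mem_nhds (by simp [hδ]) (by simp [hδ])))
    filter_upwards [e1, e2, self_mem_nhdsWithin] with p hp1 hp2 hp3
    have hx : 0 < p.1 := hp3.1
    obtain ⟨x, y⟩ := p
    simp only at hp1 hp2 hx ⊢
    have hyδ : δ ≤ y := by linarith [hp2.1]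
    have hy : 0 < y := hδ.trans_le hyδ
    have hfc := continuous_fker_right hl₀ hl₁ 0 hx
    have hF : ∫ t in (0 : ℝ)..y, fker l 0 x t = fker l 1 x y := by
      rw [intervalIntegral.integral_eq_sub_of_hasDerivAt (f := fun t => fker l 1 x t)
        (fun t _ => by
          have := hasDerivAt_fker_right hl₀ hl₁ 1 hx t
          rwa [sub_self] at this) (hfc.intervalIntegrable _ _), fker_of_nonpos le_rfl, sub_zero]
    have hci : Continuous fun t => fker l 0 x t * (ρ (y - t) - ρ y₀) :=
      hfc.mul ((hρ.comp (continuous_const.sub continuous_id)).sub continuous_const)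
    have hdiff : layer l 0 ρ x y - ρ y₀ * fker l 1 x y =
        ∫ t in (0 : ℝ)..y, fker l 0 x t * (ρ (y - t) - ρ y₀) := by
      have i1 : IntervalIntegrable (fun t => fker l 0 x t * ρ (y - t)) volume 0 y :=
        (hfc.mul (hρ.comp (continuous_const.sub continuous_id))).intervalIntegrable _ _
      have i2 : IntervalIntegrable (fun t => ρ y₀ * fker l 0 x t) volume 0 y :=
        (continuous_const.mul hfc).intervalIntegrable _ _
      rw [layer, ← hF, ← intervalIntegral.integral_const_mul, ← intervalIntegral.integral_sub i1 i2]
      refine intervalIntegral.integral_congr fun t _ => ?_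
      ring
    rw [Real.dist_eq, sub_zero, hdiff, ← intervalIntegral.integral_add_adjacent_intervals
      (hci.intervalIntegrable 0 δ) (hci.intervalIntegrable δ y)]
    have b1 : |∫ t in (0 : ℝ)..δ, fker l 0 x t * (ρ (y - t) - ρ y₀)| ≤ ε / 2 := by
      have hle : ∀ t ∈ Icc 0 δ, |fker l 0 x t * (ρ (y - t) - ρ y₀)| ≤
          |fker l 0 x t| * (ε / (2 * C₂)) := by
        intro t ht
        rw [abs_mul]
        refine mul_le_mul_of_nonneg_left ?_ (abs_nonneg _)
        have := hηρ (x := y - t) (by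
          rw [Real.dist_eq, abs_lt]
          constructor <;> linarith [hp2.1, hp2.2, ht.1, ht.2])
        rw [Real.dist_eq] at this
        exact this.le
      calc _ ≤ ∫ t in (0 : ℝ)..δ, |fker l 0 x t * (ρ (y - t) - ρ y₀)| :=
            intervalIntegral.abs_integral_le_integral_abs hδ.le
        _ ≤ ∫ t in (0 : ℝ)..δ, |fker l 0 x t| * (ε / (2 * C₂)) :=
            intervalIntegral.integral_mono_on hδ.le (hci.abs.intervalIntegrable _ _)
              ((hfc.abs.mul continuous_const).intervalIntegrable _ _) hle
        _ ≤ C₂ * (ε / (2 * C₂)) := by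
            rw [intervalIntegral.integral_mul_const]
            have := h₂ x δ hx hδ
            gcongr
        _ = ε / 2 := by field_simp
    have b2 : |∫ t in δ..y, fker l 0 x t * (ρ (y - t) - ρ y₀)| < ε / 2 := by
      have hle : ∀ t ∈ uIoc δ y, ‖fker l 0 x t * (ρ (y - t) - ρ y₀)‖ ≤
          C₁ * (x * ((l / 2) * δ ^ (-(l / 2) - 1))) * (2 * R) := by
        intro t ht
        rw [uIoc_of_le hyδ] at ht
        have ht0 : 0 < t := hδ.trans ht.1
        rw [norm_mul]
        refine mul_le_mul ((h₁ x t hx ht0).trans ?_) ?_ (norm_nonneg _) (by positivity)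
        · have i1 : Real.exp (-(x * t ^ (-(l / 2)))) ≤ 1 := by
            rw [Real.exp_le_one_iff, neg_nonpos]
            positivity
          have i2 : t ^ (-(l / 2) - 1) ≤ δ ^ (-(l / 2) - 1) :=
            Real.rpow_le_rpow_of_nonpos hδ ht.1.le (by linarith)
          refine mul_le_mul_of_nonneg_left ?_ hC₁.le
          calc _ ≤ x * (l / 2) * δ ^ (-(l / 2) - 1) * 1 := by gcongr
            _ = _ := by ring
        · have := norm_sub_le (ρ (y - t)) (ρ y₀)
          rw [Real.norm_eq_abs, Real.norm_eq_abs, Real.norm_eq_abs] at this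
          rw [Real.norm_eq_abs]
          linarith [hR (y - t), hR y₀]
      have i3 := intervalIntegral.norm_integral_le_of_norm_le_const hle
      rw [Real.norm_eq_abs] at i3
      have i4 : |y - δ| ≤ 2 * y₀ := by
        rw [abs_of_nonneg (by linarith)]
        linarith [hp2.2]
      calc _ ≤ C₁ * (x * ((l / 2) * δ ^ (-(l / 2) - 1))) * (2 * R) * |y - δ| := i3
        _ ≤ C₁ * (x * ((l / 2) * δ ^ (-(l / 2) - 1))) * (2 * R) * (2 * y₀) := by gcongr
        _ = x * (K - 1) := by rw [hK]; ring
        _ ≤ x * K := by nlinarith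
        _ < ε / (2 * K) * K := by gcongr
        _ = ε / 2 := by field_simp
    calc _ ≤ |∫ t in (0 : ℝ)..δ, fker l 0 x t * (ρ (y - t) - ρ y₀)| +
          |∫ t in δ..y, fker l 0 x t * (ρ (y - t) - ρ y₀)| := abs_add_le _ _
      _ < ε := by linarith
  have := hrest.add hmain
  rw [mul_one, zero_add] at this
  refine this.congr fun p => ?_
  ring

/-! ### Convolutions and Volterra equations -/

/-- The convolution over `(0, y)`. -/
def conv (f g : ℝ → ℝ) (y : ℝ) : ℝ := ∫ t in (0 : ℝ)..y, f t * g (y - t)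

lemma conv_comm (f g : ℝ → ℝ) (y : ℝ) : conv f g y = conv g f y := by
  have h := intervalIntegral.integral_comp_sub_left (a := 0) (b := y)
    (fun t => f t * g (y - t)) y
  simp only [sub_sub_cancel, sub_self, sub_zero] at h
  rw [conv, conv, ← h]
  exact intervalIntegral.integral_congr fun t _ => mul_comm _ _

lemma conv_congr {f f' g g' : ℝ → ℝ} {y : ℝ} (hy : 0 ≤ y) (hf : ∀ t ∈ Ioo 0 y, f t = f' t)
    (hg : ∀ t ∈ Ioo 0 y, g t = g' t) : conv f g y = conv f' g' y := by
  rw [conv, conv, intervalIntegral.integral_of_le hy, intervalIntegral.integral_of_le hy,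
    integral_Ioc_eq_integral_Ioo, integral_Ioc_eq_integral_Ioo]
  refine setIntegral_congr_fun measurableSet_Ioo fun t ht => ?_
  rw [hf t ht, hg (y - t) ⟨by linarith [ht.2], by linarith [ht.1]⟩]

lemma intervalIntegrable_conv_integrand {f g : ℝ → ℝ} {y : ℝ}
    (hf : IntervalIntegrable f volume 0 y) (hg : Continuous g) :
    IntervalIntegrable (fun t => f t * g (y - t)) volume 0 y :=
  hf.mul_continuousOn (by fun_prop)

lemma conv_add_right {f g h : ℝ → ℝ} {y : ℝ} (hf : IntervalIntegrable f volume 0 y)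
    (hg : Continuous g) (hh : Continuous h) :
    conv f (fun t => g t + h t) y = conv f g y + conv f h y := by
  rw [conv, conv, conv, ← intervalIntegral.integral_add
    (intervalIntegrable_conv_integrand hf hg) (intervalIntegrable_conv_integrand hf hh)]
  exact intervalIntegral.integral_congr fun t _ => mul_add _ _ _

lemma conv_sub_right {f g h : ℝ → ℝ} {y : ℝ} (hf : IntervalIntegrable f volume 0 y)
    (hg : Continuous g) (hh : Continuous h) :
    conv f (fun t => g t - h t) y = conv f g y - conv f h y := by
  rw [conv, conv, conv, ← intervalIntegral.integral_sub
    (intervalIntegrable_conv_integrand hf hg) (intervalIntegrable_conv_integrand hf hh)]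
  exact intervalIntegral.integral_congr fun t _ => mul_sub _ _ _

lemma conv_add_left {f g h : ℝ → ℝ} {y : ℝ} (hf : IntervalIntegrable f volume 0 y)
    (hg : IntervalIntegrable g volume 0 y) (hh : Continuous h) :
    conv (fun t => f t + g t) h y = conv f h y + conv g h y := by
  rw [conv, conv, conv, ← intervalIntegral.integral_add
    (intervalIntegrable_conv_integrand hf hh) (intervalIntegrable_conv_integrand hg hh)]
  exact intervalIntegral.integral_congr fun t _ => add_mul _ _ _

lemma conv_const_mul_left (c : ℝ) (f g : ℝ → ℝ) (y : ℝ) :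
    conv (fun t => c * f t) g y = c * conv f g y := by
  rw [conv, conv, ← intervalIntegral.integral_const_mul]
  exact intervalIntegral.integral_congr fun t _ => mul_assoc _ _ _

lemma conv_const_mul_right (c : ℝ) (f g : ℝ → ℝ) (y : ℝ) :
    conv f (fun t => c * g t) y = c * conv f g y := by
  rw [conv_comm, conv_const_mul_left, conv_comm]

lemma conv_one_left (g : ℝ → ℝ) (y : ℝ) : conv (fun _ => 1) g y = ∫ t in (0 : ℝ)..y, g t := by
  rw [conv_comm, conv]
  simp only [mul_one]

lemma continuous_conv {f ρ : ℝ → ℝ} (hf : ∀ a b, IntervalIntegrable f volume a b)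
    (hρ : Continuous ρ) {R : ℝ} (hR : ∀ t, |ρ t| ≤ R) : Continuous (conv f ρ) := by
  rw [continuous_iff_continuousAt]
  intro y₀
  have h := intervalIntegral.continuousAt_parametric_primitive_of_dominated
    (μ := volume) (F := fun y t => f t * ρ (y - t)) (fun t => |f t| * R) (y₀ - 1 - |y₀|)
    (y₀ + 1 + |y₀|) (a₀ := 0) (b₀ := y₀) (x₀ := y₀)
    (fun y => ((hf _ _).mul_continuousOn (by fun_prop)).def'.aestronglyMeasurable)
    (Eventually.of_forall fun y => Eventually.of_forall fun t => by
      rw [Real.norm_eq_abs, abs_mul]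
      exact mul_le_mul_of_nonneg_left (hR _) (abs_nonneg _))
    ((hf _ _).abs.mul_const R)
    (Eventually.of_forall fun t => by fun_prop)
    ⟨by linarith [neg_abs_le y₀, le_abs_self y₀], by linarith [neg_abs_le y₀, le_abs_self y₀]⟩
    ⟨by linarith [neg_abs_le y₀, abs_nonneg y₀], by linarith [neg_abs_le y₀, abs_nonneg y₀]⟩
    (by simp)
  exact h.comp (f := fun y : ℝ => (y, y)) (continuousAt_id.prodMk continuousAt_id)

/-- Extended by zero, the triple integrand is a whole-line convolution integrand of two integrable
functions times a bounded one, so Fubini applies; the rest matches the indicator functions. -/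
lemma conv_assoc {f g ρ : ℝ → ℝ} {y : ℝ} (hy : 0 ≤ y) (hf : IntervalIntegrable f volume 0 y)
    (hg : IntervalIntegrable g volume 0 y) (hρ : Continuous ρ) {R : ℝ} (hR : ∀ t, |ρ t| ≤ R) :
    conv f (conv g ρ) y = conv (conv f g) ρ y := by
  set F := (Ioc 0 y).indicator f with hF
  set G := (Ioc 0 y).indicator g with hG
  set P := (Ici (0 : ℝ)).indicator ρ with hP
  have hFi : Integrable F :=
    ((intervalIntegrable_iff_integrableOn_Ioc_of_le hy).1 hf).integrable_indicator measurableSet_Ioc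
  have hGi : Integrable G :=
    ((intervalIntegrable_iff_integrableOn_Ioc_of_le hy).1 hg).integrable_indicator measurableSet_Ioc
  have hPm : Measurable P := hρ.measurable.indicator measurableSet_Ici
  have hPb : ∀ t, ‖P t‖ ≤ R := by
    intro t
    rw [hP]
    refine (norm_indicator_le_norm_self _ _).trans (hR t)
  have hint : Integrable (fun p : ℝ × ℝ => F p.2 * G (p.1 - p.2) * P (y - p.1))
      (volume.prod volume) := by
    refine Integrable.mul_bdd
      (hFi.convolution_integrand (ContinuousLinearMap.mul ℝ ℝ) hGi) ?_
      (Eventually.of_forall fun p => hPb (y - p.1))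
    exact (hPm.comp (measurable_const.sub measurable_fst)).aestronglyMeasurable
  have hswap := integral_integral_swap (f := fun w s => F s * G (w - s) * P (y - w)) hint
  have hR' : ∫ w, ∫ s, F s * G (w - s) * P (y - w) = conv (conv f g) ρ y := by
    rw [conv, intervalIntegral.integral_of_le hy, ← integral_indicator measurableSet_Ioc]
    refine integral_congr_ae (Eventually.of_forall fun w => ?_)
    simp only
    by_cases hw : w ∈ Ioc 0 y
    · rw [indicator_of_mem hw, integral_mul_const, hP, indicator_of_mem (by simpa using hw.2)]
      congr 1
      rw [conv, intervalIntegral.integral_of_le hw.1.le, integral_Ioc_eq_integral_Ioo,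
        ← integral_indicator measurableSet_Ioo]
      refine integral_congr_ae (Eventually.of_forall fun s => ?_)
      simp only [hG, hF, indicator_apply, mem_Ioc, mem_Ioo]
      have h1 := hw.1
      have h2 := hw.2
      split_ifs <;> first | rfl | (simp; done) | (exfalso; grind)
    · rw [indicator_of_notMem hw]
      have h0 : ∀ s, F s * G (w - s) * P (y - w) = 0 := by
        intro s
        simp only [hG, hF, hP, indicator_apply, mem_Ioc, mem_Ici]
        rw [mem_Ioc] at hw
        split_ifs <;> first | (simp; done) | (exfalso; grind)
      simp only [h0, integral_zero]
  have hL' : ∫ s, ∫ w, F s * G (w - s) * P (y - w) = conv f (conv g ρ) y := by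
    rw [conv, intervalIntegral.integral_of_le hy, ← integral_indicator measurableSet_Ioc]
    refine integral_congr_ae (Eventually.of_forall fun s => ?_)
    simp only
    by_cases hs : s ∈ Ioc 0 y
    · have h1 : ∀ w, F s * G (w - s) * P (y - w) = f s * (G (w - s) * P (y - s - (w - s))) := by
        intro w
        rw [hF, indicator_of_mem hs, mul_assoc]
        rw [sub_sub_sub_cancel_right]
      simp only [h1]
      rw [integral_const_mul, indicator_of_mem hs,
        integral_sub_right_eq_self (fun t => G t * P (y - s - t)) s, conv,
        intervalIntegral.integral_of_le (by linarith [hs.2]), ← integral_indicator measurableSet_Ioc]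
      congr 1
      refine integral_congr_ae (Eventually.of_forall fun t => ?_)
      simp only [hG, hP, indicator_apply, mem_Ioc, mem_Ici]
      have := hs.1
      split_ifs <;> first | rfl | (simp; done) | (exfalso; grind)
    · rw [indicator_of_notMem hs]
      simp [hF, indicator_of_notMem hs]
  rw [← hL', ← hR', hswap]

/-- A linear Volterra-type equation with a kernel of small mass has a bounded continuous
solution. -/
lemma exists_fixed_conv {k : ℝ → ℝ} (hk : Integrable k) (hk1 : ∫ t, |k t| ≤ 1 / 2)
    {g : ℝ → ℝ} (hg : Continuous g) {A : ℝ} (hA : ∀ t, |g t| ≤ A) :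
    ∃ σ : ℝ → ℝ, Continuous σ ∧ (∃ R, ∀ t, |σ t| ≤ R) ∧
      ∀ y, 0 ≤ y → σ y + conv k σ y = g y := by
  have hcont : ∀ σ : BoundedContinuousFunction ℝ ℝ, Continuous fun y => conv k σ (max y 0) :=
    fun σ => (continuous_conv (fun a b => hk.intervalIntegrable) σ.continuous
      (R := ‖σ‖) (fun t => σ.norm_coe_le_norm t)).comp (by fun_prop)
  have hbd : ∀ (ρ : ℝ → ℝ) (R : ℝ), 0 ≤ R → (∀ t, |ρ t| ≤ R) → ∀ y,
      |conv k ρ (max y 0)| ≤ 1 / 2 * R := by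
    intro ρ R hR0 hR y
    have h0 : 0 ≤ max y 0 := le_max_right _ _
    rw [conv, ← Real.norm_eq_abs]
    refine (intervalIntegral.norm_integral_le_of_norm_le (g := fun t => |k t| * R) h0
      (Eventually.of_forall fun t _ => ?_) (hk.abs.mul_const R).intervalIntegrable).trans ?_
    · rw [Real.norm_eq_abs, abs_mul]
      exact mul_le_mul_of_nonneg_left (hR _) (abs_nonneg _)
    · rw [intervalIntegral.integral_mul_const, intervalIntegral.integral_of_le h0]
      refine mul_le_mul_of_nonneg_right (le_trans ?_ hk1) hR0
      exact setIntegral_le_integral hk.abs (Eventually.of_forall fun t => abs_nonneg _)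
  -- The map is frozen for negative times by `max y 0`, so it acts on bounded continuous functions
  -- of the whole line and contracts with the constant 1/2.
  let T : BoundedContinuousFunction ℝ ℝ → BoundedContinuousFunction ℝ ℝ := fun σ =>
    BoundedContinuousFunction.ofNormedAddCommGroup (fun y => g y - conv k σ (max y 0))
      (hg.sub (hcont σ)) (A + 1 / 2 * ‖σ‖) (fun y => by
        have h1 := hbd σ ‖σ‖ (norm_nonneg _) (fun t => σ.norm_coe_le_norm t) y
        refine (norm_sub_le _ _).trans (add_le_add (hA y) h1))
  have hT : ContractingWith (1 / 2) T := by
    refine ⟨by rw [div_lt_one] <;> norm_num, ?_⟩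
    refine LipschitzWith.of_dist_le_mul fun σ σ' => ?_
    rw [BoundedContinuousFunction.dist_le (by positivity)]
    intro y
    have h1 := hbd (fun t => σ t - σ' t) (dist σ σ') dist_nonneg
      (fun t => by
        rw [← Real.dist_eq]
        exact BoundedContinuousFunction.dist_coe_le_dist t) y
    rw [conv_sub_right hk.intervalIntegrable σ.continuous σ'.continuous] at h1
    change dist (g y - conv k σ (max y 0)) (g y - conv k σ' (max y 0)) ≤ _
    rw [dist_sub_left, Real.dist_eq]
    simpa using h1
  have hfix := hT.fixedPoint_isFixedPt
  set σ := ContractingWith.fixedPoint T hT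
  refine ⟨σ, σ.continuous, ⟨‖σ‖, fun t => σ.norm_coe_le_norm t⟩, fun y hy => ?_⟩
  have h2 : σ y = g y - conv k σ (max y 0) := congrArg (fun f => f y) hfix.symm
  rw [max_eq_left hy] at h2
  linarith

/-- Clamping to the unit interval. -/
def clamp (t : ℝ) : ℝ := max 0 (min t 1)

lemma continuous_clamp : Continuous clamp := by
  unfold clamp
  fun_prop

lemma clamp_mem (t : ℝ) : clamp t ∈ Icc (0 : ℝ) 1 := by
  unfold clamp
  exact ⟨le_max_left _ _, max_le zero_le_one (min_le_right _ _)⟩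

lemma clamp_of_mem {t : ℝ} (ht : t ∈ Icc (0 : ℝ) 1) : clamp t = t := by
  rw [clamp, min_eq_left ht.2, max_eq_right ht.1]

lemma exists_bound_comp_clamp {f : ℝ → ℝ} (hf : Continuous f) : ∃ R, ∀ t, |f (clamp t)| ≤ R := by
  obtain ⟨R, hR⟩ := (isCompact_Icc (a := (0 : ℝ)) (b := 1)).exists_bound_of_continuousOn
    hf.continuousOn
  exact ⟨R, fun t => hR _ (clamp_mem t)⟩

/-- Multiplying the unknown by exp(-My) replaces K by K(t) exp(-Mt), whose mass on (0, 1] is at most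
1/2 for large M, so no smallness of K is needed. Clamping time to [0, 1] keeps both the data and the
solution bounded. -/
lemma exists_volterra_solution {K : ℝ → ℝ} (hK : ∀ a b, IntervalIntegrable K volume a b)
    {r : ℝ → ℝ} (hr : Continuous r) :
    ∃ ρ : ℝ → ℝ, Continuous ρ ∧ (∃ R, ∀ t, |ρ t| ≤ R) ∧
      ∀ y ∈ Icc (0 : ℝ) 1, ρ y + conv K ρ y = r y := by
  have hKI : IntegrableOn K (Ioc 0 1) :=
    (intervalIntegrable_iff_integrableOn_Ioc_of_le zero_le_one).1 (hK 0 1)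
  obtain ⟨M, hM⟩ : ∃ M : ℝ, ∫ t in Ioc (0 : ℝ) 1, |K t| * Real.exp (-(M * t)) ≤ 1 / 2 := by
    have h : Tendsto (fun M : ℝ => ∫ t in Ioc (0 : ℝ) 1, |K t| * Real.exp (-(M * t))) atTop
        (𝓝 (∫ t in Ioc (0 : ℝ) 1, (0 : ℝ))) := by
      refine tendsto_integral_filter_of_dominated_convergence (fun t => |K t|) ?_ ?_ hKI.abs ?_
      · exact Eventually.of_forall fun M =>
          hKI.abs.aestronglyMeasurable.mul (Continuous.aestronglyMeasurable (by fun_prop))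
      · filter_upwards [eventually_ge_atTop 0] with M hM0
        filter_upwards [ae_restrict_mem measurableSet_Ioc] with t ht
        rw [norm_mul, Real.norm_eq_abs, abs_abs, Real.norm_eq_abs, Real.abs_exp]
        refine mul_le_of_le_one_right (abs_nonneg _) ?_
        rw [Real.exp_le_one_iff, neg_nonpos]
        exact mul_nonneg hM0 ht.1.le
      · filter_upwards [ae_restrict_mem measurableSet_Ioc] with t ht
        have : Tendsto (fun M : ℝ => Real.exp (-(M * t))) atTop (𝓝 0) :=
          Real.tendsto_exp_neg_atTop_nhds_zero.comp (tendsto_id.atTop_mul_const ht.1)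
        simpa using this.const_mul |K t|
    rw [integral_zero] at h
    exact (h.eventually (ge_mem_nhds (by norm_num : (0 : ℝ) < 1 / 2))).exists
  set k : ℝ → ℝ := (Ioc (0 : ℝ) 1).indicator fun t => K t * Real.exp (-(M * t)) with hk
  have hki : Integrable k := by
    rw [hk, integrable_indicator_iff measurableSet_Ioc]
    exact (intervalIntegrable_iff_integrableOn_Ioc_of_le zero_le_one).1
      ((hK 0 1).mul_continuousOn (by fun_prop))
  have hk1 : ∫ t, |k t| ≤ 1 / 2 := by
    refine le_of_eq_of_le ?_ hM
    rw [← integral_indicator measurableSet_Ioc]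
    refine integral_congr_ae (Eventually.of_forall fun t => ?_)
    simp only [hk, indicator_apply]
    split_ifs
    · rw [abs_mul, Real.abs_exp]
    · simp
  set g : ℝ → ℝ := fun t => (fun s => Real.exp (-(M * s)) * r s) (clamp t) with hg
  have hg' : Continuous fun s : ℝ => Real.exp (-(M * s)) * r s := by fun_prop
  obtain ⟨A, hA⟩ := exists_bound_comp_clamp hg'
  obtain ⟨σ, hσ, ⟨R, hR⟩, hfix⟩ := exists_fixed_conv hki hk1
    (hg'.comp continuous_clamp) hA
  have hρ : Continuous fun s : ℝ => Real.exp (M * s) * σ s := by fun_prop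
  refine ⟨fun t => (fun s => Real.exp (M * s) * σ s) (clamp t), hρ.comp continuous_clamp,
    exists_bound_comp_clamp hρ, fun y hy => ?_⟩
  have h1 := hfix y hy.1
  simp only [Function.comp_apply] at h1
  rw [clamp_of_mem hy] at h1
  have h2 : conv K (fun t => Real.exp (M * clamp t) * σ (clamp t)) y =
      Real.exp (M * y) * conv k σ y := by
    rw [conv, conv, ← intervalIntegral.integral_const_mul]
    rw [intervalIntegral.integral_of_le hy.1, intervalIntegral.integral_of_le hy.1]
    refine setIntegral_congr_fun measurableSet_Ioc fun t ht => ?_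
    have ht' : t ∈ Ioc (0 : ℝ) 1 := ⟨ht.1, ht.2.trans hy.2⟩
    rw [clamp_of_mem ⟨by linarith [ht.2], by linarith [ht.1, hy.2]⟩, hk, indicator_of_mem ht',
      mul_sub, sub_eq_add_neg, Real.exp_add]
    ring
  simp only
  rw [h2, clamp_of_mem hy, ← mul_add, h1, ← mul_assoc, ← Real.exp_add, add_neg_cancel,
    Real.exp_zero, one_mul]

/-! ### Interior regularity for equations of Abel type -/

lemma contDiff_one_of_hasDerivAt {f f' : ℝ → ℝ} (h : ∀ y, HasDerivAt f (f' y) y)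
    (hf' : Continuous f') : ContDiff ℝ 1 f := by
  rw [contDiff_one_iff_deriv]
  refine ⟨fun y => (h y).differentiableAt, ?_⟩
  rwa [funext fun y => (h y).deriv]

lemma contDiffOn_one_of_hasDerivAt {f f' : ℝ → ℝ} {s : Set ℝ} (hs : IsOpen s)
    (h : ∀ y ∈ s, HasDerivAt f (f' y) y) (hf' : ContinuousOn f' s) : ContDiffOn ℝ 1 f s := by
  rw [show (1 : WithTop ℕ∞) = 0 + 1 from rfl, contDiffOn_succ_iff_deriv_of_isOpen hs]
  refine ⟨fun y hy => (h y hy).differentiableAt.differentiableWithinAt, by simp, ?_⟩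
  rw [contDiffOn_zero]
  exact hf'.congr fun y hy => (h y hy).deriv

lemma continuousOn_deriv_of_contDiffOn {f : ℝ → ℝ} {s : Set ℝ} (hs : IsOpen s)
    (h : ContDiffOn ℝ 1 f s) : ContinuousOn (deriv f) s :=
  h.continuousOn_deriv_of_isOpen hs le_rfl

lemma hasDerivAt_of_contDiffOn {f : ℝ → ℝ} {s : Set ℝ} (hs : IsOpen s)
    (h : ContDiffOn ℝ 1 f s) {y : ℝ} (hy : y ∈ s) : HasDerivAt f (deriv f y) y :=
  ((h.differentiableOn one_ne_zero y hy).differentiableAt (hs.mem_nhds hy)).hasDerivAt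

lemma contDiff_integral {h : ℝ → ℝ} (hh : Continuous h) :
    ContDiff ℝ 1 fun y => ∫ t in (0 : ℝ)..y, h t :=
  contDiff_one_of_hasDerivAt (fun y => hh.integral_hasStrictDerivAt 0 y |>.hasDerivAt) hh

lemma hasDerivAt_integral_rpow_sub {δ e : ℝ} (hδ : 0 ≤ δ) {r : ℝ → ℝ} (hr : Continuous r)
    {y : ℝ} (hy : δ < y) :
    HasDerivAt (fun y => ∫ t in (0 : ℝ)..δ, (y - t) ^ e * r t)
      (∫ t in (0 : ℝ)..δ, e * (y - t) ^ (e - 1) * r t) y := by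
  have hcont : ∀ (e' : ℝ) (z : ℝ), δ < z → ContinuousOn (fun t => (z - t) ^ e') (uIcc 0 δ) := by
    intro e' z hz
    refine ContinuousOn.rpow_const (by fun_prop) fun t ht => Or.inl ?_
    rw [uIcc_of_le hδ] at ht
    linarith [ht.2]
  have hm : ∀ (e' : ℝ) (z : ℝ), δ < z →
      IntervalIntegrable (fun t => (z - t) ^ e' * r t) volume 0 δ :=
    fun e' z hz => ((hcont e' z hz).mul hr.continuousOn).intervalIntegrable
  set m := (δ + y) / 2 with hmdef
  obtain ⟨B, hB⟩ : ∃ B, ∀ p ∈ Icc m (y + 1) ×ˢ Icc 0 δ,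
      ‖(fun p : ℝ × ℝ => e * (p.1 - p.2) ^ (e - 1) * r p.2) p‖ ≤ B := by
    refine (isCompact_Icc.prod isCompact_Icc).exists_bound_of_continuousOn ?_
    refine ContinuousOn.mul (continuousOn_const.mul (ContinuousOn.rpow_const (by fun_prop) ?_))
      (by fun_prop)
    rintro ⟨z, t⟩ ⟨hz, ht⟩
    simp only at hz ht ⊢
    left
    have := hz.1
    have := ht.2
    intro h
    linarith
  refine (intervalIntegral.hasDerivAt_integral_of_dominated_loc_of_deriv_le
    (F := fun y t => (y - t) ^ e * r t) (F' := fun y t => e * (y - t) ^ (e - 1) * r t)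
    (bound := fun _ => B) (s := Ioo m (y + 1)) (Ioo_mem_nhds (by linarith) (by linarith))
    ?_ (hm e y hy) ?_ ?_ intervalIntegrable_const ?_).2
  · filter_upwards [Ioi_mem_nhds hy] with z hz
    exact (hm e z hz).def'.aestronglyMeasurable
  · have := (hm (e - 1) y hy).const_mul e
    simp only [← mul_assoc] at this
    exact this.def'.aestronglyMeasurable
  · refine Eventually.of_forall fun t ht z hz => ?_
    rw [uIoc_of_le hδ] at ht
    exact hB (z, t) ⟨⟨hz.1.le, hz.2.le⟩, ht.1.le, ht.2⟩
  · refine Eventually.of_forall fun t ht z hz => ?_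
    rw [uIoc_of_le hδ] at ht
    have h1 : z - t ≠ 0 := by
      have := hz.1
      have := ht.2
      intro h
      linarith
    have := (((hasDerivAt_id z).sub_const t).rpow_const (p := e) (Or.inl h1)).mul_const (r t)
    refine this.congr_deriv ?_
    simp only [id]
    ring

lemma contDiffOn_integral_rpow_sub {δ e : ℝ} (hδ : 0 ≤ δ) {r : ℝ → ℝ} (hr : Continuous r) :
    ContDiffOn ℝ 1 (fun y => ∫ t in (0 : ℝ)..δ, (y - t) ^ e * r t) (Ioi δ) := by
  refine contDiffOn_one_of_hasDerivAt isOpen_Ioi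
    (fun y hy => hasDerivAt_integral_rpow_sub hδ hr hy) ?_
  intro y hy
  have h := (hasDerivAt_integral_rpow_sub (e := e - 1) hδ hr hy).continuousAt.const_mul e
  simp only [mul_assoc, intervalIntegral.integral_const_mul]
  exact h.continuousWithinAt

lemma intervalIntegrable_rpow_neg {b : ℝ} (hb : b < 1) (x y : ℝ) :
    IntervalIntegrable (fun t : ℝ => t ^ (-b)) volume x y :=
  intervalIntegral.intervalIntegrable_rpow' (by linarith)

/-- Integration from 0 is convolution with the constant 1, and convolutions commute. -/
lemma conv_integral {k h : ℝ → ℝ} (hk : ∀ a b, IntervalIntegrable k volume a b)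
    (hh : Continuous h) {R : ℝ} (hR : ∀ t, |h t| ≤ R) {y : ℝ} (hy : 0 ≤ y) :
    conv k (fun s => ∫ t in (0 : ℝ)..s, h t) y = ∫ t in (0 : ℝ)..y, conv k h t := by
  have h1 : (fun s => ∫ t in (0 : ℝ)..s, h t) = conv (fun _ => 1) h :=
    funext fun s => (conv_one_left h s).symm
  have h2 : conv k (fun _ => 1) = conv (fun _ => 1) k := funext fun s => conv_comm _ _ _
  rw [h1, conv_assoc hy (hk _ _) intervalIntegrable_const hh hR, h2,
    ← conv_assoc hy intervalIntegrable_const (hk _ _) hh hR, conv_one_left]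

/-- Near y₀ the integral is cut at δ = y₀/2. On (0, δ) the power (y - t)^(-b) is smooth in y; on (δ,
y) one writes r as its value at δ plus the integral of its derivative, and the convolution passes
inside that integral. -/
lemma contDiffOn_conv_rpow {b : ℝ} (hb : b < 1) {r : ℝ → ℝ} (hr : Continuous r)
    (hr1 : ContDiffOn ℝ 1 r (Ioo 0 1)) :
    ContDiffOn ℝ 1 (conv (fun t => t ^ (-b)) r) (Ioo 0 1) := by
  set k : ℝ → ℝ := fun t => t ^ (-b) with hk
  have hki : ∀ x y, IntervalIntegrable k volume x y := intervalIntegrable_rpow_neg hb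
  intro y₀ hy₀
  refine ContDiffAt.contDiffWithinAt ?_
  set δ := y₀ / 2 with hδ
  have hδ0 : 0 < δ := by have := hy₀.1; positivity
  set η := (y₀ + 1) / 2 with hη
  have hη1 : η < 1 := by have := hy₀.2; rw [hη]; linarith
  have hδη : δ < η := by have := hy₀.1; linarith
  -- The derivative of r shifted by δ, with its argument clamped to the compact [δ, η] inside (0,
  -- 1), so that q is continuous and bounded on the whole line.
  set q : ℝ → ℝ := fun t => deriv r (δ + max 0 (min t (η - δ))) with hq
  have hmem : ∀ t, δ + max 0 (min t (η - δ)) ∈ Icc δ η := by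
    intro t
    constructor
    · linarith [le_max_left 0 (min t (η - δ))]
    · linarith [max_le (a := 0) (by linarith : (0 : ℝ) ≤ η - δ) (min_le_right t (η - δ))]
  have hsub : Icc δ η ⊆ Ioo 0 1 := fun t ht => ⟨hδ0.trans_le ht.1, ht.2.trans_lt hη1⟩
  have hdc : ContinuousOn (deriv r) (Icc δ η) :=
    (continuousOn_deriv_of_contDiffOn isOpen_Ioo hr1).mono hsub
  have hqc : Continuous q := hdc.comp_continuous (by fun_prop) hmem
  obtain ⟨Q, hQ⟩ := isCompact_Icc.exists_bound_of_continuousOn hdc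
  have hqb : ∀ t, |q t| ≤ Q := fun t => hQ _ (hmem t)
  have hqr : ∀ s ∈ Icc 0 (η - δ), r (δ + s) = r δ + ∫ t in (0 : ℝ)..s, q t := by
    intro s hs
    have h1 : ∫ t in (0 : ℝ)..s, q t = ∫ t in (0 : ℝ)..s, deriv r (δ + t) := by
      refine intervalIntegral.integral_congr fun t ht => ?_
      rw [uIcc_of_le hs.1] at ht
      simp only [hq]
      rw [min_eq_left (ht.2.trans hs.2), max_eq_right ht.1]
    have hm' : ∀ t ∈ uIcc 0 s, δ + t ∈ Icc δ η := by
      intro t ht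
      rw [uIcc_of_le hs.1] at ht
      exact ⟨by linarith [ht.1], by linarith [ht.2, hs.2]⟩
    rw [h1, intervalIntegral.integral_eq_sub_of_hasDerivAt (f := fun t => r (δ + t)), add_zero]
    · ring
    · intro t ht
      have h2 := (hasDerivAt_of_contDiffOn isOpen_Ioo hr1 (hsub (hm' t ht)))
      have h3 := h2.comp_const_add δ t
      exact h3
    · refine ContinuousOn.intervalIntegrable (hdc.comp (by fun_prop) hm')
  have hev : conv k r =ᶠ[𝓝 y₀] fun y => (∫ t in (0 : ℝ)..δ, (y - t) ^ (-b) * r t) +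
      (r δ * ∫ t in (0 : ℝ)..(y - δ), k t) + ∫ t in (0 : ℝ)..(y - δ), conv k q t := by
    filter_upwards [Ioo_mem_nhds (show δ < y₀ by linarith [hy₀.1])
      (show y₀ < η by have := hy₀.2; rw [hη]; linarith)] with y hy
    have hyδ : 0 ≤ y - δ := by linarith [hy.1]
    rw [conv_comm, conv, ← intervalIntegral.integral_add_adjacent_intervals (b := δ)]
    rotate_left
    · have := (hki y (y - δ)).comp_sub_left y
      rw [sub_self, sub_sub_cancel] at this
      exact this.continuousOn_mul hr.continuousOn
    · have := (hki (y - δ) 0).comp_sub_left y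
      rw [sub_zero, sub_sub_cancel] at this
      exact this.continuousOn_mul hr.continuousOn
    rw [add_assoc]
    congr 1
    · exact intervalIntegral.integral_congr fun t _ => mul_comm _ _
    · rw [← conv_integral hki hqc hqb hyδ]
      have e1 : ∫ t in δ..y, r t * k (y - t) = conv k (fun s => r (δ + s)) (y - δ) := by
        rw [conv_comm, conv]
        have := intervalIntegral.integral_comp_add_left (a := 0) (b := y - δ)
          (fun t => r t * k (y - t)) δ
        rw [add_zero, add_sub_cancel] at this
        rw [← this]
        refine intervalIntegral.integral_congr fun t _ => ?_
        simp only [sub_sub]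
      rw [e1, conv_congr (f' := k) (g' := fun s => r δ + ∫ t in (0 : ℝ)..s, q t) hyδ
        (fun _ _ => rfl) (fun t ht => hqr t ⟨ht.1.le, by linarith [ht.2, hy.2]⟩),
        conv_add_right (hki _ _) continuous_const
          (contDiff_integral hqc).continuous]
      congr 1
      rw [conv, intervalIntegral.integral_mul_const, mul_comm]
  refine ContDiffAt.congr_of_eventuallyEq ?_ hev
  have hy0 : δ < y₀ := by linarith [hy₀.1]
  refine ((((contDiffOn_integral_rpow_sub hδ0.le hr) y₀ hy0).contDiffAt
    (Ioi_mem_nhds hy0)).add (contDiffAt_const.mul ?_)).add ?_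
  · have hpos : ∀ y ∈ Ioi (0 : ℝ), HasDerivAt (fun y => ∫ t in (0 : ℝ)..y, k t) (k y) y := by
      intro y hy
      refine intervalIntegral.integral_hasDerivAt_right (hki _ _) ?_ ?_
      · exact (ContinuousOn.stronglyMeasurableAtFilter isOpen_Ioi
          (fun t ht => (Real.continuousAt_rpow_const t _ (Or.inl (ne_of_gt ht))).continuousWithinAt)
          y hy)
      · exact Real.continuousAt_rpow_const y _ (Or.inl (ne_of_gt hy))
    have h1 : ContDiffOn ℝ 1 (fun y => ∫ t in (0 : ℝ)..y, k t) (Ioi 0) :=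
      contDiffOn_one_of_hasDerivAt isOpen_Ioi hpos
        (fun t ht => (Real.continuousAt_rpow_const t _ (Or.inl (ne_of_gt ht))).continuousWithinAt)
    have h2 : ContDiffAt ℝ 1 (fun y => ∫ t in (0 : ℝ)..y, k t) (y₀ - δ) :=
      (h1 _ (by simpa using hy0)).contDiffAt (Ioi_mem_nhds (by simpa using hy0))
    exact h2.comp y₀ (f := fun y => y - δ) (by fun_prop)
  · exact (contDiff_integral (continuous_conv hki hqc hqb)).contDiffAt.comp y₀
      (f := fun y => y - δ) (by fun_prop)

/-- Scaling by y. The constant is a Beta integral whose value plays no role. -/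
lemma conv_rpow_rpow {b : ℝ} {y : ℝ} (hy : 0 < y) :
    conv (fun t => t ^ (-b)) (fun t => t ^ (-b)) y =
      conv (fun t => t ^ (-b)) (fun t => t ^ (-b)) 1 * y ^ (1 - 2 * b) := by
  have h := intervalIntegral.smul_integral_comp_mul_left (a := 0) (b := 1)
    (fun t => t ^ (-b) * (y - t) ^ (-b)) y
  rw [mul_zero, mul_one] at h
  rw [conv, ← h, conv, ← intervalIntegral.integral_mul_const, smul_eq_mul,
    ← intervalIntegral.integral_const_mul]
  refine intervalIntegral.integral_congr fun t ht => ?_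
  rw [uIcc_of_le zero_le_one] at ht
  rw [show y - y * t = y * (1 - t) by ring, Real.mul_rpow hy.le ht.1,
    Real.mul_rpow hy.le (by linarith [ht.2]), show 1 - 2 * b = 1 + (-b) + (-b) by ring,
    Real.rpow_add hy, Real.rpow_add hy, Real.rpow_one]
  ring

/-- `y ↦ ∫₀^y (y - t)^{1 - 2b} ρ(t) dt` is continuously differentiable if `b ≤ 1/2`. -/
lemma exists_conv_rpow_eq_integral {b : ℝ} (hb : b ≤ 1 / 2) {ρ : ℝ → ℝ} (hρ : Continuous ρ)
    {R : ℝ} (hR : ∀ t, |ρ t| ≤ R) :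
    ∃ h : ℝ → ℝ, Continuous h ∧ ∀ y, 0 ≤ y →
      conv (fun t => t ^ (1 - 2 * b)) ρ y = ∫ t in (0 : ℝ)..y, h t := by
  rcases hb.lt_or_eq with hb | rfl
  · have hki : ∀ x y : ℝ, IntervalIntegrable (fun t : ℝ => t ^ (-(2 * b))) volume x y :=
      intervalIntegrable_rpow_neg (by linarith)
    refine ⟨fun y => (1 - 2 * b) * conv (fun t => t ^ (-(2 * b))) ρ y,
      continuous_const.mul (continuous_conv hki hρ hR), fun y hy => ?_⟩
    rw [intervalIntegral.integral_const_mul, ← conv_one_left,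
      conv_assoc hy intervalIntegrable_const (hki _ _) hρ hR, ← conv_const_mul_left]
    refine conv_congr hy (fun t ht => ?_) fun _ _ => rfl
    rw [conv_one_left, integral_rpow (Or.inl (by linarith)), Real.zero_rpow (by linarith),
      sub_zero, show -(2 * b) + 1 = 1 - 2 * b by ring]
    have : 1 - 2 * b ≠ 0 := by linarith
    field_simp
  · refine ⟨ρ, hρ, fun y _ => ?_⟩
    rw [← conv_one_left]
    congr 1
    funext t
    norm_num

/-- Interior regularity for an Abel-type Volterra equation. -/
lemma contDiffOn_of_volterra {b κ : ℝ} (hb0 : 0 < b) (hb : b ≤ 1 / 2) {c c' : ℝ → ℝ}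
    (hc : ∀ t, HasDerivAt c (c' t) t) (hc' : Continuous c') (hc0 : c 0 = 0)
    {r ρ : ℝ → ℝ} (hr : Continuous r) (hr1 : ContDiffOn ℝ 1 r (Ioo 0 1))
    (hρ : Continuous ρ) {R : ℝ} (hR : ∀ t, |ρ t| ≤ R)
    (heq : ∀ y ∈ Icc (0 : ℝ) 1, ρ y + conv (fun t => κ * t ^ (-b) + c t) ρ y = r y) :
    ContDiffOn ℝ 1 ρ (Ioo 0 1) := by
  have hb1 : b < 1 := by linarith
  set k : ℝ → ℝ := fun t => t ^ (-b) with hk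
  have hki : ∀ x y, IntervalIntegrable k volume x y := intervalIntegrable_rpow_neg hb1
  have hcc : Continuous c := continuous_iff_continuousAt.2 fun t => (hc t).continuousAt
  -- As c(0) = 0, the function c is the convolution of 1 with c', so the smooth part of the kernel
  -- contributes a C¹ term.
  have hcρ : ∀ y, 0 ≤ y → conv c ρ y = ∫ t in (0 : ℝ)..y, conv c' ρ t := by
    intro y hy
    rw [← conv_one_left, conv_assoc hy intervalIntegrable_const (hc'.intervalIntegrable _ _) hρ hR]
    refine conv_congr hy (fun t _ => ?_) fun _ _ => rfl
    rw [conv_one_left, intervalIntegral.integral_eq_sub_of_hasDerivAt (fun t _ => hc t)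
      (hc'.intervalIntegrable _ _), hc0, sub_zero]
  have hC' : Continuous (conv c' ρ) := continuous_conv (fun _ _ => hc'.intervalIntegrable _ _) hρ hR
  set r₁ : ℝ → ℝ := fun y => r y - ∫ t in (0 : ℝ)..y, conv c' ρ t with hr₁
  have hr₁c : Continuous r₁ := hr.sub (contDiff_integral hC').continuous
  have hr₁d : ContDiffOn ℝ 1 r₁ (Ioo 0 1) := hr1.sub (contDiff_integral hC').contDiffOn
  have hkρc : Continuous (conv k ρ) := continuous_conv hki hρ hR
  have hκc : Continuous fun t => κ * conv k ρ t := continuous_const.mul hkρc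
  have h1 : ∀ y ∈ Icc (0 : ℝ) 1, ρ y = r₁ y - κ * conv k ρ y := by
    intro y hy
    have := heq y hy
    rw [conv_add_left ((hki _ _).const_mul κ) (hcc.intervalIntegrable _ _) hρ,
      conv_const_mul_left, hcρ y hy.1] at this
    simp only [hr₁]
    linarith
  obtain ⟨h, hhc, hh⟩ := exists_conv_rpow_eq_integral hb hρ hR
  -- The equation is substituted into itself. The iterated kernel is a multiple of t^(1-2b) with 1 -
  -- 2b ≥ 0, and convolution with it makes the merely continuous ρ continuously differentiable.
  have h2 : ∀ y ∈ Icc (0 : ℝ) 1, ρ y = r₁ y - κ * (conv k r₁ y -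
      κ * (conv k k 1 * ∫ t in (0 : ℝ)..y, h t)) := by
    intro y hy
    rw [h1 y hy]
    congr 2
    rw [conv_congr (f' := k) (g' := fun t => r₁ t - κ * conv k ρ t) hy.1 (fun _ _ => rfl)
      (fun t ht => h1 t ⟨ht.1.le, ht.2.le.trans hy.2⟩),
      conv_sub_right (hki _ _) hr₁c hκc, conv_const_mul_right,
      conv_assoc hy.1 (hki _ _) (hki _ _) hρ hR, ← hh y hy.1, ← conv_const_mul_left (conv k k 1)]
    congr 2
    exact conv_congr hy.1 (fun t ht => conv_rpow_rpow ht.1) fun _ _ => rfl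
  refine ContDiffOn.congr ?_ fun y hy => h2 y ⟨hy.1.le, hy.2.le⟩
  exact hr₁d.sub (contDiffOn_const.mul ((contDiffOn_conv_rpow hb1 hr₁c hr₁d).sub
    (contDiffOn_const.mul (contDiffOn_const.mul (contDiff_integral hhc).contDiffOn))))

/-! ### Potentials over the half-line -/

/-- The potential `∫₀^∞ F_a(ξ, y) G(ξ) dξ`. -/
def kint (l a : ℝ) (G : ℝ → ℝ) (y : ℝ) : ℝ := ∫ ξ in Ioi (0 : ℝ), fker l a ξ y * G ξ

/-- For y in a compact interval away from 0 the decay rate y^(-l/2) in ξ is smallest at the right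
end. The resulting exponential bound admits densities of linear growth. -/
lemma exists_abs_fker_le_of_mem_Icc {l : ℝ} (hl₀ : 0 < l) (hl₁ : l ≤ 1) (a : ℝ) {y₁ y₂ : ℝ}
    (h₁ : 0 < y₁) (h₁₂ : y₁ ≤ y₂) : ∃ C m : ℝ, 0 < C ∧ 0 < m ∧ ∀ y ∈ Icc y₁ y₂, ∀ ξ, 0 ≤ ξ →
      |fker l a ξ y| ≤ C * Real.exp (-(m * ξ)) := by
  obtain ⟨C, hC, hb⟩ := exists_abs_fker_le hl₀.le hl₁ a
  obtain ⟨K, hK⟩ := (isCompact_Icc (a := y₁) (b := y₂)).exists_bound_of_continuousOn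
    (f := fun t : ℝ => t ^ (a - 1)) (ContinuousOn.rpow_const continuousOn_id fun t ht =>
      Or.inl (ne_of_gt (h₁.trans_le ht.1)))
  have h₂ : 0 < y₂ := h₁.trans_le h₁₂
  refine ⟨C * (|K| + 1), y₂ ^ (-(l / 2)), by positivity, by positivity, fun y hy ξ hξ => ?_⟩
  have hy0 : 0 < y := h₁.trans_le hy.1
  refine (hb ξ y hξ hy0).trans ?_
  rw [mul_assoc C]
  refine mul_le_mul_of_nonneg_left ?_ hC.le
  refine mul_le_mul ?_ ?_ (Real.exp_pos _).le (by positivity)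
  · have := hK y hy
    rw [Real.norm_eq_abs] at this
    linarith [le_abs_self (y ^ (a - 1)), le_abs_self K]
  · rw [Real.exp_le_exp, neg_le_neg_iff, mul_comm]
    exact mul_le_mul_of_nonneg_left
      (Real.rpow_le_rpow_of_nonpos hy0 hy.2 (by linarith)) hξ

lemma integrableOn_exp_neg_mul_linear {m : ℝ} (hm : 0 < m) (A B : ℝ) :
    IntegrableOn (fun ξ : ℝ => Real.exp (-(m * ξ)) * (A + B * ξ)) (Ioi 0) := by
  have h0 : IntegrableOn (fun ξ : ℝ => Real.exp (-(m * ξ))) (Ioi 0) := by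
    simpa only [neg_mul] using integrableOn_exp_mul_Ioi (a := -m) (by linarith) 0
  have h1 : IntegrableOn (fun ξ : ℝ => ξ * Real.exp (-(m * ξ))) (Ioi 0) := by
    have := integrableOn_rpow_mul_exp_neg_mul_rpow (s := 1) (p := 1) (by norm_num) zero_lt_one hm
    simpa only [Real.rpow_one, neg_mul] using this
  refine ((h0.const_mul A).add (h1.const_mul B)).congr (Eventually.of_forall fun ξ => ?_)
  simp only [Pi.add_apply]
  ring

lemma measurable_fker_left {l : ℝ} (hl₁ : l ≤ 1) (a y : ℝ) : Measurable fun ξ => fker l a ξ y :=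
  (continuous_fker_left hl₁ a y).measurable

lemma integrableOn_fker_mul {l : ℝ} (hl₀ : 0 < l) (hl₁ : l ≤ 1) (a : ℝ) {y : ℝ} (hy : 0 < y)
    {G : ℝ → ℝ} (hG : Continuous G) {A B : ℝ} (hAB : ∀ ξ, 0 ≤ ξ → |G ξ| ≤ A + B * ξ) :
    IntegrableOn (fun ξ => fker l a ξ y * G ξ) (Ioi 0) := by
  obtain ⟨C, m, hC, hm, hb⟩ := exists_abs_fker_le_of_mem_Icc hl₀ hl₁ a hy le_rfl
  refine Integrable.mono' ((integrableOn_exp_neg_mul_linear hm A B).const_mul C)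
    ((measurable_fker_left hl₁ a y).mul hG.measurable).aestronglyMeasurable ?_
  filter_upwards [ae_restrict_mem measurableSet_Ioi] with ξ hξ
  rw [norm_mul, ← mul_assoc]
  exact mul_le_mul (hb y ⟨le_rfl, le_rfl⟩ ξ hξ.le) (hAB ξ hξ.le) (norm_nonneg _) (by positivity)

lemma integrableOn_fker_mul_of_bdd {l : ℝ} (hl₀ : 0 < l) (hl₁ : l ≤ 1) (a : ℝ) {y : ℝ}
    (hy : 0 < y) {G : ℝ → ℝ} (hG : Continuous G) {A : ℝ} (hA : ∀ ξ, |G ξ| ≤ A) :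
    IntegrableOn (fun ξ => fker l a ξ y * G ξ) (Ioi 0) :=
  integrableOn_fker_mul hl₀ hl₁ a hy hG (A := A) (B := 0) fun ξ _ => by simpa using hA ξ

lemma continuousOn_kint {l : ℝ} (hl₀ : 0 < l) (hl₁ : l ≤ 1) (a : ℝ) {G : ℝ → ℝ → ℝ}
    (hG : Continuous fun p : ℝ × ℝ => G p.1 p.2) {A : ℝ} (hA : ∀ x ξ, |G x ξ| ≤ A) :
    ContinuousOn (fun p : ℝ × ℝ => kint l a (G p.1) p.2) (univ ×ˢ Ioi 0) := by
  rintro ⟨x₀, y₀⟩ ⟨-, hy₀⟩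
  rw [mem_Ioi] at hy₀
  refine ContinuousAt.continuousWithinAt ?_
  obtain ⟨C, m, hC, hm, hb⟩ := exists_abs_fker_le_of_mem_Icc hl₀ hl₁ a (half_pos hy₀)
    (show y₀ / 2 ≤ 2 * y₀ by linarith)
  have hA0 : 0 ≤ A := (abs_nonneg _).trans (hA 0 0)
  refine continuousAt_of_dominated
    (bound := fun ξ => C * (Real.exp (-(m * ξ)) * (A + 0 * ξ))) ?_ ?_
    ((integrableOn_exp_neg_mul_linear hm A 0).const_mul C) ?_
  · refine Eventually.of_forall fun p => ?_
    have : Continuous fun ξ => G p.1 ξ := hG.comp (Continuous.prodMk continuous_const continuous_id)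
    exact ((measurable_fker_left hl₁ a p.2).mul this.measurable).aestronglyMeasurable
  · have : ∀ᶠ p : ℝ × ℝ in 𝓝 (x₀, y₀), p.2 ∈ Icc (y₀ / 2) (2 * y₀) :=
      continuous_snd.continuousAt.preimage_mem_nhds (Icc_mem_nhds (by simp only; linarith)
        (by simp only; linarith))
    filter_upwards [this] with p hp
    filter_upwards [ae_restrict_mem measurableSet_Ioi] with ξ hξ
    rw [norm_mul, ← mul_assoc, zero_mul, add_zero]
    exact mul_le_mul (hb p.2 hp ξ hξ.le) (hA _ _) (norm_nonneg _) (by positivity)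
  · refine Eventually.of_forall fun ξ => ?_
    refine ContinuousAt.mul ?_ ?_
    · have h1 : ContinuousAt (fun p : ℝ × ℝ => fker l a p.1 p.2) (ξ, y₀) :=
        (continuousOn_fker hl₁ a).continuousAt
          ((isOpen_lt continuous_const continuous_snd).mem_nhds hy₀)
      exact ContinuousAt.comp (x := (x₀, y₀)) (f := fun p : ℝ × ℝ => (ξ, p.2)) h1
        (continuousAt_const.prodMk continuousAt_snd)
    · exact (hG.comp (continuous_fst.prodMk continuous_const)).continuousAt

lemma hasDerivAt_kint_right {l : ℝ} (hl₀ : 0 < l) (hl₁ : l ≤ 1) (a : ℝ) {G : ℝ → ℝ}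
    (hG : Continuous G) {A : ℝ} (hA : ∀ ξ, |G ξ| ≤ A) {y : ℝ} (hy : 0 < y) :
    HasDerivAt (kint l a G) (kint l (a - 1) G y) y := by
  obtain ⟨C, m, hC, hm, hb⟩ := exists_abs_fker_le_of_mem_Icc hl₀ hl₁ (a - 1) (half_pos hy)
    (show y / 2 ≤ 2 * y by linarith)
  have hA0 : 0 ≤ A := (abs_nonneg _).trans (hA 0)
  refine (hasDerivAt_integral_of_dominated_loc_of_deriv_le
    (F := fun y ξ => fker l a ξ y * G ξ) (F' := fun y ξ => fker l (a - 1) ξ y * G ξ)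
    (bound := fun ξ => C * (Real.exp (-(m * ξ)) * (A + 0 * ξ)))
    (Ioo_mem_nhds (show y / 2 < y by linarith) (show y < 2 * y by linarith))
    (Eventually.of_forall fun z =>
      ((measurable_fker_left hl₁ a z).mul hG.measurable).aestronglyMeasurable)
    (integrableOn_fker_mul_of_bdd hl₀ hl₁ a hy hG hA)
    ((measurable_fker_left hl₁ (a - 1) y).mul hG.measurable).aestronglyMeasurable ?_
    ((integrableOn_exp_neg_mul_linear hm A 0).const_mul C) ?_).2
  · filter_upwards [ae_restrict_mem measurableSet_Ioi] with ξ hξ z hz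
    rw [norm_mul, ← mul_assoc, zero_mul, add_zero]
    exact mul_le_mul (hb z ⟨hz.1.le, hz.2.le⟩ ξ hξ.le) (hA _) (norm_nonneg _) (by positivity)
  · filter_upwards [ae_restrict_mem measurableSet_Ioi] with ξ hξ z hz
    exact (hasDerivAt_fker_right hl₀ hl₁ a hξ z).mul_const _

lemma hasDerivAt_kint_left {l : ℝ} (hl₀ : 0 < l) (hl₁ : l ≤ 1) (a : ℝ) {G G' : ℝ → ℝ → ℝ}
    (hGc : ∀ x, Continuous (G x)) (hG'c : ∀ x, Continuous (G' x))
    (hG : ∀ x ξ, HasDerivAt (fun x => G x ξ) (G' x ξ) x)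
    {A : ℝ} (hA : ∀ x ξ, |G' x ξ| ≤ A) {x : ℝ} {A' B' : ℝ}
    (hAB : ∀ ξ, 0 ≤ ξ → |G x ξ| ≤ A' + B' * ξ) {y : ℝ} (hy : 0 < y) :
    HasDerivAt (fun x => kint l a (G x) y) (kint l a (G' x) y) x := by
  obtain ⟨C, m, hC, hm, hb⟩ := exists_abs_fker_le_of_mem_Icc hl₀ hl₁ a hy le_rfl
  have hA0 : 0 ≤ A := (abs_nonneg _).trans (hA 0 0)
  refine (hasDerivAt_integral_of_dominated_loc_of_deriv_le
    (F := fun x ξ => fker l a ξ y * G x ξ) (F' := fun x ξ => fker l a ξ y * G' x ξ)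
    (bound := fun ξ => C * (Real.exp (-(m * ξ)) * (A + 0 * ξ)))
    univ_mem
    (Eventually.of_forall fun z =>
      ((measurable_fker_left hl₁ a y).mul (hGc z).measurable).aestronglyMeasurable)
    (integrableOn_fker_mul hl₀ hl₁ a hy (hGc x) hAB)
    ((measurable_fker_left hl₁ a y).mul (hG'c x).measurable).aestronglyMeasurable ?_
    ((integrableOn_exp_neg_mul_linear hm A 0).const_mul C) ?_).2
  · filter_upwards [ae_restrict_mem measurableSet_Ioi] with ξ hξ z hz
    rw [norm_mul, ← mul_assoc, zero_mul, add_zero]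
    exact mul_le_mul (hb y ⟨le_rfl, le_rfl⟩ ξ hξ.le) (hA _ _) (norm_nonneg _) (by positivity)
  · exact Eventually.of_forall fun ξ z hz => (hG z ξ).const_mul _

/-- Integration by parts in the space variable. -/
lemma kint_sub_half {l : ℝ} (hl₀ : 0 < l) (hl₁ : l ≤ 1) (a : ℝ) {G G' : ℝ → ℝ}
    (hG : ∀ ξ, HasDerivAt G (G' ξ) ξ) (hG'c : Continuous G')
    {A B : ℝ} (hAB : ∀ ξ, 0 ≤ ξ → |G ξ| ≤ A + B * ξ) {A' : ℝ} (hA : ∀ ξ, |G' ξ| ≤ A')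
    {y : ℝ} (hy : 0 < y) :
    kint l (a - l / 2) G y = fker l a 0 y * G 0 + kint l a G' y := by
  have hGc : Continuous G := continuous_iff_continuousAt.2 fun ξ => (hG ξ).continuousAt
  have hcf := continuous_fker_left hl₁ a y
  have hi1 := integrableOn_fker_mul hl₀ hl₁ (a - l / 2) hy hGc hAB
  have hi2 := integrableOn_fker_mul_of_bdd hl₀ hl₁ a hy hG'c hA
  have h0 : Tendsto (fun ξ => fker l a ξ y * G ξ) (𝓝[>] 0) (𝓝 (fker l a 0 y * G 0)) :=
    ((hcf.mul hGc).tendsto 0).mono_left nhdsWithin_le_nhds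
  have hinf : Tendsto (fun ξ => fker l a ξ y * G ξ) atTop (𝓝 0) := by
    obtain ⟨C, m, hC, hm, hb⟩ := exists_abs_fker_le_of_mem_Icc hl₀ hl₁ a hy le_rfl
    have hlim : Tendsto (fun ξ : ℝ => C * (A * Real.exp (-(m * ξ)) +
        B / m * ((m * ξ) ^ 1 * Real.exp (-(m * ξ))))) atTop (𝓝 (C * (A * 0 + B / m * 0))) := by
      have hmt : Tendsto (fun ξ : ℝ => m * ξ) atTop atTop := tendsto_id.const_mul_atTop hm
      exact (((Real.tendsto_exp_neg_atTop_nhds_zero.comp hmt).const_mul A).add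
        (((Real.tendsto_pow_mul_exp_neg_atTop_nhds_zero 1).comp hmt).const_mul (B / m))).const_mul C
    simp only [mul_zero, add_zero] at hlim
    refine squeeze_zero_norm' ?_ hlim
    filter_upwards [eventually_ge_atTop 0] with ξ hξ
    rw [norm_mul]
    calc _ ≤ C * Real.exp (-(m * ξ)) * (A + B * ξ) :=
          mul_le_mul (hb y ⟨le_rfl, le_rfl⟩ ξ hξ) (hAB ξ hξ) (abs_nonneg _) (by positivity)
      _ = _ := by field_simp
  have := integral_Ioi_mul_deriv_eq_deriv_mul (u := fun ξ => fker l a ξ y) (v := G)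
    (u' := fun ξ => -fker l (a - l / 2) ξ y) (v' := G') (a := 0)
    (fun ξ _ => hasDerivAt_fker_left hl₁ a ξ y) (fun ξ _ => hG ξ) hi2
    (by simpa only [Pi.mul_def, Pi.neg_def, neg_mul] using hi1.neg) h0 hinf
  rw [kint, kint, this]
  simp only [neg_mul, integral_neg]
  ring

lemma integral_exp_neg_mul_linear {m : ℝ} (hm : 0 < m) (A B : ℝ) :
    ∫ ξ in Ioi (0 : ℝ), Real.exp (-(m * ξ)) * (A + B * ξ) = A / m + B / m ^ 2 := by
  have h0 : IntegrableOn (fun ξ : ℝ => A * Real.exp (-(m * ξ))) (Ioi 0) := by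
    refine (integrableOn_exp_neg_mul_linear hm A 0).congr (Eventually.of_forall fun ξ => ?_)
    simp only
    ring
  have h1 : IntegrableOn (fun ξ : ℝ => B * (ξ ^ ((2 : ℝ) - 1) * Real.exp (-(m * ξ)))) (Ioi 0) := by
    refine (integrableOn_exp_neg_mul_linear hm 0 B).congr (Eventually.of_forall fun ξ => ?_)
    simp only
    rw [show (2 : ℝ) - 1 = 1 by norm_num, Real.rpow_one]
    ring
  have h2 : ∫ ξ in Ioi (0 : ℝ), Real.exp (-(m * ξ)) = 1 / m := by
    have := integral_exp_mul_Ioi (a := -m) (by linarith) 0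
    simp only [neg_mul, mul_zero, Real.exp_zero] at this
    rw [this]
    field_simp
  have h3 := Real.integral_rpow_mul_exp_neg_mul_Ioi (a := 2) (r := m) (by norm_num) hm
  calc _ = ∫ ξ in Ioi (0 : ℝ), (A * Real.exp (-(m * ξ)) +
        B * (ξ ^ ((2 : ℝ) - 1) * Real.exp (-(m * ξ)))) := by
        refine integral_congr_ae (Eventually.of_forall fun ξ => ?_)
        simp only
        rw [show (2 : ℝ) - 1 = 1 by norm_num, Real.rpow_one]
        ring
    _ = _ := by
        rw [integral_add h0 h1, integral_const_mul, integral_const_mul, h2, h3, Real.Gamma_two]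
        norm_num
        field_simp

/-- The scaling ξ ~ y^(l/2): the integration gives one factor y^(l/2), and each power of ξ in the
bound on G another. -/
lemma exists_integral_abs_fker_mul_le {l : ℝ} (hl₀ : 0 < l) (hl₁ : l ≤ 1) (a : ℝ) :
    ∃ C, 0 < C ∧ ∀ (G : ℝ → ℝ) (A B y : ℝ), Continuous G → 0 < y →
      (∀ ξ, 0 ≤ ξ → |G ξ| ≤ A + B * ξ) →
      ∫ ξ in Ioi (0 : ℝ), ‖fker l a ξ y * G ξ‖ ≤
        C * y ^ (a - 1) * (A * y ^ (l / 2) + B * y ^ l) := by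
  obtain ⟨C, hC, hb⟩ := exists_abs_fker_le hl₀.le hl₁ a
  refine ⟨C, hC, fun G A B y hG hy hAB => ?_⟩
  have hm : 0 < y ^ (-(l / 2)) := by positivity
  have hle : ∫ ξ in Ioi (0 : ℝ), ‖fker l a ξ y * G ξ‖ ≤ ∫ ξ in Ioi (0 : ℝ),
      C * y ^ (a - 1) * (Real.exp (-(y ^ (-(l / 2)) * ξ)) * (A + B * ξ)) := by
    refine setIntegral_mono_on (integrableOn_fker_mul hl₀ hl₁ a hy hG hAB).norm
      ((integrableOn_exp_neg_mul_linear hm A B).const_mul _) measurableSet_Ioi fun ξ hξ => ?_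
    rw [norm_mul, ← mul_assoc, mul_comm _ ξ, mul_assoc C]
    exact mul_le_mul (hb ξ y hξ.le hy) (hAB ξ hξ.le) (norm_nonneg _) (by positivity)
  refine hle.trans (le_of_eq ?_)
  rw [integral_const_mul, integral_exp_neg_mul_linear hm]
  congr 1
  have e1 : (y ^ (-(l / 2)))⁻¹ = y ^ (l / 2) := by rw [← Real.rpow_neg hy.le, neg_neg]
  have e2 : ((y ^ (-(l / 2))) ^ 2)⁻¹ = y ^ l := by
    rw [← Real.rpow_natCast, ← Real.rpow_mul hy.le, ← Real.rpow_neg hy.le]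
    congr 1
    push_cast
    ring
  rw [← e1, ← e2, div_eq_mul_inv A, div_eq_mul_inv B]

lemma exists_abs_kint_le {l : ℝ} (hl₀ : 0 < l) (hl₁ : l ≤ 1) (a : ℝ) :
    ∃ C, 0 < C ∧ ∀ (G : ℝ → ℝ) (A B y : ℝ), Continuous G → 0 < y →
      (∀ ξ, 0 ≤ ξ → |G ξ| ≤ A + B * ξ) →
      |kint l a G y| ≤ C * y ^ (a - 1) * (A * y ^ (l / 2) + B * y ^ l) := by
  obtain ⟨C, hC, h⟩ := exists_integral_abs_fker_mul_le hl₀ hl₁ a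
  exact ⟨C, hC, fun G A B y hG hy hAB =>
    (norm_integral_le_integral_norm _).trans (h G A B y hG hy hAB)⟩

lemma fker_one_zero {l y : ℝ} (hy : 0 < y) : fker l 1 0 y = 1 := by
  rw [fker_of_pos hy, zero_mul, wright_one_zero, sub_self, Real.rpow_zero, one_mul]

/-- F_{1-l/2} = -∂ₓF_1, so its mass over the half-line is F_1(0, y) = 1. -/
lemma kint_one {l : ℝ} (hl₀ : 0 < l) (hl₁ : l ≤ 1) {y : ℝ} (hy : 0 < y) (c : ℝ) :
    kint l (1 - l / 2) (fun _ => c) y = c := by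
  rw [kint_sub_half hl₀ hl₁ 1 (fun ξ => hasDerivAt_const ξ c) continuous_const (A := |c|) (B := 0)
    (by simp) (A' := 0) (by simp) hy, fker_one_zero hy, one_mul, kint]
  simp

/-! ### The initial-value potential -/

/-- Data for the initial-value potential: a bounded Lipschitz function `v` with primitive `T`. -/
structure InitData (T v : ℝ → ℝ) (V L : ℝ) : Prop where
  deriv : ∀ x, HasDerivAt T (v x) x
  bdd : ∀ x, |v x| ≤ V
  lip : ∀ x y, |v x - v y| ≤ L * |x - y|

/-- The potential with initial value `T`. -/
def initPot (l : ℝ) (T v : ℝ → ℝ) (x y : ℝ) : ℝ :=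
  T x + 1 / 2 * kint l 1 (fun ξ => v (x + ξ) - v (x - ξ)) y

namespace InitData

variable {T v : ℝ → ℝ} {V L : ℝ}

lemma continuous (h : InitData T v V L) : Continuous v := by
  have hL : 0 ≤ L := by
    have := (abs_nonneg _).trans (h.lip 0 1)
    simpa using this
  have : LipschitzWith L.toNNReal v := LipschitzWith.of_dist_le_mul fun x y => by
    rw [Real.dist_eq, Real.dist_eq, Real.coe_toNNReal _ hL]
    exact h.lip x y
  exact this.continuous

lemma continuous_primitive (h : InitData T v V L) : Continuous T :=
  continuous_iff_continuousAt.2 fun x => (h.deriv x).continuousAt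

lemma continuous_add (h : InitData T v V L) : Continuous fun p : ℝ × ℝ => v (p.1 + p.2) + v (p.1 - p.2) := by
  have := h.continuous
  fun_prop

lemma continuous_sub (h : InitData T v V L) : Continuous fun p : ℝ × ℝ => v (p.1 + p.2) - v (p.1 - p.2) := by
  have := h.continuous
  fun_prop

lemma abs_add_le (h : InitData T v V L) (x ξ : ℝ) : |v (x + ξ) + v (x - ξ)| ≤ 2 * V := by
  have := _root_.abs_add_le (v (x + ξ)) (v (x - ξ))
  linarith [h.bdd (x + ξ), h.bdd (x - ξ)]

lemma abs_sub_le (h : InitData T v V L) (x ξ : ℝ) : |v (x + ξ) - v (x - ξ)| ≤ 2 * V := by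
  have := abs_sub (v (x + ξ)) (v (x - ξ))
  linarith [h.bdd (x + ξ), h.bdd (x - ξ)]

lemma abs_sub_le_mul (h : InitData T v V L) (x : ℝ) {ξ : ℝ} (hξ : 0 ≤ ξ) :
    |v (x + ξ) - v (x - ξ)| ≤ 0 + 2 * L * ξ := by
  have := h.lip (x + ξ) (x - ξ)
  rw [show x + ξ - (x - ξ) = 2 * ξ by ring, abs_of_nonneg (by linarith : 0 ≤ 2 * ξ)] at this
  linarith

lemma abs_primitive_sub_le (h : InitData T v V L) (x y : ℝ) : |T y - T x| ≤ V * |y - x| :=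
  Convex.norm_image_sub_le_of_norm_hasDerivWithin_le (s := univ)
    (fun x _ => (h.deriv x).hasDerivWithinAt) (fun x _ => h.bdd x) convex_univ (mem_univ _)
    (mem_univ _)

lemma abs_primitive_add_le (h : InitData T v V L) (x : ℝ) {ξ : ℝ} (hξ : 0 ≤ ξ) :
    |T (x + ξ) + T (x - ξ)| ≤ 2 * |T x| + 2 * V * ξ := by
  have h1 := h.abs_primitive_sub_le x (x + ξ)
  have h2 := h.abs_primitive_sub_le x (x - ξ)
  rw [show x + ξ - x = ξ by ring, abs_of_nonneg hξ] at h1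
  rw [show x - ξ - x = -ξ by ring, abs_neg, abs_of_nonneg hξ] at h2
  have e1 := le_abs_self (T x)
  have e2 := neg_abs_le (T x)
  rw [abs_le] at h1 h2 ⊢
  constructor <;> linarith [h1.1, h1.2, h2.1, h2.2]

lemma abs_primitive_sub_le_mul (h : InitData T v V L) (x : ℝ) {ξ : ℝ} (hξ : 0 ≤ ξ) :
    |T (x + ξ) - T (x - ξ)| ≤ 0 + 2 * V * ξ := by
  have := h.abs_primitive_sub_le (x - ξ) (x + ξ)
  rw [show x + ξ - (x - ξ) = 2 * ξ by ring, abs_of_nonneg (by linarith : 0 ≤ 2 * ξ)] at this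
  linarith

lemma hasDerivAt_add_right (h : InitData T v V L) (x ξ : ℝ) :
    HasDerivAt (fun ξ => T (x + ξ)) (v (x + ξ)) ξ := (h.deriv (x + ξ)).comp_const_add x ξ

lemma hasDerivAt_sub_right (h : InitData T v V L) (x ξ : ℝ) :
    HasDerivAt (fun ξ => T (x - ξ)) (-v (x - ξ)) ξ := (h.deriv (x - ξ)).comp_const_sub x ξ

variable {l : ℝ}

/-- This is the convolution of T with the fundamental solution F_{1-l/2}(|x|, y)/2, folded onto the
half-line. The form used in the definition makes the limit y → 0 visible and has a y-derivative that
involves only differences of v. -/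
lemma initPot_eq (h : InitData T v V L) (hl₀ : 0 < l) (hl₁ : l ≤ 1) (x : ℝ) {y : ℝ} (hy : 0 < y) :
    initPot l T v x y = 1 / 2 * kint l (1 - l / 2) (fun ξ => T (x + ξ) + T (x - ξ)) y := by
  rw [kint_sub_half hl₀ hl₁ 1 (G := fun ξ => T (x + ξ) + T (x - ξ))
    (G' := fun ξ => v (x + ξ) - v (x - ξ))
    (fun ξ => (h.hasDerivAt_add_right x ξ).add (h.hasDerivAt_sub_right x ξ))
    (h.continuous_sub.comp (Continuous.prodMk_right x)) (fun ξ hξ => h.abs_primitive_add_le x hξ)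
    (fun ξ => h.abs_sub_le x ξ) hy, fker_one_zero hy, initPot, add_zero, sub_zero]
  ring

lemma hasDerivAt_initPot_left (h : InitData T v V L) (hl₀ : 0 < l) (hl₁ : l ≤ 1) (x : ℝ) {y : ℝ}
    (hy : 0 < y) : HasDerivAt (fun x => initPot l T v x y)
      (1 / 2 * kint l (1 - l / 2) (fun ξ => v (x + ξ) + v (x - ξ)) y) x := by
  have hT := h.continuous_primitive
  simp only [h.initPot_eq hl₀ hl₁ _ hy]
  refine (hasDerivAt_kint_left hl₀ hl₁ _ (G := fun x ξ => T (x + ξ) + T (x - ξ))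
    (G' := fun x ξ => v (x + ξ) + v (x - ξ))
    (fun x => by fun_prop) (fun x => h.continuous_add.comp (Continuous.prodMk_right x)) ?_
    h.abs_add_le (fun ξ hξ => h.abs_primitive_add_le x hξ) hy).const_mul _
  exact fun x ξ => ((h.deriv (x + ξ)).comp_add_const x ξ).add ((h.deriv (x - ξ)).comp_sub_const x ξ)

/-- v is only Lipschitz, so it is not differentiated in x. Integration by parts first trades the
parameter 1 - l/2 and the density v for 1 - l and the density T, whose x-derivative is v. -/
lemma hasDerivAt_initPot_left_left (h : InitData T v V L) (hl₀ : 0 < l) (hl₁ : l ≤ 1) (x : ℝ)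
    {y : ℝ} (hy : 0 < y) :
    HasDerivAt (fun x => 1 / 2 * kint l (1 - l / 2) (fun ξ => v (x + ξ) + v (x - ξ)) y)
      (1 / 2 * kint l (1 - l) (fun ξ => v (x + ξ) - v (x - ξ)) y) x := by
  have hT := h.continuous_primitive
  have heq : ∀ x, kint l (1 - l / 2) (fun ξ => v (x + ξ) + v (x - ξ)) y =
      kint l (1 - l) (fun ξ => T (x + ξ) - T (x - ξ)) y := by
    intro x
    have := kint_sub_half hl₀ hl₁ (1 - l / 2) (G := fun ξ => T (x + ξ) - T (x - ξ))
      (G' := fun ξ => v (x + ξ) + v (x - ξ))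
      (fun ξ => ((h.hasDerivAt_add_right x ξ).sub (h.hasDerivAt_sub_right x ξ)).congr_deriv
        (sub_neg_eq_add _ _))
      (h.continuous_add.comp (Continuous.prodMk_right x))
      (fun ξ hξ => h.abs_primitive_sub_le_mul x hξ) (fun ξ => h.abs_add_le x ξ) hy
    rw [sub_sub, add_halves] at this
    rw [this]
    simp
  simp only [heq]
  refine (hasDerivAt_kint_left hl₀ hl₁ _ (G := fun x ξ => T (x + ξ) - T (x - ξ))
    (G' := fun x ξ => v (x + ξ) - v (x - ξ))
    (fun x => by fun_prop) (fun x => h.continuous_sub.comp (Continuous.prodMk_right x)) ?_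
    h.abs_sub_le (fun ξ hξ => h.abs_primitive_sub_le_mul x hξ) hy).const_mul _
  exact fun x ξ => ((h.deriv (x + ξ)).comp_add_const x ξ).sub ((h.deriv (x - ξ)).comp_sub_const x ξ)

lemma hasDerivAt_initPot_right (h : InitData T v V L) (hl₀ : 0 < l) (hl₁ : l ≤ 1) (x : ℝ) {y : ℝ}
    (hy : 0 < y) : HasDerivAt (fun y => initPot l T v x y)
      (1 / 2 * kint l 0 (fun ξ => v (x + ξ) - v (x - ξ)) y) y := by
  have := hasDerivAt_kint_right hl₀ hl₁ 1 (h.continuous_sub.comp (Continuous.prodMk_right x))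
    (fun ξ => h.abs_sub_le x ξ) hy
  rw [sub_self] at this
  exact (this.const_mul (1 / 2)).const_add (T x)

lemma continuousOn_initPot (h : InitData T v V L) (hl₀ : 0 < l) (hl₁ : l ≤ 1) :
    ContinuousOn (fun p : ℝ × ℝ => initPot l T v p.1 p.2) (univ ×ˢ Ici 0) := by
  rintro ⟨x₀, y₀⟩ ⟨-, hy₀⟩
  have hT := h.continuous_primitive
  rcases (show 0 ≤ y₀ from hy₀).lt_or_eq with hy | rfl
  · have := (continuousOn_kint hl₀ hl₁ 1 h.continuous_sub h.abs_sub_le).continuousAt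
      ((isOpen_univ.prod isOpen_Ioi).mem_nhds (show (x₀, y₀) ∈ univ ×ˢ Ioi (0 : ℝ) from ⟨mem_univ _, hy⟩))
    exact ((hT.comp continuous_fst).continuousAt.add
      (continuousAt_const.mul this)).continuousWithinAt
  · refine ContinuousWithinAt.add (hT.comp continuous_fst).continuousWithinAt ?_
    refine continuousWithinAt_const.mul ?_
    obtain ⟨C, hC, hb⟩ := exists_abs_kint_le hl₀ hl₁ 1
    have hV : 0 ≤ V := (abs_nonneg _).trans (h.bdd 0)
    have h0 : ∀ G, kint l 1 G 0 = 0 := by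
      intro G
      rw [kint]
      simp [fker_of_nonpos le_rfl]
    rw [ContinuousWithinAt]
    simp only [h0]
    have hlim : Tendsto (fun p : ℝ × ℝ => C * (2 * V * p.2 ^ (l / 2)))
        (𝓝[univ ×ˢ Ici 0] (x₀, 0)) (𝓝 0) := by
      have : ContinuousAt (fun p : ℝ × ℝ => C * (2 * V * p.2 ^ (l / 2))) (x₀, 0) := by
        refine continuousAt_const.mul (continuousAt_const.mul ?_)
        exact continuousAt_snd.rpow_const (Or.inr (by positivity))
      have h2 := this.tendsto
      simp only [Real.zero_rpow (by positivity : l / 2 ≠ 0), mul_zero] at h2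
      exact h2.mono_left nhdsWithin_le_nhds
    refine squeeze_zero_norm' ?_ hlim
    filter_upwards [self_mem_nhdsWithin] with p hp
    rcases (show 0 ≤ p.2 from hp.2).lt_or_eq with hp' | hp'
    · have := hb (fun ξ => v (p.1 + ξ) - v (p.1 - ξ)) (2 * V) 0 p.2
        (h.continuous_sub.comp (Continuous.prodMk_right p.1)) hp'
        (fun ξ _ => by simpa using h.abs_sub_le p.1 ξ)
      rw [sub_self, Real.rpow_zero, mul_one, zero_mul, add_zero] at this
      exact this
    · rw [← hp', h0, norm_zero]
      positivity

/-- The kernel has mass one and v is Lipschitz, so the error is O(y^(l/2)) by the scaling bound. -/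
lemma tendsto_initPot_deriv (h : InitData T v V L) (hl₀ : 0 < l) (hl₁ : l ≤ 1) (x : ℝ) :
    Tendsto (fun y => 1 / 2 * kint l (1 - l / 2) (fun ξ => v (x + ξ) + v (x - ξ)) y) (𝓝[>] 0)
      (𝓝 (v x)) := by
  have hv := h.continuous
  obtain ⟨C, hC, hb⟩ := exists_abs_kint_le hl₀ hl₁ (1 - l / 2)
  rw [tendsto_iff_norm_sub_tendsto_zero]
  have hlim : Tendsto (fun y : ℝ => C * (L * y ^ (l / 2))) (𝓝[>] 0) (𝓝 0) := by
    have : ContinuousAt (fun y : ℝ => C * (L * y ^ (l / 2))) 0 :=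
      continuousAt_const.mul (continuousAt_const.mul
        (Real.continuousAt_rpow_const 0 _ (Or.inr (by positivity))))
    have h2 := this.tendsto
    simp only [Real.zero_rpow (by positivity : l / 2 ≠ 0), mul_zero] at h2
    exact h2.mono_left nhdsWithin_le_nhds
  refine squeeze_zero' (Eventually.of_forall fun _ => norm_nonneg _) ?_ hlim
  filter_upwards [self_mem_nhdsWithin] with y hy
  have hy : 0 < y := hy
  have e1 : 1 / 2 * kint l (1 - l / 2) (fun ξ => v (x + ξ) + v (x - ξ)) y - v x =
      1 / 2 * kint l (1 - l / 2) (fun ξ => v (x + ξ) + v (x - ξ) - 2 * v x) y := by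
    have e2 := kint_one hl₀ hl₁ hy (2 * v x)
    have i1 := integrableOn_fker_mul_of_bdd hl₀ hl₁ (1 - l / 2) hy
      (h.continuous_add.comp (Continuous.prodMk_right x)) (fun ξ => h.abs_add_le x ξ)
    have i2 := integrableOn_fker_mul_of_bdd hl₀ hl₁ (1 - l / 2) hy
      (continuous_const (y := 2 * v x)) (fun ξ => le_rfl)
    have e3 : kint l (1 - l / 2) (fun ξ => v (x + ξ) + v (x - ξ) - 2 * v x) y =
        kint l (1 - l / 2) (fun ξ => v (x + ξ) + v (x - ξ)) y - 2 * v x := by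
      refine Eq.trans ?_ (congrArg (kint l (1 - l / 2) (fun ξ => v (x + ξ) + v (x - ξ)) y - ·) e2)
      refine Eq.trans ?_ (integral_sub i1 i2)
      refine integral_congr_ae (Eventually.of_forall fun ξ => ?_)
      exact mul_sub _ _ _
    rw [e3]
    ring
  have e4 := hb (fun ξ => v (x + ξ) + v (x - ξ) - 2 * v x) 0 (2 * L) y (by fun_prop) hy
    (fun ξ hξ => by
      have h1 := h.lip (x + ξ) x
      have h2 := h.lip (x - ξ) x
      rw [show x + ξ - x = ξ by ring, abs_of_nonneg hξ] at h1
      rw [show x - ξ - x = -ξ by ring, abs_neg, abs_of_nonneg hξ] at h2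
      have := _root_.abs_add_le (v (x + ξ) - v x) (v (x - ξ) - v x)
      rw [show v (x + ξ) - v x + (v (x - ξ) - v x) = v (x + ξ) + v (x - ξ) - 2 * v x by ring] at this
      linarith)
  rw [e1, norm_mul, Real.norm_eq_abs, Real.norm_eq_abs, abs_of_pos (by norm_num : (0 : ℝ) < 1 / 2)]
  calc _ ≤ 1 / 2 * (C * y ^ (1 - l / 2 - 1) * (0 * y ^ (l / 2) + 2 * L * y ^ l)) := by gcongr
    _ = C * (L * (y ^ (1 - l / 2 - 1) * y ^ l)) := by ring
    _ = _ := by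
      rw [← Real.rpow_add hy]
      ring_nf

/-- With ξ = s z and s = y^(l/2) the expression is half the integral of W_{1-l}(z) (v(x + sz) - v(x
- sz))/s. The quotient tends to 2v'z and is dominated by 2Lz; the first moment of W_{1-l} is one. -/
lemma tendsto_initPot_deriv_deriv (h : InitData T v V L) (hl₀ : 0 < l) (hl₁ : l ≤ 1) {x v' : ℝ}
    (hv' : HasDerivAt v v' x) :
    Tendsto (fun y => 1 / 2 * kint l (1 - l) (fun ξ => v (x + ξ) - v (x - ξ)) y) (𝓝[>] 0)
      (𝓝 v') := by
  have hv := h.continuous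
  have hs : Tendsto (fun y : ℝ => y ^ (l / 2)) (𝓝[>] 0) (𝓝[>] 0) := by
    rw [tendsto_nhdsWithin_iff]
    constructor
    · have := (Real.continuousAt_rpow_const 0 (l / 2) (Or.inr (by positivity))).tendsto
      rw [Real.zero_rpow (by positivity : l / 2 ≠ 0)] at this
      exact this.mono_left nhdsWithin_le_nhds
    · filter_upwards [self_mem_nhdsWithin] with y hy
      exact Real.rpow_pos_of_pos hy _
  have hmain : Tendsto (fun s : ℝ => ∫ z in Ioi (0 : ℝ),
      wright l (1 - l) z * ((v (x + s * z) - v (x - s * z)) / s)) (𝓝[>] 0)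
      (𝓝 (∫ z in Ioi (0 : ℝ), wright l (1 - l) z * (2 * v' * z))) := by
    have hwc := continuous_wright hl₁ (1 - l)
    refine tendsto_integral_filter_of_dominated_convergence
      (fun z => ‖z ^ 1 * wright l (1 - l) z‖ * (2 * L)) ?_ ?_
      ((integrableOn_mul_wright hl₀.le hl₁ (1 - l) 1).norm.mul_const _) ?_
    · exact Eventually.of_forall fun s =>
        Continuous.aestronglyMeasurable (by fun_prop)
    · filter_upwards [self_mem_nhdsWithin] with s hs
      have hs : 0 < s := hs
      filter_upwards [ae_restrict_mem measurableSet_Ioi] with z hz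
      have hz : 0 < z := hz
      have h1 := h.abs_sub_le_mul x (mul_nonneg hs.le hz.le)
      rw [norm_mul, norm_mul, norm_div, pow_one, Real.norm_of_nonneg hs.le,
        Real.norm_of_nonneg hz.le, Real.norm_eq_abs (v _ - v _), mul_comm z, mul_assoc]
      refine mul_le_mul_of_nonneg_left ?_ (norm_nonneg _)
      rw [div_le_iff₀ hs]
      linarith
    · refine Eventually.of_forall fun z => Tendsto.const_mul _ ?_
      have hd : HasDerivAt (fun s : ℝ => v (x + s * z) - v (x - s * z)) (2 * v' * z) 0 := by
        have h1 : HasDerivAt (fun s : ℝ => x + s * z) z 0 := by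
          simpa using ((hasDerivAt_id (0 : ℝ)).mul_const z).const_add x
        have h2 : HasDerivAt (fun s : ℝ => x - s * z) (-z) 0 := by
          simpa using ((hasDerivAt_id (0 : ℝ)).mul_const z).const_sub x
        have h3 := HasDerivAt.comp (0 : ℝ) (h₂ := v) (h₂' := v') (by simpa using hv') h1
        have h4 := HasDerivAt.comp (0 : ℝ) (h₂ := v) (h₂' := v') (by simpa using hv') h2
        refine (h3.sub h4).congr_deriv ?_
        ring
      have h5 := hasDerivAt_iff_tendsto_slope_zero.1 hd
      refine (h5.mono_left (nhdsWithin_mono _ fun s hs => ne_of_gt hs)).congr fun s => ?_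
      simp [div_eq_inv_mul]
  have hval : ∫ z in Ioi (0 : ℝ), wright l (1 - l) z * (2 * v' * z) = 2 * v' := by
    have := integral_mul_wright_one_sub hl₀.le hl₁
    calc _ = ∫ z in Ioi (0 : ℝ), 2 * v' * (z * wright l (1 - l) z) := by
          refine integral_congr_ae (Eventually.of_forall fun z => ?_)
          simp only
          ring
      _ = _ := by rw [integral_const_mul, this, mul_one]
  rw [hval] at hmain
  have h6 := (hmain.comp hs).const_mul (1 / 2)
  rw [show 1 / 2 * (2 * v') = v' by ring] at h6
  refine h6.congr' ?_
  filter_upwards [self_mem_nhdsWithin] with y hy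
  have hy : 0 < y := hy
  have hs0 : 0 < y ^ (-(l / 2)) := by positivity
  simp only [Function.comp_apply]
  congr 1
  have h7 := integral_comp_mul_left_Ioi (fun z => y ^ (-(l / 2)) * (wright l (1 - l) z *
    ((v (x + y ^ (l / 2) * z) - v (x - y ^ (l / 2) * z)) / y ^ (l / 2)))) 0 hs0
  rw [mul_zero, integral_const_mul (μ := volume.restrict (Ioi 0)) (y ^ (-(l / 2)))
    (fun z => wright l (1 - l) z *
      ((v (x + y ^ (l / 2) * z) - v (x - y ^ (l / 2) * z)) / y ^ (l / 2))),
    smul_eq_mul, inv_mul_cancel_left₀ hs0.ne'] at h7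
  rw [← h7, kint]
  refine setIntegral_congr_fun measurableSet_Ioi fun ξ _ => ?_
  have e1 : y ^ (l / 2) * (y ^ (-(l / 2)) * ξ) = ξ := by
    rw [← mul_assoc, ← Real.rpow_add hy, add_neg_cancel, Real.rpow_zero, one_mul]
  have e2 : y ^ (1 - l - 1) = y ^ (-(l / 2)) * (y ^ (l / 2))⁻¹ := by
    rw [← Real.rpow_neg hy.le, ← Real.rpow_add hy]
    ring_nf
  rw [e1, fker_of_pos hy, e2, mul_comm ξ]
  ring

lemma intervalIntegrable_rpow_mul_rpow (hl₀ : 0 < l) (hl₁ : l < 1) {y : ℝ} (hy : 0 < y) :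
    IntervalIntegrable (fun t : ℝ => (y - t) ^ (-l) * t ^ (l - 1)) volume 0 y := by
  have h1 : IntervalIntegrable (fun t : ℝ => (y - t) ^ (-l)) volume (y / 2) y := by
    have := (intervalIntegral.intervalIntegrable_rpow' (a := y / 2) (b := 0) (r := -l)
      (by linarith)).comp_sub_left y
    rwa [sub_zero, sub_half] at this
  have h2 : IntervalIntegrable (fun t : ℝ => t ^ (l - 1)) volume 0 (y / 2) :=
    intervalIntegral.intervalIntegrable_rpow' (by linarith)
  refine IntervalIntegrable.trans (b := y / 2) (h2.continuousOn_mul ?_) (h1.mul_continuousOn ?_)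
  · refine ContinuousOn.rpow_const (by fun_prop) fun t ht => Or.inl ?_
    rw [uIcc_of_le (by linarith)] at ht
    linarith [ht.2]
  · refine ContinuousOn.rpow_const (by fun_prop) fun t ht => Or.inl ?_
    rw [uIcc_of_le (by linarith)] at ht
    linarith [ht.1]

/-- Since |v(x + ξ) - v(x - ξ)| ≤ 2Lξ, the inner integral at time t is O(t^(l-1)), and (y - t)^(-l)
t^(l-1) is integrable on (0, y). This justifies taking the Caputo integral under the potential. -/
lemma integrable_caputo_initPot (h : InitData T v V L) (hl₀ : 0 < l) (hl₁ : l < 1) (x : ℝ) {y : ℝ}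
    (hy : 0 < y) :
    Integrable (Function.uncurry fun t ξ =>
        (y - t) ^ (-l) * (fker l 0 ξ t * (v (x + ξ) - v (x - ξ))))
      ((volume.restrict (Ioc 0 y)).prod (volume.restrict (Ioi 0))) := by
  have hv := h.continuous
  have hGc : Continuous fun ξ => v (x + ξ) - v (x - ξ) := by fun_prop
  obtain ⟨C, hC, hb⟩ := exists_integral_abs_fker_mul_le hl₀ hl₁.le 0
  rw [integrable_prod_iff]
  · constructor
    · filter_upwards [ae_restrict_mem measurableSet_Ioc] with t ht
      exact (integrableOn_fker_mul_of_bdd hl₀ hl₁.le 0 ht.1 hGc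
        (fun ξ => h.abs_sub_le x ξ)).const_mul ((y - t) ^ (-l))
    · have hdom : IntegrableOn (fun t : ℝ => C * (2 * L) * ((y - t) ^ (-l) * t ^ (l - 1)))
          (Ioc 0 y) :=
        ((intervalIntegrable_iff_integrableOn_Ioc_of_le hy.le).1
          (intervalIntegrable_rpow_mul_rpow hl₀ hl₁ hy)).const_mul _
      refine Integrable.mono' hdom ?_ ?_
      · refine StronglyMeasurable.aestronglyMeasurable (StronglyMeasurable.integral_prod_right ?_)
        refine (Measurable.stronglyMeasurable ?_).norm
        refine Measurable.mul ((measurable_const.sub measurable_fst).pow_const _) ?_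
        exact ((measurable_fker hl₁.le 0).comp measurable_swap).mul
          (hGc.measurable.comp measurable_snd)
      · filter_upwards [ae_restrict_mem measurableSet_Ioc] with t ht
        have h1 := hb _ 0 (2 * L) t hGc ht.1 (fun ξ hξ => h.abs_sub_le_mul x hξ)
        have h0 : 0 ≤ y - t := by linarith [ht.2]
        rw [Real.norm_of_nonneg (integral_nonneg fun _ => norm_nonneg _)]
        simp only [Function.uncurry_def, norm_mul ((y - t) ^ (-l)), integral_const_mul]
        rw [Real.norm_of_nonneg (Real.rpow_nonneg h0 _)]
        calc _ ≤ (y - t) ^ (-l) * (C * t ^ (0 - 1 : ℝ) * (0 * t ^ (l / 2) + 2 * L * t ^ l)) :=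
              mul_le_mul_of_nonneg_left h1 (Real.rpow_nonneg h0 _)
          _ = C * (2 * L) * ((y - t) ^ (-l) * (t ^ (0 - 1 : ℝ) * t ^ l)) := by ring
          _ = _ := by
            rw [← Real.rpow_add ht.1]
            ring_nf
  · refine Measurable.aestronglyMeasurable ?_
    refine Measurable.mul ((measurable_const.sub measurable_fst).pow_const _) ?_
    exact ((measurable_fker hl₁.le 0).comp measurable_swap).mul
      (hGc.measurable.comp measurable_snd)

lemma intervalIntegrable_caputo_initPot (h : InitData T v V L) (hl₀ : 0 < l) (hl₁ : l < 1) (x : ℝ)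
    {y : ℝ} (hy : 0 < y) :
    IntervalIntegrable (fun t => (y - t) ^ (-l) *
      (1 / 2 * kint l 0 (fun ξ => v (x + ξ) - v (x - ξ)) t)) volume 0 y := by
  rw [intervalIntegrable_iff_integrableOn_Ioc_of_le hy.le]
  refine ((h.integrable_caputo_initPot hl₀ hl₁ x hy).integral_prod_left.const_mul (1 / 2)).congr
    (Eventually.of_forall fun t => ?_)
  simp only [Function.uncurry_def, integral_const_mul, kint]
  ring

lemma integral_caputo_initPot (h : InitData T v V L) (hl₀ : 0 < l) (hl₁ : l < 1) (x : ℝ)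
    {y : ℝ} (hy : 0 < y) :
    ∫ t in (0 : ℝ)..y, (y - t) ^ (-l) * (1 / 2 * kint l 0 (fun ξ => v (x + ξ) - v (x - ξ)) t) =
      Real.Gamma (1 - l) * (1 / 2 * kint l (1 - l) (fun ξ => v (x + ξ) - v (x - ξ)) y) := by
  have hswap := integral_integral_swap (h.integrable_caputo_initPot hl₀ hl₁ x hy)
  rw [intervalIntegral.integral_of_le hy.le]
  calc _ = 1 / 2 * ∫ t in Ioc 0 y, ∫ ξ in Ioi (0 : ℝ),
        (y - t) ^ (-l) * (fker l 0 ξ t * (v (x + ξ) - v (x - ξ))) := by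
        rw [← integral_const_mul]
        refine integral_congr_ae (Eventually.of_forall fun t => ?_)
        simp only [integral_const_mul, kint]
        ring
    _ = 1 / 2 * ∫ ξ in Ioi (0 : ℝ), Real.Gamma (1 - l) *
        (fker l (1 - l) ξ y * (v (x + ξ) - v (x - ξ))) := by
        rw [hswap]
        congr 1
        refine setIntegral_congr_fun measurableSet_Ioi fun ξ hξ => ?_
        have e1 := integral_rpow_mul_fker hl₀ hl₁ 0 (c := 1 - l) (by linarith) hξ hy
        rw [show (1 - l - 1 : ℝ) = -l by ring, zero_add,
          intervalIntegral.integral_of_le hy.le] at e1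
        simp only [← mul_assoc]
        rw [integral_mul_const, e1]
    _ = _ := by
        rw [integral_const_mul, kint]
        ring

end InitData

/-! ### Even reflection of the initial datum -/

/-- The distance to the nearest even integer. -/
def tri (x : ℝ) : ℝ := Metric.infDist x (range fun n : ℤ => (2 * n : ℝ))

lemma tri_le (x : ℝ) (n : ℤ) : tri x ≤ |x - 2 * n| := by
  rw [← Real.dist_eq]
  exact Metric.infDist_le_dist_of_mem (mem_range_self n)

lemma le_tri {x d : ℝ} (h : ∀ n : ℤ, d ≤ |x - 2 * n|) : d ≤ tri x := by
  refine (Metric.le_infDist (range_nonempty _)).2 ?_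
  rintro _ ⟨n, rfl⟩
  rw [Real.dist_eq]
  exact h n

lemma abs_tri_sub_le (x y : ℝ) : |tri x - tri y| ≤ |x - y| := by
  have := (Metric.lipschitz_infDist_pt (range fun n : ℤ => (2 * n : ℝ))).dist_le_mul x y
  simpa [Real.dist_eq, tri] using this

lemma tri_of_mem {x : ℝ} (hx : x ∈ Icc (0 : ℝ) 1) : tri x = x := by
  refine le_antisymm ?_ (le_tri fun n => ?_)
  · have := tri_le x 0
    simpa [abs_of_nonneg hx.1] using this
  · rcases le_or_gt n 0 with hn | hn
    · have : (n : ℝ) ≤ 0 := by exact_mod_cast hn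
      exact le_trans (by linarith) (le_abs_self _)
    · have : (1 : ℝ) ≤ n := by exact_mod_cast hn
      exact le_trans (by linarith [hx.2]) (neg_le_abs _)

lemma tri_neg (x : ℝ) : tri (-x) = tri x := by
  have key : ∀ x, tri (-x) ≤ tri x := fun x => le_tri fun n => by
    have := tri_le (-x) (-n)
    rw [← abs_neg] at this
    push_cast at this
    rwa [show -(-x - 2 * -(n : ℝ)) = x - 2 * n by ring] at this
  refine le_antisymm (key x) ?_
  have := key (-x)
  rwa [neg_neg] at this

lemma tri_one_add (s : ℝ) : tri (1 + s) = tri (1 - s) := by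
  have key : ∀ s, tri (1 + s) ≤ tri (1 - s) := fun s => le_tri fun n => by
    have := tri_le (1 + s) (1 - n)
    rw [← abs_neg] at this
    push_cast at this
    rwa [show -(1 + s - 2 * (1 - (n : ℝ))) = 1 - s - 2 * n by ring] at this
  refine le_antisymm (key s) ?_
  have := key (-s)
  rwa [sub_neg_eq_add, ← sub_eq_add_neg] at this

lemma abs_clamp_sub_le (x y : ℝ) : |clamp x - clamp y| ≤ |x - y| := by
  unfold clamp
  calc _ ≤ |min x 1 - min y 1| := by
        simpa [max_comm] using abs_max_sub_max_le_abs (min x 1) (min y 1) 0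
    _ ≤ _ := by simpa using abs_min_sub_min_le_max x 1 y 1

/-- A function of class `C²` agrees on `[0, 1]` with an initial datum whose derivative is even
about both end points. -/
lemma exists_initData {τ : ℝ → ℝ} (hτ : ContDiff ℝ 2 τ) :
    ∃ (T v : ℝ → ℝ) (V L : ℝ), InitData T v V L ∧ (∀ x ∈ Icc (0 : ℝ) 1, T x = τ x) ∧
      (∀ s, v (0 + s) = v (0 - s)) ∧ (∀ s, v (1 + s) = v (1 - s)) ∧
      ∀ x ∈ Ioo (0 : ℝ) 1, HasDerivAt v (deriv (deriv τ) x) x := by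
  have hτ' : ContDiff ℝ 1 (deriv τ) := by
    have : ContDiff ℝ (1 + 1) τ := by exact_mod_cast hτ
    exact (contDiff_succ_iff_deriv.1 this).2.2
  have hd : ∀ x, HasDerivAt (deriv τ) (deriv (deriv τ) x) x := fun x =>
    (hτ'.differentiable one_ne_zero x).hasDerivAt
  obtain ⟨V, hV⟩ := exists_bound_comp_clamp hτ'.continuous
  obtain ⟨L, hL⟩ := (isCompact_Icc (a := (0 : ℝ)) (b := 1)).exists_bound_of_continuousOn
    (hτ'.continuous_deriv le_rfl).continuousOn
  have hL0 : 0 ≤ L := (norm_nonneg _).trans (hL 0 (by simp))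
  -- `tri` folds the line onto the unit interval symmetrically about 0 and 1. Reflection preserves
  -- the Lipschitz property of the derivative but in general not C¹, hence the form of `InitData`.
  -- The clamp makes membership in [0, 1] immediate.
  set v : ℝ → ℝ := fun x => deriv τ (clamp (tri x)) with hv
  have hlip : ∀ x y, |v x - v y| ≤ L * |x - y| := by
    intro x y
    have h1 := Convex.norm_image_sub_le_of_norm_hasDerivWithin_le (f := deriv τ)
      (fun x _ => (hd x).hasDerivWithinAt) hL (convex_Icc 0 1) (clamp_mem (tri y))
      (clamp_mem (tri x))
    refine h1.trans (mul_le_mul_of_nonneg_left ?_ hL0)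
    exact (abs_clamp_sub_le _ _).trans (abs_tri_sub_le x y)
  have htri : Continuous tri := Metric.continuous_infDist_pt _
  have hvc : Continuous v := hτ'.continuous.comp (continuous_clamp.comp htri)
  have hvI : ∀ x ∈ Icc (0 : ℝ) 1, v x = deriv τ x := by
    intro x hx
    simp only [hv]
    rw [tri_of_mem hx, clamp_of_mem hx]
  refine ⟨fun x => τ 0 + ∫ t in (0 : ℝ)..x, v t, v, V, L, ⟨fun x => ?_, fun x => hV _, hlip⟩,
    fun x hx => ?_, fun s => ?_, fun s => ?_, fun x hx => ?_⟩
  · exact ((hvc.integral_hasStrictDerivAt 0 x).hasDerivAt).const_add _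
  · have : ∫ t in (0 : ℝ)..x, v t = ∫ t in (0 : ℝ)..x, deriv τ t :=
      intervalIntegral.integral_congr fun t ht => by
        rw [uIcc_of_le hx.1] at ht
        exact hvI t ⟨ht.1, ht.2.trans hx.2⟩
    simp only
    rw [this, intervalIntegral.integral_deriv_eq_sub
      (fun t _ => hτ.differentiable two_ne_zero t) (hτ'.continuous.intervalIntegrable _ _)]
    ring
  · simp only [hv, zero_add, zero_sub, tri_neg]
  · simp only [hv, tri_one_add]
  · refine (hd x).congr_of_eventuallyEq ?_
    filter_upwards [Ioo_mem_nhds hx.1 hx.2] with t ht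
    exact hvI t ⟨ht.1.le, ht.2.le⟩

/-! ### The diffusion problem in the square -/

/-- The `y`-derivative of the layer potential, up to the boundary. -/
def layerDy (l : ℝ) (ρ : ℝ → ℝ) (x y : ℝ) : ℝ := if x = 0 then ρ y else layer l 0 ρ x y

section Layer

variable {l : ℝ} {ρ : ℝ → ℝ} {R : ℝ}

lemma hasDerivAt_layer_one_right (hl₀ : 0 < l) (hl₁ : l ≤ 1) (hρ : Continuous ρ)
    (hR : ∀ t, |ρ t| ≤ R) {x y : ℝ} (hx : 0 ≤ x) (hy : 0 < y) :
    HasDerivAt (fun y => layer l 1 ρ x y) (layerDy l ρ x y) y := by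
  rcases hx.lt_or_eq with hx | rfl
  · have := hasDerivAt_layer_right hl₀ hl₁ 1 hρ hR hx hy
    rw [sub_self] at this
    rwa [layerDy, if_neg hx.ne']
  · rw [layerDy, if_pos rfl]
    refine ((hρ.integral_hasStrictDerivAt 0 y).hasDerivAt).congr_of_eventuallyEq ?_
    filter_upwards [Ioi_mem_nhds hy] with t ht
    exact layer_one_zero l ρ (le_of_lt ht)

/-- At a point of x = 0 the approach from x > 0 is the trace property `tendsto_layer_zero`, and the
approach along x = 0 is continuity of ρ. -/
lemma continuousOn_layerDy (hl₀ : 0 < l) (hl₁ : l ≤ 1) (hρ : Continuous ρ)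
    (hR : ∀ t, |ρ t| ≤ R) :
    ContinuousOn (fun p : ℝ × ℝ => layerDy l ρ p.1 p.2) (Ici 0 ×ˢ Ioi 0) := by
  rintro ⟨x, y⟩ ⟨hx, hy⟩
  have hx : 0 ≤ x := hx
  have hy : 0 < y := hy
  rcases hx.lt_or_eq with hx | rfl
  · refine ContinuousAt.continuousWithinAt ?_
    have hmem : (Ioi (0 : ℝ) ×ˢ (univ : Set ℝ)) ∈ 𝓝 (x, y) :=
      (isOpen_Ioi.prod isOpen_univ).mem_nhds ⟨hx, mem_univ _⟩
    refine ((continuousOn_layer hl₀ hl₁ 0 hρ hR).continuousAt hmem).congr ?_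
    filter_upwards [hmem] with p hp
    rw [layerDy, if_neg (ne_of_gt hp.1)]
  · have h1 : ContinuousWithinAt (fun p : ℝ × ℝ => layerDy l ρ p.1 p.2) (Ioi 0 ×ˢ univ) (0, y) := by
      rw [ContinuousWithinAt]
      simp only [layerDy, if_true]
      refine (tendsto_layer_zero hl₀ hl₁ hρ hR hy).congr' ?_
      filter_upwards [self_mem_nhdsWithin] with p hp
      rw [if_neg (ne_of_gt hp.1)]
    have h2 : ContinuousWithinAt (fun p : ℝ × ℝ => layerDy l ρ p.1 p.2) ({0} ×ˢ univ) (0, y) := by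
      refine ContinuousWithinAt.congr (f := fun p => ρ p.2)
        (hρ.comp continuous_snd).continuousWithinAt (fun p hp => ?_) ?_
      · rw [layerDy, if_pos (show p.1 = 0 from hp.1)]
      · rw [layerDy, if_pos rfl]
    refine (h1.union h2).mono ?_
    rintro ⟨a, b⟩ ⟨ha, -⟩
    rcases (show 0 ≤ a from ha).lt_or_eq with ha | ha
    · exact Or.inl ⟨ha, mem_univ _⟩
    · exact Or.inr ⟨ha.symm, mem_univ _⟩

lemma continuous_layer_right (hl₀ : 0 < l) (hl₁ : l ≤ 1) (a : ℝ) (hρ : Continuous ρ)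
    (hR : ∀ t, |ρ t| ≤ R) {x : ℝ} (hx : 0 < x) : Continuous (layer l a ρ x) :=
  (continuousOn_layer hl₀ hl₁ a hρ hR).comp_continuous (f := fun y => (x, y)) (by fun_prop)
    fun _ => ⟨hx, mem_univ _⟩

lemma contDiffOn_layer_right (hl₀ : 0 < l) (hl₁ : l ≤ 1) (a : ℝ) (hρ : Continuous ρ)
    (hR : ∀ t, |ρ t| ≤ R) {x : ℝ} (hx : 0 < x) : ContDiffOn ℝ 1 (layer l a ρ x) (Ioo 0 1) := by
  refine contDiffOn_one_of_hasDerivAt isOpen_Ioo (f' := layer l (a - 1) ρ x) (fun y hy => ?_)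
    (continuous_layer_right hl₀ hl₁ (a - 1) hρ hR hx).continuousOn
  exact hasDerivAt_layer_right hl₀ hl₁ a hρ hR hx hy.1

end Layer

/-- `c` is the Caputo derivative of order `l` of `g` at `y`, where `g` is differentiable on
`(0, y]`. -/
def HasCaputo (l : ℝ) (g : ℝ → ℝ) (y c : ℝ) : Prop :=
  ∃ g' : ℝ → ℝ, (∀ t ∈ Ioc 0 y, HasDerivAt g (g' t) t) ∧
    (l < 1 → IntervalIntegrable (fun t => (y - t) ^ (-l) * g' t) volume 0 y ∧
      ∫ t in (0 : ℝ)..y, (y - t) ^ (-l) * g' t = Real.Gamma (1 - l) * c) ∧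
    (l = 1 → g' y = c)

namespace HasCaputo

variable {l : ℝ} {g h : ℝ → ℝ} {y c d : ℝ}

lemma add (hg : HasCaputo l g y c) (hh : HasCaputo l h y d) :
    HasCaputo l (fun t => g t + h t) y (c + d) := by
  obtain ⟨g', hg1, hg2, hg3⟩ := hg
  obtain ⟨h', hh1, hh2, hh3⟩ := hh
  refine ⟨fun t => g' t + h' t, fun t ht => (hg1 t ht).add (hh1 t ht), fun hl => ?_,
    fun hl => by simp only [hg3 hl, hh3 hl]⟩
  simp only [mul_add]
  refine ⟨(hg2 hl).1.add (hh2 hl).1, ?_⟩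
  rw [intervalIntegral.integral_add (hg2 hl).1 (hh2 hl).1, (hg2 hl).2, (hh2 hl).2]

lemma congr (hg : HasCaputo l g y c) {Y : ℝ} (hY : y < Y) (he : ∀ t ∈ Ioo 0 Y, h t = g t) :
    HasCaputo l h y c := by
  obtain ⟨g', hg1, hg2, hg3⟩ := hg
  refine ⟨g', fun t ht => (hg1 t ht).congr_of_eventuallyEq ?_, hg2, hg3⟩
  filter_upwards [Ioo_mem_nhds ht.1 (ht.2.trans_lt hY)] with s hs using he s hs

lemma caputoExists (hg : HasCaputo l g y c) (hl₁ : l ≤ 1) (hy : 0 < y) : CaputoExists l g y := by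
  obtain ⟨g', hg1, hg2, hg3⟩ := hg
  rw [CaputoExists]
  split_ifs with h1
  · exact (hg1 y ⟨hy, le_rfl⟩).differentiableAt
  · have hl := lt_of_le_of_ne hl₁ h1
    refine ⟨fun t ht => (hg1 t ⟨ht.1, ht.2.le⟩).differentiableAt, ?_⟩
    refine (hg2 hl).1.congr fun t ht => ?_
    rw [uIoc_of_le hy.le] at ht
    rw [(hg1 t ht).deriv]

lemma caputo_eq (hg : HasCaputo l g y c) (hl₁ : l ≤ 1) (hy : 0 < y) : caputo l g y = c := by
  obtain ⟨g', hg1, hg2, hg3⟩ := hg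
  rw [caputo]
  split_ifs with h1
  · rw [(hg1 y ⟨hy, le_rfl⟩).deriv, hg3 h1]
  · have hl := lt_of_le_of_ne hl₁ h1
    have : ∫ t in (0 : ℝ)..y, (y - t) ^ (-l) * deriv g t = Real.Gamma (1 - l) * c := by
      rw [← (hg2 hl).2]
      refine intervalIntegral.integral_congr_ae (Eventually.of_forall fun t ht => ?_)
      rw [uIoc_of_le hy.le] at ht
      rw [(hg1 t ht).deriv]
    have hG := Real.Gamma_pos_of_pos (show 0 < 1 - l by linarith)
    rw [this]
    field_simp

end HasCaputo

lemma hasCaputo_layer {l : ℝ} {ρ : ℝ → ℝ} {R : ℝ} (hl₀ : 0 < l) (hl₁ : l ≤ 1) (hρ : Continuous ρ)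
    (hR : ∀ t, |ρ t| ≤ R) {x y : ℝ} (hx : 0 < x) (hy : 0 < y) :
    HasCaputo l (layer l 1 ρ x) y (layer l (1 - l) ρ x y) := by
  refine ⟨layer l 0 ρ x, fun t ht => ?_, fun hl => ⟨?_, integral_rpow_mul_layer hl₀ hl hρ hR hx hy⟩,
    fun hl => by rw [hl, sub_self]⟩
  · have := hasDerivAt_layer_right hl₀ hl₁ 1 hρ hR hx ht.1
    rwa [sub_self] at this
  · refine IntervalIntegrable.mul_continuousOn ?_
      (continuous_layer_right hl₀ hl₁ 0 hρ hR hx).continuousOn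
    have := (intervalIntegral.intervalIntegrable_rpow' (a := y) (b := 0) (r := -l)
      (by linarith)).comp_sub_left y
    rwa [sub_self, sub_zero] at this

lemma hasCaputo_initPot {l : ℝ} {T v : ℝ → ℝ} {V L : ℝ} (h : InitData T v V L) (hl₀ : 0 < l)
    (hl₁ : l ≤ 1) (x : ℝ) {y : ℝ} (hy : 0 < y) :
    HasCaputo l (initPot l T v x) y
      (1 / 2 * kint l (1 - l) (fun ξ => v (x + ξ) - v (x - ξ)) y) :=
  ⟨fun t => 1 / 2 * kint l 0 (fun ξ => v (x + ξ) - v (x - ξ)) t,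
    fun _ ht => h.hasDerivAt_initPot_right hl₀ hl₁ x ht.1,
    fun hl => ⟨h.intervalIntegrable_caputo_initPot hl₀ hl x hy,
      h.integral_caputo_initPot hl₀ hl x hy⟩, fun hl => by rw [hl, sub_self]⟩

/-- The densities of the two layer potentials solve a system of Abel-type Volterra equations. -/
lemma exists_densities {l : ℝ} (hl₀ : 0 < l) (hl₁ : l ≤ 1) {r₁ r₂ : ℝ → ℝ}
    (hr₁ : Continuous r₁) (hr₂ : Continuous r₂) (hr₁' : ContDiffOn ℝ 1 r₁ (Ioo 0 1))
    (hr₂' : ContDiffOn ℝ 1 r₂ (Ioo 0 1)) :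
    ∃ (ρ₁ ρ₂ : ℝ → ℝ) (R : ℝ), Continuous ρ₁ ∧ Continuous ρ₂ ∧ (∀ t, |ρ₁ t| ≤ R) ∧
      (∀ t, |ρ₂ t| ≤ R) ∧ ContDiffOn ℝ 1 ρ₁ (Ioo 0 1) ∧ ContDiffOn ℝ 1 ρ₂ (Ioo 0 1) ∧
      ∀ y ∈ Ioo (0 : ℝ) 1,
        (ρ₁ y + layer l (1 - l / 2) ρ₁ 0 y + (layer l 0 ρ₂ 1 y - layer l (1 - l / 2) ρ₂ 1 y) =
          r₁ y) ∧
        (ρ₂ y + layer l (1 - l / 2) ρ₂ 0 y + (layer l 0 ρ₁ 1 y - layer l (1 - l / 2) ρ₁ 1 y) =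
          r₂ y) := by
  set κ := wright l (1 - l / 2) 0 with hκ
  -- The interaction of the two sides takes place at distance one, where the kernels are smooth in
  -- time and vanish at t = 0. Only the self-interaction κ t^(-l/2) is singular.
  set c : ℝ → ℝ := fun t => fker l 0 1 t - fker l (1 - l / 2) 1 t with hc
  set c' : ℝ → ℝ := fun t => fker l (0 - 1) 1 t - fker l (1 - l / 2 - 1) 1 t with hc'
  have hcd : ∀ t, HasDerivAt c (c' t) t := fun t =>
    (hasDerivAt_fker_right hl₀ hl₁ 0 one_pos t).sub (hasDerivAt_fker_right hl₀ hl₁ _ one_pos t)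
  have hc'c : Continuous c' :=
    (continuous_fker_right hl₀ hl₁ _ one_pos).sub (continuous_fker_right hl₀ hl₁ _ one_pos)
  have hcc : Continuous c := continuous_iff_continuousAt.2 fun t => (hcd t).continuousAt
  have hc0 : c 0 = 0 := by simp [hc, fker_of_nonpos le_rfl]
  have hb1 : l / 2 < 1 := by linarith
  have hki : ∀ x y, IntervalIntegrable (fun t : ℝ => κ * t ^ (-(l / 2))) volume x y :=
    fun x y => (intervalIntegrable_rpow_neg hb1 x y).const_mul κ
  -- The system is symmetric in the two densities, so their sum and difference satisfy scalar
  -- equations, with ε = 1 and ε = -1 in front of the interaction term.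
  have solve : ∀ (ε : ℝ) (r : ℝ → ℝ), Continuous r → ContDiffOn ℝ 1 r (Ioo 0 1) →
      ∃ ρ : ℝ → ℝ, Continuous ρ ∧ (∃ R, ∀ t, |ρ t| ≤ R) ∧ ContDiffOn ℝ 1 ρ (Ioo 0 1) ∧
        ∀ y ∈ Icc (0 : ℝ) 1, ρ y + conv (fun t => κ * t ^ (-(l / 2))) ρ y + ε * conv c ρ y =
          r y := by
    intro ε r hr hr'
    have hεc : Continuous fun t => ε * c t := continuous_const.mul hcc
    obtain ⟨ρ, hρ, ⟨R, hR⟩, heq⟩ := exists_volterra_solution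
      (K := fun t => κ * t ^ (-(l / 2)) + ε * c t)
      (fun a b => (hki a b).add (hεc.intervalIntegrable a b)) hr
    refine ⟨ρ, hρ, ⟨R, hR⟩, contDiffOn_of_volterra (b := l / 2) (by linarith) (by linarith)
      (fun t => (hcd t).const_mul ε) (continuous_const.mul hc'c) (by rw [hc0, mul_zero])
      hr hr' hρ hR heq, fun y hy => ?_⟩
    rw [← heq y hy, conv_add_left (hki _ _) (hεc.intervalIntegrable _ _) hρ,
      conv_const_mul_left ε, add_assoc]
  obtain ⟨s, hs, ⟨S, hS⟩, hs', hseq⟩ := solve 1 (fun y => r₁ y + r₂ y) (hr₁.add hr₂) (hr₁'.add hr₂')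
  obtain ⟨d, hd, ⟨D, hD⟩, hd', hdeq⟩ := solve (-1) (fun y => r₁ y - r₂ y) (hr₁.sub hr₂)
    (hr₁'.sub hr₂')
  have hρ₁ : Continuous fun t => 1 / 2 * s t + 1 / 2 * d t := by fun_prop
  have hρ₂ : Continuous fun t => 1 / 2 * s t - 1 / 2 * d t := by fun_prop
  have hs2 : Continuous fun t => 1 / 2 * s t := by fun_prop
  have hd2 : Continuous fun t => 1 / 2 * d t := by fun_prop
  refine ⟨fun t => 1 / 2 * s t + 1 / 2 * d t, fun t => 1 / 2 * s t - 1 / 2 * d t, S + D, hρ₁, hρ₂,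
    fun t => ?_, fun t => ?_, (contDiffOn_const.mul hs').add (contDiffOn_const.mul hd'),
    (contDiffOn_const.mul hs').sub (contDiffOn_const.mul hd'), fun y hy => ?_⟩
  · have h1 := abs_le.1 (hS t)
    have h2 := abs_le.1 (hD t)
    rw [abs_le]
    constructor <;> linarith [h1.1, h1.2, h2.1, h2.2]
  · have h1 := abs_le.1 (hS t)
    have h2 := abs_le.1 (hD t)
    rw [abs_le]
    constructor <;> linarith [h1.1, h1.2, h2.1, h2.2]
  have e1 : ∀ ρ : ℝ → ℝ, layer l (1 - l / 2) ρ 0 y = conv (fun t => κ * t ^ (-(l / 2))) ρ y := by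
    intro ρ
    change conv (fker l (1 - l / 2) 0) ρ y = _
    refine conv_congr hy.1.le (fun t ht => ?_) fun _ _ => rfl
    rw [fker_of_pos ht.1, zero_mul, hκ, show 1 - l / 2 - 1 = -(l / 2) by ring, mul_comm]
  have e2 : ∀ ρ : ℝ → ℝ, Continuous ρ →
      layer l 0 ρ 1 y - layer l (1 - l / 2) ρ 1 y = conv c ρ y := by
    intro ρ hρ
    rw [conv_comm, hc, conv_sub_right (hρ.intervalIntegrable _ _)
      (continuous_fker_right hl₀ hl₁ 0 one_pos) (continuous_fker_right hl₀ hl₁ _ one_pos),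
      conv_comm, conv_comm ρ]
    rfl
  have h1 := hseq y ⟨hy.1.le, hy.2.le⟩
  have h2 := hdeq y ⟨hy.1.le, hy.2.le⟩
  rw [e1, e1, e2 _ hρ₁, e2 _ hρ₂, conv_add_right (hki _ _) hs2 hd2, conv_sub_right (hki _ _) hs2 hd2,
    conv_add_right (hcc.intervalIntegrable _ _) hs2 hd2,
    conv_sub_right (hcc.intervalIntegrable _ _) hs2 hd2]
  simp only [conv_const_mul_right]
  constructor <;> linarith

/-- A solution of the fractional diffusion equation in the square with initial value `τ`, together
with its derivatives. -/
structure SquareSolution (l : ℝ) (τ p q : ℝ → ℝ) (U Ux Uy Uxx : ℝ × ℝ → ℝ) : Prop where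
  cont : ContinuousOn U (Icc 0 1 ×ˢ Icc 0 1)
  init : ∀ x ∈ Icc (0 : ℝ) 1, U (x, 0) = τ x
  cont_x : ContinuousOn Ux (Icc 0 1 ×ˢ Ioo 0 1)
  cont_y : ContinuousOn Uy (Icc 0 1 ×ˢ Ioo 0 1)
  cont_xx : ContinuousOn Uxx (Ioo 0 1 ×ˢ Ioo 0 1)
  deriv_x : ∀ x ∈ Ioo (0 : ℝ) 1, ∀ y ∈ Ioo (0 : ℝ) 1, HasDerivAt (fun s => U (s, y)) (Ux (x, y)) x
  deriv_xx : ∀ x ∈ Ioo (0 : ℝ) 1, ∀ y ∈ Ioo (0 : ℝ) 1,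
    HasDerivAt (fun s => Ux (s, y)) (Uxx (x, y)) x
  deriv_y : ∀ x ∈ Icc (0 : ℝ) 1, ∀ y ∈ Ioo (0 : ℝ) 1, HasDerivAt (fun t => U (x, t)) (Uy (x, y)) y
  caputo : ∀ x ∈ Ioo (0 : ℝ) 1, ∀ y ∈ Ioo (0 : ℝ) 1,
    HasCaputo l (fun t => U (x, t)) y (Uxx (x, y))
  tendsto : ∀ x ∈ Ioo (0 : ℝ) 1, Tendsto (fun y => Uxx (x, y)) (𝓝[>] 0) (𝓝 (deriv (deriv τ) x))
  left : ∀ y ∈ Ioo (0 : ℝ) 1, Uy (0, y) - Ux (0, y) = p y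
  right : ∀ y ∈ Ioo (0 : ℝ) 1, Uy (1, y) + Ux (1, y) = q y
  smooth_left : ContDiffOn ℝ 1 (fun y => Uy (0, y)) (Ioo 0 1)
  smooth_right : ContDiffOn ℝ 1 (fun y => Uy (1, y)) (Ioo 0 1)

/-- The x-derivative of the initial potential on a vertical side is continued to y ≤ 0 by its limit
v(x), which makes it admissible as a right-hand side of the Volterra system. -/
lemma exists_trace {l : ℝ} {T v : ℝ → ℝ} {V L : ℝ} (h : InitData T v V L) (hl₀ : 0 < l)
    (hl₁ : l ≤ 1) (x : ℝ) : ∃ S : ℝ → ℝ, Continuous S ∧ ContDiffOn ℝ 1 S (Ioo 0 1) ∧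
      ∀ y, 0 < y → S y = 1 / 2 * kint l (1 - l / 2) (fun ξ => v (x + ξ) + v (x - ξ)) y := by
  set S₀ : ℝ → ℝ := fun y => 1 / 2 * kint l (1 - l / 2) (fun ξ => v (x + ξ) + v (x - ξ)) y with hS₀
  have hv := h.continuous
  have hGc : Continuous fun ξ => v (x + ξ) + v (x - ξ) := by fun_prop
  have hd : ∀ y, 0 < y → HasDerivAt S₀
      (1 / 2 * kint l (1 - l / 2 - 1) (fun ξ => v (x + ξ) + v (x - ξ)) y) y := fun y hy =>
    (hasDerivAt_kint_right hl₀ hl₁ (1 - l / 2) hGc (fun ξ => h.abs_add_le x ξ) hy).const_mul _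
  have heq : ∀ y, 0 < y → (if 0 < y then S₀ y else v x) = S₀ y := fun y hy => if_pos hy
  refine ⟨fun y => if 0 < y then S₀ y else v x, ?_, ?_, heq⟩
  · rw [continuous_iff_continuousAt]
    intro y
    rcases lt_trichotomy y 0 with hy | rfl | hy
    · refine (continuousAt_const (y := v x)).congr ?_
      filter_upwards [Iio_mem_nhds hy] with t ht
      rw [if_neg (not_lt.2 (le_of_lt ht))]
    · rw [continuousAt_iff_continuous_left'_right']
      constructor
      · refine (continuousWithinAt_const (b := v x)).congr (fun t ht => ?_) (by simp)
        rw [if_neg (not_lt.2 (le_of_lt ht))]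
      · rw [ContinuousWithinAt, if_neg (lt_irrefl _)]
        refine (h.tendsto_initPot_deriv hl₀ hl₁ x).congr' ?_
        filter_upwards [self_mem_nhdsWithin] with t ht
        exact (heq t ht).symm
    · refine (hd y hy).continuousAt.congr ?_
      filter_upwards [Ioi_mem_nhds hy] with t ht
      exact (heq t ht).symm
  · refine ContDiffOn.congr (f := S₀) ?_ fun y hy => heq y hy.1
    refine contDiffOn_one_of_hasDerivAt isOpen_Ioo (fun y hy => hd y hy.1) ?_
    refine continuousOn_const.mul ?_
    exact (continuousOn_kint hl₀ hl₁ (1 - l / 2 - 1) h.continuous_add h.abs_add_le).comp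
      (f := fun y => (x, y)) (by fun_prop) fun y hy => ⟨mem_univ _, hy.1⟩

-- The solution is `initPot` plus layers with densities ρ₁ on x = 0 and ρ₂ on x = 1. Because v is
-- even about both ends, the initial potential is constant in time on the vertical sides and enters
-- the side conditions only through its x-derivatives S₀ and S₁. These conditions are then the
-- system of `exists_densities` with right-hand sides p + S₀ and q - S₁.
set_option maxHeartbeats 800000 in
theorem exists_squareSolution {l : ℝ} (hl₀ : 0 < l) (hl₁ : l ≤ 1) {τ p q : ℝ → ℝ}
    (hτ : ContDiff ℝ 2 τ) (hp : Continuous p) (hq : Continuous q)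
    (hp' : ContDiffOn ℝ 1 p (Ioo 0 1)) (hq' : ContDiffOn ℝ 1 q (Ioo 0 1)) :
    ∃ U Ux Uy Uxx : ℝ × ℝ → ℝ, SquareSolution l τ p q U Ux Uy Uxx := by
  obtain ⟨T, v, V, L, hD, hT, hv0, hv1, hv'⟩ := exists_initData hτ
  obtain ⟨S₀, hS₀, hS₀', hS₀e⟩ := exists_trace hD hl₀ hl₁ 0
  obtain ⟨S₁, hS₁, hS₁', hS₁e⟩ := exists_trace hD hl₀ hl₁ 1
  obtain ⟨ρ₁, ρ₂, R, hρ₁, hρ₂, hR₁, hR₂, hρ₁', hρ₂', heq⟩ := exists_densities hl₀ hl₁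
    (hp.add hS₀) (hq.sub hS₁) (hp'.add hS₀') (hq'.sub hS₁')
  have hb : 0 < 1 - l / 2 := by linarith
  have hTc := hD.continuous_primitive
  have hk0 : ∀ (a : ℝ) (y : ℝ), kint l a (fun ξ => v (0 + ξ) - v (0 - ξ)) y = 0 := by
    intro a y
    simp only [kint, hv0, sub_self, mul_zero, integral_zero]
  have hk1 : ∀ (a : ℝ) (y : ℝ), kint l a (fun ξ => v (1 + ξ) - v (1 - ξ)) y = 0 := by
    intro a y
    simp only [kint, hv1, sub_self, mul_zero, integral_zero]
  refine ⟨fun z => initPot l T v z.1 z.2 + layer l 1 ρ₁ z.1 z.2 + layer l 1 ρ₂ (1 - z.1) z.2,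
    fun z => 1 / 2 * kint l (1 - l / 2) (fun ξ => v (z.1 + ξ) + v (z.1 - ξ)) z.2 -
      layer l (1 - l / 2) ρ₁ z.1 z.2 + layer l (1 - l / 2) ρ₂ (1 - z.1) z.2,
    fun z => 1 / 2 * kint l 0 (fun ξ => v (z.1 + ξ) - v (z.1 - ξ)) z.2 +
      layerDy l ρ₁ z.1 z.2 + layerDy l ρ₂ (1 - z.1) z.2,
    fun z => 1 / 2 * kint l (1 - l) (fun ξ => v (z.1 + ξ) - v (z.1 - ξ)) z.2 +
      layer l (1 - l) ρ₁ z.1 z.2 + layer l (1 - l) ρ₂ (1 - z.1) z.2, ?_⟩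
  constructor
  · refine ContinuousOn.add (ContinuousOn.add ?_ ?_) ?_
    · exact (hD.continuousOn_initPot hl₀ hl₁).mono fun z hz => ⟨mem_univ _, hz.2.1⟩
    · exact (continuousOn_layer_of_pos hl₀ hl₁ one_pos hρ₁ hR₁).mono
        fun z hz => ⟨hz.1.1, mem_univ _⟩
    · exact (continuousOn_layer_of_pos hl₀ hl₁ one_pos hρ₂ hR₂).comp
        (f := fun z : ℝ × ℝ => (1 - z.1, z.2)) (by fun_prop)
        fun z hz => ⟨by simpa using hz.1.2, mem_univ _⟩
  · intro x hx
    simp only [layer_of_nonpos _ _ _ _ le_rfl, initPot, kint, fker_of_nonpos le_rfl, zero_mul,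
      integral_zero, mul_zero, add_zero]
    exact hT x hx
  · refine ContinuousOn.add (ContinuousOn.sub (continuousOn_const.mul ?_) ?_) ?_
    · exact (continuousOn_kint hl₀ hl₁ _ hD.continuous_add hD.abs_add_le).mono
        fun z hz => ⟨mem_univ _, hz.2.1⟩
    · exact (continuousOn_layer_of_pos hl₀ hl₁ hb hρ₁ hR₁).mono
        fun z hz => ⟨hz.1.1, mem_univ _⟩
    · exact (continuousOn_layer_of_pos hl₀ hl₁ hb hρ₂ hR₂).comp
        (f := fun z : ℝ × ℝ => (1 - z.1, z.2)) (by fun_prop)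
        fun z hz => ⟨by simpa using hz.1.2, mem_univ _⟩
  · refine ContinuousOn.add (ContinuousOn.add (continuousOn_const.mul ?_) ?_) ?_
    · exact (continuousOn_kint hl₀ hl₁ _ hD.continuous_sub hD.abs_sub_le).mono
        fun z hz => ⟨mem_univ _, hz.2.1⟩
    · exact (continuousOn_layerDy hl₀ hl₁ hρ₁ hR₁).mono fun z hz => ⟨hz.1.1, hz.2.1⟩
    · exact (continuousOn_layerDy hl₀ hl₁ hρ₂ hR₂).comp
        (f := fun z : ℝ × ℝ => (1 - z.1, z.2)) (by fun_prop)
        fun z hz => ⟨by simpa using hz.1.2, hz.2.1⟩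
  · refine ContinuousOn.add (ContinuousOn.add (continuousOn_const.mul ?_) ?_) ?_
    · exact (continuousOn_kint hl₀ hl₁ _ hD.continuous_sub hD.abs_sub_le).mono
        fun z hz => ⟨mem_univ _, hz.2.1⟩
    · exact (continuousOn_layer hl₀ hl₁ _ hρ₁ hR₁).mono fun z hz => ⟨hz.1.1, mem_univ _⟩
    · exact (continuousOn_layer hl₀ hl₁ _ hρ₂ hR₂).comp
        (f := fun z : ℝ × ℝ => (1 - z.1, z.2)) (by fun_prop)
        fun z hz => ⟨by simpa using hz.1.2, mem_univ _⟩
  · intro x hx y hy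
    have h3 : HasDerivAt (fun s => layer l 1 ρ₂ (1 - s) y) (-(-layer l (1 - l / 2) ρ₂ (1 - x) y)) x :=
      (hasDerivAt_layer_left hl₀ hl₁ 1 hρ₂ hR₂ (x := 1 - x) (by linarith [hx.2])
      y).comp_const_sub 1 x
    refine (((hD.hasDerivAt_initPot_left hl₀ hl₁ x hy.1).add
      (hasDerivAt_layer_left hl₀ hl₁ 1 hρ₁ hR₁ hx.1 y)).add h3).congr_deriv ?_
    ring
  · intro x hx y hy
    have h3 : HasDerivAt (fun s => layer l (1 - l / 2) ρ₂ (1 - s) y)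
        (-(-layer l (1 - l / 2 - l / 2) ρ₂ (1 - x) y)) x :=
      (hasDerivAt_layer_left hl₀ hl₁ (1 - l / 2) hρ₂ hR₂ (x := 1 - x) (by linarith [hx.2])
      y).comp_const_sub 1 x
    refine (((hD.hasDerivAt_initPot_left_left hl₀ hl₁ x hy.1).sub
      (hasDerivAt_layer_left hl₀ hl₁ (1 - l / 2) hρ₁ hR₁ hx.1 y)).add h3).congr_deriv ?_
    rw [sub_sub, add_halves]
    ring
  · intro x hx y hy
    have hx' : 0 ≤ 1 - x := by linarith [hx.2]
    have h1 := hD.hasDerivAt_initPot_right hl₀ hl₁ x hy.1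
    have h2 := hasDerivAt_layer_one_right hl₀ hl₁ hρ₁ hR₁ hx.1 hy.1
    have h3 := hasDerivAt_layer_one_right hl₀ hl₁ hρ₂ hR₂ hx' hy.1
    exact (h1.add h2).add h3
  · intro x hx y hy
    have hx' : 0 < 1 - x := by linarith [hx.2]
    have h1 := hasCaputo_initPot hD hl₀ hl₁ x hy.1
    have h2 := hasCaputo_layer hl₀ hl₁ hρ₁ hR₁ hx.1 hy.1
    have h3 := hasCaputo_layer hl₀ hl₁ hρ₂ hR₂ hx' hy.1
    exact (h1.add h2).add h3
  · intro x hx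
    have hlay : ∀ (ρ : ℝ → ℝ), Continuous ρ → (∀ t, |ρ t| ≤ R) → ∀ x, 0 < x →
        Tendsto (fun y => layer l (1 - l) ρ x y) (𝓝[>] 0) (𝓝 0) := by
      intro ρ hρ hR x hx
      have := (continuous_layer_right hl₀ hl₁ (1 - l) hρ hR hx).tendsto 0
      rw [layer_of_nonpos _ _ _ _ le_rfl] at this
      exact this.mono_left nhdsWithin_le_nhds
    have := ((hD.tendsto_initPot_deriv_deriv hl₀ hl₁ (hv' x hx)).add
      (hlay ρ₁ hρ₁ hR₁ x hx.1)).add (hlay ρ₂ hρ₂ hR₂ (1 - x) (by linarith [hx.2]))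
    simpa only [add_zero] using this
  · intro y hy
    have h1 := (heq y hy).1
    simp only [hk0, sub_zero, Pi.add_apply, hS₀e y hy.1, layerDy, if_true, if_neg one_ne_zero] at h1 ⊢
    linarith
  · intro y hy
    have h1 := (heq y hy).2
    simp only [hk1, sub_self, Pi.sub_apply, hS₁e y hy.1, layerDy, if_true, if_neg one_ne_zero] at h1 ⊢
    linarith
  · refine ContDiffOn.congr
      (hρ₁'.add (contDiffOn_layer_right hl₀ hl₁ 0 hρ₂ hR₂ one_pos)) fun y _ => ?_
    simp only [hk0, sub_zero, layerDy, if_true, if_neg one_ne_zero]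
    ring
  · refine ContDiffOn.congr
      ((contDiffOn_layer_right hl₀ hl₁ 0 hρ₁ hR₁ one_pos).add hρ₂') fun y _ => ?_
    simp only [hk1, sub_self, layerDy, if_true, if_neg one_ne_zero]
    ring

/-! ### Extension of the data and the differential equation for the trace -/

/-- A `C¹` function on a compact interval extends to a `C¹` function on the line. -/
lemma exists_contDiff_extension {a b : ℝ} (hab : a < b) {f : ℝ → ℝ}
    (hf : ContDiffOn ℝ 1 f (Icc a b)) : ∃ F : ℝ → ℝ, ContDiff ℝ 1 F ∧ EqOn F f (Icc a b) := by
  have hc : ContinuousOn (derivWithin f (Icc a b)) (Icc a b) :=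
    hf.continuousOn_derivWithin (uniqueDiffOn_Icc hab) le_rfl
  set g : ℝ → ℝ := fun t => derivWithin f (Icc a b) (max a (min t b)) with hg
  have hmem : ∀ t, max a (min t b) ∈ Icc a b :=
    fun t => ⟨le_max_left _ _, max_le hab.le (min_le_right _ _)⟩
  have hgc : Continuous g := hc.comp_continuous (by fun_prop) hmem
  refine ⟨fun x => f a + ∫ t in a..x, g t, contDiff_one_of_hasDerivAt
    (fun x => (hgc.integral_hasStrictDerivAt a x).hasDerivAt.const_add _) hgc, fun x hx => ?_⟩
  have h1 : ∫ t in a..x, g t = f x - f a := by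
    refine intervalIntegral.integral_eq_sub_of_hasDeriv_right_of_le hx.1
      (hf.continuousOn.mono (Icc_subset_Icc_right hx.2)) (fun t ht => ?_)
      (hgc.intervalIntegrable _ _)
    have ht' : t ∈ Icc a b := ⟨ht.1.le, ht.2.le.trans hx.2⟩
    have h2 : HasDerivWithinAt f (derivWithin f (Icc a b) t) (Icc a b) t :=
      (hf.differentiableOn one_ne_zero t ht').hasDerivWithinAt
    have h3 := h2.hasDerivAt (Icc_mem_nhds ht.1 (ht.2.trans_le hx.2))
    simp only [hg]
    rw [min_eq_left ht'.2, max_eq_right ht'.1]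
    exact h3.hasDerivWithinAt
  simp only
  rw [h1]
  ring

/-- The boundary value problem `τ'' + τ' = G'`, `τ(0) = A`, `τ(1) = B`. -/
lemma exists_ode_solution {G : ℝ → ℝ} (hG : ContDiff ℝ 1 G) (A B : ℝ) :
    ∃ τ : ℝ → ℝ, ContDiff ℝ 2 τ ∧ τ 0 = A ∧ τ 1 = B ∧
      ∀ x, deriv (deriv τ) x = deriv G x - deriv τ x := by
  have hGc := hG.continuous
  set J := ∫ t in (0 : ℝ)..1, Real.exp t * G t with hJ
  have he : Real.exp 1 - 1 ≠ 0 := by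
    have := Real.add_one_lt_exp (one_ne_zero (α := ℝ))
    intro h
    linarith
  -- One integration gives τ' + τ = G + c, which the integrating factor exp(x) solves; this value of
  -- c is forced by τ(1) = B.
  set c := (Real.exp 1 * B - A - J) / (Real.exp 1 - 1) with hc
  have hh : Continuous fun t => Real.exp t * (G t + c) := by fun_prop
  set τ : ℝ → ℝ := fun x => Real.exp (-x) * (A + ∫ t in (0 : ℝ)..x, Real.exp t * (G t + c)) with hτ
  have hd : ∀ x, HasDerivAt τ (G x + c - τ x) x := by
    intro x
    have h1 : HasDerivAt (fun x : ℝ => Real.exp (-x)) (-Real.exp (-x)) x := by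
      simpa using (hasDerivAt_neg x).exp
    have h2 := ((hh.integral_hasStrictDerivAt 0 x).hasDerivAt).const_add A
    refine (h1.mul h2).congr_deriv ?_
    simp only [hτ]
    rw [← mul_assoc, ← Real.exp_add, neg_add_cancel, Real.exp_zero]
    ring
  have hder : deriv τ = fun x => G x + c - τ x := funext fun x => (hd x).deriv
  have hτ1 : ContDiff ℝ 1 τ := by
    have hcont : Continuous τ := continuous_iff_continuousAt.2 fun x => (hd x).continuousAt
    exact contDiff_one_of_hasDerivAt hd ((hGc.add continuous_const).sub hcont)
  refine ⟨τ, ?_, ?_, ?_, fun x => ?_⟩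
  · have : ContDiff ℝ (1 + 1) τ := by
      rw [contDiff_succ_iff_deriv]
      refine ⟨fun x => (hd x).differentiableAt, by simp, ?_⟩
      rw [hder]
      exact (hG.add contDiff_const).sub hτ1
    exact_mod_cast this
  · simp [hτ]
  · have h1 : ∫ t in (0 : ℝ)..1, Real.exp t * (G t + c) = J + c * (Real.exp 1 - 1) := by
      have i1 : IntervalIntegrable (fun t => Real.exp t * G t) volume 0 1 :=
        (Real.continuous_exp.mul hGc).intervalIntegrable _ _
      have i2 : IntervalIntegrable (fun t => Real.exp t * c) volume 0 1 :=
        (Real.continuous_exp.mul continuous_const).intervalIntegrable _ _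
      simp only [mul_add]
      rw [intervalIntegral.integral_add i1 i2, intervalIntegral.integral_mul_const, integral_exp,
        Real.exp_zero, mul_comm c]
    simp only [hτ]
    rw [h1, hc, div_mul_cancel₀ _ he, Real.exp_neg]
    field_simp
    ring
  · rw [hder]
    have h3 := (((hG.differentiable one_ne_zero x).hasDerivAt).add_const c).sub (hd x)
    exact h3.deriv

/-! ### Piecewise regularity and d'Alembert's formula -/

lemma continuousOn_of_closed_cover {f : ℝ × ℝ → ℝ} {s A B : Set (ℝ × ℝ)} (hA : IsClosed A)
    (hB : IsClosed B) (hs : s ⊆ A ∪ B) (h₁ : ContinuousOn f (s ∩ A))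
    (h₂ : ContinuousOn f (s ∩ B)) : ContinuousOn f s := by
  have key : ∀ C : Set (ℝ × ℝ), IsClosed C → ContinuousOn f (s ∩ C) → ∀ x ∈ s,
      ContinuousWithinAt f (s ∩ C) x := by
    intro C hC h x hx
    by_cases hxC : x ∈ C
    · exact h x ⟨hx, hxC⟩
    · refine continuousWithinAt_of_notMem_closure fun hx' => hxC ?_
      exact hC.closure_subset (closure_mono inter_subset_right hx')
  intro x hx
  refine ((key A hA h₁ x hx).union (key B hB h₂ x hx)).mono ?_
  rw [← inter_union_distrib_left]
  exact subset_inter Subset.rfl hs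

/-- A continuous function whose derivative has a limit at a point is differentiable there from each
side. It serves on the lines x = 0 and x = 1, where the formula for the glued solution changes. -/
lemma hasDerivAt_of_eventually_ne {f g : ℝ → ℝ} {x : ℝ}
    (h : ∀ᶠ y in 𝓝[≠] x, HasDerivAt f (g y) y) (hf : ContinuousAt f x) (hg : ContinuousAt g x) :
    HasDerivAt f (g x) x := by
  have hR : {y | HasDerivAt f (g y) y} ∈ 𝓝[>] x :=
    nhdsWithin_mono x (fun y hy => ne_of_gt hy) h
  have hL : {y | HasDerivAt f (g y) y} ∈ 𝓝[<] x :=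
    nhdsWithin_mono x (fun y hy => ne_of_lt hy) h
  have hd : DifferentiableOn ℝ f {y | HasDerivAt f (g y) y} :=
    fun y hy => (show HasDerivAt f (g y) y from hy).differentiableAt.differentiableWithinAt
  have h1 : HasDerivWithinAt f (g x) (Ici x) x := by
    refine hasDerivWithinAt_Ici_of_tendsto_deriv hd hf.continuousWithinAt hR ?_
    refine (hg.tendsto.mono_left nhdsWithin_le_nhds).congr' ?_
    filter_upwards [hR] with y hy
    exact (show HasDerivAt f (g y) y from hy).deriv.symm
  have h2 : HasDerivWithinAt f (g x) (Iic x) x := by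
    refine hasDerivWithinAt_Iic_of_tendsto_deriv hd hf.continuousWithinAt hL ?_
    refine (hg.tendsto.mono_left nhdsWithin_le_nhds).congr' ?_
    filter_upwards [hL] with y hy
    exact (show HasDerivAt f (g y) y from hy).deriv.symm
  have := h1.union h2
  rwa [Ici_union_Iic, hasDerivWithinAt_univ] at this

/-- A function with continuous partial derivatives on an open set is `C¹` there. -/
lemma contDiffOn_of_partials {u ux uy : ℝ × ℝ → ℝ} {D : Set (ℝ × ℝ)} (hD : IsOpen D)
    (hx : ∀ z ∈ D, HasDerivAt (fun s => u (s, z.2)) (ux z) z.1)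
    (hy : ∀ z ∈ D, HasDerivAt (fun t => u (z.1, t)) (uy z) z.2)
    (hxc : ContinuousOn ux D) (hyc : ContinuousOn uy D) : ContDiffOn ℝ 1 u D := by
  set A : ℝ × ℝ → ℝ →L[ℝ] ℝ := fun z => ContinuousLinearMap.toSpanSingleton ℝ (ux z) with hA
  set B : ℝ × ℝ → ℝ →L[ℝ] ℝ := fun z => ContinuousLinearMap.toSpanSingleton ℝ (uy z) with hB
  have hs : Continuous fun c : ℝ => ContinuousLinearMap.toSpanSingleton ℝ c :=
    (ContinuousLinearMap.toSpanSingletonLIE ℝ ℝ).continuous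
  have hAc : ContinuousOn A D := hs.comp_continuousOn hxc
  have hBc : ContinuousOn B D := hs.comp_continuousOn hyc
  have hfd : ∀ z ∈ D, HasFDerivAt u ((A z).coprod (B z)) z := by
    intro z hz
    have h := hasStrictFDerivAt_uncurry_coprod (𝕜 := ℝ) (u := z) (f := fun a b => u (a, b))
      (f₁ := fun a b => A (a, b)) (f₂ := fun a b => B (a, b))
      (by
        filter_upwards [hD.mem_nhds hz] with w hw
        exact (hx w hw).hasFDerivAt)
      (by
        filter_upwards [hD.mem_nhds hz] with w hw
        exact (hy w hw).hasFDerivAt)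
      (hAc.continuousAt (hD.mem_nhds hz)) (hBc.continuousAt (hD.mem_nhds hz))
    exact h.hasFDerivAt
  have hc : ContinuousOn (fun z => (A z).coprod (B z)) D := by
    have : Continuous fun p : (ℝ →L[ℝ] ℝ) × (ℝ →L[ℝ] ℝ) => p.1.coprod p.2 := by
      have h1 : (fun p : (ℝ →L[ℝ] ℝ) × (ℝ →L[ℝ] ℝ) => p.1.coprod p.2) = fun p =>
          p.1.comp (ContinuousLinearMap.fst ℝ ℝ ℝ) + p.2.comp (ContinuousLinearMap.snd ℝ ℝ ℝ) := by
        funext p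
        ext <;> simp
      rw [h1]
      fun_prop
    exact this.comp_continuousOn (hAc.prodMk hBc)
  rw [show (1 : WithTop ℕ∞) = 0 + 1 from rfl, contDiffOn_succ_iff_fderiv_of_isOpen hD]
  refine ⟨fun z hz => (hfd z hz).differentiableAt.differentiableWithinAt, by simp, ?_⟩
  rw [contDiffOn_zero]
  exact hc.congr fun z hz => (hfd z hz).fderiv

lemma hasDerivAt_deriv_of_contDiffOn_two {A : ℝ → ℝ} {I : Set ℝ} (hI : IsOpen I)
    (hA : ContDiffOn ℝ 2 A I) {s : ℝ} (hs : s ∈ I) :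
    HasDerivAt A (deriv A s) s ∧ HasDerivAt (deriv A) (deriv (deriv A) s) s := by
  have h1 : ContDiffOn ℝ (1 + 1) A I := by exact_mod_cast hA
  rw [contDiffOn_succ_iff_deriv_of_isOpen hI] at h1
  exact ⟨hasDerivAt_of_contDiffOn hI (hA.of_le one_le_two) hs,
    hasDerivAt_of_contDiffOn hI h1.2.2 hs⟩

/-- D'Alembert's form of solutions of the wave equation. -/
lemma wave_of_eq {u : ℝ × ℝ → ℝ} {A B : ℝ → ℝ} {D : Set (ℝ × ℝ)} {I J : Set ℝ} (hD : IsOpen D)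
    (hI : IsOpen I) (hJ : IsOpen J) (hA : ContDiffOn ℝ 2 A I) (hB : ContDiffOn ℝ 2 B J)
    (h₁ : ∀ z ∈ D, z.1 + z.2 ∈ I) (h₂ : ∀ z ∈ D, z.1 - z.2 ∈ J)
    (hu : ∀ z ∈ D, u z = A (z.1 + z.2) + B (z.1 - z.2)) :
    ContDiffOn ℝ 2 u D ∧ (∀ z ∈ D, dx (dx u) z - dy (dy u) z = 0) ∧
      ∀ z ∈ D, dy u z = deriv A (z.1 + z.2) - deriv B (z.1 - z.2) := by
  -- Stated for arbitrary A, B and w, so that it applies to u and again to its first derivative.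
  have hdx : ∀ (A B : ℝ → ℝ) (w : ℝ × ℝ → ℝ) (a b : ℝ) (z : ℝ × ℝ), z ∈ D →
      HasDerivAt A a (z.1 + z.2) → HasDerivAt B b (z.1 - z.2) →
      (∀ z ∈ D, w z = A (z.1 + z.2) + B (z.1 - z.2)) → dx w z = a + b := by
    intro A B w a b z hz ha hb hw
    have h3 : HasDerivAt (fun s => A (s + z.2) + B (s - z.2)) (a + b) z.1 :=
      (ha.comp_add_const z.1 z.2).add (hb.comp_sub_const z.1 z.2)
    refine (h3.congr_of_eventuallyEq ?_).deriv
    have : ∀ᶠ s in 𝓝 z.1, (s, z.2) ∈ D :=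
      (Continuous.prodMk_left z.2).continuousAt.preimage_mem_nhds (hD.mem_nhds hz)
    filter_upwards [this] with s hs using hw _ hs
  have hdy : ∀ (A B : ℝ → ℝ) (w : ℝ × ℝ → ℝ) (a b : ℝ) (z : ℝ × ℝ), z ∈ D →
      HasDerivAt A a (z.1 + z.2) → HasDerivAt B b (z.1 - z.2) →
      (∀ z ∈ D, w z = A (z.1 + z.2) + B (z.1 - z.2)) → dy w z = a - b := by
    intro A B w a b z hz ha hb hw
    have h3 : HasDerivAt (fun t => A (z.1 + t) + B (z.1 - t)) (a + -b) z.2 :=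
      (ha.comp_const_add z.1 z.2).add (hb.comp_const_sub z.1 z.2)
    rw [sub_eq_add_neg]
    refine (h3.congr_of_eventuallyEq ?_).deriv
    have : ∀ᶠ t in 𝓝 z.2, (z.1, t) ∈ D :=
      (Continuous.prodMk_right z.1).continuousAt.preimage_mem_nhds (hD.mem_nhds hz)
    filter_upwards [this] with t ht using hw _ ht
  have hA' := fun z hz => hasDerivAt_deriv_of_contDiffOn_two hI hA (h₁ z hz)
  have hB' := fun z hz => hasDerivAt_deriv_of_contDiffOn_two hJ hB (h₂ z hz)
  have e1 : ∀ z ∈ D, dx u z = deriv A (z.1 + z.2) + deriv B (z.1 - z.2) := fun z hz =>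
    hdx A B u _ _ z hz (hA' z hz).1 (hB' z hz).1 hu
  have e2 : ∀ z ∈ D, dy u z = deriv A (z.1 + z.2) - deriv B (z.1 - z.2) := fun z hz =>
    hdy A B u _ _ z hz (hA' z hz).1 (hB' z hz).1 hu
  refine ⟨?_, fun z hz => ?_, e2⟩
  · refine ContDiffOn.congr ?_ hu
    exact (hA.comp (contDiff_fst.add contDiff_snd).contDiffOn h₁).add
      (hB.comp (contDiff_fst.sub contDiff_snd).contDiffOn h₂)
  · have e3 : dx (dx u) z = deriv (deriv A) (z.1 + z.2) + deriv (deriv B) (z.1 - z.2) :=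
      hdx (deriv A) (deriv B) (dx u) _ _ z hz (hA' z hz).2 (hB' z hz).2 e1
    have e4 : dy (dy u) z = deriv (deriv A) (z.1 + z.2) - -deriv (deriv B) (z.1 - z.2) := by
      refine hdy (deriv A) (fun s => -deriv B s) (dy u) _ _ z hz (hA' z hz).2 (hB' z hz).2.neg
        fun w hw => ?_
      rw [e2 w hw, sub_eq_add_neg]
    rw [e3, e4]
    ring

/-! ### Gluing the pieces and existence -/

/-- The compatible data from which the solution is glued together. -/
structure GlueData (l : ℝ) (τ Φ ψ χ : ℝ → ℝ) (U Ux Uy Uxx : ℝ × ℝ → ℝ) : Prop where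
  le_one : l ≤ 1
  hτ : ContDiff ℝ 2 τ
  hΦ : ContDiff ℝ 1 Φ
  hΦ₂ : ContDiffOn ℝ 2 Φ (Ioo (1 / 2) 1)
  hψ : ContDiff ℝ 1 ψ
  hψ₂ : ContDiffOn ℝ 2 ψ (Ioo 0 (1 / 2))
  hχ : ContDiff ℝ 1 χ
  hχ₂ : ContDiffOn ℝ 2 χ (Ioo 0 (1 / 2))
  ode : ∀ x, deriv (deriv τ) x = deriv Φ ((x + 1) / 2) - deriv τ x
  left : ψ 0 = τ 0
  right : χ 0 = τ 1
  corner : Φ 1 = τ 1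
  square : SquareSolution l τ (fun y => deriv ψ (y / 2)) (fun y => deriv χ (y / 2)) U Ux Uy Uxx

/-- The solution in the lower triangle. -/
def lowerSol (τ Φ : ℝ → ℝ) (z : ℝ × ℝ) : ℝ :=
  Φ ((z.1 + z.2 + 1) / 2) + (τ (z.1 - z.2) - Φ ((z.1 - z.2 + 1) / 2))

/-- The solution in the left triangle. -/
def leftSol (U : ℝ × ℝ → ℝ) (ψ : ℝ → ℝ) (z : ℝ × ℝ) : ℝ :=
  U (0, z.1 + z.2) - ψ ((z.1 + z.2) / 2) + ψ (-(z.1 - z.2) / 2)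

/-- The solution in the right triangle. -/
def rightSol (U : ℝ × ℝ → ℝ) (χ : ℝ → ℝ) (z : ℝ × ℝ) : ℝ :=
  χ ((z.1 + z.2 - 1) / 2) + (U (1, 1 - (z.1 - z.2)) - χ ((1 - (z.1 - z.2)) / 2))

/-- The glued solution. -/
def glued (τ Φ ψ χ : ℝ → ℝ) (U : ℝ × ℝ → ℝ) (z : ℝ × ℝ) : ℝ :=
  if z.2 < 0 then lowerSol τ Φ z else if z.1 < 0 then leftSol U ψ z
  else if 1 < z.1 then rightSol U χ z else U z

/-- The part of the mixed domain above the `x`-axis. -/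
def upper : Set (ℝ × ℝ) :=
  {z | 0 < z.2 ∧ z.2 < 1 ∧ 0 < z.1 + z.2 ∧ z.2 - z.1 < 1 ∧ z.1 - z.2 < 1 ∧ z.1 + z.2 < 2}

/-- The closed lower triangle. -/
def lowerTri : Set (ℝ × ℝ) := {z | z.2 ≤ 0 ∧ 0 ≤ z.1 + z.2 ∧ z.1 - z.2 ≤ 1}

/-- The closed left triangle. -/
def leftTri : Set (ℝ × ℝ) := {z | z.1 ≤ 0 ∧ 0 ≤ z.1 + z.2 ∧ z.2 - z.1 ≤ 1}

/-- The closed right triangle. -/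
def rightTri : Set (ℝ × ℝ) := {z | 1 ≤ z.1 ∧ z.1 - z.2 ≤ 1 ∧ z.1 + z.2 ≤ 2}

lemma isOpen_upper : IsOpen upper := by
  simp only [upper, ofPred_and]
  refine IsOpen.inter ?_ (IsOpen.inter ?_ (IsOpen.inter ?_ (IsOpen.inter ?_ (IsOpen.inter ?_ ?_))))
    <;> exact isOpen_lt (by fun_prop) (by fun_prop)

lemma isOpen_Ω₀ : IsOpen Ω₀ := by
  simp only [Ω₀, ofPred_and]
  refine IsOpen.inter ?_ (IsOpen.inter ?_ (IsOpen.inter ?_ ?_))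
    <;> exact isOpen_lt (by fun_prop) (by fun_prop)

lemma isOpen_Ω₁ : IsOpen Ω₁ := by
  simp only [Ω₁, ofPred_and]
  refine IsOpen.inter ?_ (IsOpen.inter ?_ ?_) <;> exact isOpen_lt (by fun_prop) (by fun_prop)

lemma isOpen_Ω₂ : IsOpen Ω₂ := by
  simp only [Ω₂, ofPred_and]
  refine IsOpen.inter ?_ (IsOpen.inter ?_ ?_) <;> exact isOpen_lt (by fun_prop) (by fun_prop)

lemma isOpen_Ω₃ : IsOpen Ω₃ := by
  simp only [Ω₃, ofPred_and]
  refine IsOpen.inter ?_ (IsOpen.inter ?_ ?_) <;> exact isOpen_lt (by fun_prop) (by fun_prop)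

lemma isClosed_lowerTri : IsClosed lowerTri := by
  simp only [lowerTri, ofPred_and]
  refine IsClosed.inter ?_ (IsClosed.inter ?_ ?_) <;> exact isClosed_le (by fun_prop) (by fun_prop)

lemma isClosed_leftTri : IsClosed leftTri := by
  simp only [leftTri, ofPred_and]
  refine IsClosed.inter ?_ (IsClosed.inter ?_ ?_) <;> exact isClosed_le (by fun_prop) (by fun_prop)

lemma isClosed_rightTri : IsClosed rightTri := by
  simp only [rightTri, ofPred_and]
  refine IsClosed.inter ?_ (IsClosed.inter ?_ ?_) <;> exact isClosed_le (by fun_prop) (by fun_prop)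

lemma isClosed_square : IsClosed (Icc (0 : ℝ) 1 ×ˢ Icc (0 : ℝ) 1) := isClosed_Icc.prod isClosed_Icc

lemma closure_Ω_subset :
    closure Ω ⊆ Icc (0 : ℝ) 1 ×ˢ Icc (0 : ℝ) 1 ∪ (lowerTri ∪ (leftTri ∪ rightTri)) := by
  refine closure_minimal ?_ (isClosed_square.union
    (isClosed_lowerTri.union (isClosed_leftTri.union isClosed_rightTri)))
  rintro ⟨x, y⟩ h
  simp only [Ω, Ω₀, Ω₁, Ω₂, Ω₃, AB, AA₀, BB₀, mem_union, mem_ofPred_eq] at h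
  simp only [lowerTri, leftTri, rightTri, mem_union, mem_ofPred_eq, mem_prod, mem_Icc]
  grind

lemma Ω_diff_AB_subset : Ω \ AB ⊆ Ω₁ ∪ upper := by
  rintro ⟨x, y⟩ ⟨h, h'⟩
  simp only [Ω, Ω₀, Ω₁, Ω₂, Ω₃, AB, AA₀, BB₀, mem_union, mem_ofPred_eq] at h h'
  simp only [Ω₁, upper, mem_union, mem_ofPred_eq]
  rcases h with (((((h | h) | h) | h) | h) | h) | h
  · right
    refine ⟨?_, ?_, ?_, ?_, ?_, ?_⟩ <;> linarith [h.1, h.2.1, h.2.2.1, h.2.2.2]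
  · exact Or.inl h
  · right
    refine ⟨?_, ?_, ?_, ?_, ?_, ?_⟩ <;> linarith [h.1, h.2.1, h.2.2]
  · right
    refine ⟨?_, ?_, ?_, ?_, ?_, ?_⟩ <;> linarith [h.1, h.2.1, h.2.2]
  · exact absurd h h'
  · right
    refine ⟨?_, ?_, ?_, ?_, ?_, ?_⟩ <;> linarith [h.1, h.2.1, h.2.2]
  · right
    refine ⟨?_, ?_, ?_, ?_, ?_, ?_⟩ <;> linarith [h.1, h.2.1, h.2.2]

namespace GlueData

variable {l : ℝ} {τ Φ ψ χ : ℝ → ℝ} {U Ux Uy Uxx : ℝ × ℝ → ℝ}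

lemma glued_square {z : ℝ × ℝ}
    (hz : z ∈ Icc (0 : ℝ) 1 ×ˢ Icc (0 : ℝ) 1) : glued τ Φ ψ χ U z = U z := by
  rw [glued, if_neg (not_lt.2 hz.2.1), if_neg (not_lt.2 hz.1.1), if_neg (not_lt.2 hz.1.2)]

/-- On the edge y = 0, where `glued` takes its value from the square, the two terms in Φ cancel and
τ = U(·, 0) remains. -/
lemma glued_lower (h : GlueData l τ Φ ψ χ U Ux Uy Uxx) {z : ℝ × ℝ} (hz : z ∈ lowerTri) :
    glued τ Φ ψ χ U z = lowerSol τ Φ z := by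
  obtain ⟨x, y⟩ := z
  obtain ⟨h1, h2, h3⟩ := hz
  simp only at h1 h2 h3
  rcases h1.lt_or_eq with h1 | rfl
  · rw [glued, if_pos h1]
  · rw [add_zero] at h2
    rw [sub_zero] at h3
    rw [glued_square ⟨⟨h2, h3⟩, ⟨le_rfl, zero_le_one⟩⟩, h.square.init x ⟨h2, h3⟩, lowerSol]
    simp

lemma glued_left {z : ℝ × ℝ} (hz : z ∈ leftTri) :
    glued τ Φ ψ χ U z = leftSol U ψ z := by
  obtain ⟨x, y⟩ := z
  obtain ⟨h1, h2, h3⟩ := hz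
  simp only at h1 h2 h3
  rcases h1.lt_or_eq with h1 | rfl
  · rw [glued, if_neg (not_lt.2 (by simp only; linarith)), if_pos h1]
  · rw [glued_square ⟨⟨le_rfl, zero_le_one⟩, ⟨by simpa using h2, by simpa using h3⟩⟩, leftSol]
    simp

lemma glued_right {z : ℝ × ℝ} (hz : z ∈ rightTri) :
    glued τ Φ ψ χ U z = rightSol U χ z := by
  obtain ⟨x, y⟩ := z
  obtain ⟨h1, h2, h3⟩ := hz
  simp only at h1 h2 h3
  rcases h1.lt_or_eq with h1 | rfl
  · rw [glued, if_neg (not_lt.2 (by simp only; linarith)),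
      if_neg (not_lt.2 (by simp only; linarith)), if_pos h1]
  · rw [glued_square ⟨⟨zero_le_one, le_rfl⟩, ⟨by simp only; linarith, by simp only; linarith⟩⟩,
      rightSol]
    simp only [add_sub_cancel_left, sub_sub_cancel]
    ring

lemma continuousOn_side (h : GlueData l τ Φ ψ χ U Ux Uy Uxx) {x : ℝ} (hx : x ∈ Icc (0 : ℝ) 1) :
    ContinuousOn (fun s => U (x, s)) (Icc 0 1) :=
  h.square.cont.comp (Continuous.prodMk_right x).continuousOn fun _ hs => ⟨hx, hs⟩

lemma continuousOn_leftSol (h : GlueData l τ Φ ψ χ U Ux Uy Uxx) :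
    ContinuousOn (leftSol U ψ) leftTri := by
  have hψ := h.hψ.continuous
  refine ContinuousOn.add (ContinuousOn.sub ?_ (by fun_prop)) (by fun_prop)
  exact (h.continuousOn_side ⟨le_rfl, zero_le_one⟩).comp (f := fun z : ℝ × ℝ => z.1 + z.2)
    (by fun_prop) fun z hz => ⟨hz.2.1, by linarith [hz.1, hz.2.2]⟩

lemma continuousOn_rightSol (h : GlueData l τ Φ ψ χ U Ux Uy Uxx) :
    ContinuousOn (rightSol U χ) rightTri := by
  have hχ := h.hχ.continuous
  refine ContinuousOn.add (by fun_prop) (ContinuousOn.sub ?_ (by fun_prop))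
  exact (h.continuousOn_side ⟨zero_le_one, le_rfl⟩).comp (f := fun z : ℝ × ℝ => 1 - (z.1 - z.2))
    (by fun_prop) fun z hz => ⟨by linarith [hz.2.1], by linarith [hz.1, hz.2.2]⟩

lemma continuousOn_glued (h : GlueData l τ Φ ψ χ U Ux Uy Uxx) :
    ContinuousOn (glued τ Φ ψ χ U)
      (Icc (0 : ℝ) 1 ×ˢ Icc (0 : ℝ) 1 ∪ (lowerTri ∪ (leftTri ∪ rightTri))) := by
  have hτ := h.hτ.continuous
  have hΦ := h.hΦ.continuous
  refine ContinuousOn.union_of_isClosed (h.square.cont.congr fun z hz => glued_square hz)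
    (ContinuousOn.union_of_isClosed (ContinuousOn.congr (f := lowerSol τ Φ) ?_
      fun z hz => h.glued_lower hz)
      (ContinuousOn.union_of_isClosed (h.continuousOn_leftSol.congr fun z hz => glued_left hz)
        (h.continuousOn_rightSol.congr fun z hz => glued_right hz)
        isClosed_leftTri isClosed_rightTri) isClosed_lowerTri
        (isClosed_leftTri.union isClosed_rightTri)) isClosed_square
      (isClosed_lowerTri.union (isClosed_leftTri.union isClosed_rightTri))
  unfold lowerSol
  fun_prop

/-- The boundary values on the vertical sides of the square are twice continuously
differentiable. -/
lemma contDiffOn_side (h : GlueData l τ Φ ψ χ U Ux Uy Uxx) {x : ℝ} (hx : x ∈ Icc (0 : ℝ) 1)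
    (hU : ContDiffOn ℝ 1 (fun y => Uy (x, y)) (Ioo 0 1)) :
    ContDiffOn ℝ 2 (fun s => U (x, s)) (Ioo 0 1) := by
  have hd := h.square.deriv_y x hx
  have : ContDiffOn ℝ (1 + 1) (fun s => U (x, s)) (Ioo 0 1) := by
    rw [contDiffOn_succ_iff_deriv_of_isOpen isOpen_Ioo]
    refine ⟨fun s hs => (hd s hs).differentiableAt.differentiableWithinAt, by simp, ?_⟩
    exact hU.congr fun s hs => (hd s hs).deriv
  exact_mod_cast this

lemma wave_lower (h : GlueData l τ Φ ψ χ U Ux Uy Uxx) :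
    ContDiffOn ℝ 2 (glued τ Φ ψ χ U) Ω₁ ∧
      (∀ z ∈ Ω₁, dx (dx (glued τ Φ ψ χ U)) z - dy (dy (glued τ Φ ψ χ U)) z = 0) ∧
      ∀ z ∈ Ω₁, dy (glued τ Φ ψ χ U) z = deriv (fun s => Φ ((s + 1) / 2)) (z.1 + z.2) -
        deriv (fun s => τ s - Φ ((s + 1) / 2)) (z.1 - z.2) := by
  have hA : ContDiffOn ℝ 2 (fun s : ℝ => Φ ((s + 1) / 2)) (Ioo 0 1) :=
    h.hΦ₂.comp (f := fun s : ℝ => (s + 1) / 2) (by fun_prop)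
      fun s hs => ⟨by linarith [hs.1], by linarith [hs.2]⟩
  refine wave_of_eq (A := fun s => Φ ((s + 1) / 2)) (B := fun s => τ s - Φ ((s + 1) / 2))
    isOpen_Ω₁ isOpen_Ioo isOpen_Ioo hA (h.hτ.contDiffOn.sub hA) ?_ ?_ ?_
  · rintro ⟨x, y⟩ ⟨h1, h2, h3⟩
    simp only at h1 h2 h3
    exact ⟨h2, by simp only; linarith⟩
  · rintro ⟨x, y⟩ ⟨h1, h2, h3⟩
    simp only at h1 h2 h3
    exact ⟨by simp only; linarith, h3⟩
  · rintro z ⟨h1, h2, h3⟩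
    exact h.glued_lower ⟨h1.le, h2.le, h3.le⟩

lemma wave_left (h : GlueData l τ Φ ψ χ U Ux Uy Uxx) :
    ContDiffOn ℝ 2 (glued τ Φ ψ χ U) Ω₂ ∧
      ∀ z ∈ Ω₂, dx (dx (glued τ Φ ψ χ U)) z - dy (dy (glued τ Φ ψ χ U)) z = 0 := by
  have hψ₁ : ContDiffOn ℝ 2 (fun s : ℝ => ψ (s / 2)) (Ioo 0 1) :=
    h.hψ₂.comp (f := fun s : ℝ => s / 2) (by fun_prop)
      fun s hs => ⟨by linarith [hs.1], by linarith [hs.2]⟩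
  have hψ₂ : ContDiffOn ℝ 2 (fun s : ℝ => ψ (-s / 2)) (Ioo (-1) 0) :=
    h.hψ₂.comp (f := fun s : ℝ => -s / 2) (by fun_prop)
      fun s hs => ⟨by linarith [hs.2], by linarith [hs.1]⟩
  have := wave_of_eq (u := glued τ Φ ψ χ U) (A := fun s => U (0, s) - ψ (s / 2))
    (B := fun s => ψ (-s / 2)) isOpen_Ω₂ isOpen_Ioo isOpen_Ioo
    ((h.contDiffOn_side ⟨le_rfl, zero_le_one⟩ h.square.smooth_left).sub hψ₁) hψ₂ ?_ ?_ ?_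
  · exact ⟨this.1, this.2.1⟩
  · rintro ⟨x, y⟩ ⟨h1, h2, h3⟩
    simp only at h1 h2 h3
    exact ⟨h2, by simp only; linarith⟩
  · rintro ⟨x, y⟩ ⟨h1, h2, h3⟩
    simp only at h1 h2 h3
    exact ⟨by simp only; linarith, by simp only; linarith⟩
  · rintro z ⟨h1, h2, h3⟩
    exact glued_left ⟨h1.le, h2.le, h3.le⟩

lemma wave_right (h : GlueData l τ Φ ψ χ U Ux Uy Uxx) :
    ContDiffOn ℝ 2 (glued τ Φ ψ χ U) Ω₃ ∧
      ∀ z ∈ Ω₃, dx (dx (glued τ Φ ψ χ U)) z - dy (dy (glued τ Φ ψ χ U)) z = 0 := by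
  have hχ₁ : ContDiffOn ℝ 2 (fun s : ℝ => χ ((s - 1) / 2)) (Ioo 1 2) :=
    h.hχ₂.comp (f := fun s : ℝ => (s - 1) / 2) (by fun_prop)
      fun s hs => ⟨by linarith [hs.1], by linarith [hs.2]⟩
  have hχ₂ : ContDiffOn ℝ 2 (fun s : ℝ => χ ((1 - s) / 2)) (Ioo 0 1) :=
    h.hχ₂.comp (f := fun s : ℝ => (1 - s) / 2) (by fun_prop)
      fun s hs => ⟨by linarith [hs.2], by linarith [hs.1]⟩
  have hU : ContDiffOn ℝ 2 (fun s : ℝ => U (1, 1 - s)) (Ioo 0 1) :=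
    (h.contDiffOn_side ⟨zero_le_one, le_rfl⟩ h.square.smooth_right).comp (f := fun s : ℝ => 1 - s)
      (by fun_prop) fun s hs => ⟨by linarith [hs.2], by linarith [hs.1]⟩
  have := wave_of_eq (u := glued τ Φ ψ χ U) (A := fun s => χ ((s - 1) / 2))
    (B := fun s => U (1, 1 - s) - χ ((1 - s) / 2)) isOpen_Ω₃ isOpen_Ioo isOpen_Ioo
    hχ₁ (hU.sub hχ₂) ?_ ?_ ?_
  · exact ⟨this.1, this.2.1⟩
  · rintro ⟨x, y⟩ ⟨h1, h2, h3⟩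
    simp only at h1 h2 h3
    exact ⟨by simp only; linarith, h3⟩
  · rintro ⟨x, y⟩ ⟨h1, h2, h3⟩
    simp only at h1 h2 h3
    exact ⟨by simp only; linarith, by simp only; linarith⟩
  · rintro z ⟨h1, h2, h3⟩
    exact glued_right ⟨h1.le, h2.le, h3.le⟩

end GlueData

namespace GlueData

variable {l : ℝ} {τ Φ ψ χ : ℝ → ℝ} {U Ux Uy Uxx : ℝ × ℝ → ℝ}

/-- The `x`-derivative of the glued solution above the axis. -/
def gluedDx (ψ χ : ℝ → ℝ) (Ux Uy : ℝ × ℝ → ℝ) (z : ℝ × ℝ) : ℝ :=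
  if z.1 < 0 then Uy (0, z.1 + z.2) - deriv ψ ((z.1 + z.2) / 2) / 2 -
      deriv ψ (-(z.1 - z.2) / 2) / 2
  else if 1 < z.1 then deriv χ ((z.1 + z.2 - 1) / 2) / 2 -
      (Uy (1, 1 - (z.1 - z.2)) - deriv χ ((1 - (z.1 - z.2)) / 2) / 2)
  else Ux z

/-- The `y`-derivative of the glued solution above the axis. -/
def gluedDy (ψ χ : ℝ → ℝ) (Uy : ℝ × ℝ → ℝ) (z : ℝ × ℝ) : ℝ :=
  if z.1 < 0 then Uy (0, z.1 + z.2) - deriv ψ ((z.1 + z.2) / 2) / 2 +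
      deriv ψ (-(z.1 - z.2) / 2) / 2
  else if 1 < z.1 then deriv χ ((z.1 + z.2 - 1) / 2) / 2 +
      (Uy (1, 1 - (z.1 - z.2)) - deriv χ ((1 - (z.1 - z.2)) / 2) / 2)
  else Uy z

lemma continuousOn_side_deriv (h : GlueData l τ Φ ψ χ U Ux Uy Uxx) {x : ℝ}
    (hx : x ∈ Icc (0 : ℝ) 1) : ContinuousOn (fun s => Uy (x, s)) (Ioo 0 1) :=
  h.square.cont_y.comp (Continuous.prodMk_right x).continuousOn fun _ hs => ⟨hx, hs⟩

lemma continuousOn_upper_of {F G H K : ℝ × ℝ → ℝ}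
    (hG : ContinuousOn G (upper ∩ {z | z.1 ≤ 0})) (hH : ContinuousOn H (upper ∩ {z | 1 ≤ z.1}))
    (hK : ContinuousOn K (Icc 0 1 ×ˢ Ioo 0 1)) (h₁ : ∀ z ∈ upper, z.1 ≤ 0 → F z = G z)
    (h₂ : ∀ z ∈ upper, 1 ≤ z.1 → F z = H z)
    (h₃ : ∀ z ∈ Icc (0 : ℝ) 1 ×ˢ Ioo (0 : ℝ) 1, F z = K z) : ContinuousOn F upper := by
  refine continuousOn_of_closed_cover (A := {z | z.1 ≤ 0}) (B := {z | 0 ≤ z.1})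
    (isClosed_le (by fun_prop) (by fun_prop)) (isClosed_le (by fun_prop) (by fun_prop))
    (fun z _ => le_total z.1 0) (hG.congr fun z hz => h₁ z hz.1 hz.2) ?_
  refine continuousOn_of_closed_cover (A := {z | z.1 ≤ 1}) (B := {z | 1 ≤ z.1})
    (isClosed_le (by fun_prop) (by fun_prop)) (isClosed_le (by fun_prop) (by fun_prop))
    (fun z _ => le_total z.1 1) ?_ ((hH.mono ?_).congr fun z hz => h₂ z hz.1.1 hz.2)
  · have hsub : upper ∩ {z | 0 ≤ z.1} ∩ {z | z.1 ≤ 1} ⊆ Icc (0 : ℝ) 1 ×ˢ Ioo (0 : ℝ) 1 :=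
      fun z hz => ⟨⟨hz.1.2, hz.2⟩, hz.1.1.1, hz.1.1.2.1⟩
    exact (hK.mono hsub).congr fun z hz => h₃ z (hsub hz)
  · exact fun z hz => ⟨hz.1.1, hz.2⟩

lemma mapsTo_left : MapsTo (fun z : ℝ × ℝ => z.1 + z.2) (upper ∩ {z | z.1 ≤ 0}) (Ioo 0 1) := by
  rintro ⟨x, y⟩ ⟨⟨h1, h2, h3, h4, h5, h6⟩, hx⟩
  have hx : x ≤ 0 := hx
  exact ⟨h3, by simp only at *; linarith⟩

lemma mapsTo_right :
    MapsTo (fun z : ℝ × ℝ => 1 - (z.1 - z.2)) (upper ∩ {z | 1 ≤ z.1}) (Ioo 0 1) := by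
  rintro ⟨x, y⟩ ⟨⟨h1, h2, h3, h4, h5, h6⟩, hx⟩
  have hx : 1 ≤ x := hx
  exact ⟨by simp only at *; linarith, by simp only at *; linarith⟩

/-- The side conditions `left` and `right` of `SquareSolution` are used here: they say exactly that
the x-derivatives from the square and from the triangles agree on x = 0 and x = 1. For the
y-derivatives agreement is automatic. -/
lemma continuousOn_gluedDx (h : GlueData l τ Φ ψ χ U Ux Uy Uxx) :
    ContinuousOn (gluedDx ψ χ Ux Uy) upper := by
  have hψ := h.hψ.continuous_deriv le_rfl
  have hχ := h.hχ.continuous_deriv le_rfl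
  refine continuousOn_upper_of
    (G := fun z => Uy (0, z.1 + z.2) - deriv ψ ((z.1 + z.2) / 2) / 2 -
      deriv ψ (-(z.1 - z.2) / 2) / 2)
    (H := fun z => deriv χ ((z.1 + z.2 - 1) / 2) / 2 -
      (Uy (1, 1 - (z.1 - z.2)) - deriv χ ((1 - (z.1 - z.2)) / 2) / 2)) ?_ ?_ h.square.cont_x
    ?_ ?_ ?_
  · refine ContinuousOn.sub (ContinuousOn.sub ?_ (by fun_prop)) (by fun_prop)
    exact (h.continuousOn_side_deriv ⟨le_rfl, zero_le_one⟩).comp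
      (f := fun z : ℝ × ℝ => z.1 + z.2) (by fun_prop) mapsTo_left
  · refine ContinuousOn.sub (by fun_prop) (ContinuousOn.sub ?_ (by fun_prop))
    exact (h.continuousOn_side_deriv ⟨zero_le_one, le_rfl⟩).comp
      (f := fun z : ℝ × ℝ => 1 - (z.1 - z.2)) (by fun_prop) mapsTo_right
  · rintro ⟨x, y⟩ hz hx
    rcases hx.lt_or_eq with hx | hx
    · rw [gluedDx, if_pos hx]
    · simp only at hx
      subst hx
      have := h.square.left y ⟨hz.1, hz.2.1⟩
      simp only [gluedDx, lt_irrefl, if_false, if_neg (not_lt.2 zero_le_one), zero_add, zero_sub,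
        neg_neg]
      linarith
  · rintro ⟨x, y⟩ hz hx
    have hx0 : ¬ x < 0 := not_lt.2 (le_trans zero_le_one hx)
    rcases (show 1 ≤ x from hx).lt_or_eq with hx | hx
    · rw [gluedDx, if_neg hx0, if_pos hx]
    · subst hx
      have := h.square.right y ⟨hz.1, hz.2.1⟩
      simp only [gluedDx, lt_irrefl, if_false, if_neg hx0, add_sub_cancel_left, sub_sub_cancel]
      linarith
  · intro z hz
    rw [gluedDx, if_neg (not_lt.2 hz.1.1), if_neg (not_lt.2 hz.1.2)]

lemma continuousOn_gluedDy (h : GlueData l τ Φ ψ χ U Ux Uy Uxx) :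
    ContinuousOn (gluedDy ψ χ Uy) upper := by
  have hψ := h.hψ.continuous_deriv le_rfl
  have hχ := h.hχ.continuous_deriv le_rfl
  refine continuousOn_upper_of
    (G := fun z => Uy (0, z.1 + z.2) - deriv ψ ((z.1 + z.2) / 2) / 2 +
      deriv ψ (-(z.1 - z.2) / 2) / 2)
    (H := fun z => deriv χ ((z.1 + z.2 - 1) / 2) / 2 +
      (Uy (1, 1 - (z.1 - z.2)) - deriv χ ((1 - (z.1 - z.2)) / 2) / 2)) ?_ ?_ h.square.cont_y
    ?_ ?_ ?_
  · refine ContinuousOn.add (ContinuousOn.sub ?_ (by fun_prop)) (by fun_prop)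
    exact (h.continuousOn_side_deriv ⟨le_rfl, zero_le_one⟩).comp
      (f := fun z : ℝ × ℝ => z.1 + z.2) (by fun_prop) mapsTo_left
  · refine ContinuousOn.add (by fun_prop) (ContinuousOn.sub ?_ (by fun_prop))
    exact (h.continuousOn_side_deriv ⟨zero_le_one, le_rfl⟩).comp
      (f := fun z : ℝ × ℝ => 1 - (z.1 - z.2)) (by fun_prop) mapsTo_right
  · rintro ⟨x, y⟩ hz hx
    rcases hx.lt_or_eq with hx | hx
    · rw [gluedDy, if_pos hx]
    · simp only at hx
      subst hx
      simp only [gluedDy, lt_irrefl, if_false, if_neg (not_lt.2 zero_le_one), zero_add, zero_sub,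
        neg_neg]
      ring
  · rintro ⟨x, y⟩ hz hx
    have hx0 : ¬ x < 0 := not_lt.2 (le_trans zero_le_one hx)
    rcases (show 1 ≤ x from hx).lt_or_eq with hx | hx
    · rw [gluedDy, if_neg hx0, if_pos hx]
    · subst hx
      simp only [gluedDy, lt_irrefl, if_false, if_neg hx0, add_sub_cancel_left, sub_sub_cancel]
      ring
  · intro z hz
    rw [gluedDy, if_neg (not_lt.2 hz.1.1), if_neg (not_lt.2 hz.1.2)]

lemma hasDerivAt_left (h : GlueData l τ Φ ψ χ U Ux Uy Uxx) {x y : ℝ} (h1 : 0 < x + y)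
    (h2 : x + y < 1) :
    HasDerivAt (fun s => leftSol U ψ (s, y)) (Uy (0, x + y) - deriv ψ ((x + y) / 2) / 2 -
      deriv ψ (-(x - y) / 2) / 2) x ∧
    HasDerivAt (fun t => leftSol U ψ (x, t)) (Uy (0, x + y) - deriv ψ ((x + y) / 2) / 2 +
      deriv ψ (-(x - y) / 2) / 2) y := by
  have hψd := fun s => (h.hψ.differentiable one_ne_zero s).hasDerivAt
  have hU := h.square.deriv_y 0 ⟨le_rfl, zero_le_one⟩ (x + y) ⟨h1, h2⟩
  have e1 : HasDerivAt (fun s : ℝ => U (0, s) - ψ (s / 2))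
      (Uy (0, x + y) - deriv ψ ((x + y) / 2) / 2) (x + y) := by
    have := HasDerivAt.comp (x + y) (hψd ((x + y) / 2)) ((hasDerivAt_id (x + y)).div_const 2)
    refine (hU.sub this).congr_deriv ?_
    ring
  have e2 : HasDerivAt (fun s : ℝ => ψ (-s / 2)) (-(deriv ψ (-(x - y) / 2) / 2)) (x - y) := by
    have := HasDerivAt.comp (x - y) (hψd (-(x - y) / 2)) ((hasDerivAt_neg (x - y)).div_const 2)
    refine this.congr_deriv ?_
    ring
  refine ⟨((e1.comp_add_const x y).add (e2.comp_sub_const x y)).congr_deriv ?_,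
    ((e1.comp_const_add x y).add (e2.comp_const_sub x y)).congr_deriv ?_⟩ <;> ring

lemma hasDerivAt_right (h : GlueData l τ Φ ψ χ U Ux Uy Uxx) {x y : ℝ} (h1 : 0 < x - y)
    (h2 : x - y < 1) :
    HasDerivAt (fun s => rightSol U χ (s, y)) (deriv χ ((x + y - 1) / 2) / 2 -
      (Uy (1, 1 - (x - y)) - deriv χ ((1 - (x - y)) / 2) / 2)) x ∧
    HasDerivAt (fun t => rightSol U χ (x, t)) (deriv χ ((x + y - 1) / 2) / 2 +
      (Uy (1, 1 - (x - y)) - deriv χ ((1 - (x - y)) / 2) / 2)) y := by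
  have hχd := fun s => (h.hχ.differentiable one_ne_zero s).hasDerivAt
  have hU := h.square.deriv_y 1 ⟨zero_le_one, le_rfl⟩ (1 - (x - y)) ⟨by linarith, by linarith⟩
  have e1 : HasDerivAt (fun s : ℝ => χ ((s - 1) / 2)) (deriv χ ((x + y - 1) / 2) / 2) (x + y) := by
    have := HasDerivAt.comp (x + y) (hχd ((x + y - 1) / 2))
      (((hasDerivAt_id (x + y)).sub_const 1).div_const 2)
    refine this.congr_deriv ?_
    ring
  have e2 : HasDerivAt (fun s : ℝ => U (1, 1 - s) - χ ((1 - s) / 2))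
      (-(Uy (1, 1 - (x - y)) - deriv χ ((1 - (x - y)) / 2) / 2)) (x - y) := by
    have h3 := hU.comp_const_sub 1 (x - y)
    have h4 := HasDerivAt.comp (x - y) (hχd ((1 - (x - y)) / 2))
      (((hasDerivAt_id (x - y)).const_sub 1).div_const 2)
    refine (h3.sub h4).congr_deriv ?_
    ring
  refine ⟨((e1.comp_add_const x y).add (e2.comp_sub_const x y)).congr_deriv ?_,
    ((e1.comp_const_add x y).add (e2.comp_const_sub x y)).congr_deriv ?_⟩ <;> ring

lemma upper_subset : upper ⊆
    Icc (0 : ℝ) 1 ×ˢ Icc (0 : ℝ) 1 ∪ (lowerTri ∪ (leftTri ∪ rightTri)) := by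
  rintro ⟨x, y⟩ ⟨h1, h2, h3, h4, h5, h6⟩
  simp only at h1 h2 h3 h4 h5 h6
  rcases le_total x 0 with hx | hx
  · exact Or.inr (Or.inr (Or.inl ⟨hx, h3.le, h4.le⟩))
  · rcases le_total x 1 with hx1 | hx1
    · exact Or.inl ⟨⟨hx, hx1⟩, h1.le, h2.le⟩
    · exact Or.inr (Or.inr (Or.inr ⟨hx1, h5.le, h6.le⟩))

lemma hasDerivAt_glued_right (h : GlueData l τ Φ ψ χ U Ux Uy Uxx) {z : ℝ × ℝ} (hz : z ∈ upper) :
    HasDerivAt (fun t => glued τ Φ ψ χ U (z.1, t)) (gluedDy ψ χ Uy z) z.2 := by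
  obtain ⟨x, y⟩ := z
  have hev : ∀ᶠ t in 𝓝 y, (x, t) ∈ upper :=
    (Continuous.prodMk_right x).continuousAt.preimage_mem_nhds (isOpen_upper.mem_nhds hz)
  obtain ⟨h1, h2, h3, h4, h5, h6⟩ := hz
  simp only at h1 h2 h3 h4 h5 h6 ⊢
  rcases lt_or_ge x 0 with hx | hx
  · rw [gluedDy, if_pos hx]
    refine (h.hasDerivAt_left h3 (by linarith)).2.congr_of_eventuallyEq ?_
    filter_upwards [hev] with t ht
    exact glued_left ⟨hx.le, ht.2.2.1.le, ht.2.2.2.1.le⟩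
  · rcases lt_or_ge 1 x with hx1 | hx1
    · rw [gluedDy, if_neg (not_lt.2 hx), if_pos hx1]
      refine (h.hasDerivAt_right (by linarith) h5).2.congr_of_eventuallyEq ?_
      filter_upwards [hev] with t ht
      exact glued_right ⟨hx1.le, ht.2.2.2.2.1.le, ht.2.2.2.2.2.le⟩
    · rw [gluedDy, if_neg (not_lt.2 hx), if_neg (not_lt.2 hx1)]
      refine (h.square.deriv_y x ⟨hx, hx1⟩ y ⟨h1, h2⟩).congr_of_eventuallyEq ?_
      filter_upwards [hev] with t ht
      exact glued_square ⟨⟨hx, hx1⟩, ht.1.le, ht.2.1.le⟩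

lemma hasDerivAt_glued_left_of_ne (h : GlueData l τ Φ ψ χ U Ux Uy Uxx) {x y : ℝ}
    (hz : (x, y) ∈ upper) (hx0 : x ≠ 0) (hx1 : x ≠ 1) :
    HasDerivAt (fun s => glued τ Φ ψ χ U (s, y)) (gluedDx ψ χ Ux Uy (x, y)) x := by
  have hev : ∀ᶠ s in 𝓝 x, (s, y) ∈ upper :=
    (Continuous.prodMk_left y).continuousAt.preimage_mem_nhds (isOpen_upper.mem_nhds hz)
  obtain ⟨h1, h2, h3, h4, h5, h6⟩ := hz
  simp only at h1 h2 h3 h4 h5 h6 ⊢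
  rcases lt_or_gt_of_ne hx0 with hx | hx
  · rw [gluedDx, if_pos hx]
    refine (h.hasDerivAt_left h3 (by linarith)).1.congr_of_eventuallyEq ?_
    filter_upwards [hev, Iio_mem_nhds hx] with s hs hs'
    exact glued_left ⟨le_of_lt hs', hs.2.2.1.le, hs.2.2.2.1.le⟩
  · rcases lt_or_gt_of_ne hx1 with hx1 | hx1
    · rw [gluedDx, if_neg (not_lt.2 hx.le), if_neg (not_lt.2 hx1.le)]
      refine (h.square.deriv_x x ⟨hx, hx1⟩ y ⟨h1, h2⟩).congr_of_eventuallyEq ?_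
      filter_upwards [Ioo_mem_nhds hx hx1] with s hs
      exact glued_square ⟨⟨hs.1.le, hs.2.le⟩, h1.le, h2.le⟩
    · rw [gluedDx, if_neg (not_lt.2 hx.le), if_pos hx1]
      refine (h.hasDerivAt_right (by linarith) h5).1.congr_of_eventuallyEq ?_
      filter_upwards [hev, Ioi_mem_nhds hx1] with s hs hs'
      exact glued_right ⟨le_of_lt hs', hs.2.2.2.2.1.le, hs.2.2.2.2.2.le⟩

lemma hasDerivAt_glued_left (h : GlueData l τ Φ ψ χ U Ux Uy Uxx) {z : ℝ × ℝ} (hz : z ∈ upper) :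
    HasDerivAt (fun s => glued τ Φ ψ χ U (s, z.2)) (gluedDx ψ χ Ux Uy z) z.1 := by
  obtain ⟨x, y⟩ := z
  have hcu : ContinuousAt (glued τ Φ ψ χ U) (x, y) :=
    (h.continuousOn_glued.mono upper_subset).continuousAt (isOpen_upper.mem_nhds hz)
  have hcg : ContinuousAt (gluedDx ψ χ Ux Uy) (x, y) :=
    h.continuousOn_gluedDx.continuousAt (isOpen_upper.mem_nhds hz)
  have hev : ∀ᶠ s in 𝓝 x, (s, y) ∈ upper :=
    (Continuous.prodMk_left y).continuousAt.preimage_mem_nhds (isOpen_upper.mem_nhds hz)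
  have hne : ∀ᶠ s in 𝓝[≠] x, s ≠ 0 ∧ s ≠ 1 := by
    have key : ∀ c : ℝ, ∀ᶠ s in 𝓝[≠] x, s ≠ c := by
      intro c
      rcases eq_or_ne x c with rfl | hxc
      · exact self_mem_nhdsWithin
      · exact nhdsWithin_le_nhds (isOpen_ne.mem_nhds hxc)
    exact (key 0).and (key 1)
  refine hasDerivAt_of_eventually_ne (g := fun s => gluedDx ψ χ Ux Uy (s, y)) ?_ ?_ ?_
  · filter_upwards [hne, nhdsWithin_le_nhds hev] with s hs hs'
    exact h.hasDerivAt_glued_left_of_ne hs' hs.1 hs.2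
  · exact ContinuousAt.comp (x := x) (f := fun s : ℝ => (s, y)) hcu (by fun_prop)
  · exact ContinuousAt.comp (x := x) (f := fun s : ℝ => (s, y)) hcg (by fun_prop)

lemma contDiffOn_upper (h : GlueData l τ Φ ψ χ U Ux Uy Uxx) :
    ContDiffOn ℝ 1 (glued τ Φ ψ χ U) upper :=
  contDiffOn_of_partials isOpen_upper (fun _ hz => h.hasDerivAt_glued_left hz)
    (fun _ hz => h.hasDerivAt_glued_right hz) h.continuousOn_gluedDx h.continuousOn_gluedDy

lemma Ω₀_eq : Ω₀ = Ioo (0 : ℝ) 1 ×ˢ Ioo (0 : ℝ) 1 := by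
  ext z
  simp only [Ω₀, mem_ofPred_eq, mem_prod, mem_Ioo]
  tauto

lemma dx_glued (h : GlueData l τ Φ ψ χ U Ux Uy Uxx) {x y : ℝ} (hx : x ∈ Ioo (0 : ℝ) 1)
    (hy : y ∈ Ioo (0 : ℝ) 1) :
    HasDerivAt (fun s => glued τ Φ ψ χ U (s, y)) (Ux (x, y)) x := by
  refine (h.square.deriv_x x hx y hy).congr_of_eventuallyEq ?_
  filter_upwards [Ioo_mem_nhds hx.1 hx.2] with s hs
  exact glued_square ⟨⟨hs.1.le, hs.2.le⟩, hy.1.le, hy.2.le⟩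

lemma dx_dx_glued (h : GlueData l τ Φ ψ χ U Ux Uy Uxx) {x y : ℝ} (hx : x ∈ Ioo (0 : ℝ) 1)
    (hy : y ∈ Ioo (0 : ℝ) 1) :
    HasDerivAt (fun s => dx (glued τ Φ ψ χ U) (s, y)) (Uxx (x, y)) x := by
  refine (h.square.deriv_xx x hx y hy).congr_of_eventuallyEq ?_
  filter_upwards [Ioo_mem_nhds hx.1 hx.2] with s hs
  exact (h.dx_glued hs hy).deriv

lemma hasCaputo_glued (h : GlueData l τ Φ ψ χ U Ux Uy Uxx) {x y : ℝ} (hx : x ∈ Ioo (0 : ℝ) 1)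
    (hy : y ∈ Ioo (0 : ℝ) 1) :
    HasCaputo l (fun t => glued τ Φ ψ χ U (x, t)) y (Uxx (x, y)) :=
  (h.square.caputo x hx y hy).congr hy.2 fun _ ht =>
    glued_square ⟨⟨hx.1.le, hx.2.le⟩, ht.1.le, ht.2.le⟩

lemma caputoY_glued (h : GlueData l τ Φ ψ χ U Ux Uy Uxx) {x y : ℝ} (hx : x ∈ Ioo (0 : ℝ) 1)
    (hy : y ∈ Ioo (0 : ℝ) 1) : caputoY l (glued τ Φ ψ χ U) (x, y) = Uxx (x, y) :=
  (h.hasCaputo_glued hx hy).caputo_eq h.le_one hy.1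

lemma isC2Caputo_glued (h : GlueData l τ Φ ψ χ U Ux Uy Uxx) :
    IsC2Caputo l (glued τ Φ ψ χ U) := by
  constructor
  all_goals rw [Ω₀_eq]
  · rintro ⟨x, y⟩ ⟨hx, hy⟩
    exact (h.dx_glued hx hy).differentiableAt
  · rintro ⟨x, y⟩ ⟨hx, hy⟩
    exact (h.dx_dx_glued hx hy).differentiableAt
  · rintro ⟨x, y⟩ ⟨hx, hy⟩
    exact (h.hasCaputo_glued hx hy).caputoExists h.le_one hy.1
  · exact h.continuousOn_glued.mono fun z hz =>
      Or.inl ⟨⟨hz.1.1.le, hz.1.2.le⟩, hz.2.1.le, hz.2.2.le⟩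
  · refine (h.square.cont_x.mono fun z hz => ⟨⟨hz.1.1.le, hz.1.2.le⟩, hz.2⟩).congr ?_
    rintro ⟨x, y⟩ ⟨hx, hy⟩
    exact (h.dx_glued hx hy).deriv
  · refine h.square.cont_xx.congr ?_
    rintro ⟨x, y⟩ ⟨hx, hy⟩
    exact (h.dx_dx_glued hx hy).deriv
  · refine h.square.cont_xx.congr ?_
    rintro ⟨x, y⟩ ⟨hx, hy⟩
    exact h.caputoY_glued hx hy

lemma memW_glued (h : GlueData l τ Φ ψ χ U Ux Uy Uxx) : MemW l (glued τ Φ ψ χ U) where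
  cont := h.continuousOn_glued.mono closure_Ω_subset
  c1 := by
    have : ContDiffOn ℝ 1 (glued τ Φ ψ χ U) (Ω₁ ∪ upper) :=
      ContDiffOn.union_of_isOpen (h.wave_lower.1.of_le one_le_two) h.contDiffOn_upper isOpen_Ω₁
        isOpen_upper
    exact this.mono Ω_diff_AB_subset
  c2Caputo := h.isC2Caputo_glued
  c2_Ω₁ := h.wave_lower.1
  c2_Ω₂ := h.wave_left.1
  c2_Ω₃ := h.wave_right.1

/-- From above the Caputo derivative is U_xx, which tends to τ''. From below d'Alembert's formula
gives Φ'((x+1)/2) - τ'(x). The field `ode` equates the two. -/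
lemma gluing (h : GlueData l τ Φ ψ χ U Ux Uy Uxx) {x : ℝ} (hx : x ∈ Ioo (0 : ℝ) 1) :
    Tendsto (fun y => caputoY l (glued τ Φ ψ χ U) (x, y)) (𝓝[>] 0) (𝓝 (deriv (deriv τ) x)) ∧
    Tendsto (fun y => dy (glued τ Φ ψ χ U) (x, y)) (𝓝[<] 0) (𝓝 (deriv (deriv τ) x)) := by
  constructor
  · refine (h.square.tendsto x hx).congr' ?_
    filter_upwards [Ioo_mem_nhdsGT (zero_lt_one (α := ℝ))] with y hy
    exact (h.caputoY_glued hx hy).symm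
  · have hΦd : ∀ s : ℝ, HasDerivAt (fun s => Φ ((s + 1) / 2)) (deriv Φ ((s + 1) / 2) / 2) s := by
      intro s
      have := HasDerivAt.comp s ((h.hΦ.differentiable one_ne_zero ((s + 1) / 2)).hasDerivAt)
        (((hasDerivAt_id s).add_const 1).div_const 2)
      refine this.congr_deriv ?_
      ring
    have hτd : ∀ s : ℝ, HasDerivAt (fun s => τ s - Φ ((s + 1) / 2))
        (deriv τ s - deriv Φ ((s + 1) / 2) / 2) s := fun s =>
      ((h.hτ.differentiable two_ne_zero s).hasDerivAt).sub (hΦd s)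
    have hΦ' := h.hΦ.continuous_deriv le_rfl
    have hτ' := h.hτ.continuous_deriv one_le_two
    have hc : Continuous fun y => deriv Φ ((x + y + 1) / 2) / 2 -
        (deriv τ (x - y) - deriv Φ ((x - y + 1) / 2) / 2) := by fun_prop
    have hlim := (hc.tendsto 0).mono_left (nhdsWithin_le_nhds (s := Iio 0))
    have hval : deriv Φ ((x + 0 + 1) / 2) / 2 - (deriv τ (x - 0) - deriv Φ ((x - 0 + 1) / 2) / 2) =
        deriv (deriv τ) x := by
      rw [h.ode, add_zero, sub_zero]
      ring
    rw [hval] at hlim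
    refine hlim.congr' ?_
    have hm : 0 < min x (1 - x) := lt_min hx.1 (by linarith [hx.2])
    filter_upwards [Ioo_mem_nhdsLT (show -min x (1 - x) < 0 by linarith)] with y hy
    have hz : (x, y) ∈ Ω₁ :=
      ⟨hy.2, by simp only; linarith [hy.1, min_le_left x (1 - x)],
        by simp only; linarith [hy.1, min_le_right x (1 - x)]⟩
    rw [h.wave_lower.2.2 _ hz, (hΦd _).deriv, (hτd _).deriv]

theorem isSolution_glued (h : GlueData l τ Φ ψ χ U Ux Uy Uxx) {a₁ a₂ a₃ φ₁ φ₂ : ℝ → ℝ}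
    (hnl : ∀ t ∈ Icc (0 : ℝ) (1 / 2),
      a₁ t * ψ t + a₂ t * (Φ (1 / 2) + (τ (2 * t) - Φ ((2 * t + 1) / 2))) = a₃ t)
    (hφ₁ : EqOn Φ φ₁ (Icc (1 / 2) 1)) (hφ₂ : EqOn χ φ₂ (Icc 0 (1 / 2))) :
    IsSolution l a₁ a₂ a₃ φ₁ φ₂ (glued τ Φ ψ χ U) where
  memW := h.memW_glued
  eq_parabolic := by
    rw [Ω₀_eq]
    rintro ⟨x, y⟩ ⟨hx, hy⟩
    rw [h.caputoY_glued hx hy, dx, (h.dx_dx_glued hx hy).deriv, sub_self]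
  eq_hyperbolic := by
    rintro z ((hz | hz) | hz)
    · exact h.wave_lower.2.1 z hz
    · exact h.wave_left.2 z hz
    · exact h.wave_right.2 z hz
  nonlocal := by
    intro t ht
    have e1 : glued τ Φ ψ χ U (-t, t) = ψ t := by
      rw [glued_left ⟨by simpa using ht.1, by simp, by simp only; linarith [ht.2]⟩, leftSol]
      simp only [neg_add_cancel, zero_div, h.square.init 0 ⟨le_rfl, zero_le_one⟩, h.left]
      rw [show -(-t - t) / 2 = t by ring]
      ring
    have e2 : glued τ Φ ψ χ U (t, -t) = Φ (1 / 2) + (τ (2 * t) - Φ ((2 * t + 1) / 2)) := by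
      rw [h.glued_lower ⟨by simpa using ht.1, by simp, by simp only; linarith [ht.2]⟩, lowerSol]
      simp only [add_neg_cancel, zero_add]
      rw [show t - -t = 2 * t by ring]
    rw [e1, e2, hnl t ht]
  on_CB := by
    intro x hx
    rw [h.glued_lower ⟨by simp only; linarith [hx.2], by simp only; linarith [hx.1],
      by simp only; linarith⟩, lowerSol, ← hφ₁ hx]
    simp only [sub_sub_cancel]
    rw [show (x + (x - 1) + 1) / 2 = x by ring, show ((1 : ℝ) + 1) / 2 = 1 by norm_num, h.corner]
    ring
  on_BE := by
    intro y hy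
    rw [glued_right ⟨by simp only; linarith [hy.1], by simp only; linarith,
      by simp only; linarith [hy.2]⟩, rightSol, ← hφ₂ hy]
    simp only [add_sub_cancel_right, sub_self, zero_div]
    rw [show (1 + y + y - 1) / 2 = y by ring, h.square.init 1 ⟨zero_le_one, le_rfl⟩, h.right]
    ring
  gluing := fun x hx => ⟨_, h.gluing hx⟩

end GlueData

theorem exists_isSolution (lam : ℝ) (hlam₀ : 0 < lam) (hlam₁ : lam ≤ 1)
    (a₁ a₂ a₃ φ₁ φ₂ : ℝ → ℝ)
    (ha₁ : ContDiffOn ℝ 1 a₁ (Icc 0 (1 / 2)) ∧ ContDiffOn ℝ 2 a₁ (Ioo 0 (1 / 2)))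
    (ha₂ : ContDiffOn ℝ 1 a₂ (Icc 0 (1 / 2)) ∧ ContDiffOn ℝ 2 a₂ (Ioo 0 (1 / 2)))
    (ha₃ : ContDiffOn ℝ 1 a₃ (Icc 0 (1 / 2)) ∧ ContDiffOn ℝ 2 a₃ (Ioo 0 (1 / 2)))
    (hφ₂ : ContDiffOn ℝ 1 φ₂ (Icc 0 (1 / 2)) ∧ ContDiffOn ℝ 2 φ₂ (Ioo 0 (1 / 2)))
    (hφ₁ : ContDiffOn ℝ 1 φ₁ (Icc (1 / 2) 1) ∧ ContDiffOn ℝ 2 φ₁ (Ioo (1 / 2) 1))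
    (hcompat : φ₁ 1 = φ₂ 0)
    (ha₁_ne : ∀ t ∈ Icc (0 : ℝ) (1 / 2), a₁ t ≠ 0)
    (ha_ne : a₁ 0 + a₂ 0 ≠ 0) : ∃ u : ℝ × ℝ → ℝ, IsSolution lam a₁ a₂ a₃ φ₁ φ₂ u := by
  have h0 : (0 : ℝ) ∈ Icc (0 : ℝ) (1 / 2) := ⟨le_rfl, by norm_num⟩
  obtain ⟨Φ, hΦ, hΦe⟩ := exists_contDiff_extension (by norm_num) hφ₁.1
  obtain ⟨χ, hχ, hχe⟩ := exists_contDiff_extension (by norm_num) hφ₂.1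
  have hΦ₂ : ContDiffOn ℝ 2 Φ (Ioo (1 / 2) 1) := hφ₁.2.congr fun t ht => hΦe ⟨ht.1.le, ht.2.le⟩
  have hχ₂ : ContDiffOn ℝ 2 χ (Ioo 0 (1 / 2)) := hφ₂.2.congr fun t ht => hχe ⟨ht.1.le, ht.2.le⟩
  have hG : ContDiff ℝ 1 fun x : ℝ => 2 * Φ ((x + 1) / 2) :=
    contDiff_const.mul (hΦ.comp (by fun_prop))
  -- The left end value is forced by the non-local condition at t = 0, where both arguments of u are
  -- the corner A. The factor 2 in G compensates the inner derivative of (x + 1)/2.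
  obtain ⟨τ, hτ, hτ0, hτ1, hode⟩ := exists_ode_solution hG (a₃ 0 / (a₁ 0 + a₂ 0)) (Φ 1)
  have hode' : ∀ x, deriv (deriv τ) x = deriv Φ ((x + 1) / 2) - deriv τ x := by
    intro x
    rw [hode]
    congr 1
    have := HasDerivAt.comp x ((hΦ.differentiable one_ne_zero ((x + 1) / 2)).hasDerivAt)
      (((hasDerivAt_id x).add_const 1).div_const 2)
    refine ((this.const_mul 2).congr_deriv ?_).deriv
    ring
  -- K(t) is the value at (t, -t) of the solution in the lower triangle; the non-local condition is
  -- then solved for the values ψ on `AD`, dividing by a₁.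
  set K : ℝ → ℝ := fun t => Φ (1 / 2) + (τ (2 * t) - Φ ((2 * t + 1) / 2)) with hK
  have hτc : ContDiff ℝ 2 fun t : ℝ => τ (2 * t) := hτ.comp (by fun_prop)
  have hK1 : ContDiff ℝ 1 K :=
    contDiff_const.add ((hτc.of_le one_le_two).sub (hΦ.comp (by fun_prop)))
  have hK2 : ContDiffOn ℝ 2 K (Ioo 0 (1 / 2)) := by
    refine contDiffOn_const.add (hτc.contDiffOn.sub ?_)
    exact hΦ₂.comp (f := fun t : ℝ => (2 * t + 1) / 2) (by fun_prop)
      fun t ht => ⟨by linarith [ht.1], by linarith [ht.2]⟩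
  have hψ₁ : ContDiffOn ℝ 1 (fun t => (a₃ t - a₂ t * K t) / a₁ t) (Icc 0 (1 / 2)) :=
    (ha₃.1.sub (ha₂.1.mul hK1.contDiffOn)).div ha₁.1 ha₁_ne
  obtain ⟨ψ, hψ, hψe⟩ := exists_contDiff_extension (by norm_num) hψ₁
  have hψ₂ : ContDiffOn ℝ 2 ψ (Ioo 0 (1 / 2)) :=
    ((ha₃.2.sub (ha₂.2.mul hK2)).div ha₁.2 fun t ht => ha₁_ne t ⟨ht.1.le, ht.2.le⟩).congr
      fun t ht => hψe ⟨ht.1.le, ht.2.le⟩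
  have hdc : ∀ {f : ℝ → ℝ}, ContDiff ℝ 1 f → ContDiffOn ℝ 2 f (Ioo 0 (1 / 2)) →
      Continuous (fun y => deriv f (y / 2)) ∧
        ContDiffOn ℝ 1 (fun y => deriv f (y / 2)) (Ioo 0 1) := by
    intro f hf hf2
    refine ⟨(hf.continuous_deriv le_rfl).comp (by fun_prop), ?_⟩
    have h2 : ContDiffOn ℝ (1 + 1) f (Ioo 0 (1 / 2)) := by exact_mod_cast hf2
    rw [contDiffOn_succ_iff_deriv_of_isOpen isOpen_Ioo] at h2
    exact h2.2.2.comp (f := fun y : ℝ => y / 2) (by fun_prop)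
      fun t ht => ⟨by linarith [ht.1], by linarith [ht.2]⟩
  obtain ⟨U, Ux, Uy, Uxx, hU⟩ := exists_squareSolution hlam₀ hlam₁ hτ (hdc hψ hψ₂).1
    (hdc hχ hχ₂).1 (hdc hψ hψ₂).2 (hdc hχ hχ₂).2
  have hK0 : K 0 = τ 0 := by
    simp only [hK, mul_zero, zero_add]
    ring
  have hglue : GlueData lam τ Φ ψ χ U Ux Uy Uxx :=
    { le_one := hlam₁, hτ := hτ, hΦ := hΦ, hΦ₂ := hΦ₂, hψ := hψ, hψ₂ := hψ₂,
      hχ := hχ, hχ₂ := hχ₂, ode := hode', square := hU, corner := hτ1.symm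
      left := by
        rw [hψe h0]
        simp only [hK0, hτ0]
        have := ha₁_ne 0 h0
        field_simp
        ring
      right := by rw [hτ1, hχe h0, ← hcompat, hΦe ⟨by norm_num, le_rfl⟩] }
  refine ⟨_, hglue.isSolution_glued (fun t ht => ?_) hΦe hχe⟩
  rw [hψe ht]
  have := ha₁_ne t ht
  simp only [hK]
  field_simp
  ring

/-! ### The wave equation along characteristics -/

lemma hasDerivAt_line {u : ℝ × ℝ → ℝ} {z d : ℝ × ℝ} {s : ℝ} (h : DifferentiableAt ℝ u (z + s • d)) :
    HasDerivAt (fun t : ℝ => u (z + t • d)) (fderiv ℝ u (z + s • d) d) s := by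
  have h1 : HasDerivAt (fun t : ℝ => z + t • d) d s := by
    simpa using ((hasDerivAt_id s).smul_const d).const_add z
  exact h.hasFDerivAt.comp_hasDerivAt s h1

lemma dx_eq_fderiv {u : ℝ × ℝ → ℝ} {z : ℝ × ℝ} (h : DifferentiableAt ℝ u z) :
    dx u z = fderiv ℝ u z (1, 0) := by
  have h1 : HasDerivAt (fun s : ℝ => (s, z.2)) ((1 : ℝ), (0 : ℝ)) z.1 :=
    (hasDerivAt_id z.1).prodMk (hasDerivAt_const z.1 z.2)
  exact (HasFDerivAt.comp_hasDerivAt (l := u) z.1 (f := fun s : ℝ => (s, z.2)) h.hasFDerivAt h1).deriv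

lemma dy_eq_fderiv {u : ℝ × ℝ → ℝ} {z : ℝ × ℝ} (h : DifferentiableAt ℝ u z) :
    dy u z = fderiv ℝ u z (0, 1) := by
  have h1 : HasDerivAt (fun t : ℝ => (z.1, t)) ((0 : ℝ), (1 : ℝ)) z.2 :=
    (hasDerivAt_const z.2 z.1).prodMk (hasDerivAt_id z.2)
  exact (HasFDerivAt.comp_hasDerivAt (l := u) z.2 (f := fun t : ℝ => (z.1, t)) h.hasFDerivAt h1).deriv

lemma deriv_congr_dx {f g : ℝ × ℝ → ℝ} {D : Set (ℝ × ℝ)} (hD : IsOpen D) (h : EqOn f g D)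
    {z : ℝ × ℝ} (hz : z ∈ D) : dx f z = dx g z := by
  refine EventuallyEq.deriv_eq ?_
  have : ∀ᶠ s in 𝓝 z.1, (s, z.2) ∈ D :=
    (Continuous.prodMk_left z.2).continuousAt.preimage_mem_nhds (hD.mem_nhds hz)
  filter_upwards [this] with s hs using h hs

lemma deriv_congr_dy {f g : ℝ × ℝ → ℝ} {D : Set (ℝ × ℝ)} (hD : IsOpen D) (h : EqOn f g D)
    {z : ℝ × ℝ} (hz : z ∈ D) : dy f z = dy g z := by
  refine EventuallyEq.deriv_eq ?_
  have : ∀ᶠ t in 𝓝 z.2, (z.1, t) ∈ D :=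
    (Continuous.prodMk_right z.1).continuousAt.preimage_mem_nhds (hD.mem_nhds hz)
  filter_upwards [this] with t ht using h ht

/-- The mixed derivative of a solution of the wave equation along the two characteristic directions
vanishes. -/
lemma fderiv_characteristic {u : ℝ × ℝ → ℝ} {D : Set (ℝ × ℝ)} (hD : IsOpen D)
    (hu : ContDiffOn ℝ 2 u D) (hw : ∀ z ∈ D, dx (dx u) z - dy (dy u) z = 0) {z : ℝ × ℝ}
    (hz : z ∈ D) :
    DifferentiableAt ℝ (fun p => fderiv ℝ u p (1, -1)) z ∧
      fderiv ℝ (fun p => fderiv ℝ u p (1, -1)) z (1, 1) = 0 := by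
  have hud : ∀ p ∈ D, DifferentiableAt ℝ u p := fun p hp =>
    (hu.differentiableOn two_ne_zero p hp).differentiableAt (hD.mem_nhds hp)
  have hF : DifferentiableAt ℝ (fderiv ℝ u) z := by
    have h2 : ContDiffOn ℝ (1 + 1) u D := by exact_mod_cast hu
    rw [contDiffOn_succ_iff_fderiv_of_isOpen hD] at h2
    exact (h2.2.2.differentiableOn one_ne_zero z hz).differentiableAt (hD.mem_nhds hz)
  have hFd : ∀ d : ℝ × ℝ, HasFDerivAt (fun p => fderiv ℝ u p d)
      ((ContinuousLinearMap.apply ℝ ℝ d).comp (fderiv ℝ (fderiv ℝ u) z)) z := fun d =>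
    (ContinuousLinearMap.apply ℝ ℝ d).hasFDerivAt.comp z hF.hasFDerivAt
  have hval : ∀ d e : ℝ × ℝ, fderiv ℝ (fun p => fderiv ℝ u p d) z e =
      fderiv ℝ (fderiv ℝ u) z e d := by
    intro d e
    rw [(hFd d).fderiv]
    rfl
  have hsymm : IsSymmSndFDerivAt ℝ u z :=
    (hu.contDiffAt (hD.mem_nhds hz)).isSymmSndFDerivAt (by simp)
  have hxx : dx (dx u) z = fderiv ℝ (fderiv ℝ u) z (1, 0) (1, 0) := by
    rw [deriv_congr_dx hD (g := fun p => fderiv ℝ u p (1, 0)) (fun p hp => dx_eq_fderiv (hud p hp))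
      hz, dx_eq_fderiv (hFd _).differentiableAt, hval]
  have hyy : dy (dy u) z = fderiv ℝ (fderiv ℝ u) z (0, 1) (0, 1) := by
    rw [deriv_congr_dy hD (g := fun p => fderiv ℝ u p (0, 1)) (fun p hp => dy_eq_fderiv (hud p hp))
      hz, dy_eq_fderiv (hFd _).differentiableAt, hval]
  refine ⟨(hFd _).differentiableAt, ?_⟩
  have h1 := hw z hz
  rw [hxx, hyy] at h1
  have h2 := hsymm (1, 0) (0, 1)
  rw [hval, show ((1 : ℝ), (1 : ℝ)) = (1, 0) + (0, 1) by simp,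
    show ((1 : ℝ), (-1 : ℝ)) = (1, 0) - (0, 1) by simp, map_add, map_sub,
    _root_.add_apply, _root_.add_apply]
  linarith

lemma eq_of_deriv_zero_unit {f : ℝ → ℝ} (h : ∀ s ∈ Icc (0 : ℝ) 1, HasDerivAt f 0 s) : f 1 = f 0 := by
  have := constant_of_has_deriv_right_zero (f := f) (a := 0) (b := 1)
    (fun s hs => (h s hs).continuousAt.continuousWithinAt)
    (fun s hs => (h s ⟨hs.1, hs.2.le⟩).hasDerivWithinAt)
  exact this 1 ⟨zero_le_one, le_rfl⟩

/-- Since the mixed characteristic derivative vanishes, the derivative in the direction (1,-1) is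
the same on two opposite sides of the parallelogram; integrating it along them gives the identity.
Convexity keeps the parallelogram inside D. -/
lemma parallelogram_open {u : ℝ × ℝ → ℝ} {D : Set (ℝ × ℝ)} (hD : IsOpen D) (hc : Convex ℝ D)
    (hu : ContDiffOn ℝ 2 u D) (hw : ∀ z ∈ D, dx (dx u) z - dy (dy u) z = 0) {z : ℝ × ℝ} {r s : ℝ}
    (h₀ : z ∈ D) (h₁ : z + r • ((1 : ℝ), (1 : ℝ)) ∈ D) (h₂ : z + s • ((1 : ℝ), (-1 : ℝ)) ∈ D)
    (h₃ : z + r • ((1 : ℝ), (1 : ℝ)) + s • ((1 : ℝ), (-1 : ℝ)) ∈ D) :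
    u z + u (z + r • ((1 : ℝ), (1 : ℝ)) + s • ((1 : ℝ), (-1 : ℝ))) =
      u (z + r • ((1 : ℝ), (1 : ℝ))) + u (z + s • ((1 : ℝ), (-1 : ℝ))) := by
  set e : ℝ × ℝ := (1, 1) with he
  set f : ℝ × ℝ := (1, -1) with hf
  have hud : ∀ p ∈ D, DifferentiableAt ℝ u p := fun p hp =>
    (hu.differentiableOn two_ne_zero p hp).differentiableAt (hD.mem_nhds hp)
  have hmem : ∀ ρ ∈ Icc (0 : ℝ) 1, ∀ σ ∈ Icc (0 : ℝ) 1, z + σ • (s • f) + ρ • (r • e) ∈ D := by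
    intro ρ hρ σ hσ
    have a1 : (1 - σ) • z + σ • (z + s • f) ∈ D :=
      hc h₀ h₂ (by linarith [hσ.2]) hσ.1 (by ring)
    have a2 : (1 - σ) • (z + r • e) + σ • (z + r • e + s • f) ∈ D :=
      hc h₁ h₃ (by linarith [hσ.2]) hσ.1 (by ring)
    have a3 := hc a1 a2 (show 0 ≤ 1 - ρ by linarith [hρ.2]) hρ.1 (by ring)
    convert a3 using 1
    module
  have hq : ∀ σ ∈ Icc (0 : ℝ) 1,
      fderiv ℝ u (z + σ • (s • f) + r • e) f = fderiv ℝ u (z + σ • (s • f)) f := by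
    intro σ hσ
    have := eq_of_deriv_zero_unit
      (f := fun ρ : ℝ => fderiv ℝ u (z + σ • (s • f) + ρ • (r • e)) f) fun ρ hρ => by
        have h4 := fderiv_characteristic hD hu hw (hmem ρ hρ σ hσ)
        have h5 := hasDerivAt_line (u := fun p => fderiv ℝ u p f) (z := z + σ • (s • f))
          (d := r • e) (s := ρ) h4.1
        refine h5.congr_deriv ?_
        rw [map_smul, h4.2, smul_zero]
    simpa using this
  have hm1 : ∀ σ ∈ Icc (0 : ℝ) 1, z + r • e + σ • (s • f) ∈ D := by
    intro σ hσ
    have := hmem 1 ⟨zero_le_one, le_rfl⟩ σ hσ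
    rw [one_smul] at this
    convert this using 1
    module
  have hm0 : ∀ σ ∈ Icc (0 : ℝ) 1, z + σ • (s • f) ∈ D := by
    intro σ hσ
    have := hmem 0 ⟨le_rfl, zero_le_one⟩ σ hσ
    rwa [zero_smul, add_zero] at this
  have := eq_of_deriv_zero_unit
    (f := fun σ : ℝ => u (z + r • e + σ • (s • f)) - u (z + σ • (s • f))) fun σ hσ => by
      have h4 := (hasDerivAt_line (hud _ (hm1 σ hσ))).sub (hasDerivAt_line (hud _ (hm0 σ hσ)))
      refine h4.congr_deriv ?_
      rw [map_smul, map_smul, ← smul_sub,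
        show z + r • e + σ • (s • f) = z + σ • (s • f) + r • e by module, hq σ hσ, sub_self,
        smul_zero]
  simp only [one_smul, zero_smul, add_zero] at this
  linarith

/-- The parallelogram law for the wave equation, up to the boundary. -/
lemma parallelogram {u : ℝ × ℝ → ℝ} {D : Set (ℝ × ℝ)} (hD : IsOpen D) (hc : Convex ℝ D)
    (hne : D.Nonempty) (hcont : ContinuousOn u (closure D))
    (hu : ContDiffOn ℝ 2 u D) (hw : ∀ z ∈ D, dx (dx u) z - dy (dy u) z = 0) {z : ℝ × ℝ} {r s : ℝ}
    (h₀ : z ∈ closure D) (h₁ : z + r • ((1 : ℝ), (1 : ℝ)) ∈ closure D)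
    (h₂ : z + s • ((1 : ℝ), (-1 : ℝ)) ∈ closure D)
    (h₃ : z + r • ((1 : ℝ), (1 : ℝ)) + s • ((1 : ℝ), (-1 : ℝ)) ∈ closure D) :
    u z + u (z + r • ((1 : ℝ), (1 : ℝ)) + s • ((1 : ℝ), (-1 : ℝ))) =
      u (z + r • ((1 : ℝ), (1 : ℝ))) + u (z + s • ((1 : ℝ), (-1 : ℝ))) := by
  obtain ⟨c, hcD⟩ := hne
  set e : ℝ × ℝ := (1, 1) with he
  set f : ℝ × ℝ := (1, -1) with hf
  -- Contracting towards an interior point c sends the closed parallelogram to one inside D with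
  -- sides scaled by 1 - ε; continuity then gives the limit.
  have hin : ∀ p ∈ closure D, ∀ ε ∈ Ioo (0 : ℝ) 1, (1 - ε) • p + ε • c ∈ D := by
    intro p hp ε hε
    have := hc.combo_closure_interior_mem_interior hp (by rwa [hD.interior_eq])
      (show 0 ≤ 1 - ε by linarith [hε.2]) hε.1 (by ring)
    rwa [hD.interior_eq] at this
  have hlim : ∀ p ∈ closure D,
      Tendsto (fun ε : ℝ => u ((1 - ε) • p + ε • c)) (𝓝[>] 0) (𝓝 (u p)) := by
    intro p hp
    refine (hcont p hp).tendsto.comp ?_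
    rw [tendsto_nhdsWithin_iff]
    constructor
    · have h4 : Continuous fun ε : ℝ => (1 - ε) • p + ε • c := by fun_prop
      have h5 := h4.tendsto 0
      simp only [sub_zero, one_smul, zero_smul, add_zero] at h5
      exact h5.mono_left nhdsWithin_le_nhds
    · filter_upwards [Ioo_mem_nhdsGT (zero_lt_one (α := ℝ))] with ε hε
      exact subset_closure (hin p hp ε hε)
  refine tendsto_nhds_unique ((hlim _ h₀).add (hlim _ h₃)) (((hlim _ h₁).add (hlim _ h₂)).congr' ?_)
  filter_upwards [Ioo_mem_nhdsGT (zero_lt_one (α := ℝ))] with ε hε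
  have e1 : (1 - ε) • (z + r • e) + ε • c = (1 - ε) • z + ε • c + ((1 - ε) * r) • e := by module
  have e2 : (1 - ε) • (z + s • f) + ε • c = (1 - ε) • z + ε • c + ((1 - ε) * s) • f := by module
  have e3 : (1 - ε) • (z + r • e + s • f) + ε • c =
      (1 - ε) • z + ε • c + ((1 - ε) * r) • e + ((1 - ε) * s) • f := by module
  have m0 := hin _ h₀ ε hε
  have m1 := hin _ h₁ ε hε
  have m2 := hin _ h₂ ε hε
  have m3 := hin _ h₃ ε hε
  rw [e1] at m1 ⊢
  rw [e2] at m2 ⊢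
  rw [e3] at m3 ⊢
  exact (parallelogram_open hD hc hu hw m0 m1 m2 m3).symm

/-! ### The difference of two solutions -/

lemma caputo_sub {l : ℝ} (hl : 0 < l) {f g : ℝ → ℝ} {y : ℝ} (hy : 0 < y) (hf : CaputoExists l f y)
    (hg : CaputoExists l g y) :
    CaputoExists l (fun t => f t - g t) y ∧
      caputo l (fun t => f t - g t) y = caputo l f y - caputo l g y := by
  by_cases h : l = 1
  · simp only [CaputoExists, caputo, if_pos h] at hf hg ⊢
    exact ⟨hf.sub hg, (hf.hasDerivAt.sub hg.hasDerivAt).deriv⟩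
  · simp only [CaputoExists, caputo, if_neg h] at hf hg ⊢
    have he : ∀ t ∈ uIoc 0 y, (y - t) ^ (-l) * deriv f t - (y - t) ^ (-l) * deriv g t =
        (y - t) ^ (-l) * deriv (fun t => f t - g t) t := by
      intro t ht
      rw [uIoc_of_le hy.le] at ht
      rcases ht.2.lt_or_eq with h1 | rfl
      · have h2 : deriv (fun t => f t - g t) t = deriv f t - deriv g t :=
          ((hf.1 t ⟨ht.1, h1⟩).hasDerivAt.sub (hg.1 t ⟨ht.1, h1⟩).hasDerivAt).deriv
        rw [h2, mul_sub]
      -- At t = y the weight `0 ^ (-l)` is zero by convention, so differentiability at the end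
      -- point, which `CaputoExists` does not supply, is not needed.
      · simp [Real.zero_rpow (neg_ne_zero.2 hl.ne')]
    refine ⟨⟨fun t ht => (hf.1 t ht).sub (hg.1 t ht), (hf.2.sub hg.2).congr he⟩, ?_⟩
    rw [← mul_sub, ← intervalIntegral.integral_sub hf.2 hg.2]
    congr 1
    refine (intervalIntegral.integral_congr_ae (ae_of_all _ he)).symm

lemma dx_sub_eqOn {f g : ℝ × ℝ → ℝ} {D : Set (ℝ × ℝ)}
    (hf : ∀ p ∈ D, DifferentiableAt ℝ (fun s => f (s, p.2)) p.1)
    (hg : ∀ p ∈ D, DifferentiableAt ℝ (fun s => g (s, p.2)) p.1) :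
    EqOn (dx fun p => f p - g p) (fun p => dx f p - dx g p) D := fun p hp =>
  ((hf p hp).hasDerivAt.sub (hg p hp).hasDerivAt).deriv

lemma dy_sub_eqOn {f g : ℝ × ℝ → ℝ} {D : Set (ℝ × ℝ)}
    (hf : ∀ p ∈ D, DifferentiableAt ℝ (fun t => f (p.1, t)) p.2)
    (hg : ∀ p ∈ D, DifferentiableAt ℝ (fun t => g (p.1, t)) p.2) :
    EqOn (dy fun p => f p - g p) (fun p => dy f p - dy g p) D := fun p hp =>
  ((hf p hp).hasDerivAt.sub (hg p hp).hasDerivAt).deriv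

lemma IsC2Caputo.sub {l : ℝ} (hl : 0 < l) {f g : ℝ × ℝ → ℝ} (hf : IsC2Caputo l f)
    (hg : IsC2Caputo l g) :
    IsC2Caputo l (fun p => f p - g p) ∧
      (∀ p ∈ Ω₀, dx (dx fun p => f p - g p) p = dx (dx f) p - dx (dx g) p) ∧
      ∀ p ∈ Ω₀, caputoY l (fun p => f p - g p) p = caputoY l f p - caputoY l g p := by
  have h1 := dx_sub_eqOn hf.diff_x hg.diff_x
  have h2 : EqOn (dx (dx fun p => f p - g p)) (fun p => dx (dx f) p - dx (dx g) p) Ω₀ := fun p hp =>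
    (deriv_congr_dx isOpen_Ω₀ h1 hp).trans (dx_sub_eqOn hf.diff_xx hg.diff_xx hp)
  have h3 : ∀ p ∈ Ω₀, _ := fun p hp =>
    caputo_sub hl hp.2.2.1 (hf.caputo_exists p hp) (hg.caputo_exists p hp)
  refine ⟨⟨fun p hp => (hf.diff_x p hp).sub (hg.diff_x p hp), fun p hp => ?_, fun p hp => (h3 p hp).1,
    hf.cont.sub hg.cont, (hf.cont_x.sub hg.cont_x).congr h1, (hf.cont_xx.sub hg.cont_xx).congr h2,
    (hf.cont_caputo.sub hg.cont_caputo).congr fun p hp => (h3 p hp).2⟩, h2, fun p hp => (h3 p hp).2⟩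
  refine ((hf.diff_xx p hp).sub (hg.diff_xx p hp)).congr_of_eventuallyEq ?_
  have : ∀ᶠ s in 𝓝 p.1, (s, p.2) ∈ Ω₀ :=
    (Continuous.prodMk_left p.2).continuousAt.preimage_mem_nhds (isOpen_Ω₀.mem_nhds hp)
  filter_upwards [this] with s hs using h1 hs

lemma differentiableAt_partials {f : ℝ × ℝ → ℝ} {z : ℝ × ℝ} (h : DifferentiableAt ℝ f z) :
    DifferentiableAt ℝ (fun s => f (s, z.2)) z.1 ∧ DifferentiableAt ℝ (fun t => f (z.1, t)) z.2 := by
  constructor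
  · exact DifferentiableAt.comp (g := f) (f := fun s : ℝ => (s, z.2)) z.1 h (by fun_prop)
  · exact DifferentiableAt.comp (g := f) (f := fun s : ℝ => (z.1, s)) z.2 h (by fun_prop)

lemma partials_of_contDiffOn_two {f : ℝ × ℝ → ℝ} {D : Set (ℝ × ℝ)} (hD : IsOpen D)
    (hf : ContDiffOn ℝ 2 f D) :
    (∀ p ∈ D, DifferentiableAt ℝ f p) ∧ (∀ p ∈ D, DifferentiableAt ℝ (dx f) p) ∧
      ∀ p ∈ D, DifferentiableAt ℝ (dy f) p := by
  have hd : ∀ p ∈ D, DifferentiableAt ℝ f p := fun p hp =>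
    (hf.differentiableOn two_ne_zero p hp).differentiableAt (hD.mem_nhds hp)
  have hF : ∀ p ∈ D, DifferentiableAt ℝ (fderiv ℝ f) p := fun p hp => by
    have h2 : ContDiffOn ℝ (1 + 1) f D := by exact_mod_cast hf
    rw [contDiffOn_succ_iff_fderiv_of_isOpen hD] at h2
    exact (h2.2.2.differentiableOn one_ne_zero p hp).differentiableAt (hD.mem_nhds hp)
  refine ⟨hd, fun p hp => ?_, fun p hp => ?_⟩
  · refine ((hF p hp).clm_apply (differentiableAt_const ((1 : ℝ), (0 : ℝ)))).congr_of_eventuallyEq ?_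
    filter_upwards [hD.mem_nhds hp] with q hq using dx_eq_fderiv (hd q hq)
  · refine ((hF p hp).clm_apply (differentiableAt_const ((0 : ℝ), (1 : ℝ)))).congr_of_eventuallyEq ?_
    filter_upwards [hD.mem_nhds hp] with q hq using dy_eq_fderiv (hd q hq)

lemma wave_sub {f g : ℝ × ℝ → ℝ} {D : Set (ℝ × ℝ)} (hD : IsOpen D) (hf : ContDiffOn ℝ 2 f D)
    (hg : ContDiffOn ℝ 2 g D) {p : ℝ × ℝ} (hp : p ∈ D) (hwf : dx (dx f) p - dy (dy f) p = 0)
    (hwg : dx (dx g) p - dy (dy g) p = 0) :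
    dx (dx fun p => f p - g p) p - dy (dy fun p => f p - g p) p = 0 := by
  obtain ⟨f1, f2, f3⟩ := partials_of_contDiffOn_two hD hf
  obtain ⟨g1, g2, g3⟩ := partials_of_contDiffOn_two hD hg
  rw [deriv_congr_dx hD (dx_sub_eqOn (fun p hp => (differentiableAt_partials (f1 p hp)).1)
      fun p hp => (differentiableAt_partials (g1 p hp)).1) hp,
    deriv_congr_dy hD (dy_sub_eqOn (fun p hp => (differentiableAt_partials (f1 p hp)).2)
      fun p hp => (differentiableAt_partials (g1 p hp)).2) hp,
    dx_sub_eqOn (fun p hp => (differentiableAt_partials (f2 p hp)).1)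
      (fun p hp => (differentiableAt_partials (g2 p hp)).1) hp,
    dy_sub_eqOn (fun p hp => (differentiableAt_partials (f3 p hp)).2)
      (fun p hp => (differentiableAt_partials (g3 p hp)).2) hp]
  linarith

/-- The difference of two solutions solves the homogeneous problem. -/
lemma IsSolution.sub {l : ℝ} (hl : 0 < l) {a₁ a₂ a₃ φ₁ φ₂ : ℝ → ℝ} {v u : ℝ × ℝ → ℝ}
    (hv : IsSolution l a₁ a₂ a₃ φ₁ φ₂ v) (hu : IsSolution l a₁ a₂ a₃ φ₁ φ₂ u) :
    IsSolution l a₁ a₂ 0 0 0 (fun p => v p - u p) := by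
  obtain ⟨h1, h2, h3⟩ := hv.memW.c2Caputo.sub hl hu.memW.c2Caputo
  refine ⟨⟨hv.memW.cont.sub hu.memW.cont, hv.memW.c1.sub hu.memW.c1, h1,
    hv.memW.c2_Ω₁.sub hu.memW.c2_Ω₁, hv.memW.c2_Ω₂.sub hu.memW.c2_Ω₂,
    hv.memW.c2_Ω₃.sub hu.memW.c2_Ω₃⟩, ?_, ?_, ?_, ?_, ?_, ?_⟩
  · intro p hp
    rw [h2 p hp, h3 p hp]
    linarith [hv.eq_parabolic p hp, hu.eq_parabolic p hp]
  · intro p hp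
    have e1 := hv.eq_hyperbolic p hp
    have e2 := hu.eq_hyperbolic p hp
    rcases hp with (hp | hp) | hp
    · exact wave_sub isOpen_Ω₁ hv.memW.c2_Ω₁ hu.memW.c2_Ω₁ hp e1 e2
    · exact wave_sub isOpen_Ω₂ hv.memW.c2_Ω₂ hu.memW.c2_Ω₂ hp e1 e2
    · exact wave_sub isOpen_Ω₃ hv.memW.c2_Ω₃ hu.memW.c2_Ω₃ hp e1 e2
  · intro t ht
    simp only [Pi.zero_apply]
    linarith [hv.nonlocal t ht, hu.nonlocal t ht]
  · intro x hx
    simp only [hv.on_CB x hx, hu.on_CB x hx, sub_self, Pi.zero_apply]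
  · intro x hx
    simp only [hv.on_BE x hx, hu.on_BE x hx, sub_self, Pi.zero_apply]
  · intro x hx
    obtain ⟨ν, a, b⟩ := hv.gluing x hx
    obtain ⟨μ, c, d⟩ := hu.gluing x hx
    refine ⟨ν - μ, (a.sub c).congr' ?_, (b.sub d).congr' ?_⟩
    · filter_upwards [Ioo_mem_nhdsGT (zero_lt_one (α := ℝ))] with y hy
      exact (h3 (x, y) ⟨hx.1, hx.2, hy.1, hy.2⟩).symm
    · filter_upwards [Ioo_mem_nhdsLT (show max (-x) (x - 1) < 0 by
        simp only [max_lt_iff]; constructor <;> linarith [hx.1, hx.2])] with y hy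
      have hm : (x, y) ∈ Ω₁ := by
        have h5 := max_lt_iff.1 hy.1
        exact ⟨hy.2, by simp only; linarith [h5.1], by simp only; linarith [h5.2]⟩
      exact (dy_sub_eqOn
        (fun p hp => (differentiableAt_partials
          ((partials_of_contDiffOn_two isOpen_Ω₁ hv.memW.c2_Ω₁).1 p hp)).2)
        (fun p hp => (differentiableAt_partials
          ((partials_of_contDiffOn_two isOpen_Ω₁ hu.memW.c2_Ω₁).1 p hp)).2) hm).symm

/-! ### Closures and convexity of the pieces of the domain -/

lemma mem_closure_of_combo {D : Set (ℝ × ℝ)} {z c : ℝ × ℝ}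
    (h : ∀ ε ∈ Ioo (0 : ℝ) 1, (1 - ε) • z + ε • c ∈ D) : z ∈ closure D := by
  have h4 : Continuous fun ε : ℝ => (1 - ε) • z + ε • c := by fun_prop
  have h5 := h4.tendsto 0
  simp only [sub_zero, one_smul, zero_smul, add_zero] at h5
  refine mem_closure_of_tendsto (h5.mono_left nhdsWithin_le_nhds) (b := 𝓝[>] 0) ?_
  filter_upwards [Ioo_mem_nhdsGT (zero_lt_one (α := ℝ))] with ε hε using h ε hε

lemma lowerTri_subset : lowerTri ⊆ closure Ω₁ := by
  rintro ⟨x, y⟩ ⟨h1, h2, h3⟩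
  simp only at h1 h2 h3
  refine mem_closure_of_combo (c := (1 / 2, -1 / 4)) fun ε hε => ?_
  simp only [Ω₁, mem_ofPred_eq, Prod.smul_mk, Prod.mk_add_mk, smul_eq_mul]
  have h4 : 0 < 1 - ε := by linarith [hε.2]
  have h5 := hε.1
  refine ⟨?_, ?_, ?_⟩ <;>
    nlinarith [mul_nonneg h4.le (neg_nonneg.2 h1), mul_nonneg h4.le h2,
      mul_nonneg h4.le (sub_nonneg.2 h3)]

lemma leftTri_subset : leftTri ⊆ closure Ω₂ := by
  rintro ⟨x, y⟩ ⟨h1, h2, h3⟩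
  simp only at h1 h2 h3
  refine mem_closure_of_combo (c := (-1 / 4, 1 / 2)) fun ε hε => ?_
  simp only [Ω₂, mem_ofPred_eq, Prod.smul_mk, Prod.mk_add_mk, smul_eq_mul]
  have h4 : 0 < 1 - ε := by linarith [hε.2]
  have h5 := hε.1
  refine ⟨?_, ?_, ?_⟩ <;>
    nlinarith [mul_nonneg h4.le (neg_nonneg.2 h1), mul_nonneg h4.le h2,
      mul_nonneg h4.le (sub_nonneg.2 h3)]

lemma rightTri_subset : rightTri ⊆ closure Ω₃ := by
  rintro ⟨x, y⟩ ⟨h1, h2, h3⟩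
  simp only at h1 h2 h3
  refine mem_closure_of_combo (c := (5 / 4, 1 / 2)) fun ε hε => ?_
  simp only [Ω₃, mem_ofPred_eq, Prod.smul_mk, Prod.mk_add_mk, smul_eq_mul]
  have h4 : 0 < 1 - ε := by linarith [hε.2]
  have h5 := hε.1
  refine ⟨?_, ?_, ?_⟩ <;>
    nlinarith [mul_nonneg h4.le (sub_nonneg.2 h1), mul_nonneg h4.le (sub_nonneg.2 h2),
      mul_nonneg h4.le (sub_nonneg.2 h3)]

lemma square_subset : Icc (0 : ℝ) 1 ×ˢ Icc (0 : ℝ) 1 ⊆ closure Ω₀ := by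
  rintro ⟨x, y⟩ ⟨⟨h1, h2⟩, h3, h4⟩
  simp only at h1 h2 h3 h4
  refine mem_closure_of_combo (c := (1 / 2, 1 / 2)) fun ε hε => ?_
  simp only [Ω₀, mem_ofPred_eq, Prod.smul_mk, Prod.mk_add_mk, smul_eq_mul]
  have h6 : 0 < 1 - ε := by linarith [hε.2]
  have h5 := hε.1
  refine ⟨?_, ?_, ?_, ?_⟩ <;>
    nlinarith [mul_nonneg h6.le h1, mul_nonneg h6.le h3, mul_nonneg h6.le (sub_nonneg.2 h2),
      mul_nonneg h6.le (sub_nonneg.2 h4)]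

lemma convex_combo_lt {x y a b c : ℝ} (hx : x < c) (hy : y < c) (ha : 0 ≤ a) (hb : 0 ≤ b)
    (hab : a + b = 1) : a * x + b * y < c := by
  have := convex_Iio (𝕜 := ℝ) c hx hy ha hb hab
  simpa using this

lemma convex_Ω₁ : Convex ℝ Ω₁ := by
  rintro ⟨x, y⟩ ⟨h1, h2, h3⟩ ⟨x', y'⟩ ⟨h1', h2', h3'⟩ a b ha hb hab
  simp only at h1 h2 h3 h1' h2' h3'
  simp only [Ω₁, mem_ofPred_eq, Prod.smul_mk, Prod.mk_add_mk, smul_eq_mul]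
  have e1 := convex_combo_lt h1 h1' ha hb hab
  have e2 := convex_combo_lt (neg_neg_of_pos h2) (neg_neg_of_pos h2') ha hb hab
  have e3 := convex_combo_lt h3 h3' ha hb hab
  refine ⟨?_, ?_, ?_⟩ <;> linarith

lemma convex_Ω₂ : Convex ℝ Ω₂ := by
  rintro ⟨x, y⟩ ⟨h1, h2, h3⟩ ⟨x', y'⟩ ⟨h1', h2', h3'⟩ a b ha hb hab
  simp only at h1 h2 h3 h1' h2' h3'
  simp only [Ω₂, mem_ofPred_eq, Prod.smul_mk, Prod.mk_add_mk, smul_eq_mul]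
  have e1 := convex_combo_lt h1 h1' ha hb hab
  have e2 := convex_combo_lt (neg_neg_of_pos h2) (neg_neg_of_pos h2') ha hb hab
  have e3 := convex_combo_lt h3 h3' ha hb hab
  refine ⟨?_, ?_, ?_⟩ <;> linarith

lemma convex_Ω₃ : Convex ℝ Ω₃ := by
  rintro ⟨x, y⟩ ⟨h1, h2, h3⟩ ⟨x', y'⟩ ⟨h1', h2', h3'⟩ a b ha hb hab
  simp only at h1 h2 h3 h1' h2' h3'
  simp only [Ω₃, mem_ofPred_eq, Prod.smul_mk, Prod.mk_add_mk, smul_eq_mul]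
  have e1 := convex_combo_lt (neg_lt_neg h1) (neg_lt_neg h1') ha hb hab
  have e2 := convex_combo_lt h2 h2' ha hb hab
  have e3 := convex_combo_lt h3 h3' ha hb hab
  refine ⟨?_, ?_, ?_⟩ <;> linarith

lemma Ω₀_subset : Ω₀ ⊆ Ω := fun _ h => by simp [Ω, h]

lemma Ω₁_subset : Ω₁ ⊆ Ω := fun _ h => by simp [Ω, h]

lemma Ω₂_subset : Ω₂ ⊆ Ω := fun _ h => by simp [Ω, h]

lemma Ω₃_subset : Ω₃ ⊆ Ω := fun _ h => by simp [Ω, h]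

lemma upper_subset : upper ⊆ Ω \ AB := by
  rintro ⟨x, y⟩ h
  simp only [upper, mem_ofPred_eq] at h
  obtain ⟨h1, h2, h3, h4, h5, h6⟩ := h
  simp only [Ω, Ω₀, Ω₁, Ω₂, Ω₃, AB, AA₀, BB₀, Set.mem_sdiff, mem_union, mem_ofPred_eq]
  refine ⟨?_, fun h => h1.ne' h.2.2⟩
  rcases lt_trichotomy x 0 with hx | hx | hx
  · simp [hx, h3, h4]
  · simp [hx, h1, h2]
  · rcases lt_trichotomy x 1 with hx' | hx' | hx'
    · simp [hx, hx', h1, h2]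
    · simp [hx', h1, h2]
    · simp [hx', h5, h6]

/-! ### The homogeneous problem in the triangles -/

namespace IsSolution

variable {l : ℝ} {a₁ a₂ : ℝ → ℝ} {w : ℝ × ℝ → ℝ}

lemma continuousOn_square (h : IsSolution l a₁ a₂ 0 0 0 w) :
    ContinuousOn w (Icc (0 : ℝ) 1 ×ˢ Icc (0 : ℝ) 1) :=
  h.memW.cont.mono (square_subset.trans (closure_mono Ω₀_subset))

/-- The parallelogram goes from (x, y) along (1,1) to `AB` and along (1,-1) to `CB`. Its fourth
vertex also lies on `CB`, where the data vanish, so w depends on x - y alone. -/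
lemma eq_lower (h : IsSolution l a₁ a₂ 0 0 0 w) {x y : ℝ} (hz : (x, y) ∈ lowerTri) :
    w (x, y) = w (x - y, 0) := by
  obtain ⟨h1, h2, h3⟩ := hz
  simp only at h1 h2 h3
  have key := parallelogram isOpen_Ω₁ convex_Ω₁ ⟨(1 / 2, -1 / 4), by norm_num [Ω₁]⟩
    (h.memW.cont.mono (closure_mono Ω₁_subset)) h.memW.c2_Ω₁
    (fun z hz => h.eq_hyperbolic z (Or.inl (Or.inl hz))) (z := (x, y)) (r := -y)
    (s := (1 - x + y) / 2)
  have e1 : (x, y) + (-y) • ((1 : ℝ), (1 : ℝ)) = (x - y, 0) := by ext <;> simp; ring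
  have e2 : (x, y) + ((1 - x + y) / 2) • ((1 : ℝ), (-1 : ℝ)) =
      ((1 + x + y) / 2, (1 + x + y) / 2 - 1) := by ext <;> simp <;> ring
  have e3 : (x - y, 0) + ((1 - x + y) / 2) • ((1 : ℝ), (-1 : ℝ)) =
      ((1 + x - y) / 2, (1 + x - y) / 2 - 1) := by ext <;> simp <;> ring
  rw [e1, e2, e3] at key
  have := key (lowerTri_subset ⟨h1, h2, h3⟩)
    (lowerTri_subset ⟨le_rfl, by simp only; linarith, by simp only; linarith⟩)
    (lowerTri_subset ⟨by simp only; linarith, by simp only; linarith, by simp only; linarith⟩)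
    (lowerTri_subset ⟨by simp only; linarith, by simp only; linarith, by simp only; linarith⟩)
  rw [h.on_CB _ ⟨by linarith, by linarith⟩, h.on_CB _ ⟨by linarith, by linarith⟩] at this
  simpa using this

/-- Here two vertices lie on `AD` and one on `AA₀`. The vanishing on `AD` is a separate hypothesis
because it becomes available only once the trace on `AB` is known to be zero. -/
lemma eq_left (h : IsSolution l a₁ a₂ 0 0 0 w) (h0 : ∀ t ∈ Icc (0 : ℝ) (1 / 2), w (-t, t) = 0)
    {x y : ℝ} (hz : (x, y) ∈ leftTri) : w (x, y) = w (0, x + y) := by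
  obtain ⟨h1, h2, h3⟩ := hz
  simp only at h1 h2 h3
  have key := parallelogram isOpen_Ω₂ convex_Ω₂ ⟨(-1 / 4, 1 / 2), by norm_num [Ω₂]⟩
    (h.memW.cont.mono (closure_mono Ω₂_subset)) h.memW.c2_Ω₂
    (fun z hz => h.eq_hyperbolic z (Or.inl (Or.inr hz))) (z := (x, y)) (r := -(x + y) / 2)
    (s := -x)
  have e1 : (x, y) + (-(x + y) / 2) • ((1 : ℝ), (1 : ℝ)) = (-((y - x) / 2), (y - x) / 2) := by
    ext <;> simp <;> ring
  have e2 : (x, y) + (-x) • ((1 : ℝ), (-1 : ℝ)) = (0, x + y) := by ext <;> simp; ring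
  have e3 : (-((y - x) / 2), (y - x) / 2) + (-x) • ((1 : ℝ), (-1 : ℝ)) =
      (-((x + y) / 2), (x + y) / 2) := by ext <;> simp <;> ring
  rw [e1, e2, e3] at key
  have := key (leftTri_subset ⟨h1, h2, h3⟩)
    (leftTri_subset ⟨by simp only; linarith, by simp only; linarith, by simp only; linarith⟩)
    (leftTri_subset ⟨le_rfl, by simp only; linarith, by simp only; linarith⟩)
    (leftTri_subset ⟨by simp only; linarith, by simp only; linarith, by simp only; linarith⟩)
  rw [h0 _ ⟨by linarith, by linarith⟩, h0 _ ⟨by linarith, by linarith⟩] at this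
  simpa using this

lemma eq_right (h : IsSolution l a₁ a₂ 0 0 0 w) {x y : ℝ} (hz : (x, y) ∈ rightTri) :
    w (x, y) = w (1, 1 - x + y) := by
  obtain ⟨h1, h2, h3⟩ := hz
  simp only at h1 h2 h3
  have key := parallelogram isOpen_Ω₃ convex_Ω₃ ⟨(5 / 4, 1 / 2), by norm_num [Ω₃]⟩
    (h.memW.cont.mono (closure_mono Ω₃_subset)) h.memW.c2_Ω₃
    (fun z hz => h.eq_hyperbolic z (Or.inr hz)) (z := (x, y)) (r := 1 - x)
    (s := (1 - x + y) / 2)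
  have e1 : (x, y) + (1 - x) • ((1 : ℝ), (1 : ℝ)) = (1, 1 - x + y) := by ext <;> simp; ring
  have e2 : (x, y) + ((1 - x + y) / 2) • ((1 : ℝ), (-1 : ℝ)) =
      (1 + (x + y - 1) / 2, (x + y - 1) / 2) := by ext <;> simp <;> ring
  have e3 : (1, 1 - x + y) + ((1 - x + y) / 2) • ((1 : ℝ), (-1 : ℝ)) =
      (1 + (1 - x + y) / 2, (1 - x + y) / 2) := by ext <;> simp; ring
  rw [e1, e2, e3] at key
  have := key (rightTri_subset ⟨h1, h2, h3⟩)
    (rightTri_subset ⟨le_rfl, by simp only; linarith, by simp only; linarith⟩)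
    (rightTri_subset ⟨by simp only; linarith, by simp only; linarith, by simp only; linarith⟩)
    (rightTri_subset ⟨by simp only; linarith, by simp only; linarith, by simp only; linarith⟩)
  rw [h.on_BE _ ⟨by linarith, by linarith⟩, h.on_BE _ ⟨by linarith, by linarith⟩] at this
  simpa using this

lemma zero_left_corner (h : IsSolution l a₁ a₂ 0 0 0 w) (ha : a₁ 0 + a₂ 0 ≠ 0) : w (0, 0) = 0 := by
  have := h.nonlocal 0 ⟨le_rfl, by norm_num⟩
  simp only [neg_zero, Pi.zero_apply, ← add_mul] at this
  exact (mul_eq_zero.1 this).resolve_left ha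

lemma zero_right_corner (h : IsSolution l a₁ a₂ 0 0 0 w) : w (1, 0) = 0 := by
  simpa using h.on_CB 1 ⟨by norm_num, le_rfl⟩

end IsSolution

/-! ### Vanishing of the trace on `AB` -/

/-- A polynomial bump on `[α, β]`, vanishing to second order at the ends. -/
def bump (α β s : ℝ) : ℝ := ((s - α) * (β - s)) ^ 2

/-- The derivative of `bump`. -/
def bumpDeriv (α β s : ℝ) : ℝ := 2 * ((s - α) * (β - s)) * (α + β - 2 * s)

/-- The second derivative of `bump`. -/
def bumpDeriv₂ (α β s : ℝ) : ℝ := 2 * (α + β - 2 * s) ^ 2 - 4 * ((s - α) * (β - s))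

lemma hasDerivAt_bump (α β s : ℝ) : HasDerivAt (bump α β) (bumpDeriv α β s) s := by
  have h1 : HasDerivAt (fun s : ℝ => (s - α) * (β - s)) (1 * (β - s) + (s - α) * -1) s :=
    ((hasDerivAt_id s).sub_const α).mul ((hasDerivAt_id s).const_sub β)
  refine (h1.pow 2).congr_deriv ?_
  simp only [bumpDeriv]
  push_cast
  ring

lemma hasDerivAt_bumpDeriv (α β s : ℝ) : HasDerivAt (bumpDeriv α β) (bumpDeriv₂ α β s) s := by
  have h1 : HasDerivAt (fun s : ℝ => (s - α) * (β - s)) (1 * (β - s) + (s - α) * -1) s :=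
    ((hasDerivAt_id s).sub_const α).mul ((hasDerivAt_id s).const_sub β)
  have h2 : HasDerivAt (fun s : ℝ => α + β - 2 * s) (-(2 * 1)) s :=
    ((hasDerivAt_id s).const_mul 2).const_sub (α + β)
  refine ((h1.const_mul 2).mul h2).congr_deriv ?_
  simp only [bumpDeriv₂]
  ring

lemma continuous_bump (α β : ℝ) : Continuous (bump α β) := by unfold bump; fun_prop

lemma continuous_bumpDeriv (α β : ℝ) : Continuous (bumpDeriv α β) := by unfold bumpDeriv; fun_prop

lemma continuous_bumpDeriv₂ (α β : ℝ) : Continuous (bumpDeriv₂ α β) := by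
  unfold bumpDeriv₂; fun_prop

/-- Integrating twice by parts against the bump. -/
lemma integral_mul_bump {f f₁ f₂ : ℝ → ℝ} {α β : ℝ} (hαβ : α ≤ β)
    (h₁ : ∀ s ∈ Icc α β, HasDerivAt f (f₁ s) s) (h₂ : ∀ s ∈ Icc α β, HasDerivAt f₁ (f₂ s) s)
    (hc : ContinuousOn f₂ (Icc α β)) :
    ∫ s in α..β, f₂ s * bump α β s = ∫ s in α..β, f s * bumpDeriv₂ α β s := by
  rw [← uIcc_of_le hαβ] at h₁ h₂ hc
  have hc₁ : ContinuousOn f₁ (uIcc α β) := fun s hs => (h₂ s hs).continuousAt.continuousWithinAt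
  have e1 := intervalIntegral.integral_mul_deriv_eq_deriv_mul h₁
    (fun s _ => hasDerivAt_bumpDeriv α β s) hc₁.intervalIntegrable
    ((continuous_bumpDeriv₂ α β).intervalIntegrable α β)
  have e2 := intervalIntegral.integral_mul_deriv_eq_deriv_mul h₂
    (fun s _ => hasDerivAt_bump α β s) hc.intervalIntegrable
    ((continuous_bumpDeriv α β).intervalIntegrable α β)
  simp only [bump, bumpDeriv, sub_self, mul_zero, zero_mul, ne_eq, OfNat.ofNat_ne_zero,
    not_false_eq_true, zero_pow, zero_sub] at e1 e2
  simp only [bump]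
  rw [e1, e2, neg_neg]

/-- If the second `x`-derivatives converge pointwise at the initial line, their limit is the second
derivative of the trace: by Baire's theorem the convergence is bounded on some interval. -/
lemma second_deriv_trace_eq {p px pxx : ℝ × ℝ → ℝ} {τ τ₁ τ₂ g : ℝ → ℝ}
    (hp : ∀ z ∈ Ω₀, HasDerivAt (fun s => p (s, z.2)) (px z) z.1)
    (hpx : ∀ z ∈ Ω₀, HasDerivAt (fun s => px (s, z.2)) (pxx z) z.1)
    (hpxx : ContinuousOn pxx Ω₀) (hcont : ContinuousOn p (Icc (0 : ℝ) 1 ×ˢ Icc (0 : ℝ) 1))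
    (hinit : ∀ x ∈ Icc (0 : ℝ) 1, p (x, 0) = τ x)
    (hτ : ∀ x ∈ Ioo (0 : ℝ) 1, HasDerivAt τ (τ₁ x) x)
    (hτ₁ : ∀ x ∈ Ioo (0 : ℝ) 1, HasDerivAt τ₁ (τ₂ x) x) (hτ₂ : ContinuousOn τ₂ (Ioo 0 1))
    (hg : ContinuousOn g (Ioo 0 1))
    (hlim : ∀ x ∈ Ioo (0 : ℝ) 1, Tendsto (fun y => pxx (x, y)) (𝓝[>] 0) (𝓝 (g x))) {x₀ : ℝ}
    (hx₀ : x₀ ∈ Ioo (0 : ℝ) 1) : τ₂ x₀ = g x₀ := by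
  by_contra hne
  -- By continuity k keeps the sign of k(x₀) on an interval [a, b]; it suffices to show that k
  -- integrates to zero against a bump in some subinterval.
  set k : ℝ → ℝ := fun x => τ₂ x - g x with hk
  have hkc : ContinuousOn k (Ioo 0 1) := hτ₂.sub hg
  have hk0 : k x₀ ≠ 0 := sub_ne_zero.2 hne
  have hpos : ∀ᶠ x in 𝓝 x₀, x ∈ Ioo (0 : ℝ) 1 ∧ 0 < k x₀ * k x := by
    refine Eventually.and (isOpen_Ioo.mem_nhds hx₀) ?_
    have h1 : ContinuousAt (fun x => k x₀ * k x) x₀ :=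
      continuousAt_const.mul (hkc.continuousAt (isOpen_Ioo.mem_nhds hx₀))
    exact h1.eventually (lt_mem_nhds (mul_self_pos.2 hk0))
  obtain ⟨ε, hε, hball⟩ := Metric.eventually_nhds_iff.1 hpos
  set a := x₀ - ε / 2 with ha
  set b := x₀ + ε / 2 with hb
  have hab : a < b := by rw [ha, hb]; linarith
  have hI : ∀ x ∈ Icc a b, x ∈ Ioo (0 : ℝ) 1 ∧ 0 < k x₀ * k x := by
    intro x hx
    apply hball
    rw [Real.dist_eq, abs_lt]
    constructor <;> linarith [hx.1, hx.2]
  -- Retraction onto [a, b]: it turns the sets to which Baire's theorem is applied into closed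
  -- subsets of the whole line.
  set c : ℝ → ℝ := fun x => max a (min x b) with hc
  have hcc : Continuous c := by fun_prop
  have hcm : ∀ x, c x ∈ Icc a b := fun x => ⟨le_max_left _ _, max_le hab.le (min_le_right _ _)⟩
  have hceq : ∀ x ∈ Icc a b, c x = x := fun x hx => by
    simp only [hc, min_eq_left hx.2, max_eq_right hx.1]
  -- At a point of E n the second derivative is bounded by n for all times below 1/(n+1). Pointwise
  -- convergence makes these sets cover the line, so one of them contains an interval meeting (a,
  -- b).
  set E : ℕ → Set ℝ := fun n => ⋂ y ∈ Ioo (0 : ℝ) (1 / (n + 1)), {x | |pxx (c x, y)| ≤ n} with hE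
  have hy1 : ∀ (n : ℕ) (y : ℝ), y ∈ Ioo (0 : ℝ) (1 / (n + 1)) → y ∈ Ioo (0 : ℝ) 1 := by
    intro n y hy
    refine ⟨hy.1, hy.2.trans_le ?_⟩
    rw [div_le_one (by positivity)]
    linarith [Nat.cast_nonneg (α := ℝ) n]
  have hEc : ∀ n, IsClosed (E n) := by
    intro n
    refine isClosed_biInter fun y hy => isClosed_le ?_ continuous_const
    refine Continuous.abs ?_
    refine hpxx.comp_continuous (by fun_prop) fun x => ?_
    have h1 := (hI _ (hcm x)).1
    exact ⟨h1.1, h1.2, (hy1 n y hy).1, (hy1 n y hy).2⟩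
  have hEu : ⋃ n, E n = univ := by
    refine eq_univ_of_forall fun x => ?_
    have h1 := ((hlim _ (hI _ (hcm x)).1).abs).eventually (gt_mem_nhds (lt_add_one _))
    obtain ⟨δ, hδ, hsub⟩ := mem_nhdsGT_iff_exists_Ioo_subset.1 h1
    obtain ⟨n₁, hn₁⟩ := exists_nat_one_div_lt (mem_Ioi.1 hδ)
    obtain ⟨n₂, hn₂⟩ := exists_nat_ge (|g (c x)| + 1)
    refine mem_iUnion.2 ⟨max n₁ n₂, mem_iInter₂.2 fun y hy => ?_⟩
    have h2 : (1 : ℝ) / ((max n₁ n₂ : ℕ) + 1) ≤ 1 / (n₁ + 1) := by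
      refine one_div_le_one_div_of_le (by positivity) ?_
      have : (n₁ : ℝ) ≤ (max n₁ n₂ : ℕ) := by exact_mod_cast le_max_left _ _
      linarith
    have h3 := hsub ⟨hy.1, hy.2.trans (h2.trans_lt hn₁)⟩
    have h4 : (n₂ : ℝ) ≤ (max n₁ n₂ : ℕ) := by exact_mod_cast le_max_right _ _
    exact (le_of_lt h3).trans (hn₂.trans h4)
  obtain ⟨x₁, hx₁, hx₁'⟩ := (dense_iUnion_interior_of_closed hEc hEu).exists_mem_open
    (isOpen_Ioo (a := a) (b := b)) (nonempty_Ioo.2 hab)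
  obtain ⟨n, hn⟩ := mem_iUnion.1 hx₁
  obtain ⟨η, hη, hball'⟩ := Metric.mem_nhds_iff.1
    ((isOpen_interior.inter isOpen_Ioo).mem_nhds ⟨hn, hx₁'⟩)
  set α := x₁ - η / 2 with hα
  set β := x₁ + η / 2 with hβ
  have hαβ : α < β := by rw [hα, hβ]; linarith
  have hJ : ∀ x ∈ Icc α β, x ∈ E n ∧ x ∈ Ioo a b := by
    intro x hx
    have : x ∈ Metric.ball x₁ η := by
      rw [Metric.mem_ball, Real.dist_eq, abs_lt]
      constructor <;> linarith [hx.1, hx.2]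
    exact ⟨interior_subset (hball' this).1, (hball' this).2⟩
  have hJ01 : ∀ x ∈ Icc α β, x ∈ Ioo (0 : ℝ) 1 := fun x hx => (hI x (Ioo_subset_Icc_self (hJ x hx).2)).1
  have hbd : ∀ x ∈ Icc α β, ∀ y ∈ Ioo (0 : ℝ) (1 / (n + 1)), |pxx (x, y)| ≤ n := by
    intro x hx y hy
    have h1 := mem_iInter₂.1 (hJ x hx).1 y hy
    rwa [mem_ofPred_eq, hceq x (Ioo_subset_Icc_self (hJ x hx).2)] at h1
  have hsmall : ∀ᶠ y in 𝓝[>] (0 : ℝ), y ∈ Ioo (0 : ℝ) (1 / (n + 1)) :=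
    Ioo_mem_nhdsGT (by positivity)
  have hmem : ∀ x ∈ Icc α β, ∀ y ∈ Ioo (0 : ℝ) (1 / (n + 1)), (x, y) ∈ Ω₀ := fun x hx y hy =>
    ⟨(hJ01 x hx).1, (hJ01 x hx).2, (hy1 n y hy).1, (hy1 n y hy).2⟩
  have hslice : ∀ y ∈ Ioo (0 : ℝ) (1 / (n + 1)), ContinuousOn (fun s => pxx (s, y)) (Icc α β) :=
    fun y hy => hpxx.comp (by fun_prop) fun x hx => hmem x hx y hy
  obtain ⟨M, hM⟩ := (isCompact_Icc.prod isCompact_Icc).exists_bound_of_continuousOn hcont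
  have hIoc : ∀ s ∈ uIoc α β, s ∈ Icc α β := fun s hs => by
    rw [uIoc_of_le hαβ.le] at hs
    exact Ioc_subset_Icc_self hs
  have hsq : ∀ x ∈ Icc α β, ∀ y ∈ Icc (0 : ℝ) 1, (x, y) ∈ Icc (0 : ℝ) 1 ×ˢ Icc (0 : ℝ) 1 :=
    fun x hx y hy => ⟨Ioo_subset_Icc_self (hJ01 x hx), hy⟩
  -- The bound n on the subinterval permits dominated convergence for p_xx. Moving both derivatives
  -- onto the bump, the same integral converges by continuity of p up to y = 0; comparing the limits
  -- gives e1.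
  have L1 : Tendsto (fun y => ∫ s in α..β, pxx (s, y) * bump α β s) (𝓝[>] 0)
      (𝓝 (∫ s in α..β, g s * bump α β s)) := by
    refine intervalIntegral.tendsto_integral_filter_of_dominated_convergence
      (fun s => n * |bump α β s|) ?_ ?_ ?_ ?_
    · filter_upwards [hsmall] with y hy
      refine (((hslice y hy).mono hIoc).mul
        (continuous_bump α β).continuousOn).aestronglyMeasurable measurableSet_uIoc
    · filter_upwards [hsmall] with y hy
      refine ae_of_all _ fun s hs => ?_
      rw [norm_mul, Real.norm_eq_abs, Real.norm_eq_abs]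
      exact mul_le_mul_of_nonneg_right (hbd s (hIoc s hs) y hy) (abs_nonneg _)
    · exact (continuous_const.mul (continuous_bump α β).abs).intervalIntegrable _ _
    · exact ae_of_all _ fun s hs => (hlim s (hJ01 s (hIoc s hs))).mul_const _
  have L2 : Tendsto (fun y => ∫ s in α..β, p (s, y) * bumpDeriv₂ α β s) (𝓝[>] 0)
      (𝓝 (∫ s in α..β, τ s * bumpDeriv₂ α β s)) := by
    refine intervalIntegral.tendsto_integral_filter_of_dominated_convergence
      (fun s => M * |bumpDeriv₂ α β s|) ?_ ?_ ?_ ?_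
    · filter_upwards [hsmall] with y hy
      have h1 : ContinuousOn (fun s => p (s, y)) (uIoc α β) :=
        hcont.comp (by fun_prop) fun s hs => hsq s (hIoc s hs) y (Ioo_subset_Icc_self (hy1 n y hy))
      exact (h1.mul (continuous_bumpDeriv₂ α β).continuousOn).aestronglyMeasurable measurableSet_uIoc
    · filter_upwards [hsmall] with y hy
      refine ae_of_all _ fun s hs => ?_
      rw [norm_mul, Real.norm_eq_abs (bumpDeriv₂ α β s)]
      exact mul_le_mul_of_nonneg_right
        (hM _ (hsq s (hIoc s hs) y (Ioo_subset_Icc_self (hy1 n y hy)))) (abs_nonneg _)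
    · exact (continuous_const.mul (continuous_bumpDeriv₂ α β).abs).intervalIntegrable _ _
    · refine ae_of_all _ fun s hs => Tendsto.mul_const _ ?_
      rw [← hinit s (Ioo_subset_Icc_self (hJ01 s (hIoc s hs)))]
      refine (hcont _ (hsq s (hIoc s hs) 0 ⟨le_rfl, zero_le_one⟩)).tendsto.comp ?_
      rw [tendsto_nhdsWithin_iff]
      constructor
      · exact ((Continuous.prodMk_right s).tendsto 0).mono_left nhdsWithin_le_nhds
      · filter_upwards [hsmall] with y hy
        exact hsq s (hIoc s hs) y (Ioo_subset_Icc_self (hy1 n y hy))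
  have e1 : ∫ s in α..β, g s * bump α β s = ∫ s in α..β, τ s * bumpDeriv₂ α β s := by
    refine tendsto_nhds_unique L1 (L2.congr' ?_)
    filter_upwards [hsmall] with y hy
    exact (integral_mul_bump hαβ.le (fun s hs => hp (s, y) (hmem s hs y hy))
      (fun s hs => hpx (s, y) (hmem s hs y hy)) (hslice y hy)).symm
  have e2 := integral_mul_bump hαβ.le (fun s hs => hτ s (hJ01 s hs)) (fun s hs => hτ₁ s (hJ01 s hs))
    (hτ₂.mono hJ01)
  have hgi : IntervalIntegrable (fun s => g s * bump α β s) volume α β := by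
    refine ContinuousOn.intervalIntegrable ?_
    rw [uIcc_of_le hαβ.le]
    exact (hg.mono hJ01).mul (continuous_bump α β).continuousOn
  have hti : IntervalIntegrable (fun s => τ₂ s * bump α β s) volume α β := by
    refine ContinuousOn.intervalIntegrable ?_
    rw [uIcc_of_le hαβ.le]
    exact (hτ₂.mono hJ01).mul (continuous_bump α β).continuousOn
  have e3 : ∫ s in α..β, k x₀ * (τ₂ s * bump α β s - g s * bump α β s) = 0 := by
    rw [intervalIntegral.integral_const_mul, intervalIntegral.integral_sub hti hgi, e1, e2, sub_self,
      mul_zero]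
  have e4 := intervalIntegral.intervalIntegral_pos_of_pos_on ((hti.sub hgi).const_mul (k x₀))
    (fun s hs => ?_) hαβ
  · exact e4.ne' e3
  · have h1 := (hI s (Ioo_subset_Icc_self (hJ s (Ioo_subset_Icc_self hs)).2)).2
    have h2 : 0 < bump α β s := by
      have h3 : 0 < (s - α) * (β - s) := mul_pos (by linarith [hs.1]) (by linarith [hs.2])
      exact pow_pos h3 2
    have := mul_pos h1 h2
    simp only [hk] at this ⊢
    nlinarith

/-- A solution of `τ'' = -τ'` which vanishes at both ends of the unit interval is zero. -/
lemma eq_zero_of_second_deriv {τ τ₁ : ℝ → ℝ} (hc : ContinuousOn τ (Icc 0 1))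
    (h₁ : ∀ x ∈ Ioo (0 : ℝ) 1, HasDerivAt τ (τ₁ x) x)
    (h₂ : ∀ x ∈ Ioo (0 : ℝ) 1, HasDerivAt τ₁ (-τ₁ x) x) (h0 : τ 0 = 0) (h1 : τ 1 = 0) :
    ∀ x ∈ Icc (0 : ℝ) 1, τ x = 0 := by
  -- Rolle gives one zero of τ₁; since exp(x) τ₁(x) is constant, τ₁ vanishes everywhere.
  obtain ⟨c, hcm, hc0⟩ := exists_deriv_eq_zero zero_lt_one hc (h0.trans h1.symm)
  rw [(h₁ c hcm).deriv] at hc0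
  have hE : ∀ x ∈ Ioo (0 : ℝ) 1, HasDerivAt (fun x => Real.exp x * τ₁ x) 0 x := fun x hx => by
    refine ((Real.hasDerivAt_exp x).mul (h₂ x hx)).congr_deriv ?_
    ring
  have hz : ∀ x ∈ Ioo (0 : ℝ) 1, τ₁ x = 0 := by
    intro x hx
    have h4 := isOpen_Ioo.is_const_of_deriv_eq_zero isPreconnected_Ioo
      (fun y hy => (hE y hy).differentiableAt.differentiableWithinAt)
      (fun y hy => (hE y hy).deriv) hx hcm
    simpa [hc0] using h4
  intro x hx
  rcases hx.1.eq_or_lt with rfl | hx0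
  · exact h0
  obtain ⟨d, hd, hs⟩ := exists_hasDerivAt_eq_slope τ τ₁ hx0 (hc.mono (Icc_subset_Icc_right hx.2))
    fun y hy => h₁ y ⟨hy.1, hy.2.trans_le hx.2⟩
  rw [hz d ⟨hd.1, hd.2.trans_le hx.2⟩, h0, sub_zero, sub_zero, eq_comm, div_eq_zero_iff] at hs
  exact hs.resolve_right hx0.ne'

namespace IsSolution

variable {l : ℝ} {a₁ a₂ : ℝ → ℝ} {w : ℝ × ℝ → ℝ}

/-- w is constant on the characteristic from (x, 0) to the point (3x/4, -x/4) of the open triangle,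
where C² regularity is part of the class. No regularity on `AB` itself is assumed. -/
lemma contDiffOn_trace (h : IsSolution l a₁ a₂ 0 0 0 w) :
    ContDiffOn ℝ 2 (fun x => w (x, 0)) (Ioo 0 1) := by
  have h1 : ContDiffOn ℝ 2 (fun x : ℝ => w (3 * x / 4, -x / 4)) (Ioo 0 1) := by
    refine h.memW.c2_Ω₁.comp (f := fun x : ℝ => (3 * x / 4, -x / 4)) (by fun_prop) fun x hx => ?_
    refine ⟨?_, ?_, ?_⟩ <;> simp only <;> linarith [hx.1, hx.2]
  refine h1.congr fun x hx => ?_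
  rw [h.eq_lower (x := 3 * x / 4) (y := -x / 4) ⟨by simp only; linarith [hx.1],
    by simp only; linarith [hx.1], by simp only; linarith [hx.2]⟩]
  congr 2
  ring

lemma dy_lower (h : IsSolution l a₁ a₂ 0 0 0 w) {z : ℝ × ℝ} (hz : z ∈ Ω₁) :
    dy w z = -deriv (fun x => w (x, 0)) (z.1 - z.2) := by
  have hm : z.1 - z.2 ∈ Ioo (0 : ℝ) 1 := ⟨by linarith [hz.1, hz.2.1], hz.2.2⟩
  have h1 := hasDerivAt_of_contDiffOn isOpen_Ioo (h.contDiffOn_trace.of_le one_le_two) hm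
  have h2 : HasDerivAt (fun t : ℝ => z.1 - t) (-1) z.2 := (hasDerivAt_id z.2).const_sub z.1
  have h3 := h1.comp z.2 h2
  rw [mul_neg_one] at h3
  rw [dy, ← h3.deriv]
  refine EventuallyEq.deriv_eq ?_
  have : ∀ᶠ t in 𝓝 z.2, (z.1, t) ∈ Ω₁ :=
    (Continuous.prodMk_right z.1).continuousAt.preimage_mem_nhds (isOpen_Ω₁.mem_nhds hz)
  filter_upwards [this] with t ht
  exact h.eq_lower ⟨ht.1.le, ht.2.1.le, ht.2.2.le⟩

/-- By the gluing condition the Caputo derivative, and by the equation also w_xx, tends to the limit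
of w_y from below, which `dy_lower` computes from the trace. -/
lemma tendsto_dx_dx (h : IsSolution l a₁ a₂ 0 0 0 w) {x : ℝ} (hx : x ∈ Ioo (0 : ℝ) 1) :
    Tendsto (fun y => dx (dx w) (x, y)) (𝓝[>] 0) (𝓝 (-deriv (fun x => w (x, 0)) x)) := by
  obtain ⟨ν, hν₁, hν₂⟩ := h.gluing x hx
  have hlim : Tendsto (fun y => dy w (x, y)) (𝓝[<] 0) (𝓝 (-deriv (fun x => w (x, 0)) x)) := by
    have hc := ((continuousOn_deriv_of_contDiffOn isOpen_Ioo
      (h.contDiffOn_trace.of_le one_le_two)).continuousAt (isOpen_Ioo.mem_nhds hx)).neg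
    have h2 : Tendsto (fun y : ℝ => x - y) (𝓝[<] 0) (𝓝 x) := by
      have h3 : Continuous fun y : ℝ => x - y := by fun_prop
      have h4 := h3.tendsto 0
      rw [sub_zero] at h4
      exact h4.mono_left nhdsWithin_le_nhds
    refine (hc.tendsto.comp h2).congr' ?_
    filter_upwards [Ioo_mem_nhdsLT (show max (-x) (x - 1) < 0 by
      simp only [max_lt_iff]; constructor <;> linarith [hx.1, hx.2])] with y hy
    have h5 := max_lt_iff.1 hy.1
    exact (h.dy_lower (z := (x, y))
      ⟨hy.2, by simp only; linarith [h5.1], by simp only; linarith [h5.2]⟩).symm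
  rw [← tendsto_nhds_unique hν₂ hlim]
  refine hν₁.congr' ?_
  filter_upwards [Ioo_mem_nhdsGT (zero_lt_one (α := ℝ))] with y hy
  linarith [h.eq_parabolic (x, y) ⟨hx.1, hx.2, hy.1, hy.2⟩]

/-- `second_deriv_trace_eq` identifies the pointwise limit of w_xx with τ'', so τ'' = -τ'. The
corner values are zero: at A because a₁(0) + a₂(0) ≠ 0, at B by the datum on `CB`. -/
lemma trace_eq_zero (h : IsSolution l a₁ a₂ 0 0 0 w) (ha : a₁ 0 + a₂ 0 ≠ 0) :
    ∀ x ∈ Icc (0 : ℝ) 1, w (x, 0) = 0 := by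
  have hτ := fun x hx => hasDerivAt_deriv_of_contDiffOn_two isOpen_Ioo h.contDiffOn_trace
    (s := x) hx
  have hc₁ := continuousOn_deriv_of_contDiffOn isOpen_Ioo (h.contDiffOn_trace.of_le one_le_two)
  have hc₂ : ContinuousOn (deriv (deriv fun x => w (x, 0))) (Ioo 0 1) := by
    have h1 : ContDiffOn ℝ (1 + 1) (fun x => w (x, 0)) (Ioo 0 1) := by
      exact_mod_cast h.contDiffOn_trace
    rw [contDiffOn_succ_iff_deriv_of_isOpen isOpen_Ioo] at h1
    exact continuousOn_deriv_of_contDiffOn isOpen_Ioo h1.2.2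
  refine eq_zero_of_second_deriv (τ := fun x => w (x, 0)) ?_ (fun x hx => (hτ x hx).1)
    (fun x hx => (hτ x hx).2.congr_deriv ?_) (h.zero_left_corner ha) h.zero_right_corner
  · exact h.continuousOn_square.comp (by fun_prop) fun x hx => ⟨hx, le_rfl, zero_le_one⟩
  · exact second_deriv_trace_eq (τ := fun x => w (x, 0))
      (fun z hz => (h.memW.c2Caputo.diff_x z hz).hasDerivAt)
      (fun z hz => (h.memW.c2Caputo.diff_xx z hz).hasDerivAt) h.memW.c2Caputo.cont_xx
      h.continuousOn_square (fun _ _ => rfl) (fun x hx => (hτ x hx).1) (fun x hx => (hτ x hx).2)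
      hc₂ hc₁.neg (fun x hx => h.tendsto_dx_dx hx) hx

lemma left_characteristic_eq_zero (h : IsSolution l a₁ a₂ 0 0 0 w) (ha : a₁ 0 + a₂ 0 ≠ 0)
    (ha₁ : ∀ t ∈ Icc (0 : ℝ) (1 / 2), a₁ t ≠ 0) : ∀ t ∈ Icc (0 : ℝ) (1 / 2), w (-t, t) = 0 := by
  intro t ht
  have h1 := h.nonlocal t ht
  rw [h.eq_lower (x := t) (y := -t) ⟨by simp only; linarith [ht.1], by simp only; linarith,
    by simp only; linarith [ht.2]⟩, h.trace_eq_zero ha _ ⟨by linarith [ht.1], by linarith [ht.2]⟩,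
    mul_zero, add_zero, Pi.zero_apply] at h1
  exact (mul_eq_zero.1 h1).resolve_left (ha₁ t ht)

end IsSolution

/-! ### The maximum principle and uniqueness -/

lemma deriv_le_of_eventually_le {f : ℝ → ℝ} {f' c : ℝ} (h : HasDerivAt f f' 0)
    (hle : ∀ᶠ s in 𝓝[>] (0 : ℝ), f s ≤ f 0 + c * s) : f' ≤ c := by
  refine le_of_tendsto h.tendsto_slope_zero_right ?_
  filter_upwards [hle, self_mem_nhdsWithin] with s hs hs0
  have hs0' : 0 < s := hs0
  rw [zero_add, smul_eq_mul, inv_mul_le_iff₀ hs0']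
  linarith

lemma fderiv_le_of_eventually_le {w : ℝ × ℝ → ℝ} {z d : ℝ × ℝ} {c : ℝ}
    (h : DifferentiableAt ℝ w z) (hle : ∀ᶠ s in 𝓝[>] (0 : ℝ), w (z + s • d) ≤ w z + c * s) :
    fderiv ℝ w z d ≤ c := by
  have h0 : z + (0 : ℝ) • d = z := by rw [zero_smul, add_zero]
  have h1 := hasDerivAt_line (u := w) (z := z) (d := d) (s := 0) (by rwa [h0])
  rw [h0] at h1
  refine deriv_le_of_eventually_le h1 ?_
  simpa only [h0] using hle

/-- If the second derivative were positive, the critical point would also be a local minimum, so f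
would be locally constant and its second derivative zero. -/
lemma deriv_deriv_nonpos_of_isLocalMax {f : ℝ → ℝ} {x : ℝ} (h : IsLocalMax f x)
    (hc : ContinuousAt f x) : deriv (deriv f) x ≤ 0 := by
  by_contra! hpos
  have hmin := isLocalMin_of_deriv_deriv_pos hpos h.deriv_eq_zero hc
  have he : f =ᶠ[𝓝 x] fun _ => f x := by
    filter_upwards [h, hmin] with y h1 h2 using le_antisymm h1 h2
  have := he.deriv.deriv_eq
  simp only [deriv_const'] at this
  exact hpos.ne' this

/-- The Caputo derivative is positive at a positive maximum attained strictly in time. -/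
lemma caputo_pos {l : ℝ} (hl₀ : 0 < l) (hl₁ : l ≤ 1) {g : ℝ → ℝ} {y ε : ℝ} (hy : 0 < y)
    (hε : 0 < ε) (hex : CaputoExists l g y) (hc : ContinuousOn g (Icc 0 y))
    (hd : DifferentiableAt ℝ g y) (h0 : g 0 = 0) (hpos : 0 < g y)
    (hle : ∀ t ∈ Icc 0 y, g t ≤ g y + ε * (t - y)) : 0 < caputo l g y := by
  rw [CaputoExists] at hex
  rw [caputo]
  split_ifs at hex ⊢ with h
  -- For l = 1 strict positivity comes from the slope ε; for l < 1 it comes from g(y) > 0.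
  · have h1 : HasDerivAt (fun s => g (y - s)) (-deriv g y) 0 := by
      have h2 : HasDerivAt (fun s : ℝ => y - s) (-1) 0 := (hasDerivAt_id (0 : ℝ)).const_sub y
      have h3 : HasDerivAt g (deriv g y) (y - 0) := by rw [sub_zero]; exact hd.hasDerivAt
      have := h3.comp 0 h2
      rwa [mul_neg_one] at this
    have h2 := deriv_le_of_eventually_le (c := -ε) h1 (by
      filter_upwards [Ioo_mem_nhdsGT hy] with s hs
      have := hle (y - s) ⟨by linarith [hs.2], by linarith [hs.1]⟩
      rw [sub_zero]
      linarith)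
    linarith
  · have hl : l < 1 := lt_of_le_of_ne hl₁ h
    have hG := Real.Gamma_pos_of_pos (show 0 < 1 - l by linarith)
    refine mul_pos (by positivity) ?_
    -- Integration by parts as an inequality: since g ≤ g(y), the derivative of Q is at most (y -
    -- t)^(-l) g'(t). Differentiability of g at y and l < 1 make Q continuous on [0, y] with Q(y) =
    -- 0, so the integral is at least -Q(0) = y^(-l) g(y) > 0.
    set Q : ℝ → ℝ := fun t => (y - t) ^ (-l) * (g t - g y) with hQ
    have hQc : ContinuousOn Q (Icc 0 y) := by
      have h1 : ContinuousOn (fun t => -((y - t) ^ (1 - l) * dslope g y t)) (Icc 0 y) := by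
        refine ContinuousOn.neg (ContinuousOn.mul ?_ ?_)
        · refine ContinuousOn.rpow_const (by fun_prop) fun t _ => Or.inr (by linarith)
        · intro t ht
          rcases eq_or_ne t y with rfl | hne
          · exact (continuousAt_dslope_same.2 hd).continuousWithinAt
          · exact (continuousWithinAt_dslope_of_ne hne).2 (hc t ht)
      refine h1.congr fun t ht => ?_
      simp only [hQ]
      rcases ht.2.lt_or_eq with hlt | rfl
      · have h2 : (t - y) * dslope g y t = g t - g y := sub_smul_dslope g y t
        have h3 : 0 < y - t := sub_pos.2 hlt
        rw [← h2, show (1 : ℝ) - l = -l + 1 by ring, Real.rpow_add_one h3.ne']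
        ring
      · simp [Real.zero_rpow (show 1 - l ≠ 0 by linarith)]
    have hQd : ∀ t ∈ Ioo 0 y, HasDerivAt Q
        (l * (y - t) ^ (-l - 1) * (g t - g y) + (y - t) ^ (-l) * deriv g t) t := by
      intro t ht
      have h1 : HasDerivAt (fun t : ℝ => y - t) (-1) t := (hasDerivAt_id t).const_sub y
      have h2 := h1.rpow_const (p := -l) (Or.inl (sub_pos.2 ht.2).ne')
      refine (h2.mul ((hex.1 t ht).hasDerivAt.sub_const (g y))).congr_deriv ?_
      ring
    have key := intervalIntegral.sub_le_integral_of_hasDeriv_right_of_le hy.le hQc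
      (fun t ht => (hQd t ht).hasDerivWithinAt)
      ((intervalIntegrable_iff_integrableOn_Icc_of_le hy.le).1 hex.2) (fun t ht => by
        have h1 : g t - g y ≤ 0 := by
          have := hle t (Ioo_subset_Icc_self ht)
          nlinarith [ht.2]
        have h2 : 0 ≤ l * (y - t) ^ (-l - 1) :=
          mul_nonneg hl₀.le (Real.rpow_nonneg (sub_nonneg.2 ht.2.le) _)
        linarith [mul_nonpos_of_nonneg_of_nonpos h2 h1])
    refine lt_of_lt_of_le ?_ key
    simp only [hQ, sub_self, mul_zero, sub_zero, h0, zero_sub, mul_neg, neg_neg]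
    exact mul_pos (Real.rpow_pos_of_pos hy _) hpos

namespace IsSolution

variable {l : ℝ} {a₁ a₂ : ℝ → ℝ} {w : ℝ × ℝ → ℝ}

/-- The maximum principle in the square, the characteristic triangles providing the boundary
conditions on its vertical sides. -/
lemma nonpos_of_lt_one (h : IsSolution l a₁ a₂ 0 0 0 w) (hl₀ : 0 < l) (hl₁ : l ≤ 1)
    (ha : a₁ 0 + a₂ 0 ≠ 0) (ha₁ : ∀ t ∈ Icc (0 : ℝ) (1 / 2), a₁ t ≠ 0) {x₁ y₁ : ℝ}
    (hx₁ : x₁ ∈ Icc (0 : ℝ) 1) (hy₁ : y₁ ∈ Ico (0 : ℝ) 1) : w (x₁, y₁) ≤ 0 := by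
  by_contra! hpos
  -- This ε keeps w - εy positive at (x₁, y₁) because y₁ < 1.
  set ε := w (x₁, y₁) / 2 with hε
  have hε0 : 0 < ε := by positivity
  have hsub : Icc (0 : ℝ) 1 ×ˢ Icc (0 : ℝ) y₁ ⊆ Icc (0 : ℝ) 1 ×ˢ Icc (0 : ℝ) 1 :=
    prod_mono le_rfl (Icc_subset_Icc_right hy₁.2.le)
  obtain ⟨⟨x, y⟩, ⟨hx, hy⟩, hmax⟩ := (isCompact_Icc.prod isCompact_Icc).exists_isMaxOn
    ⟨(x₁, y₁), hx₁, hy₁.1, le_rfl⟩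
    ((h.continuousOn_square.mono hsub).sub
      (continuous_const.mul continuous_snd : Continuous fun p : ℝ × ℝ => ε * p.2).continuousOn)
  simp only at hx hy
  have hm : ∀ x' ∈ Icc (0 : ℝ) 1, ∀ y' ∈ Icc (0 : ℝ) y₁, w (x', y') - ε * y' ≤ w (x, y) - ε * y :=
    fun x' hx' y' hy' => hmax (a := (x', y')) ⟨hx', hy'⟩
  have hval : 0 < w (x, y) - ε * y := by
    have h1 := hm x₁ hx₁ y₁ ⟨hy₁.1, le_rfl⟩
    have h2 : ε * y₁ < w (x₁, y₁) := by nlinarith [hy₁.2]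
    linarith
  have hy0 : 0 < y := by
    rcases hy.1.eq_or_lt with rfl | h1
    · rw [h.trace_eq_zero ha x hx] at hval
      simp at hval
    · exact h1
  have hy1 : y < 1 := hy.2.trans_lt hy₁.2
  have hw0 : 0 < w (x, y) := by nlinarith
  have hup : (x, y) ∈ upper :=
    ⟨hy0, hy1, by simp only; linarith [hx.1], by simp only; linarith [hx.1],
      by simp only; linarith [hx.2], by simp only; linarith [hx.2]⟩
  have hd : DifferentiableAt ℝ w (x, y) :=
    ((h.memW.c1.mono upper_subset).differentiableOn one_ne_zero _ hup).differentiableAt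
      (isOpen_upper.mem_nhds hup)
  -- Only backward times are compared, since the maximum may lie on the top edge y = y₁; in effect
  -- w_y ≥ ε.
  have hdown : fderiv ℝ w (x, y) (0, -1) ≤ -ε := by
    refine fderiv_le_of_eventually_le hd ?_
    filter_upwards [Ioo_mem_nhdsGT hy0] with s hs
    have h1 := hm x hx (y - s) ⟨by linarith [hs.2], by linarith [hs.1, hy.2]⟩
    have h2 : (x, y) + s • ((0 : ℝ), (-1 : ℝ)) = (x, y - s) := by ext <;> simp; ring
    rw [h2]
    linarith
  -- On x = 0, w is constant in the direction (-1,1) into the left triangle. As w is C¹ across the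
  -- side, w_x = w_y ≥ ε, whereas maximality in the square gives w_x ≤ 0. The side x = 1 is treated
  -- with the direction (1,1).
  rcases hx.1.eq_or_lt with rfl | hx0
  · have h1 : fderiv ℝ w (0, y) (1, 0) ≤ 0 := by
      refine fderiv_le_of_eventually_le hd ?_
      filter_upwards [Ioo_mem_nhdsGT (zero_lt_one (α := ℝ))] with s hs
      have h2 := hm s (Ioo_subset_Icc_self hs) y hy
      have h3 : (0, y) + s • ((1 : ℝ), (0 : ℝ)) = (s, y) := by ext <;> simp
      rw [h3]
      linarith
    have h2 : fderiv ℝ w (0, y) (-1, 1) ≤ 0 := by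
      refine fderiv_le_of_eventually_le hd ?_
      filter_upwards [Ioo_mem_nhdsGT (show 0 < (1 - y) / 2 by linarith)] with s hs
      have h3 : (0, y) + s • ((-1 : ℝ), (1 : ℝ)) = (-s, y + s) := by ext <;> simp
      have h4 := h.eq_left (h.left_characteristic_eq_zero ha ha₁) (x := -s) (y := y + s)
        ⟨by simp only; linarith [hs.1], by simp only; linarith [hs.1],
          by simp only; linarith [hs.2]⟩
      rw [h3, h4, show -s + (y + s) = y by ring, zero_mul, add_zero]
    rw [show ((-1 : ℝ), (1 : ℝ)) = -(1, 0) - (0, -1) by simp, map_sub, map_neg] at h2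
    linarith
  rcases hx.2.eq_or_lt with rfl | hx1
  · have h1 : fderiv ℝ w (1, y) (-1, 0) ≤ 0 := by
      refine fderiv_le_of_eventually_le hd ?_
      filter_upwards [Ioo_mem_nhdsGT (zero_lt_one (α := ℝ))] with s hs
      have h2 := hm (1 - s) ⟨by linarith [hs.2], by linarith [hs.1]⟩ y hy
      have h3 : (1, y) + s • ((-1 : ℝ), (0 : ℝ)) = (1 - s, y) := by ext <;> simp; ring
      rw [h3]
      linarith
    have h2 : fderiv ℝ w (1, y) (1, 1) ≤ 0 := by
      refine fderiv_le_of_eventually_le hd ?_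
      filter_upwards [Ioo_mem_nhdsGT (show 0 < (1 - y) / 2 by linarith)] with s hs
      have h3 : (1, y) + s • ((1 : ℝ), (1 : ℝ)) = (1 + s, y + s) := by ext <;> simp
      have h4 := h.eq_right (x := 1 + s) (y := y + s)
        ⟨by simp only; linarith [hs.1], by simp only; linarith, by simp only; linarith [hs.2]⟩
      rw [h3, h4, show 1 - (1 + s) + (y + s) = y by ring, zero_mul, add_zero]
    rw [show ((1 : ℝ), (1 : ℝ)) = -(-1, 0) - (0, -1) by simp, map_sub, map_neg] at h2
    linarith
  -- At an interior maximum w_xx ≤ 0 while the Caputo derivative is positive, against the equation.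
  have hΩ : (x, y) ∈ Ω₀ := ⟨hx0, hx1, hy0, hy1⟩
  have hxx : dx (dx w) (x, y) ≤ 0 := by
    refine deriv_deriv_nonpos_of_isLocalMax (f := fun s => w (s, y)) ?_
      (h.memW.c2Caputo.diff_x (x, y) hΩ).continuousAt
    filter_upwards [Ioo_mem_nhds hx0 hx1] with s hs
    linarith [hm s (Ioo_subset_Icc_self hs) y hy]
  have hcap : 0 < caputoY l w (x, y) := by
    refine caputo_pos hl₀ hl₁ hy0 hε0 (h.memW.c2Caputo.caputo_exists _ hΩ) ?_
      (differentiableAt_partials hd).2 (h.trace_eq_zero ha x hx) hw0 fun t ht => ?_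
    · exact h.continuousOn_square.comp (by fun_prop) fun t ht => ⟨hx, ht.1, ht.2.trans hy1.le⟩
    · linarith [hm x hx t ⟨ht.1, ht.2.trans hy.2⟩]
  linarith [h.eq_parabolic _ hΩ]

/-- The edge y = 1 is reached by continuity only: C¹ regularity is given in Ω without `AB`, which
excludes y = 1. -/
lemma nonpos_square (h : IsSolution l a₁ a₂ 0 0 0 w) (hl₀ : 0 < l) (hl₁ : l ≤ 1)
    (ha : a₁ 0 + a₂ 0 ≠ 0) (ha₁ : ∀ t ∈ Icc (0 : ℝ) (1 / 2), a₁ t ≠ 0) {z : ℝ × ℝ}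
    (hz : z ∈ Icc (0 : ℝ) 1 ×ˢ Icc (0 : ℝ) 1) : w z ≤ 0 := by
  obtain ⟨x, y⟩ := z
  obtain ⟨hx, hy⟩ := hz
  simp only at hx hy
  have hc : ContinuousOn (fun t => w (x, t)) (Icc 0 1) :=
    h.continuousOn_square.comp (by fun_prop) fun t ht => ⟨hx, ht⟩
  rw [← closure_Ico (zero_ne_one (α := ℝ))] at hy hc
  exact (isClosed_Iic (a := (0 : ℝ))).closure_subset_iff.2
    (image_subset_iff.2 fun t ht => h.nonpos_of_lt_one hl₀ hl₁ ha ha₁ hx ht)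
    (hc.image_closure (mem_image_of_mem _ hy))

/-- Characteristics transport the values in the triangles to `AB`, where w vanishes, or to the
vertical sides of the square. -/
lemma nonpos (h : IsSolution l a₁ a₂ 0 0 0 w) (hl₀ : 0 < l) (hl₁ : l ≤ 1)
    (ha : a₁ 0 + a₂ 0 ≠ 0) (ha₁ : ∀ t ∈ Icc (0 : ℝ) (1 / 2), a₁ t ≠ 0) {z : ℝ × ℝ}
    (hz : z ∈ closure Ω) : w z ≤ 0 := by
  obtain ⟨x, y⟩ := z
  rcases closure_Ω_subset hz with hz | hz | hz | hz
  · exact h.nonpos_square hl₀ hl₁ ha ha₁ hz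
  · rw [h.eq_lower hz, h.trace_eq_zero ha]
    obtain ⟨h1, h2, h3⟩ := hz
    exact ⟨by simp only at h1 h2; linarith, h3⟩
  · rw [h.eq_left (h.left_characteristic_eq_zero ha ha₁) hz]
    obtain ⟨h1, h2, h3⟩ := hz
    exact h.nonpos_square hl₀ hl₁ ha ha₁
      ⟨⟨le_rfl, zero_le_one⟩, h2, by simp only at h1 h3 ⊢; linarith⟩
  · rw [h.eq_right hz]
    obtain ⟨h1, h2, h3⟩ := hz
    simp only at h1 h2 h3
    exact h.nonpos_square hl₀ hl₁ ha ha₁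
      ⟨⟨zero_le_one, le_rfl⟩, by simp only; linarith, by simp only; linarith⟩

/-- Uniqueness for the mixed problem. -/
theorem eqOn {a₃ φ₁ φ₂ : ℝ → ℝ} {v u : ℝ × ℝ → ℝ} (hl₀ : 0 < l) (hl₁ : l ≤ 1)
    (ha : a₁ 0 + a₂ 0 ≠ 0) (ha₁ : ∀ t ∈ Icc (0 : ℝ) (1 / 2), a₁ t ≠ 0)
    (hv : IsSolution l a₁ a₂ a₃ φ₁ φ₂ v) (hu : IsSolution l a₁ a₂ a₃ φ₁ φ₂ u) :
    EqOn v u (closure Ω) := fun _ hz =>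
  le_antisymm (sub_nonpos.1 ((hv.sub hl₀ hu).nonpos hl₀ hl₁ ha ha₁ hz))
    (sub_nonpos.1 ((hu.sub hl₀ hv).nonpos hl₀ hl₁ ha ha₁ hz))

end IsSolution

end MixedProblem

end

theorem mainTheorem1 (lam : ℝ) (hlam₀ : 0 < lam) (hlam₁ : lam ≤ 1)
    (a₁ a₂ a₃ φ₁ φ₂ : ℝ → ℝ)
    (ha₁ : ContDiffOn ℝ 1 a₁ (Set.Icc 0 (1 / 2)) ∧ ContDiffOn ℝ 2 a₁ (Set.Ioo 0 (1 / 2)))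
    (ha₂ : ContDiffOn ℝ 1 a₂ (Set.Icc 0 (1 / 2)) ∧ ContDiffOn ℝ 2 a₂ (Set.Ioo 0 (1 / 2)))
    (ha₃ : ContDiffOn ℝ 1 a₃ (Set.Icc 0 (1 / 2)) ∧ ContDiffOn ℝ 2 a₃ (Set.Ioo 0 (1 / 2)))
    (hφ₂ : ContDiffOn ℝ 1 φ₂ (Set.Icc 0 (1 / 2)) ∧ ContDiffOn ℝ 2 φ₂ (Set.Ioo 0 (1 / 2)))
    (hφ₁ : ContDiffOn ℝ 1 φ₁ (Set.Icc (1 / 2) 1) ∧ ContDiffOn ℝ 2 φ₁ (Set.Ioo (1 / 2) 1))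
    (hcompat : φ₁ 1 = φ₂ 0)
    (ha₁_ne : ∀ t ∈ Set.Icc (0 : ℝ) (1 / 2), a₁ t ≠ 0)
    (ha_ne : a₁ 0 + a₂ 0 ≠ 0) :
    ∃ u : ℝ × ℝ → ℝ, MixedProblem.IsSolution lam a₁ a₂ a₃ φ₁ φ₂ u ∧
      ∀ v : ℝ × ℝ → ℝ, MixedProblem.IsSolution lam a₁ a₂ a₃ φ₁ φ₂ v →
        Set.EqOn v u (closure MixedProblem.Ω) := by
  obtain ⟨u, hu⟩ := MixedProblem.exists_isSolution lam hlam₀ hlam₁ a₁ a₂ a₃ φ₁ φ₂ ha₁ ha₂ ha₃ hφ₂ hφ₁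
    hcompat ha₁_ne ha_ne
  exact ⟨u, hu, fun v hv => hv.eqOn hlam₀ hlam₁ ha_ne ha₁_ne hu⟩
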